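/- **Setting.** Fix a finite relational signature $\sigma$ (arities $\geq 0$), a collection $\mathbb{S}$ of rings and/or abelian groups, a finite set $\mathbf{W}$ of weight symbols $\mathtt{w}$, each with an arity $\geq 1$ and a type in $\mathbb{S}$, and a countable set $\mathbb{P}$ of predicate names $\mathsf{P}$, each with an arity $m\geq 1$, a type $(S_1,\dots,S_m)\in\mathbb{S}^m$ and a semantics $[\![\mathsf{P}]\!]\subseteq S_1\times\cdots\times S_m$. A $(\sigma,\mathbf{W})$-structure $\mathcal{A}$ is a finite non-empty $\sigma$-structure with maps $\mathtt{w}^{\mathcal A}\colon A^{\mathrm{ar}(\mathtt w)}\to\mathrm{type}(\mathtt w)$ such that every tuple of non-zero weight has length one, is constant, or has all its entries in a single tuple of some relation of $\mathcal{A}$. Distances $\mathrm{dist}^{\mathcal A}$ are taken in the Gaifman graph of $\mathcal{A}$; $\mathcal{N}_r^{\mathcal A}(\bar a)$ is the substructure (with restricted relations and weights) induced on the set of elements at distance $\leq r$ from some entry of $\bar a$. Formulas are built from $x=y$, $R(\bar x)$, $(s=\mathtt{w}(\bar x))$, $\neg$, $\vee$, $\exists y$, $(s=\sum \mathtt{w}(\bar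 y).\varphi)$ and $\mathsf{P}(t_1,\dots,t_m)$, where $s\in\mathrm{type}(\mathtt w)$, the variables in a weight tuple are pairwise distinct and the types of $t_1,\dots,t_m$ match that of $\mathsf P$; terms of type $S\in\mathbb{S}$ are built from constants $s\in S$ and $\mathtt{w}(\bar x)$ by $+$, $-$, $\cdot$ (the latter only if $S$ is a ring) and $\sum p.\varphi$, where $p$ is a product of constants and weights $\mathtt{w}(\bar y)$ of type $S$ (a single factor if $S$ is not a ring). Here $(s=\sum\mathtt{w}(\bar y).\varphi)$ says that the sum of $\mathtt{w}(\bar a)$ over all $\bar a$ satisfying $\varphi$ is $s$, and $\sum p.\varphi$ is the sum of the values of $p$ over all assignments to the variables of $p$ that satisfy $\varphi$. A formula is in $\mathrm{FOW}_1$ if it applies $(s=\sum \mathtt{w}(\bar y).\varphi)$ only for $\mathtt{w}$ of finite type, applies $\mathsf{P}(t_1,\dots,t_m)$ only if $t_1,\dots,t_m$ together have at most one free variable, and contains no term $\sum p.\varphi$. A formula $\psi$ with free variables among a non-empty tuple $\bar x$ is *$r$-local around $\bar x$* if $\mathcal{A}\models\psi[\bar a]\iff\mathcal{N}_r^{\mathcal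 A}(\bar a)\models\psi[\bar a]$ for all $(\sigma,\mathbf W)$-structures $\mathcal A$ and tuples $\bar a$; it is *local* if it is $r$-local for some $r$. A *local aggregation sentence* is a $\mathrm{FOW}_1$-sentence $(s=\sum\mathtt{w}(\bar y).\lambda(\bar y))$ with $\lambda$ local around $\bar y$. A *basic cl-term of radius $r$* is a term $\sum p.(\psi(\bar y)\wedge\delta(\bar y))$, where $\bar y=(y_1,\dots,y_k)$, $k\geq 1$, are distinct variables including those of $p$, $\psi$ is a $\mathrm{FOW}_1$-formula that is $r$-local around $\bar y$, and $\delta$ is a first-order formula over $\sigma$ expressing, for some connected graph $G$ on $\{1,\dots,k\}$, that for all $i\neq j$: $\mathrm{dist}(y_i,y_j)\leq 2r+1$ iff $ij\in E(G)$. A *cl-term* is built from basic cl-terms, constants and terms $\mathtt{w}(\bar x)$ by $+,-,\cdot$; its radius is the maximum of the radii of the basic cl-terms it is built from ($0$ if there are none). It is *ground* if it has no free variable. **Theorem.** Suppose that $\mathbb{S}$ contains the integer ring $\mathbb{Z}$, and that there is a unary weight symbol $\mathtt{one}\in\mathbf{W}$ of type $\mathbb{Z}$. Let $\varphi$ be a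 $\mathrm{FOW}_1$-formula and $\bar x$ a finite tuple of variables containing all free variables of $\varphi$. Then there is a Boolean combination $\varphi'$ of - $\mathrm{FOW}_1$-formulas whose free variables are exactly $\bar x$ and that are local around $\bar x$ (none if $\bar x$ is empty), - local aggregation sentences, and - statements "$g\geq 1$" for ground cl-terms $g$ of type $\mathbb{Z}$, such that $\varphi$ and $\varphi'$ are equivalent in all $(\sigma,\mathbf{W})$-structures $\mathcal{A}$ with $\mathtt{one}^{\mathcal A}(a)=1$ for all $a\in A$. Furthermore, there is an algorithm that, on input $\varphi$ and $\bar x$, outputs such a $\varphi'$, the radius of each ground cl-term in $\varphi'$ (for a decomposition into basic cl-terms), and a number $r$ such that all local formulas in $\varphi'$, including those inside its local aggregation sentences, are $r$-local. Here expressions are coded by natural numbers via arbitrary injective codings of the relation, weight and predicate symbols and of the elements of an arbitrary subset $D$ of $\bigsqcup_{S\in\mathbb S}S$ that contains all elements of the finite types of weight symbols; for every such coding there is an algorithm that handles all $\varphi$ with constants in $D$ and outputs $\varphi'$ with constants in $D$, and that uses only an oracle telling whether a given code of an element of $D$ denotes the zero of its ring or group. -/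

import Mathlib

namespace WA

/-! ### Rings and abelian groups, signatures -/

/-- A member of a collection of rings and/or abelian groups. -/
inductive Alg : Type 1
  | group (S : Type) (str : AddCommGroup S)
  | ring (S : Type) (str : Ring S)

namespace Alg

def Carrier : Alg → Type
  | group S _ => S
  | ring S _ => S

instance addCommGroup : (a : Alg) → AddCommGroup a.Carrier
  | group _ str => str
  | ring _ str => str.toAddCommGroup

def IsRing : Alg → Prop
  | group _ _ => False
  | ring _ _ => True

/-- Multiplication, available for rings only. -/
def mul : (a : Alg) → a.IsRing → a.Carrier → a.Carrier → a.Carrier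
  | group _ _, h, _, _ => h.elim
  | ring _ str, _, x, y => str.mul x y

/-- `a` is (a copy of) the integer ring. -/
structure IntIso (a : Alg) where
  isRing : a.IsRing
  toInt : a.Carrier ≃+ ℤ
  map_mul : ∀ x y, toInt (a.mul isRing x y) = toInt x * toInt y

end Alg

/-- The data the logic is built over: a finite relational signature (arity `0` allowed), a
collection of rings and/or abelian groups (indexed by `Ty`), a finite set of weight symbols with
positive arity and a type, and a countable collection of typed predicates with a semantics. -/
structure Lang where
  Rel : Type
  rel_finite : Finite Rel
  arR : Rel → ℕ
  Ty : Type
  alg : Ty → Alg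
  Wt : Type
  wt_finite : Finite Wt
  arW : Wt → ℕ
  arW_pos : ∀ w, 1 ≤ arW w
  tyW : Wt → Ty
  Prd : Type
  prd_countable : Countable Prd
  arP : Prd → ℕ
  arP_pos : ∀ P, 1 ≤ arP P
  tyP : (P : Prd) → Fin (arP P) → Ty
  sem : (P : Prd) → Set ((j : Fin (arP P)) → (alg (tyP P j)).Carrier)

/-- The underlying set of the ring or group with index `i`. -/
abbrev Lang.El (L : Lang) (i : L.Ty) : Type := (L.alg i).Carrier

/-- All elements of all members of the collection. -/
abbrev Lang.Const (L : Lang) : Type := Σ i : L.Ty, L.El i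

/-! ### Expressions.  Variables are natural numbers. -/

/-- A factor of a weight product: an element of the ring/group, or `w(y₁,…,yₖ)` with pairwise
distinct variables. -/
inductive Factor (L : Lang) : L.Ty → Type
  | const (i : L.Ty) (s : L.El i) : Factor L i
  | wt (w : L.Wt) (y : Fin (L.arW w) ↪ ℕ) : Factor L (L.tyW w)

/-- Weight products `t₁ · … · tₗ` with `ℓ ≥ 1`; more than one factor only in a ring. -/
inductive WProd (L : Lang) (i : L.Ty) : Type
  | single (f : Factor L i) : WProd L i
  | times (h : (L.alg i).IsRing) (f : Factor L i) (p : WProd L i) : WProd L i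

mutual

/-- Formulas of first-order logic with weight aggregation. -/
inductive Formula (L : Lang) : Type
  /-- `x = y` -/
  | eq (x y : ℕ) : Formula L
  /-- `R(x₁,…,xₖ)` -/
  | rel (R : L.Rel) (x : Fin (L.arR R) → ℕ) : Formula L
  /-- `(s = w(x₁,…,xₖ))`, the variables being pairwise distinct -/
  | weq (w : L.Wt) (s : L.El (L.tyW w)) (x : Fin (L.arW w) ↪ ℕ) : Formula L
  | neg (φ : Formula L) : Formula L
  | or (φ ψ : Formula L) : Formula L
  | ex (y : ℕ) (φ : Formula L) : Formula L
  /-- `(s = ∑ w(y₁,…,yₖ).φ)`, the variables being pairwise distinct -/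
  | agg (w : L.Wt) (s : L.El (L.tyW w)) (y : Fin (L.arW w) ↪ ℕ) (φ : Formula L) : Formula L
  /-- `P(t₁,…,tₘ)` -/
  | pred (P : L.Prd) (t : (j : Fin (L.arP P)) → Term L (L.tyP P j)) : Formula L

/-- Terms of first-order logic with weight aggregation, indexed by their type. -/
inductive Term (L : Lang) : L.Ty → Type
  | const (i : L.Ty) (s : L.El i) : Term L i
  | wt (w : L.Wt) (x : Fin (L.arW w) ↪ ℕ) : Term L (L.tyW w)
  | add {i : L.Ty} (s t : Term L i) : Term L i
  | sub {i : L.Ty} (s t : Term L i) : Term L i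
  | mul {i : L.Ty} (h : (L.alg i).IsRing) (s t : Term L i) : Term L i
  /-- `∑ p.φ` -/
  | sum {i : L.Ty} (p : WProd L i) (φ : Formula L) : Term L i

end

/-- Conjunction, as the usual shorthand. -/
def Formula.and {L : Lang} (φ ψ : Formula L) : Formula L :=
  .neg (.or (.neg φ) (.neg ψ))

/-! ### Variables -/

def Factor.vars {L : Lang} {i : L.Ty} : Factor L i → Finset ℕ
  | .const _ _ => ∅
  | .wt _ y => Finset.univ.map y

def WProd.vars {L : Lang} {i : L.Ty} : WProd L i → Finset ℕ
  | .single f => f.vars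
  | .times _ f p => f.vars ∪ p.vars

mutual

/-- Free variables of a formula. -/
def Formula.free {L : Lang} : Formula L → Finset ℕ
  | .eq x y => {x, y}
  | .rel _ x => Finset.univ.image x
  | .weq _ _ x => Finset.univ.map x
  | .neg φ => φ.free
  | .or φ ψ => φ.free ∪ ψ.free
  | .ex y φ => φ.free \ {y}
  | .agg _ _ y φ => φ.free \ Finset.univ.map y
  | .pred _ t => Finset.univ.biUnion fun j => (t j).free

/-- Free variables of a term. -/
def Term.free {L : Lang} {i : L.Ty} : Term L i → Finset ℕ
  | .const _ _ => ∅
  | .wt _ x => Finset.univ.map x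
  | .add s t => s.free ∪ t.free
  | .sub s t => s.free ∪ t.free
  | .mul _ s t => s.free ∪ t.free
  | .sum p φ => φ.free \ p.vars

end

/-! ### Weighted structures -/

/-- Relations and weights on `A`, not yet subject to the locality condition for weights. -/
structure Str (L : Lang) (A : Type) where
  rel : (R : L.Rel) → Set (Fin (L.arR R) → A)
  wt : (w : L.Wt) → (Fin (L.arW w) → A) → L.El (L.tyW w)

namespace Str

variable {L : Lang} {A : Type}

/-- The locality condition that weighted structures have to satisfy: a tuple of nonzero weight is
of length one, or constant, or contained in a tuple of some relation. -/
def IsWeighted (M : Str L A) : Prop :=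
  ∀ (w : L.Wt) (a : Fin (L.arW w) → A), M.wt w a ≠ 0 →
    L.arW w = 1 ∨ (∀ i j, a i = a j) ∨
      ∃ (R : L.Rel) (b : Fin (L.arR R) → A), b ∈ M.rel R ∧ Set.range a ⊆ Set.range b

/-- Induced substructure; weights are restricted. -/
def induce (M : Str L A) (B : Set A) : Str L B where
  rel R := {b | (fun i => (b i : A)) ∈ M.rel R}
  wt w b := M.wt w fun i => (b i : A)

/-- Gaifman graph. -/
def gaifman (M : Str L A) : SimpleGraph A where
  Adj a b := a ≠ b ∧ ∃ (R : L.Rel) (t : Fin (L.arR R) → A),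
    t ∈ M.rel R ∧ a ∈ Set.range t ∧ b ∈ Set.range t
  symm := ⟨fun _ _ ⟨h, R, t, ht, ha, hb⟩ => ⟨h.symm, R, t, ht, hb, ha⟩⟩
  loopless := ⟨fun _ h => h.1 rfl⟩

/-- The set of elements at distance at most `r` from some element of `C`. -/
def ball (M : Str L A) (r : ℕ) (C : Set A) : Set A :=
  {b | ∃ c ∈ C, M.gaifman.edist c b ≤ r}

end Str

/-! ### Semantics -/

section Semantics

variable {L : Lang} {A : Type}

def Factor.val (M : Str L A) (β : ℕ → A) : {i : L.Ty} → Factor L i → L.El i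
  | _, .const _ s => s
  | _, .wt w y => M.wt w fun j => β (y j)

def WProd.val (M : Str L A) (β : ℕ → A) {i : L.Ty} : WProd L i → L.El i
  | .single f => f.val M β
  | .times h f p => (L.alg i).mul h (f.val M β) (p.val M β)

mutual

/-- Satisfaction under the assignment `β`.  `Function.extend y a β` is the assignment that maps
`y j` to `a j` and agrees with `β` elsewhere. -/
noncomputable def Formula.Sat (M : Str L A) : Formula L → (ℕ → A) → Prop
  | .eq x y, β => β x = β y
  | .rel R x, β => (fun j => β (x j)) ∈ M.rel R
  | .weq w s x, β => s = M.wt w fun j => β (x j)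
  | .neg φ, β => ¬ φ.Sat M β
  | .or φ ψ, β => φ.Sat M β ∨ ψ.Sat M β
  | .ex y φ, β => ∃ a : A, φ.Sat M (Function.update β y a)
  | .agg w s y φ, β =>
      s = ∑ᶠ (a : Fin (L.arW w) → A) (_ : φ.Sat M (Function.extend y a β)), M.wt w a
  | .pred P t, β => (fun j => (t j).val M β) ∈ L.sem P

/-- The value of a term under the assignment `β`. -/
noncomputable def Term.val (M : Str L A) : {i : L.Ty} → Term L i → (ℕ → A) → L.El i
  | _, .const _ s, _ => s
  | _, .wt w x, β => M.wt w fun j => β (x j)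
  | _, .add s t, β => s.val M β + t.val M β
  | _, .sub s t, β => s.val M β - t.val M β
  | i, .mul h s t, β => (L.alg i).mul h (s.val M β) (t.val M β)
  | _, .sum p φ, β =>
      ∑ᶠ (a : {y : ℕ // y ∈ p.vars} → A) (_ : φ.Sat M (Function.extend Subtype.val a β)),
        p.val M (Function.extend Subtype.val a β)

end

end Semantics

/-! ### Fragments -/

section Fragments

variable {L : Lang}

mutual

/-- Formulas of the fragment `FOW₁`: aggregation `(s = ∑ w(y).φ)` only over finite types,
predicates only applied to terms with at most one free variable in total, and no terms `∑ p.φ`. -/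
def Formula.IsFOW : Formula L → Prop
  | .eq _ _ => True
  | .rel _ _ => True
  | .weq _ _ _ => True
  | .neg φ => φ.IsFOW
  | .or φ ψ => φ.IsFOW ∧ ψ.IsFOW
  | .ex _ φ => φ.IsFOW
  | .agg w _ _ φ => Finite (L.El (L.tyW w)) ∧ φ.IsFOW
  | .pred _ t => (Finset.univ.biUnion fun j => (t j).free).card ≤ 1 ∧ ∀ j, (t j).IsFOW

/-- Terms that use no aggregation `∑ p.φ`. -/
def Term.IsFOW {i : L.Ty} : Term L i → Prop
  | .const _ _ => True
  | .wt _ _ => True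
  | .add s t => s.IsFOW ∧ t.IsFOW
  | .sub s t => s.IsFOW ∧ t.IsFOW
  | .mul _ s t => s.IsFOW ∧ t.IsFOW
  | .sum _ _ => False

end

/-- Plain first-order formulas. -/
def Formula.IsFO : Formula L → Prop
  | .eq _ _ => True
  | .rel _ _ => True
  | .weq _ _ _ => False
  | .neg φ => φ.IsFO
  | .or φ ψ => φ.IsFO ∧ ψ.IsFO
  | .ex _ φ => φ.IsFO
  | .agg _ _ _ _ => False
  | .pred _ _ => False

end Fragments

/-! ### Locality -/

section Locality

variable {L : Lang}

/-- `ψ` is `r`-local around the variables in `X` (used for nonempty `X ⊇ free ψ`): in every finite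
weighted structure, `ψ` holds iff it holds in the `r`-neighbourhood of the values of the variables
in `X`. -/
def Formula.IsLocal (r : ℕ) (X : Finset ℕ) (ψ : Formula L) : Prop :=
  ∀ (A : Type) [Finite A] [Nonempty A] (M : Str L A), M.IsWeighted →
    ∀ (β : ℕ → A) (γ : ℕ → M.ball r (β '' X)), (∀ x ∈ X, (γ x : A) = β x) →
      (ψ.Sat M β ↔ ψ.Sat (M.induce (M.ball r (β '' X))) γ)

/-- `χ` is a sentence `(s = ∑ w(y).lam(y))` of `FOW₁` with `lam` being `r`-local around `y`. -/
def Formula.IsLocalAgg (r : ℕ) (χ : Formula L) : Prop :=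
  χ.IsFOW ∧ ∃ (w : L.Wt) (s : L.El (L.tyW w)) (y : Fin (L.arW w) ↪ ℕ) (lam : Formula L),
    χ = .agg w s y lam ∧ lam.free ⊆ Finset.univ.map y ∧ lam.IsLocal r (Finset.univ.map y)

/-- `δ` is a first-order formula expressing that the tuple `y` has distance pattern `G` at
threshold `m`: distinct positions have distance at most `m` iff they are adjacent in `G`. -/
def Formula.IsPattern {k : ℕ} (G : SimpleGraph (Fin k)) (m : ℕ) (y : Fin k ↪ ℕ)
    (δ : Formula L) : Prop :=
  δ.IsFO ∧ δ.free ⊆ Finset.univ.map y ∧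
    ∀ (A : Type) [Finite A] [Nonempty A] (M : Str L A), M.IsWeighted → ∀ β : ℕ → A,
      (δ.Sat M β ↔ ∀ i j, i ≠ j → (G.Adj i j ↔ M.gaifman.edist (β (y i)) (β (y j)) ≤ m))

/-- Basic connected local terms `∑ p.(ψ(y₁,…,yₖ) ∧ δ(y₁,…,yₖ))` of radius `r`. -/
def Term.IsBasicCl (r : ℕ) {i : L.Ty} (t : Term L i) : Prop :=
  ∃ (k : ℕ) (y : Fin k ↪ ℕ) (p : WProd L i) (ψ δ : Formula L) (G : SimpleGraph (Fin k)),
    1 ≤ k ∧ t = .sum p (ψ.and δ) ∧ p.vars ⊆ Finset.univ.map y ∧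
    ψ.IsFOW ∧ ψ.free ⊆ Finset.univ.map y ∧ ψ.IsLocal r (Finset.univ.map y) ∧
    G.Connected ∧ δ.IsPattern G (2 * r + 1) y

/-- Connected local terms.  The radius is the maximum of the radii of the basic connected local
terms from which the term is built. -/
inductive Term.IsCl : ℕ → {i : L.Ty} → Term L i → Prop
  | basic {r : ℕ} {i : L.Ty} {t : Term L i} (h : t.IsBasicCl r) : IsCl r t
  | const (i : L.Ty) (s : L.El i) : IsCl 0 (.const i s)
  | wt (w : L.Wt) (x : Fin (L.arW w) ↪ ℕ) : IsCl 0 (.wt w x)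
  | add {r r' : ℕ} {i : L.Ty} {s t : Term L i} (hs : IsCl r s) (ht : IsCl r' t) :
      IsCl (max r r') (.add s t)
  | sub {r r' : ℕ} {i : L.Ty} {s t : Term L i} (hs : IsCl r s) (ht : IsCl r' t) :
      IsCl (max r r') (.sub s t)
  | mul {r r' : ℕ} {i : L.Ty} (h : (L.alg i).IsRing) {s t : Term L i}
      (hs : IsCl r s) (ht : IsCl r' t) : IsCl (max r r') (.mul h s t)

end Locality

/-! ### Boolean combinations of local formulas, local aggregation sentences and `g ≥ 1` -/

/-- Boolean combinations of three kinds of statements: formulas (meant to be local), aggregation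
sentences, and statements `g ≥ 1` for terms `g` of type `Z`. -/
inductive ClForm (L : Lang) (Z : L.Ty) : Type
  | loc (ψ : Formula L) : ClForm L Z
  | aggr (χ : Formula L) : ClForm L Z
  | geOne (g : Term L Z) : ClForm L Z
  | neg (θ : ClForm L Z) : ClForm L Z
  | or (θ η : ClForm L Z) : ClForm L Z

namespace ClForm

variable {L : Lang} {Z : L.Ty}

def Sat (eZ : (L.alg Z).IntIso) {A : Type} (M : Str L A) : ClForm L Z → (ℕ → A) → Prop
  | loc ψ, β => ψ.Sat M β
  | aggr χ, β => χ.Sat M β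
  | geOne g, β => 1 ≤ eZ.toInt (g.val M β)
  | neg θ, β => ¬ θ.Sat eZ M β
  | or θ η, β => θ.Sat eZ M β ∨ η.Sat eZ M β

/-- The terms `g` of the statements `g ≥ 1`, from left to right. -/
def groundTerms : ClForm L Z → List (Term L Z)
  | loc _ => []
  | aggr _ => []
  | geOne g => [g]
  | neg θ => θ.groundTerms
  | or θ η => θ.groundTerms ++ η.groundTerms

/-- All parts have the required form: the formulas `ψ(x)` belong to `FOW₁`, have exactly the free
variables `x` (at least one) and are `r`-local around them, the aggregation sentences are local
ones with a summation condition that is `r`-local, and the terms `g` are ground and connected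
local. -/
def IsNormal (x : List ℕ) (r : ℕ) : ClForm L Z → Prop
  | loc ψ => x ≠ [] ∧ ψ.IsFOW ∧ ψ.free = x.toFinset ∧ ψ.IsLocal r x.toFinset
  | aggr χ => χ.IsLocalAgg r
  | geOne g => g.free = ∅ ∧ ∃ ρ, g.IsCl ρ
  | neg θ => θ.IsNormal x r
  | or θ η => θ.IsNormal x r ∧ η.IsNormal x r

end ClForm

/-- Equivalence of a formula and a Boolean combination, over all finite weighted structures in
which the weight symbol `one` is interpreted by the integer `1` everywhere. -/
def Equivalent {L : Lang} (one : L.Wt) (eZ : (L.alg (L.tyW one)).IntIso)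
    (φ : Formula L) (θ : ClForm L (L.tyW one)) : Prop :=
  ∀ (A : Type) [Finite A] [Nonempty A] (M : Str L A), M.IsWeighted →
    (∀ a, eZ.toInt (M.wt one a) = 1) →
    ∀ β : ℕ → A, φ.Sat M β ↔ θ.Sat eZ M β

/-! ### Expressions as inputs and outputs of algorithms -/

/-- Names (natural numbers) for the symbols and for the ring and group elements in `dom` that may
occur in expressions.  As the rings and groups may be uncountable, `dom` is an arbitrary set whose
elements can be named injectively; it has to contain the elements of the finite types of weight
symbols. -/
structure Coding (L : Lang) where
  rel : L.Rel → ℕ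
  rel_inj : Function.Injective rel
  wt : L.Wt → ℕ
  wt_inj : Function.Injective wt
  prd : L.Prd → ℕ
  prd_inj : Function.Injective prd
  dom : Set L.Const
  el : L.Const → ℕ
  el_injOn : Set.InjOn el dom
  fin_mem : ∀ w, Finite (L.El (L.tyW w)) → ∀ s : L.El (L.tyW w), ⟨L.tyW w, s⟩ ∈ dom

section Codes

variable {L : Lang}

open Classical in
/-- The oracle that tells whether a name denotes the zero element of its ring or group. -/
noncomputable def Coding.zeroTest (N : Coding L) (n : ℕ) : ℕ :=
  if ∃ c ∈ N.dom, N.el c = n ∧ c.2 = 0 then 1 else 0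

/-- The list of the entries of a tuple, as a natural number. -/
def tupleCode {k : ℕ} (x : Fin k → ℕ) : ℕ := Encodable.encode (List.ofFn x)

def Factor.code (N : Coding L) : {i : L.Ty} → Factor L i → ℕ
  | _, .const i s => Nat.pair 0 (N.el ⟨i, s⟩)
  | _, .wt w y => Nat.pair 1 (Nat.pair (N.wt w) (tupleCode y))

def WProd.code (N : Coding L) {i : L.Ty} : WProd L i → ℕ
  | .single f => Nat.pair 0 (f.code N)
  | .times _ f p => Nat.pair 1 (Nat.pair (f.code N) (p.code N))

mutual

/-- The number that represents a formula. -/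
def Formula.code (N : Coding L) : Formula L → ℕ
  | .eq x y => Nat.pair 0 (Nat.pair x y)
  | .rel R x => Nat.pair 1 (Nat.pair (N.rel R) (tupleCode x))
  | .weq w s x => Nat.pair 2 (Nat.pair (N.wt w) (Nat.pair (N.el ⟨L.tyW w, s⟩) (tupleCode x)))
  | .neg φ => Nat.pair 3 (φ.code N)
  | .or φ ψ => Nat.pair 4 (Nat.pair (φ.code N) (ψ.code N))
  | .ex y φ => Nat.pair 5 (Nat.pair y (φ.code N))
  | .agg w s y φ => Nat.pair 6 (Nat.pair (N.wt w)
      (Nat.pair (N.el ⟨L.tyW w, s⟩) (Nat.pair (tupleCode y) (φ.code N))))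
  | .pred P t => Nat.pair 7 (Nat.pair (N.prd P) (tupleCode fun j => (t j).code N))

/-- The number that represents a term. -/
def Term.code (N : Coding L) : {i : L.Ty} → Term L i → ℕ
  | _, .const i s => Nat.pair 0 (N.el ⟨i, s⟩)
  | _, .wt w x => Nat.pair 1 (Nat.pair (N.wt w) (tupleCode x))
  | _, .add s t => Nat.pair 2 (Nat.pair (s.code N) (t.code N))
  | _, .sub s t => Nat.pair 3 (Nat.pair (s.code N) (t.code N))
  | _, .mul _ s t => Nat.pair 4 (Nat.pair (s.code N) (t.code N))
  | _, .sum p φ => Nat.pair 5 (Nat.pair (p.code N) (φ.code N))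

end

/-- The number that represents a Boolean combination. -/
def ClForm.code (N : Coding L) {Z : L.Ty} : ClForm L Z → ℕ
  | loc ψ => Nat.pair 0 (ψ.code N)
  | aggr χ => Nat.pair 1 (χ.code N)
  | geOne g => Nat.pair 2 (g.code N)
  | neg θ => Nat.pair 3 (θ.code N)
  | or θ η => Nat.pair 4 (Nat.pair (θ.code N) (η.code N))

/-! All ring and group elements occurring in an expression belong to `D`. -/

def Factor.Over (D : Set L.Const) {i : L.Ty} : Factor L i → Prop
  | .const i s => ⟨i, s⟩ ∈ D
  | .wt _ _ => True

def WProd.Over (D : Set L.Const) {i : L.Ty} : WProd L i → Prop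
  | .single f => f.Over D
  | .times _ f p => f.Over D ∧ p.Over D

mutual

def Formula.Over (D : Set L.Const) : Formula L → Prop
  | .eq _ _ => True
  | .rel _ _ => True
  | .weq w s _ => ⟨L.tyW w, s⟩ ∈ D
  | .neg φ => φ.Over D
  | .or φ ψ => φ.Over D ∧ ψ.Over D
  | .ex _ φ => φ.Over D
  | .agg w s _ φ => ⟨L.tyW w, s⟩ ∈ D ∧ φ.Over D
  | .pred _ t => ∀ j, (t j).Over D

def Term.Over (D : Set L.Const) {i : L.Ty} : Term L i → Prop
  | .const i s => ⟨i, s⟩ ∈ D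
  | .wt _ _ => True
  | .add s t => s.Over D ∧ t.Over D
  | .sub s t => s.Over D ∧ t.Over D
  | .mul _ s t => s.Over D ∧ t.Over D
  | .sum p φ => p.Over D ∧ φ.Over D

end

def ClForm.Over (D : Set L.Const) {Z : L.Ty} : ClForm L Z → Prop
  | loc ψ => ψ.Over D
  | aggr χ => χ.Over D
  | geOne g => g.Over D
  | neg θ => θ.Over D
  | or θ η => θ.Over D ∧ η.Over D

end Codes

end WA

-- The proof is an induction on formulas in the spirit of Gaifman's theorem. Variables are coloured,
-- and variables of different colours are assumed to be far apart (`Far`). Under this assumption the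
-- truth value of a formula is computed by a decision tree whose tests are formulas local around the
-- variables of one colour, local aggregation sentences and statements `g ≥ 1` (`Rep`). In the end
-- all free variables get the same colour, the assumption becomes void, and the tree is written out
-- as a Boolean combination.
--
-- An atomic formula whose variables have one colour is a test. If several colours occur, equations
-- and relations fail, and a weight is zero, so that `(s = w(x))` holds iff `s` is zero; only here
-- the oracle is needed. A predicate sees at most one variable and hence at most one colour.
--
-- Existential quantifiers and sums are treated together, as sums in a commutative monoid (`Kind`,
-- `qval`). A tuple of nonzero weight has diameter at most one. So it is close to exactly one colour
-- class or far from all of them (`far_of_guard`), and the sum splits accordingly (`qval_decomp`).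
-- In each case the tuple receives a colour, the induction hypothesis yields a tree, and the
-- summation is pulled through this tree: closed tests and tests at other colours do not depend on
-- the tuple, a test at its own colour splits the sum in two (`repQuant_other`, `repQuant_own`).
-- What remains are sums over the tuples that satisfy one local condition. Close to a colour class
-- this is bounded quantification, which is local (`loc_form`), and the value is found by testing
-- the finitely many possibilities. Far from all classes, a sum is the sum over all tuples,
-- accessible to local aggregation sentences, minus the sums close to the classes (`rep_farSum`).
--
-- For existence there is no subtraction. Elements of a set far from all classes exist iff they
-- exist at medium distance, or the set has a scattered subset larger than the maximal scattered
-- subsets close to the classes taken together (`exists_far_iff`). The sizes of the latter are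
-- bounded by the number of coloured variables and are found by local tests. A large scattered
-- subset exists iff `g ≥ 1` for a term `g` that counts tuples with pairwise large distances. Such a
-- count is a cl-term (`countDer_all`): a far condition is a difference of counts, a disconnected
-- pattern of close pairs gives a product of two counts, and a connected one gives a sum over
-- patterns that decide all distances, which are basic cl-terms.
--
-- If the subformula is handled with radius `q`, close means distance at most `p = q + 1`, and the
-- argument for existence requires classes at distance more than `4 * p + 1`. Hence each quantifier
-- turns `q` into `4 * q + 5`.
--
-- The construction is presented as a finite set of Horn clauses about codes, with primitive
-- recursive functions and the graph of the oracle as ingredients. Derivable facts can be found by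
-- search relative to the oracle (`exists_search`). All rules are sound for an intended meaning
-- (`meaning_of_der`), and every input admits a derivation (`exists_result`); so whatever the search
-- finds is a correct output. The statement without codings follows by naming the constants of the
-- formula (`exists_coding`).

namespace WA

/-! ### Horn clauses over natural numbers and search for derivations -/

/-- Patterns: expressions over variables that are evaluated to natural numbers. -/
inductive Pat : Type
  | var (k : ℕ) : Pat
  | lit (n : ℕ) : Pat
  | pair (a b : Pat) : Pat
  | app (f : ℕ → ℕ → ℕ) (hf : Primrec₂ f) (a b : Pat) : Pat

/-- Variables beyond the end of the list have the value `0`, so every finite list is a valuation and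
valuations can be enumerated. -/
def Pat.eval (v : List ℕ) : Pat → ℕ
  | .var k => v.getD k 0
  | .lit n => n
  | .pair a b => Nat.pair (a.eval v) (b.eval v)
  | .app f _ a b => f (a.eval v) (b.eval v)

theorem Pat.eval_primrec (p : Pat) : Primrec fun v => p.eval v := by
  induction p with
  | var k => exact (Primrec.list_getD 0).comp Primrec.id (Primrec.const k)
  | lit n => exact Primrec.const n
  | pair a b iha ihb => exact Primrec₂.natPair.comp iha ihb
  | app f hf a b iha ihb => exact hf.comp iha ihb

/-- Horn clauses whose atoms are lists of numbers. -/
structure Clause where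
  head : List Pat
  body : List (List Pat)

/-- The lists derivable from the clauses in `P` and the graph of `O`. -/
inductive Der (P : List Clause) (O : ℕ → ℕ) : List ℕ → Prop
  | graph (s : ℕ) : Der P O [0, s, O s]
  | rule (c : Clause) (hc : c ∈ P) (v : List ℕ)
      (h : ∀ b ∈ c.body, Der P O (b.map (Pat.eval v))) : Der P O (c.head.map (Pat.eval v))

/-- Add the instance of a clause given by `v` if its premises have been derived. -/
def Clause.fire (c : Clause) (v : List ℕ) (D : List (List ℕ)) : List (List ℕ) :=
  if ∀ b ∈ c.body.map (fun b : List Pat => b.map (Pat.eval v)), b ∈ D then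
    c.head.map (Pat.eval v) :: D else D

/-- One step of the bottom-up evaluation, `t` being a part of the graph of the oracle. -/
def fireAll (P : List Clause) (t : List (ℕ × ℕ)) (v : List ℕ) (D : List (List ℕ)) :
    List (List ℕ) :=
  P.foldr (fun c D => c.fire v D)
    (if (v.getD 0 0, v.getD 1 0) ∈ t then [0, v.getD 0 0, v.getD 1 0] :: D else D)

def fireList (P : List Clause) (t : List (ℕ × ℕ)) (vs : List (List ℕ)) : List (List ℕ) :=
  vs.foldr (fun v D => fireAll P t v D) []

theorem evalList_primrec (l : List Pat) : Primrec fun v => l.map (Pat.eval v) := by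
  induction l with
  | nil => exact Primrec.const _
  | cons a l ih => exact Primrec.list_cons.comp a.eval_primrec ih

theorem evalLists_primrec (l : List (List Pat)) :
    Primrec fun v => l.map (fun b => b.map (Pat.eval v)) := by
  induction l with
  | nil => exact Primrec.const _
  | cons a l ih => exact Primrec.list_cons.comp (evalList_primrec a) ih

theorem mem_primrec {α : Type*} [Primcodable α] :
    PrimrecRel fun (a : α) (l : List α) => a ∈ l :=
  ((PrimrecRel.exists_mem_list (R := fun a b : α => a = b) Primrec.eq).comp
    Primrec.snd Primrec.fst).of_eq fun p => by simp

theorem subset_primrec {α : Type*} [Primcodable α] :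
    PrimrecRel fun (l l' : List α) => ∀ a ∈ l, a ∈ l' :=
  PrimrecRel.forall_mem_list mem_primrec

theorem fire_primrec (c : Clause) : Primrec₂ c.fire := by
  classical
  have := Primrec.ite
    (subset_primrec.comp ((evalLists_primrec c.body).comp (Primrec.fst (α := List ℕ)))
      (Primrec.snd (β := List (List ℕ))))
    (Primrec.list_cons.comp ((evalList_primrec c.head).comp Primrec.fst) Primrec.snd) Primrec.snd
  exact this.of_eq fun p => by simp only [Clause.fire]

/-- The program is not an input: the recursion over it happens outside, one composition of primitive
recursive functions per clause. -/
theorem fireAll_primrec (P : List Clause) :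
    Primrec fun q : (List (ℕ × ℕ) × List ℕ) × List (List ℕ) => fireAll P q.1.1 q.1.2 q.2 := by
  classical
  induction P with
  | nil =>
    have hv (k : ℕ) : Primrec fun q : (List (ℕ × ℕ) × List ℕ) × List (List ℕ) =>
        q.1.2.getD k 0 :=
      (Primrec.list_getD 0).comp (Primrec.snd.comp Primrec.fst) (Primrec.const k)
    exact Primrec.ite (mem_primrec.comp (Primrec.pair (hv 0) (hv 1))
      (Primrec.fst.comp Primrec.fst))
      (Primrec.list_cons.comp (Primrec.list_cons.comp (Primrec.const 0)
        (Primrec.list_cons.comp (hv 0) (Primrec.list_cons.comp (hv 1) (Primrec.const []))))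
        Primrec.snd) Primrec.snd
  | cons c P ih => exact (fire_primrec c).comp (Primrec.snd.comp Primrec.fst) ih

theorem fireList_primrec (P : List Clause) : Primrec₂ (fireList P) :=
  Primrec.list_foldr (f := fun q : List (ℕ × ℕ) × List (List ℕ) => q.2) (g := fun _ => [])
    (h := fun q r => fireAll P q.1 r.1 r.2) Primrec.snd (Primrec.const [])
    ((fireAll_primrec P).comp (Primrec.pair (Primrec.pair (Primrec.fst.comp Primrec.fst)
      (Primrec.fst.comp Primrec.snd)) (Primrec.snd.comp Primrec.snd)))

theorem Clause.mem_fire {c : Clause} {v : List ℕ} {D : List (List ℕ)} {j : List ℕ} :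
    j ∈ c.fire v D ↔ j ∈ D ∨
      (∀ b ∈ c.body, b.map (Pat.eval v) ∈ D) ∧ j = c.head.map (Pat.eval v) := by
  unfold Clause.fire
  simp only [List.forall_mem_map]
  split_ifs with h
  · rw [List.mem_cons]; tauto
  · tauto

theorem mem_fireAll_nil {t : List (ℕ × ℕ)} {v : List ℕ} {D : List (List ℕ)} {j : List ℕ} :
    j ∈ fireAll [] t v D ↔ j ∈ D ∨
      (v.getD 0 0, v.getD 1 0) ∈ t ∧ j = [0, v.getD 0 0, v.getD 1 0] := by
  simp only [fireAll, List.foldr_nil]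
  split_ifs with h
  · rw [List.mem_cons]; tauto
  · tauto

theorem mem_fireAll_cons {c : Clause} {P : List Clause} {t : List (ℕ × ℕ)} {v : List ℕ}
    {D : List (List ℕ)} {j : List ℕ} :
    j ∈ fireAll (c :: P) t v D ↔ j ∈ fireAll P t v D ∨
      (∀ b ∈ c.body, b.map (Pat.eval v) ∈ fireAll P t v D) ∧ j = c.head.map (Pat.eval v) :=
  Clause.mem_fire

theorem mem_fireAll_of_nil {P : List Clause} {t : List (ℕ × ℕ)} {v : List ℕ}
    {D : List (List ℕ)} {j : List ℕ} (h : j ∈ fireAll [] t v D) : j ∈ fireAll P t v D := by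
  induction P with
  | nil => exact h
  | cons c P ih => exact mem_fireAll_cons.2 (.inl ih)

theorem mem_fireAll_of_mem {P : List Clause} {t : List (ℕ × ℕ)} {v : List ℕ}
    {D : List (List ℕ)} {j : List ℕ} (h : j ∈ D) : j ∈ fireAll P t v D :=
  mem_fireAll_of_nil (mem_fireAll_nil.2 (.inl h))

/-- The induction runs over a part `P'` of the program, since derivability has to refer to the fixed
whole program `P`. -/
theorem der_of_mem_fireAll {P P' : List Clause} {O : ℕ → ℕ} {t : List (ℕ × ℕ)}
    (hP : ∀ c ∈ P', c ∈ P) (ht : ∀ s ∈ t, O s.1 = s.2) {v : List ℕ} {D : List (List ℕ)}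
    (hD : ∀ j ∈ D, Der P O j) : ∀ j ∈ fireAll P' t v D, Der P O j := by
  induction P' with
  | nil =>
    intro j hj
    rcases mem_fireAll_nil.1 hj with hj | ⟨h, rfl⟩
    · exact hD j hj
    · rw [← show O (v.getD 0 0) = v.getD 1 0 from ht _ h]
      exact .graph _
  | cons c P' ih =>
    have ih := ih fun c hc => hP c (List.mem_cons_of_mem _ hc)
    intro j hj
    rcases mem_fireAll_cons.1 hj with hj | ⟨h, rfl⟩
    · exact ih j hj
    · exact .rule c (hP c List.mem_cons_self) v fun b hb => ih _ (h _ hb)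

theorem der_of_mem_fireList {P : List Clause} {O : ℕ → ℕ} {t : List (ℕ × ℕ)}
    (ht : ∀ s ∈ t, O s.1 = s.2) (vs : List (List ℕ)) :
    ∀ j ∈ fireList P t vs, Der P O j := by
  induction vs with
  | nil => simp [fireList]
  | cons v vs ih => exact der_of_mem_fireAll (fun _ h => h) ht ih

/-- The right end of the list of valuations is processed first, and derived facts are never removed.
-/
theorem fireList_append_mem {P : List Clause} {t : List (ℕ × ℕ)} {vs ws : List (List ℕ)}
    {j : List ℕ} (h : j ∈ fireList P t ws) : j ∈ fireList P t (vs ++ ws) := by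
  induction vs with
  | nil => exact h
  | cons v vs ih => exact mem_fireAll_of_mem ih

theorem fireAll_mono {P : List Clause} {t t' : List (ℕ × ℕ)} (ht : ∀ s ∈ t, s ∈ t')
    {v : List ℕ} {D D' : List (List ℕ)} (hD : ∀ j ∈ D, j ∈ D') :
    ∀ j ∈ fireAll P t v D, j ∈ fireAll P t' v D' := by
  induction P with
  | nil =>
    intro j hj
    exact mem_fireAll_nil.2 ((mem_fireAll_nil.1 hj).imp (hD j) fun h => ⟨ht _ h.1, h.2⟩)
  | cons c P ih =>
    intro j hj
    exact mem_fireAll_cons.2 ((mem_fireAll_cons.1 hj).imp (ih j)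
      fun h => ⟨fun b hb => ih _ (h.1 b hb), h.2⟩)

theorem fireList_mono {P : List Clause} {t t' : List (ℕ × ℕ)} (ht : ∀ s ∈ t, s ∈ t')
    (vs : List (List ℕ)) {D D' : List (List ℕ)} (hD : ∀ j ∈ D, j ∈ D') :
    ∀ j ∈ vs.foldr (fun v D => fireAll P t v D) D,
      j ∈ vs.foldr (fun v D => fireAll P t' v D) D' := by
  induction vs with
  | nil => exact hD
  | cons v vs ih => exact fireAll_mono ht ih

theorem mem_fireAll_of_clause {P : List Clause} {t : List (ℕ × ℕ)} {v : List ℕ}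
    {D : List (List ℕ)} {c : Clause} (hc : c ∈ P)
    (h : ∀ b ∈ c.body, b.map (Pat.eval v) ∈ D) :
    c.head.map (Pat.eval v) ∈ fireAll P t v D := by
  induction P with
  | nil => simp at hc
  | cons c' P ih =>
    rcases List.mem_cons.1 hc with rfl | hc
    · exact mem_fireAll_cons.2 (.inr ⟨fun b hb => mem_fireAll_of_mem (h b hb), rfl⟩)
    · exact mem_fireAll_cons.2 (.inl (ih hc))

/-- The graph of `O` below `m`. -/
def graphList (O : ℕ → ℕ) : ℕ → List (ℕ × ℕ)
  | 0 => []
  | m + 1 => (m, O m) :: graphList O m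

theorem mem_graphList {O : ℕ → ℕ} {m : ℕ} {s : ℕ × ℕ} :
    s ∈ graphList O m ↔ s.1 < m ∧ O s.1 = s.2 := by
  induction m with
  | zero => simp [graphList]
  | succ m ih =>
    rw [graphList, List.mem_cons, ih]
    constructor
    · rintro (rfl | h)
      · simp
      · exact ⟨by omega, h.2⟩
    · rintro ⟨h, h'⟩
      rcases Nat.lt_succ_iff_lt_or_eq.1 h with h1 | h1
      · exact .inr ⟨h1, h'⟩
      · exact .inl (Prod.ext h1 (by rw [← h', h1]))

/-- Completeness of bottom-up evaluation: a derivation is finite, so it uses finitely many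
valuations and asks finitely many questions to the oracle. -/
theorem exists_fireList_of_der {P : List Clause} {O : ℕ → ℕ} {j : List ℕ} (h : Der P O j) :
    ∃ m vs, j ∈ fireList P (graphList O m) vs := by
  induction h with
  | graph s =>
    refine ⟨s + 1, [[s, O s]], ?_⟩
    exact mem_fireAll_of_nil (mem_fireAll_nil.2 (.inr ⟨by simp [mem_graphList], rfl⟩))
  | rule c hc v _ ih =>
    have : ∃ m vs, ∀ b ∈ c.body, b.map (Pat.eval v) ∈ fireList P (graphList O m) vs := by
      have : ∀ bs : List (List Pat), (∀ b ∈ bs, ∃ m vs,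
          b.map (Pat.eval v) ∈ fireList P (graphList O m) vs) →
          ∃ m vs, ∀ b ∈ bs, b.map (Pat.eval v) ∈ fireList P (graphList O m) vs := by
        intro bs
        induction bs with
        | nil => intro _; exact ⟨0, [], by simp⟩
        | cons b bs ihb =>
          intro hb
          obtain ⟨m₁, vs₁, h₁⟩ := hb b (by simp)
          obtain ⟨m₂, vs₂, h₂⟩ := ihb fun b' hb' => hb b' (by simp [hb'])
          have mono (m : ℕ) (hm : m ≤ max m₁ m₂) :
              ∀ s ∈ graphList O m, s ∈ graphList O (max m₁ m₂) := fun s hs => by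
            rw [mem_graphList] at hs ⊢; exact ⟨by omega, hs.2⟩
          -- The runs for the single premises are concatenated; each survives the other because
          -- evaluation is monotone in the known facts and in the known part of the oracle.
          refine ⟨max m₁ m₂, vs₂ ++ vs₁, fun b' hb' => ?_⟩
          rcases List.mem_cons.1 hb' with rfl | hb'
          · exact fireList_append_mem (fireList_mono (mono m₁ (by simp)) vs₁ (by simp) _ h₁)
          · simp only [fireList, List.foldr_append]
            exact fireList_mono (mono m₂ (by simp)) vs₂ (by simp) _ (h₂ b' hb')
      exact this c.body ih
    obtain ⟨m, vs, h⟩ := this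
    -- The valuation of the last rule stands at the head of the list and is thus processed last,
    -- when all premises are present.
    exact ⟨m, v :: vs, mem_fireAll_of_clause hc h⟩

-- Computation relative to an oracle

/-- Total functions that are recursive in the oracles `O`. -/
def TotIn (O : Set (ℕ →. ℕ)) (f : ℕ → ℕ) : Prop := Nat.RecursiveIn O fun n => Part.some (f n)

theorem TotIn.of_primrec {O : Set (ℕ →. ℕ)} {f : ℕ → ℕ} (hf : Primrec f) : TotIn O f :=
  Nat.Primrec.recursiveIn (Primrec.nat_iff.1 hf)

theorem TotIn.comp {O : Set (ℕ →. ℕ)} {f g : ℕ → ℕ} (hf : TotIn O f) (hg : TotIn O g) :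
    TotIn O fun n => f (g n) :=
  (Nat.RecursiveIn.comp hf hg).of_eq fun n => by
    change (Part.some (g n)).bind _ = _
    rw [Part.bind_some]

theorem TotIn.pair {O : Set (ℕ →. ℕ)} {f g : ℕ → ℕ} (hf : TotIn O f) (hg : TotIn O g) :
    TotIn O fun n => Nat.pair (f n) (g n) :=
  (Nat.RecursiveIn.pair hf hg).of_eq fun n => by simp [Seq.seq]

/-- The recursion scheme for oracle computations carries a parameter; here it is the dummy `0`. -/
theorem TotIn.nat_rec {O : Set (ℕ →. ℕ)} {f : ℕ → ℕ → ℕ}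
    (hf : TotIn O fun n => f n.unpair.1 n.unpair.2) :
    TotIn O fun n => Nat.rec 0 f n := by
  have h := Nat.RecursiveIn.prec (O := O) .zero
    (hf.comp (TotIn.of_primrec (Primrec.snd.comp Primrec.unpair)))
  have h0 : TotIn O fun n => Nat.pair 0 n :=
    .of_primrec (Primrec₂.natPair.comp (Primrec.const 0) Primrec.id)
  refine (Nat.RecursiveIn.comp h h0).of_eq fun n => ?_
  change (Part.some (Nat.pair 0 n)).bind _ = _
  rw [Part.bind_some]
  simp only [Nat.unpair_pair]
  induction n with
  | zero => rfl
  | succ n ih =>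
    simp only at ih ⊢
    rw [ih]
    change (Part.some _).bind _ = _
    rw [Part.bind_some]

/-- The only computation that questions the oracle: everything else is primitive recursive in a
finite table of answers. -/
theorem graphList_recursiveIn (O : ℕ → ℕ) :
    TotIn {(O : ℕ →. ℕ)} fun m => Encodable.encode (graphList O m) := by
  have ho : TotIn {(O : ℕ →. ℕ)} O := .oracle _ rfl
  have h1 : TotIn {(O : ℕ →. ℕ)} fun n => n.unpair.1 :=
    .of_primrec (Primrec.fst.comp Primrec.unpair)
  have h2 : TotIn {(O : ℕ →. ℕ)} fun n => n.unpair.2 :=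
    .of_primrec (Primrec.snd.comp Primrec.unpair)
  have h := TotIn.nat_rec (f := fun y i => Nat.succ (Nat.pair (Nat.pair y (O y)) i))
    ((TotIn.of_primrec Primrec.succ).comp ((h1.pair (ho.comp h1)).pair h2))
  refine h.of_eq fun m => congrArg Part.some ?_
  induction m with
  | zero => rfl
  | succ m ih =>
    simp only at ih ⊢
    simp only [graphList, Encodable.encode_list_cons, ih, Encodable.encode_prod_val]
    rfl

/-- Derivable lists can be searched for. -/
theorem exists_search (P : List Clause) (O : ℕ → ℕ) :
    ∃ F : ℕ →. ℕ, Nat.RecursiveIn {(O : ℕ →. ℕ)} F ∧ ∀ a b,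
      (∀ y ∈ F (Nat.pair a b), Der P O [1, a, b, y]) ∧
      ((∃ y, Der P O [1, a, b, y]) → (F (Nat.pair a b)).Dom) := by
  classical
  let T := graphList O
  -- The search runs over numbers that code a triple: a candidate for the output, a bound for the
  -- questions to the oracle, and a list of valuations.
  let vsOf : ℕ → List (List ℕ) := fun m => (Encodable.decode m.unpair.2.unpair.2).getD []
  let tOf : ℕ → List (ℕ × ℕ) := fun t => (Encodable.decode t).getD []
  let good : ℕ → ℕ → ℕ → Prop := fun n m t =>
    [1, n.unpair.1, n.unpair.2, m.unpair.1] ∈ fireList P (tOf t) (vsOf m)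
  let c : ℕ → ℕ := fun u =>
    if good u.unpair.1.unpair.1 u.unpair.1.unpair.2 u.unpair.2 then 0 else 1
  have hc : Primrec c := by
    have h1 : Primrec fun u : ℕ => u.unpair.1.unpair.1 :=
      Primrec.fst.comp (Primrec.unpair.comp (Primrec.fst.comp Primrec.unpair))
    have h2 : Primrec fun u : ℕ => u.unpair.1.unpair.2 :=
      Primrec.snd.comp (Primrec.unpair.comp (Primrec.fst.comp Primrec.unpair))
    have h3 : Primrec fun u : ℕ => u.unpair.2 := Primrec.snd.comp Primrec.unpair
    have hvs : Primrec vsOf := Primrec.option_getD.comp (Primrec.decode.comp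
      (Primrec.snd.comp (Primrec.unpair.comp (Primrec.snd.comp Primrec.unpair))))
      (Primrec.const [])
    have ht : Primrec tOf := Primrec.option_getD.comp Primrec.decode (Primrec.const [])
    refine Primrec.ite (mem_primrec.comp (Primrec.list_cons.comp (Primrec.const 1)
      (Primrec.list_cons.comp (Primrec.fst.comp (Primrec.unpair.comp h1))
      (Primrec.list_cons.comp (Primrec.snd.comp (Primrec.unpair.comp h1))
      (Primrec.list_cons.comp (Primrec.fst.comp (Primrec.unpair.comp h2)) (Primrec.const [])))))
      ((fireList_primrec P).comp (ht.comp h3) (hvs.comp h2))) (Primrec.const 0) (Primrec.const 1)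
  -- The check `c` is primitive recursive; the oracle enters only through the coded table of its
  -- answers below the guessed bound.
  let f : ℕ → ℕ := fun x => c (Nat.pair x (Encodable.encode (T x.unpair.2.unpair.2.unpair.1)))
  have hf : TotIn {(O : ℕ →. ℕ)} f :=
    (TotIn.of_primrec hc).comp ((TotIn.of_primrec Primrec.id).pair
      ((graphList_recursiveIn O).comp (TotIn.of_primrec (Primrec.fst.comp (Primrec.unpair.comp
        (Primrec.snd.comp (Primrec.unpair.comp (Primrec.snd.comp Primrec.unpair))))))))
  have hout : TotIn {(O : ℕ →. ℕ)} fun n => n.unpair.1 :=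
    .of_primrec (Primrec.fst.comp Primrec.unpair)
  have hgood (n m : ℕ) : f (Nat.pair n m) = 0 ↔
      [1, n.unpair.1, n.unpair.2, m.unpair.1] ∈ fireList P (T m.unpair.2.unpair.1) (vsOf m) := by
    simp [f, c, good, tOf]
  refine ⟨_, Nat.RecursiveIn.comp hout (Nat.RecursiveIn.rfind hf), fun a b => ⟨fun y hy => ?_, ?_⟩⟩
  · simp only [Part.bind_eq_bind, Part.mem_bind_iff] at hy
    obtain ⟨m, hm, hy⟩ := hy
    have hm := Nat.rfind_spec hm
    simp only [Part.map_eq_map, Part.map_some, Part.mem_some_iff] at hm hy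
    have := (hgood _ _).1 (of_decide_eq_true hm.symm)
    rw [Nat.unpair_pair, ← hy] at this
    exact der_of_mem_fireList (fun s hs => (mem_graphList.1 hs).2) _ _ this
  · rintro ⟨y, hy⟩
    obtain ⟨m, vs, h⟩ := exists_fireList_of_der hy
    let k := Nat.pair y (Nat.pair m (Encodable.encode vs))
    have hk : f (Nat.pair (Nat.pair a b) k) = 0 := by
      rw [hgood]
      simpa [k, vsOf, T] using h
    rw [Part.bind_eq_bind, Part.bind_dom]
    refine ⟨?_, trivial⟩
    refine Nat.rfind_dom.2 ⟨k, ?_, fun _ => ?_⟩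
    · simp [hk]
    · simp

end WA

namespace WA

-- No induction hypothesis is provided for the arguments of predicates: in `FOW₁` these terms
-- contain no formulas.
open Classical in
theorem Formula.induction {L : Lang} {motive : Formula L → Prop}
    (eq : ∀ x y, motive (.eq x y)) (rel : ∀ R x, motive (.rel R x))
    (weq : ∀ w s x, motive (.weq w s x)) (neg : ∀ φ, motive φ → motive (.neg φ))
    (or : ∀ φ ψ, motive φ → motive ψ → motive (.or φ ψ))
    (ex : ∀ y φ, motive φ → motive (.ex y φ))
    (agg : ∀ w s y φ, motive φ → motive (.agg w s y φ))
    (pred : ∀ P t, motive (.pred P t)) (φ : Formula L) : motive φ :=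
  Formula.rec (motive_1 := motive) (motive_2 := fun _ _ => True) eq rel weq neg or ex agg
    (fun P t _ => pred P t) (fun _ _ => trivial) (fun _ _ => trivial) (fun _ _ _ _ => trivial)
    (fun _ _ _ _ => trivial) (fun _ _ _ _ _ => trivial) (fun _ _ _ => trivial) φ

-- Connectives: satisfaction, free variables, fragments and constants

section Basic

variable {L : Lang} {A : Type} {M : Str L A} {β : ℕ → A}

@[simp] theorem sat_eq {x y : ℕ} : (Formula.eq x y : Formula L).Sat M β ↔ β x = β y := by
  simp only [Formula.Sat]

@[simp] theorem sat_neg {φ : Formula L} : φ.neg.Sat M β ↔ ¬ φ.Sat M β := by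
  simp only [Formula.Sat]

@[simp] theorem sat_or {φ ψ : Formula L} :
    (φ.or ψ).Sat M β ↔ φ.Sat M β ∨ ψ.Sat M β := by
  simp only [Formula.Sat]

@[simp] theorem sat_and {φ ψ : Formula L} :
    (φ.and ψ).Sat M β ↔ φ.Sat M β ∧ ψ.Sat M β := by
  simp only [Formula.and, sat_neg, sat_or]; tauto

@[simp] theorem sat_ex {y : ℕ} {φ : Formula L} :
    (Formula.ex y φ).Sat M β ↔ ∃ a, φ.Sat M (Function.update β y a) := by
  simp only [Formula.Sat]

@[simp] theorem free_neg {φ : Formula L} : φ.neg.free = φ.free := by simp only [Formula.free]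

@[simp] theorem free_or {φ ψ : Formula L} : (φ.or ψ).free = φ.free ∪ ψ.free := by
  simp only [Formula.free]

@[simp] theorem free_and {φ ψ : Formula L} : (φ.and ψ).free = φ.free ∪ ψ.free := by
  simp only [Formula.and, free_neg, free_or]

@[simp] theorem free_eq {x y : ℕ} : (Formula.eq x y : Formula L).free = {x, y} := by
  simp only [Formula.free]

@[simp] theorem free_ex {y : ℕ} {φ : Formula L} : (Formula.ex y φ).free = φ.free \ {y} := by
  simp only [Formula.free]

@[simp] theorem isFOW_eq {x y : ℕ} : (Formula.eq x y : Formula L).IsFOW := by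
  simp only [Formula.IsFOW]

@[simp] theorem isFOW_neg {φ : Formula L} : φ.neg.IsFOW ↔ φ.IsFOW := by
  simp only [Formula.IsFOW]

@[simp] theorem isFOW_or {φ ψ : Formula L} : (φ.or ψ).IsFOW ↔ φ.IsFOW ∧ ψ.IsFOW := by
  simp only [Formula.IsFOW]

@[simp] theorem isFOW_and {φ ψ : Formula L} : (φ.and ψ).IsFOW ↔ φ.IsFOW ∧ ψ.IsFOW := by
  simp only [Formula.and, isFOW_neg, isFOW_or]

@[simp] theorem isFOW_ex {y : ℕ} {φ : Formula L} : (Formula.ex y φ).IsFOW ↔ φ.IsFOW := by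
  simp only [Formula.IsFOW]

variable {D : Set L.Const}

@[simp] theorem over_eq {x y : ℕ} : (Formula.eq x y : Formula L).Over D := by
  simp only [Formula.Over]

@[simp] theorem over_neg {φ : Formula L} : φ.neg.Over D ↔ φ.Over D := by
  simp only [Formula.Over]

@[simp] theorem over_or {φ ψ : Formula L} : (φ.or ψ).Over D ↔ φ.Over D ∧ ψ.Over D := by
  simp only [Formula.Over]

@[simp] theorem over_and {φ ψ : Formula L} : (φ.and ψ).Over D ↔ φ.Over D ∧ ψ.Over D := by
  simp only [Formula.and, over_neg, over_or]

@[simp] theorem over_ex {y : ℕ} {φ : Formula L} : (Formula.ex y φ).Over D ↔ φ.Over D := by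
  simp only [Formula.Over]

@[simp] theorem isFO_neg {φ : Formula L} : φ.neg.IsFO ↔ φ.IsFO := by simp only [Formula.IsFO]

@[simp] theorem isFO_eq {x y : ℕ} : (Formula.eq x y : Formula L).IsFO := by
  simp only [Formula.IsFO]

@[simp] theorem isFO_or {φ ψ : Formula L} : (φ.or ψ).IsFO ↔ φ.IsFO ∧ ψ.IsFO := by
  simp only [Formula.IsFO]

@[simp] theorem isFO_and {φ ψ : Formula L} : (φ.and ψ).IsFO ↔ φ.IsFO ∧ ψ.IsFO := by
  simp only [Formula.and, isFO_neg, isFO_or]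

@[simp] theorem isFO_ex {y : ℕ} {φ : Formula L} : (Formula.ex y φ).IsFO ↔ φ.IsFO := by
  simp only [Formula.IsFO]

theorem Formula.IsFO.isFOW {φ : Formula L} : φ.IsFO → φ.IsFOW := by
  induction φ using Formula.induction with
  | eq => simp
  | rel => simp [Formula.IsFOW]
  | weq => simp [Formula.IsFOW]
  | neg φ ih => simpa using ih
  | or φ ψ ih ih' => rw [isFO_or, isFOW_or]; exact And.imp ih ih'
  | ex y φ ih => simpa using ih
  | agg => simp [Formula.IsFO]
  | pred => simp [Formula.IsFO]

theorem Formula.IsFO.over {φ : Formula L} : φ.IsFO → φ.Over D := by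
  induction φ using Formula.induction with
  | eq => simp
  | rel => simp [Formula.Over]
  | weq => simp [Formula.IsFO]
  | neg φ ih => simpa using ih
  | or φ ψ ih ih' => rw [isFO_or, over_or]; exact And.imp ih ih'
  | ex y φ ih => simpa using ih
  | agg => simp [Formula.IsFO]
  | pred => simp [Formula.IsFO]

end Basic

/-! ### Iterated quantifiers -/

/-- `∃ m … ∃ (m + k - 1)` -/
def exs {L : Lang} (m : ℕ) : ℕ → Formula L → Formula L
  | 0, φ => φ
  | k + 1, φ => exs m k (.ex (m + k) φ)

section Exs

variable {L : Lang} {A : Type} {M : Str L A}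

theorem sat_exs {m k : ℕ} {φ : Formula L} {β : ℕ → A} : (exs m k φ).Sat M β ↔
    ∃ β', (∀ y, y < m ∨ m + k ≤ y → β' y = β y) ∧ φ.Sat M β' := by
  induction k generalizing φ with
  | zero =>
    refine ⟨fun h => ⟨β, fun _ _ => rfl, h⟩, fun ⟨β', h, h'⟩ => ?_⟩
    rwa [show β' = β from funext fun y => h y (by omega)] at h'
  | succ k ih =>
    rw [exs, ih]
    constructor
    · rintro ⟨β', h, h'⟩
      obtain ⟨a, h'⟩ := sat_ex.1 h'
      refine ⟨_, fun y hy => ?_, h'⟩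
      rw [Function.update_of_ne (by omega), h y (by omega)]
    · rintro ⟨β', h, h'⟩
      -- The value at `m + k` is handed to the innermost quantifier; outside of it this variable has
      -- to be reset to its original value.
      refine ⟨Function.update β' (m + k) (β (m + k)), fun y hy => ?_, sat_ex.2 ⟨β' (m + k), ?_⟩⟩
      · by_cases hk : y = m + k
        · subst hk; simp
        · rw [Function.update_of_ne hk, h y (by omega)]
      · simpa using h'

theorem free_exs {m k : ℕ} {φ : Formula L} :
    (exs m k φ).free = φ.free \ Finset.Ico m (m + k) := by
  induction k generalizing φ with
  | zero => simp [exs]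
  | succ k ih =>
    rw [exs, ih, free_ex]
    ext y
    simp only [Finset.mem_sdiff, Finset.mem_singleton, Finset.mem_Ico]
    constructor
    · rintro ⟨⟨h, h'⟩, h''⟩; exact ⟨h, by omega⟩
    · rintro ⟨h, h'⟩; exact ⟨⟨h, by omega⟩, by omega⟩

theorem isFO_exs {m k : ℕ} {φ : Formula L} : (exs m k φ).IsFO ↔ φ.IsFO := by
  induction k generalizing φ with
  | zero => rfl
  | succ k ih => rw [exs, ih, isFO_ex]

theorem isFOW_exs {m k : ℕ} {φ : Formula L} : (exs m k φ).IsFOW ↔ φ.IsFOW := by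
  induction k generalizing φ with
  | zero => rfl
  | succ k ih => rw [exs, ih, isFOW_ex]

theorem over_exs {D : Set L.Const} {m k : ℕ} {φ : Formula L} :
    (exs m k φ).Over D ↔ φ.Over D := by
  induction k generalizing φ with
  | zero => rfl
  | succ k ih => rw [exs, ih, over_ex]

end Exs

/-! ### Distance formulas -/

/-- Pairs of distinct positions in the relations. -/
noncomputable def positions (L : Lang) : List (Σ R : L.Rel, Fin (L.arR R) × Fin (L.arR R)) :=
  haveI := L.rel_finite
  haveI := Fintype.ofFinite L.Rel
  Finset.univ.toList.filter fun s => s.2.1 ≠ s.2.2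

theorem mem_positions {L : Lang} {s : Σ R : L.Rel, Fin (L.arR R) × Fin (L.arR R)} :
    s ∈ positions L ↔ s.2.1 ≠ s.2.2 := by simp [positions]

/-- `x` and `z` are the entries at the positions `s.2` of a tuple of `s.1`. -/
def posF {L : Lang} (x z : ℕ) (s : Σ R : L.Rel, Fin (L.arR R) × Fin (L.arR R)) : Formula L :=
  exs (x + z + 1) (L.arR s.1) (.rel s.1 fun l =>
    if l = s.2.1 then x else if l = s.2.2 then z else x + z + 1 + l)

/-- `x` and `z` are equal or adjacent. -/
noncomputable def stepF {L : Lang} (x z : ℕ) : Formula L :=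
  (positions L).foldr (fun s φ => (posF x z s).or φ) (.eq x z)

/-- The distance of `x` and `y` is at most `m`. -/
noncomputable def distF {L : Lang} : ℕ → ℕ → ℕ → Formula L
  | 0, x, y => .eq x y
  | m + 1, x, y => .ex (x + y + 1) ((stepF x (x + y + 1)).and (distF m (x + y + 1) y))

section Distance

variable {L : Lang} {A : Type} {M : Str L A}

theorem foldr_or_sat {ι : Type} (l : List ι) (f : ι → Formula L) (φ : Formula L) {β : ℕ → A} :
    (l.foldr (fun s φ => (f s).or φ) φ).Sat M β ↔ (∃ s ∈ l, (f s).Sat M β) ∨ φ.Sat M β := by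
  induction l with
  | nil => simp
  | cons a l ih => simp [ih, or_assoc]

theorem edist_le_one_iff {a b : A} : M.gaifman.edist a b ≤ 1 ↔
    a = b ∨ ∃ (R : L.Rel) (t : Fin (L.arR R) → A), t ∈ M.rel R ∧ a ∈ Set.range t ∧
      b ∈ Set.range t := by
  rw [SimpleGraph.edist_le_one_iff_adj_or_eq]
  simp only [Str.gaifman]
  by_cases h : a = b <;> simp [h]

/-- The bound variables start at `x + z + 1`, above both free variables, so nothing is captured;
they fill the positions other than the two in `s`. -/
theorem sat_posF {x z : ℕ} {β : ℕ → A} {s : Σ R : L.Rel, Fin (L.arR R) × Fin (L.arR R)}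
    (hs : s.2.1 ≠ s.2.2) :
    (posF x z s).Sat M β ↔ ∃ t ∈ M.rel s.1, t s.2.1 = β x ∧ t s.2.2 = β z := by
  rw [posF, sat_exs]
  simp only [Formula.Sat]
  constructor
  · rintro ⟨β', h, h'⟩
    refine ⟨_, h', ?_, ?_⟩
    · simp [h x (by omega)]
    · simp [hs.symm, h z (by omega)]
  · rintro ⟨t, ht, h1, h2⟩
    refine ⟨fun y => if h : x + z + 1 ≤ y ∧ y < x + z + 1 + L.arR s.1 then
      t ⟨y - (x + z + 1), by omega⟩ else β y, fun y hy => dif_neg (by omega), ?_⟩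
    convert ht using 1
    funext l
    dsimp only
    by_cases h3 : l = s.2.1
    · rw [if_pos h3, dif_neg (by omega), h3, h1]
    · rw [if_neg h3]
      by_cases h4 : l = s.2.2
      · rw [if_pos h4, dif_neg (by omega), h4, h2]
      · rw [if_neg h4, dif_pos ⟨by omega, by have := l.2; omega⟩]
        congr 1; ext; simp

theorem sat_stepF {x z : ℕ} {β : ℕ → A} :
    (stepF x z).Sat M β ↔ M.gaifman.edist (β x) (β z) ≤ 1 := by
  rw [stepF, foldr_or_sat, edist_le_one_iff, sat_eq]
  constructor
  · rintro (⟨s, hs, h⟩ | h)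
    · obtain ⟨t, ht, h1, h2⟩ := (sat_posF (mem_positions.1 hs)).1 h
      exact .inr ⟨s.1, t, ht, ⟨_, h1⟩, ⟨_, h2⟩⟩
    · exact .inl h
  · rintro (h | ⟨R, t, ht, ⟨i, hi⟩, ⟨j, hj⟩⟩)
    · exact .inr h
    -- Only pairs of distinct positions are listed; entries at the same position are equal and are
    -- covered by the disjunct `x = z`.
    · by_cases hij : i = j
      · subst hij; exact .inr (hi.symm.trans hj)
      · exact .inl ⟨⟨R, i, j⟩, mem_positions.2 hij, (sat_posF hij).2 ⟨t, ht, hi, hj⟩⟩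

/-- Split off the first step of a shortest walk; the recursion of `distF` follows this equivalence.
-/
theorem edist_le_succ_iff {G : SimpleGraph A} {a b : A} {m : ℕ} :
    G.edist a b ≤ (m + 1 : ℕ) ↔ ∃ c, G.edist a c ≤ 1 ∧ G.edist c b ≤ m := by
  constructor
  · intro h
    obtain ⟨p, hp⟩ := SimpleGraph.exists_walk_of_edist_ne_top
      (ne_top_of_le_ne_top (ENat.natCast_ne_top _) h)
    rw [← hp] at h
    cases p with
    | nil => exact ⟨a, by simp, by simp⟩
    | cons hadj p =>
      refine ⟨_, SimpleGraph.edist_le_one_iff_adj_or_eq.2 (.inl hadj),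
        (SimpleGraph.edist_le p).trans ?_⟩
      rw [SimpleGraph.Walk.length_cons] at h
      exact_mod_cast Nat.le_of_succ_le_succ (by exact_mod_cast h)
  · rintro ⟨c, h, h'⟩
    refine (SimpleGraph.edist_triangle (v := c)).trans ((add_le_add h h').trans ?_)
    rw [add_comm]; push_cast; rfl

theorem sat_distF {m x y : ℕ} {β : ℕ → A} :
    (distF m x y).Sat M β ↔ M.gaifman.edist (β x) (β y) ≤ m := by
  induction m generalizing x β with
  | zero => simp [distF]
  | succ m ih =>
    rw [distF, edist_le_succ_iff, sat_ex]
    refine exists_congr fun c => ?_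
    rw [sat_and, sat_stepF, ih, Function.update_self, Function.update_of_ne (by omega),
      Function.update_of_ne (by omega)]

theorem free_stepF {x z : ℕ} : (stepF x z : Formula L).free ⊆ {x, z} := by
  unfold stepF
  generalize positions L = l
  induction l with
  | nil => simp
  | cons s l ih =>
    rw [List.foldr_cons, free_or, Finset.union_subset_iff]
    refine ⟨?_, ih⟩
    rw [posF, free_exs]
    intro y hy
    simp only [Formula.free, Finset.mem_sdiff, Finset.mem_image, Finset.mem_univ, true_and,
      Finset.mem_Ico, not_and, not_lt] at hy
    obtain ⟨⟨l, rfl⟩, hl⟩ := hy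
    split_ifs at hl ⊢ with h1 h2
    · simp
    · simp
    · have := l.2
      have := hl (by omega)
      omega

theorem isFO_stepF {x z : ℕ} : (stepF x z : Formula L).IsFO := by
  unfold stepF
  generalize positions L = l
  induction l with
  | nil => simp
  | cons s l ih =>
    rw [List.foldr_cons, isFO_or]
    exact ⟨isFO_exs.2 (by simp [Formula.IsFO]), ih⟩

theorem free_distF {m x y : ℕ} : (distF m x y : Formula L).free ⊆ {x, y} := by
  induction m generalizing x with
  | zero => simp [distF]
  | succ m ih =>
    intro u hu
    rw [distF, free_ex, free_and, Finset.mem_sdiff, Finset.mem_union] at hu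
    rcases hu with ⟨h | h, hu⟩
    · have := free_stepF h
      simp only [Finset.mem_insert, Finset.mem_singleton] at this hu ⊢
      tauto
    · have := ih h
      simp only [Finset.mem_insert, Finset.mem_singleton] at this hu ⊢
      tauto

theorem isFO_distF {m x y : ℕ} : (distF m x y : Formula L).IsFO := by
  induction m generalizing x with
  | zero => simp [distF]
  | succ m ih => simp [distF, isFO_stepF, ih]

/-! ### Distances in induced substructures -/

theorem edist_le_of_induce {B : Set A} {m : ℕ} {a b : B}
    (h : (M.induce B).gaifman.edist a b ≤ m) : M.gaifman.edist (a : A) b ≤ m := by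
  induction m generalizing a with
  | zero =>
    have : a = b := by simpa using h
    simp [this]
  | succ m ih =>
    obtain ⟨c, h1, h2⟩ := edist_le_succ_iff.1 h
    refine edist_le_succ_iff.2 ⟨c, ?_, ih h2⟩
    rw [edist_le_one_iff] at h1 ⊢
    rcases h1 with rfl | ⟨R, t, ht, ⟨i, rfl⟩, ⟨j, rfl⟩⟩
    · exact .inl rfl
    · exact .inr ⟨R, _, ht, ⟨i, rfl⟩, ⟨j, rfl⟩⟩

/-- Walks survive in the substructure only if the whole relation tuples behind their edges do. The
entries of such a tuple are at distance at most one from both ends of the edge, so they may deviate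
from the geodesic, which is why the two distances sum up to `m + 1` and not to `m`. -/
theorem edist_induce_le {B : Set A} {m : ℕ} {a b : B}
    (hB : ∀ d i j, 1 ≤ i → 1 ≤ j → i + j = m + 1 → M.gaifman.edist (a : A) d ≤ (i : ℕ) →
      M.gaifman.edist d b ≤ (j : ℕ) → d ∈ B)
    (h : M.gaifman.edist (a : A) b ≤ m) : (M.induce B).gaifman.edist a b ≤ m := by
  induction m generalizing a with
  | zero =>
    have : a = b := by simpa [Subtype.ext_iff] using h
    simp [this]
  | succ m ih =>
    obtain ⟨c, h1, h2⟩ := edist_le_succ_iff.1 h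
    have hle : (m : ℕ∞) ≤ (m + 1 : ℕ) := by exact_mod_cast Nat.le_succ m
    have hc : c ∈ B := hB c 1 (m + 1) le_rfl (by omega) (by omega) (by exact_mod_cast h1)
      (h2.trans hle)
    refine edist_le_succ_iff.2 ⟨⟨c, hc⟩, ?_, ih ?_ h2⟩
    · rw [edist_le_one_iff] at h1 ⊢
      rcases h1 with h1 | ⟨R, t, ht, hi, hj⟩
      · exact .inl (Subtype.ext h1)
      · have htB : ∀ l, t l ∈ B := fun l => by
          refine hB (t l) 1 (m + 1) le_rfl (by omega) (by omega) ?_ ?_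
          · exact_mod_cast edist_le_one_iff.2 (.inr ⟨R, t, ht, hi, ⟨l, rfl⟩⟩)
          · exact edist_le_succ_iff.2 ⟨c, edist_le_one_iff.2 (.inr ⟨R, t, ht, ⟨l, rfl⟩, hj⟩), h2⟩
        obtain ⟨i, hi⟩ := hi
        obtain ⟨j, hj⟩ := hj
        exact .inr ⟨R, fun l => ⟨t l, htB l⟩, ht, ⟨i, Subtype.ext hi⟩, ⟨j, Subtype.ext hj⟩⟩
    · intro d i j hi hj hij had hdb
      refine hB d (i + 1) j (by omega) hj (by omega) ?_ hdb
      exact edist_le_succ_iff.2 ⟨c, h1, had⟩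

/-- As the second distance is at least one, the first one is at most `m`; a ball around one endpoint
suffices. -/
theorem edist_induce_le_iff_of_center {B : Set A} {m p : ℕ} (hm : m ≤ p) {a b : B}
    (hB : ∀ d, M.gaifman.edist (a : A) d ≤ p → d ∈ B) :
    (M.induce B).gaifman.edist a b ≤ m ↔ M.gaifman.edist (a : A) b ≤ m :=
  ⟨edist_le_of_induce, edist_induce_le fun d i j _ _ hij h _ =>
    hB d (h.trans (by exact_mod_cast (by omega : i ≤ p)))⟩

/-- Two numbers with sum at most `2 * r + 1` cannot both exceed `r`, so balls of radius `r` around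
both endpoints suffice. -/
theorem edist_induce_le_iff_of_ends {B : Set A} {m r : ℕ} (hm : m ≤ 2 * r) {a b : B}
    (hB : ∀ d, M.gaifman.edist (a : A) d ≤ r → d ∈ B)
    (hB' : ∀ d, M.gaifman.edist (b : A) d ≤ r → d ∈ B) :
    (M.induce B).gaifman.edist a b ≤ m ↔ M.gaifman.edist (a : A) b ≤ m := by
  refine ⟨edist_le_of_induce, edist_induce_le fun d i j hi hj hij h h' => ?_⟩
  rcases le_or_gt i r with hir | hir
  · exact hB d (h.trans (by exact_mod_cast hir))
  · refine hB' d ?_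
    rw [SimpleGraph.edist_comm]
    exact h'.trans (by exact_mod_cast (by omega : j ≤ r))

end Distance

/-! ### Robust locality -/

section Loc

variable {L : Lang} {D : Set L.Const}

/-- `ψ` belongs to `FOW₁`, has its constants in `D` and its free variables in `X`, and its truth
value is the same in every induced substructure that contains the `r`-neighbourhood of the values
of the variables in `X`.  The structures are not required to satisfy the locality condition for
weights, which is not inherited by induced substructures. -/
structure Loc (D : Set L.Const) (r : ℕ) (X : Set ℕ) (ψ : Formula L) : Prop where
  isFOW : ψ.IsFOW
  constsIn : ψ.Over D
  free : (ψ.free : Set ℕ) ⊆ X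
  sat_iff : ∀ (A : Type) [Finite A] (M : Str L A) (B : Set A) (β : ℕ → A) (γ : ℕ → B),
    (∀ x ∈ X, (γ x : A) = β x) → M.ball r (β '' X) ⊆ B →
      (ψ.Sat M β ↔ ψ.Sat (M.induce B) γ)

theorem ball_mono {A : Type} {M : Str L A} {r r' : ℕ} (hr : r ≤ r') {C C' : Set A}
    (hC : C ⊆ C') : M.ball r C ⊆ M.ball r' C' :=
  fun _ ⟨c, hc, h⟩ => ⟨c, hC hc, h.trans (by exact_mod_cast hr)⟩

theorem Loc.mono {r r' : ℕ} {X X' : Set ℕ} {ψ : Formula L} (h : Loc D r X ψ) (hr : r ≤ r')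
    (hX : X ⊆ X') : Loc D r' X' ψ where
  isFOW := h.isFOW
  constsIn := h.constsIn
  free := h.free.trans hX
  sat_iff A _ M B β γ hγ hB := h.sat_iff A M B β γ (fun x hx => hγ x (hX hx))
    ((ball_mono hr (Set.image_mono hX)).trans hB)

theorem Loc.neg {r : ℕ} {X : Set ℕ} {ψ : Formula L} (h : Loc D r X ψ) : Loc D r X ψ.neg where
  isFOW := isFOW_neg.2 h.isFOW
  constsIn := over_neg.2 h.constsIn
  free := by simpa using h.free
  sat_iff A _ M B β γ hγ hB := by rw [sat_neg, sat_neg, h.sat_iff A M B β γ hγ hB]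

theorem Loc.or {r : ℕ} {X : Set ℕ} {ψ χ : Formula L} (h : Loc D r X ψ) (h' : Loc D r X χ) :
    Loc D r X (ψ.or χ) where
  isFOW := isFOW_or.2 ⟨h.isFOW, h'.isFOW⟩
  constsIn := over_or.2 ⟨h.constsIn, h'.constsIn⟩
  free := by simpa using ⟨h.free, h'.free⟩
  sat_iff A _ M B β γ hγ hB := by
    rw [sat_or, sat_or, h.sat_iff A M B β γ hγ hB, h'.sat_iff A M B β γ hγ hB]

theorem Loc.and {r : ℕ} {X : Set ℕ} {ψ χ : Formula L} (h : Loc D r X ψ) (h' : Loc D r X χ) :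
    Loc D r X (ψ.and χ) := (h.neg.or h'.neg).neg

theorem loc_eq {r : ℕ} {X : Set ℕ} {x y : ℕ} (hx : x ∈ X) (hy : y ∈ X) :
    Loc D r X (.eq x y) where
  isFOW := isFOW_eq
  constsIn := over_eq
  free := by simp [Set.insert_subset_iff, hx, hy]
  sat_iff A _ M B β γ hγ hB := by
    rw [sat_eq, sat_eq, ← hγ x hx, ← hγ y hy, Subtype.ext_iff]

theorem mem_ball_self {A : Type} {M : Str L A} {r : ℕ} {β : ℕ → A} {X : Set ℕ} {x : ℕ}
    (hx : x ∈ X) {d : A} (h : M.gaifman.edist (β x) d ≤ r) : d ∈ M.ball r (β '' X) :=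
  ⟨β x, ⟨x, hx, rfl⟩, h⟩

theorem loc_distF {m r : ℕ} {X : Set ℕ} {x y : ℕ} (hm : m ≤ 2 * r) (hx : x ∈ X) (hy : y ∈ X) :
    Loc D r X (distF m x y) where
  isFOW := isFO_distF.isFOW
  constsIn := isFO_distF.over
  free := (Finset.coe_subset.2 free_distF).trans (by simp [Set.insert_subset_iff, hx, hy])
  sat_iff A _ M B β γ hγ hB := by
    rw [sat_distF, sat_distF, edist_induce_le_iff_of_ends hm, hγ x hx, hγ y hy]
    · exact fun d hd => hB (mem_ball_self hx (by rwa [← hγ x hx]))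
    · exact fun d hd => hB (mem_ball_self hy (by rwa [← hγ y hy]))

theorem loc_rel {r : ℕ} {X : Set ℕ} {R : L.Rel} {x : Fin (L.arR R) → ℕ} (hx : ∀ l, x l ∈ X) :
    Loc D r X (.rel R x) where
  isFOW := by simp [Formula.IsFOW]
  constsIn := by simp [Formula.Over]
  free := by simpa [Formula.free, Set.range_subset_iff] using hx
  sat_iff A _ M B β γ hγ hB := by
    simp only [Formula.Sat, Str.induce, Set.mem_ofPred_eq]
    rw [show (fun j => (γ (x j) : A)) = fun j => β (x j) from funext fun j => hγ _ (hx j)]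

theorem loc_weq {r : ℕ} {X : Set ℕ} {w : L.Wt} {s : L.El (L.tyW w)} {x : Fin (L.arW w) ↪ ℕ}
    (hs : (⟨_, s⟩ : L.Const) ∈ D) (hx : ∀ l, x l ∈ X) : Loc D r X (.weq w s x) where
  isFOW := by simp [Formula.IsFOW]
  constsIn := by simpa [Formula.Over] using hs
  free := by simpa [Formula.free, Set.range_subset_iff] using hx
  sat_iff A _ M B β γ hγ hB := by
    simp only [Formula.Sat, Str.induce]
    rw [show (fun j => (γ (x j) : A)) = fun j => β (x j) from funext fun j => hγ _ (hx j)]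

/-- Without sums a term only looks up weights at its free variables, and weights are merely
restricted in substructures; hence radius `0` suffices. -/
theorem Term.val_induce {A : Type} {M : Str L A} {B : Set A} {β : ℕ → A} {γ : ℕ → B} :
    ∀ {i : L.Ty} (t : Term L i), t.IsFOW → (∀ x ∈ t.free, (γ x : A) = β x) →
      t.val M β = t.val (M.induce B) γ
  | _, .const _ _, _, _ => by simp only [Term.val]
  | _, .wt w x, _, h => by
    simp only [Term.val, Str.induce]
    congr 1
    funext j
    exact (h _ (by simp [Term.free])).symm
  | _, .add s t, ht, h => by
    simp only [Term.free, Finset.mem_union, Term.IsFOW] at h ht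
    simp only [Term.val]
    rw [Term.val_induce s ht.1 fun x hx => h x (.inl hx),
      Term.val_induce t ht.2 fun x hx => h x (.inr hx)]
  | _, .sub s t, ht, h => by
    simp only [Term.free, Finset.mem_union, Term.IsFOW] at h ht
    simp only [Term.val]
    rw [Term.val_induce s ht.1 fun x hx => h x (.inl hx),
      Term.val_induce t ht.2 fun x hx => h x (.inr hx)]
  | _, .mul _ s t, ht, h => by
    simp only [Term.free, Finset.mem_union, Term.IsFOW] at h ht
    simp only [Term.val]
    rw [Term.val_induce s ht.1 fun x hx => h x (.inl hx),
      Term.val_induce t ht.2 fun x hx => h x (.inr hx)]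
  | _, .sum _ _, ht, _ => by simp [Term.IsFOW] at ht

theorem loc_pred {r : ℕ} {X : Set ℕ} {P : L.Prd} {t : (j : Fin (L.arP P)) → Term L (L.tyP P j)}
    (ht : (Formula.pred P t).IsFOW) (hD : (Formula.pred P t).Over D)
    (hX : ∀ j, ((t j).free : Set ℕ) ⊆ X) : Loc D r X (.pred P t) where
  isFOW := ht
  constsIn := hD
  free := by simpa [Formula.free] using hX
  sat_iff A _ M B β γ hγ hB := by
    simp only [Formula.Sat]
    simp only [Formula.IsFOW] at ht
    rw [show (fun j => (t j).val M β) = fun j => (t j).val (M.induce B) γ from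
      funext fun j => Term.val_induce _ (ht.2 j) fun x hx => hγ x (hX j hx)]

/-- The whole universe is an admissible substructure. Both assignments are compared there with the
same third one. -/
theorem Loc.sat_congr {r : ℕ} {X : Set ℕ} {ψ : Formula L} (h : Loc D r X ψ) {A : Type} [Finite A]
    {M : Str L A} {β β' : ℕ → A} (hβ : ∀ x ∈ X, β x = β' x) : ψ.Sat M β ↔ ψ.Sat M β' := by
  have h1 := h.sat_iff A M Set.univ β (fun x => ⟨β x, trivial⟩) (fun _ _ => rfl)
    (Set.subset_univ _)
  have h2 := h.sat_iff A M Set.univ β' (fun x => ⟨β x, trivial⟩) (fun x hx => hβ x hx)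
    (Set.subset_univ _)
  rw [h1, h2]

theorem Loc.isLocal {r : ℕ} {X : Finset ℕ} {ψ : Formula L} (h : Loc D r X ψ) :
    ψ.IsLocal r X :=
  fun A _ _ M _ β γ hγ => h.sat_iff A M _ β γ hγ subset_rfl

end Loc

end WA

namespace WA

/-! ### Quantifiers as sums -/

/-- The quantifiers `∃` and `∑ w`. -/
inductive Kind (L : Lang) : Type
  | ex : Kind L
  | sum (w : L.Wt) : Kind L

namespace Kind

variable {L : Lang}

def ar : Kind L → ℕ
  | ex => 1
  | sum w => L.arW w

/-- The monoid in which the values are added up; `∃` is treated as counting. -/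
def V : Kind L → Type
  | ex => ℕ
  | sum w => L.El (L.tyW w)

instance addCommMonoid : (κ : Kind L) → AddCommMonoid κ.V
  | ex => inferInstanceAs (AddCommMonoid ℕ)
  | sum w => inferInstanceAs (AddCommMonoid (L.El (L.tyW w)))

def wt {A : Type} (M : Str L A) : (κ : Kind L) → (Fin κ.ar → A) → κ.V
  | ex, _ => (1 : ℕ)
  | sum w, a => M.wt w a

/-- `∃ y.φ` or `(e = ∑ w(y).φ)` -/
def form : (κ : Kind L) → κ.V → (Fin κ.ar ↪ ℕ) → Formula L → Formula L
  | ex, _, y, φ => .ex (y (0 : Fin 1)) φ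
  | sum w, e, y, φ => .agg w e y φ

/-- For `∃` the value `e` is a dummy, and the condition is that the number of witnesses is not zero.
-/
def Holds : (κ : Kind L) → κ.V → κ.V → Prop
  | ex, _, v => v ≠ 0
  | sum _, e, v => e = v

/-- Admissible quantifiers: the types of sums are finite. -/
def Fin' : Kind L → Prop
  | ex => True
  | sum w => Finite (L.El (L.tyW w))

def ValIn (D : Set L.Const) : (κ : Kind L) → κ.V → Prop
  | ex, _ => True
  | sum w, e => (⟨L.tyW w, e⟩ : L.Const) ∈ D

theorem ar_pos : (κ : Kind L) → 0 < κ.ar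
  | ex => Nat.one_pos
  | sum w => L.arW_pos w

/-- This is how the locality condition on weights enters: the tuples that contribute to a sum have
diameter at most one. For `∃` and for unary weights the tuple has a single entry. -/
theorem edist_le_one_of_wt_ne {A : Type} {M : Str L A} (hM : M.IsWeighted) {κ : Kind L}
    {a : Fin κ.ar → A} (ha : κ.wt M a ≠ 0) (i j : Fin κ.ar) :
    M.gaifman.edist (a i) (a j) ≤ 1 := by
  cases κ with
  | ex =>
    rw [show i = j from Subsingleton.elim (α := Fin 1) i j]
    simp
  | sum w =>
    rcases hM w a ha with h | h | ⟨R, b, hb, hab⟩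
    · have : i = j := by
        have hi : (i : ℕ) < L.arW w := i.2
        have hj : (j : ℕ) < L.arW w := j.2
        exact Fin.ext (by omega)
      rw [this]; simp
    · rw [h i j]; simp
    · exact edist_le_one_iff.2 (.inr ⟨R, b, hb, hab ⟨i, rfl⟩, hab ⟨j, rfl⟩⟩)

end Kind

section QVal

variable {L : Lang} {A : Type}

/-- The sum of the weights of all tuples for `y` such that `P` holds. -/
noncomputable def qval (κ : Kind L) (M : Str L A) (y : Fin κ.ar ↪ ℕ) (β : ℕ → A)
    (P : (ℕ → A) → Prop) : κ.V :=
  ∑ᶠ (a : Fin κ.ar → A) (_ : P (Function.extend y a β)), κ.wt M a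

open Classical in
theorem qval_eq_sum [Fintype A] (κ : Kind L) (M : Str L A) (y : Fin κ.ar ↪ ℕ) (β : ℕ → A)
    (P : (ℕ → A) → Prop) :
    qval κ M y β P = ∑ a, if P (Function.extend y a β) then κ.wt M a else 0 := by
  rw [qval, ← finsum_eq_sum_of_fintype]
  exact finsum_congr fun a => finsum_eq_if

variable {κ : Kind L} {M : Str L A} {y : Fin κ.ar ↪ ℕ} {β : ℕ → A}

/-- All tuples that satisfy the condition lie in `B`, so the inclusion is a weight-preserving
bijection between the index sets of the two sums. -/
theorem qval_induce {B : Set A} {γ : ℕ → B} {P : (ℕ → A) → Prop} {P' : (ℕ → B) → Prop}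
    (h1 : ∀ a, P (Function.extend y a β) → ∀ l, a l ∈ B)
    (h2 : ∀ b : Fin κ.ar → B,
      P (Function.extend y (fun l => (b l : A)) β) ↔ P' (Function.extend y b γ)) :
    qval κ M y β P = qval κ (M.induce B) y γ P' := by
  classical
  have hw : ∀ b : Fin κ.ar → B, κ.wt (M.induce B) b = κ.wt M fun l => (b l : A) := by
    intro b; cases κ <;> rfl
  symm
  refine finsum_mem_eq_of_bijOn (s := {b | P' (Function.extend y b γ)})
    (t := {a | P (Function.extend y a β)}) (fun b l => (b l : A)) ⟨?_, ?_, ?_⟩ fun b _ => hw b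
  · exact fun b hb => (h2 b).2 hb
  · intro b _ b' _ h
    exact funext fun l => Subtype.ext (congrFun h l)
  · intro a ha
    refine ⟨fun l => ⟨a l, h1 a ha l⟩, ?_, rfl⟩
    exact (h2 fun l => ⟨a l, h1 a ha l⟩).1 ha

theorem update_eq_extend (y : Fin 1 ↪ ℕ) (β : ℕ → A) (a : A) :
    Function.update β (y 0) a = Function.extend y (fun _ => a) β := by
  funext x
  by_cases hx : x = y 0
  · subst hx; rw [Function.update_self, y.injective.extend_apply]
  · rw [Function.update_of_ne hx, Function.extend_apply']
    rintro ⟨i, rfl⟩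
    exact hx (by rw [Subsingleton.elim i 0])

variable [Finite A]

/-- Tuples of weight zero may be ignored. This permits to use properties that hold only for tuples
of small diameter. -/
theorem qval_congr {P P' : (ℕ → A) → Prop} (h : ∀ a, κ.wt M a ≠ 0 →
    (P (Function.extend y a β) ↔ P' (Function.extend y a β))) :
    qval κ M y β P = qval κ M y β P' := by
  classical
  have := Fintype.ofFinite A
  rw [qval_eq_sum, qval_eq_sum]
  refine Finset.sum_congr rfl fun a _ => ?_
  by_cases ha : κ.wt M a = 0
  · simp [ha]
  · simp [h a ha]

theorem qval_split (P R : (ℕ → A) → Prop) :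
    qval κ M y β P = qval κ M y β (fun β' => P β' ∧ R β') +
      qval κ M y β (fun β' => P β' ∧ ¬ R β') := by
  classical
  have := Fintype.ofFinite A
  rw [qval_eq_sum, qval_eq_sum, qval_eq_sum, ← Finset.sum_add_distrib]
  refine Finset.sum_congr rfl fun a _ => ?_
  by_cases hP : P (Function.extend y a β) <;> by_cases hR : R (Function.extend y a β) <;>
    simp [hP, hR]

theorem qval_false {P : (ℕ → A) → Prop} (h : ∀ β', ¬ P β') : qval κ M y β P = 0 := by
  have := Fintype.ofFinite A
  rw [qval_eq_sum]
  simp [h]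

/-- If the sets `Q j` are disjoint then the sum splits accordingly. -/
theorem qval_decomp {P : (ℕ → A) → Prop} {Q : ℕ → (ℕ → A) → Prop} {n : ℕ}
    (h : ∀ i < n, ∀ j < n, i ≠ j → ∀ a, Q i (Function.extend y a β) →
      ¬ Q j (Function.extend y a β)) :
    qval κ M y β P = ∑ j ∈ Finset.range n, qval κ M y β (fun β' => Q j β' ∧ P β') +
      qval κ M y β (fun β' => (∀ j < n, ¬ Q j β') ∧ P β') := by
  induction n with
  | zero => simp
  | succ n ih =>
    rw [ih fun i hi j hj => h i (by omega) j (by omega), Finset.sum_range_succ, add_assoc]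
    congr 1
    rw [qval_split _ (Q n)]
    congr 1
    · refine qval_congr fun a _ => ?_
      constructor
      · rintro ⟨⟨-, h1⟩, h2⟩; exact ⟨h2, h1⟩
      · rintro ⟨h1, h2⟩
        exact ⟨⟨fun j hj => h n (by omega) j (by omega) (by omega) a h1, h2⟩, h1⟩
    · refine qval_congr fun a _ => ?_
      constructor
      · rintro ⟨⟨h1, h2⟩, h3⟩
        exact ⟨fun j hj => (Nat.lt_succ_iff_lt_or_eq.1 hj).elim (h1 j) (by rintro rfl; exact h3), h2⟩
      · rintro ⟨h1, h2⟩
        exact ⟨⟨fun j hj => h1 j (by omega), h2⟩, h1 n (by omega)⟩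

/-- For `∃` the sum counts the witnesses. -/
theorem sat_form {e : κ.V} {φ : Formula L} :
    (κ.form e y φ).Sat M β ↔ κ.Holds e (qval κ M y β (φ.Sat M)) := by
  cases κ with
  | sum w => simp only [Kind.form, Formula.Sat]; rfl
  | ex =>
    classical
    have := Fintype.ofFinite A
    rw [qval_eq_sum, Kind.form, sat_ex]
    change _ ↔ (∑ a : Fin 1 → A, if φ.Sat M (Function.extend y a β) then 1 else 0 : ℕ) ≠ 0
    rw [Finset.sum_boole, Nat.cast_id, Finset.card_ne_zero, Finset.filter_nonempty_iff]
    constructor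
    · rintro ⟨a, h⟩
      exact ⟨fun _ => a, Finset.mem_univ _,
        (congrArg (φ.Sat M) (update_eq_extend y β a)).mp h⟩
    · rintro ⟨a, -, h⟩
      refine ⟨a 0, ?_⟩
      refine (congrArg (φ.Sat M) (update_eq_extend y β (a 0))).mpr ?_
      have : (fun _ : Fin 1 => a 0) = a := funext fun i => by rw [Subsingleton.elim i 0]
      exact this ▸ h

end QVal

/-! ### Locality of bounded quantification -/

section BoundedQuantification

variable {L : Lang} {D : Set L.Const}

/-- `ν` says that all entries of `y` are at distance at most `p` from some variable in `X`. -/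
structure IsNear (p : ℕ) (X : Set ℕ) (Z : Set ℕ) (ν : Formula L) : Prop where
  isFO : ν.IsFO
  free : (ν.free : Set ℕ) ⊆ X ∪ Z
  sat_iff : ∀ (A : Type) (M : Str L A) (β : ℕ → A), ν.Sat M β ↔
    ∀ z ∈ Z, ∃ x ∈ X, M.gaifman.edist (β x) (β z) ≤ p

theorem extend_apply_of_disjoint {A : Type} {k : ℕ} {y : Fin k ↪ ℕ} {X : Set ℕ}
    (hX : Disjoint X (Set.range y)) {a : Fin k → A} {β : ℕ → A} {x : ℕ} (hx : x ∈ X) :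
    Function.extend y a β x = β x :=
  Function.extend_apply' _ _ _ fun ⟨l, hl⟩ => Set.disjoint_left.1 hX hx ⟨l, hl⟩

/-- Tuples close to `X` lie in the `(p + q)`-neighbourhood of `X` together with their own
`q`-neighbourhoods, so `acc` is evaluated correctly there. The closeness condition `ν` itself is
evaluated correctly because it only measures distances up to `p` from elements whose balls belong to
the substructure. -/
theorem loc_form {κ : Kind L} (hκ : κ.Fin') {e : κ.V} (he : κ.ValIn D e) {y : Fin κ.ar ↪ ℕ}
    {X : Set ℕ} (hX : Disjoint X (Set.range y)) {p q : ℕ} {ν acc : Formula L}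
    (hν : IsNear p X (Set.range y) ν) (hacc : Loc D q (X ∪ Set.range y) acc) :
    Loc D (p + q) X (κ.form e y (ν.and acc)) where
  isFOW := by
    have : (ν.and acc).IsFOW := isFOW_and.2 ⟨hν.isFO.isFOW, hacc.isFOW⟩
    cases κ with
    | ex => simpa [Kind.form] using this
    | sum w => simp only [Kind.form, Formula.IsFOW]; exact ⟨hκ, this⟩
  constsIn := by
    have : (ν.and acc).Over D := over_and.2 ⟨hν.isFO.over, hacc.constsIn⟩
    cases κ with
    | ex => simpa [Kind.form] using this
    | sum w => simp only [Kind.form, Formula.Over]; exact ⟨he, this⟩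
  free := by
    have : (((ν.and acc).free : Finset ℕ) : Set ℕ) ⊆ X ∪ Set.range y := by
      simpa using ⟨hν.free, hacc.free⟩
    intro x hx
    cases κ with
    | ex =>
      simp only [Kind.form, free_ex, Finset.coe_sdiff, Finset.coe_singleton, Set.mem_sdiff,
        Set.mem_singleton_iff] at hx
      refine (this hx.1).resolve_right ?_
      rintro ⟨i, rfl⟩
      exact hx.2 (by rw [Subsingleton.elim (α := Fin 1) i 0])
    | sum w =>
      simp only [Kind.form, Formula.free, Finset.coe_sdiff, Set.mem_sdiff] at hx
      exact (this hx.1).resolve_right fun ⟨l, hl⟩ =>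
        hx.2 (Finset.mem_coe.2 (Finset.mem_map.2 ⟨l, Finset.mem_univ _, hl⟩))
  sat_iff A _ M B β γ hγ hB := by
    have hball : ∀ x ∈ X, ∀ b, M.gaifman.edist (β x) b ≤ (p + q : ℕ) → b ∈ B :=
      fun x hx b hb => hB (mem_ball_self hx hb)
    have hpq : (p : ℕ∞) ≤ (p + q : ℕ) := by exact_mod_cast Nat.le_add_right p q
    rw [sat_form, sat_form]
    rw [qval_induce (B := B) (γ := γ) (P' := (ν.and acc).Sat (M.induce B))]
    · intro a ha l
      rw [sat_and, hν.sat_iff] at ha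
      obtain ⟨x, hx, hl⟩ := ha.1 (y l) ⟨l, rfl⟩
      rw [extend_apply_of_disjoint hX hx, y.injective.extend_apply] at hl
      exact hball x hx _ (hl.trans hpq)
    · intro b
      rw [sat_and, sat_and, hν.sat_iff, hν.sat_iff]
      -- Closeness means the same in the structure and in the substructure, each distance being
      -- measured from a variable in `X`.
      have h1 : (∀ z ∈ Set.range y, ∃ x ∈ X, M.gaifman.edist
          (Function.extend y (fun l => (b l : A)) β x)
          (Function.extend y (fun l => (b l : A)) β z) ≤ p) ↔
          ∀ z ∈ Set.range y, ∃ x ∈ X, (M.induce B).gaifman.edist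
            (Function.extend y b γ x) (Function.extend y b γ z) ≤ p := by
        simp only [Set.forall_mem_range]
        refine forall_congr' fun l => exists_congr fun x => and_congr_right fun hx => ?_
        rw [extend_apply_of_disjoint hX hx, extend_apply_of_disjoint hX hx,
          y.injective.extend_apply, y.injective.extend_apply,
          edist_induce_le_iff_of_center le_rfl, hγ x hx]
        exact fun d hd => hball x hx d (by rw [← hγ x hx]; exact hd.trans hpq)
      rw [← h1]
      refine and_congr_right fun hn => ?_
      refine hacc.sat_iff A M B _ _ ?_ ?_
      · rintro x (hx | ⟨l, rfl⟩)
        · rw [extend_apply_of_disjoint hX hx, extend_apply_of_disjoint hX hx, hγ x hx]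
        · rw [y.injective.extend_apply, y.injective.extend_apply]
      · rintro d ⟨_, ⟨x, hx | ⟨l, rfl⟩, rfl⟩, hd⟩
        · rw [extend_apply_of_disjoint hX hx] at hd
          exact hball x hx d (hd.trans (by exact_mod_cast Nat.le_add_left q p))
        · obtain ⟨x, hx, hxl⟩ := hn (y l) ⟨l, rfl⟩
          rw [extend_apply_of_disjoint hX hx] at hxl
          refine hball x hx d (SimpleGraph.edist_triangle.trans ((add_le_add hxl hd).trans ?_))
          push_cast; rfl

end BoundedQuantification

/-! ### Families of variables that are far apart -/

section Far

variable {L : Lang} {A : Type} {M : Str L A} {β : ℕ → A}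

/-- Variables in different members of the family have distance more than `q`. -/
def Far (M : Str L A) (β : ℕ → A) (Y : ℕ → Set ℕ) (q : ℕ) : Prop :=
  ∀ i j, i ≠ j → ∀ x ∈ Y i, ∀ y ∈ Y j, (q : ℕ∞) < M.gaifman.edist (β x) (β y)

theorem Far.mono {Y Y' : ℕ → Set ℕ} {q q' : ℕ} (h : Far M β Y q) (hY : ∀ i, Y' i ⊆ Y i)
    (hq : q' ≤ q) : Far M β Y' q' := fun i j hij x hx y hy =>
  lt_of_le_of_lt (by exact_mod_cast hq) (h i j hij x (hY i hx) y (hY j hy))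

/-- All variables in `Z` are close to some variable in `X`. -/
def NearAll (M : Str L A) (p : ℕ) (X Z : Set ℕ) (β : ℕ → A) : Prop :=
  ∀ z ∈ Z, ∃ x ∈ X, M.gaifman.edist (β x) (β z) ≤ p

theorem edist_le_add {G : SimpleGraph A} {a b c : A} {m n k : ℕ} (h : G.edist a b ≤ m)
    (h' : G.edist b c ≤ n) (hk : m + n ≤ k) : G.edist a c ≤ k :=
  SimpleGraph.edist_triangle.trans ((add_le_add h h').trans (by exact_mod_cast hk))

theorem edist_le_comm {G : SimpleGraph A} {a b : A} {m : ℕ∞} (h : G.edist a b ≤ m) :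
    G.edist b a ≤ m := by rwa [SimpleGraph.edist_comm]

/-- A common element close to two parts would join them by a path of length `2 * p`. The set `Z` has
to be nonempty. -/
theorem Far.nearAll_unique {Y : ℕ → Set ℕ} {Z : Set ℕ} {p q : ℕ} (h : Far M β Y q)
    (hp : 2 * p ≤ q) (hZ : Z.Nonempty) {i j : ℕ} (hij : i ≠ j) (hi : NearAll M p (Y i) Z β) :
    ¬ NearAll M p (Y j) Z β := by
  intro hj
  obtain ⟨z, hz⟩ := hZ
  obtain ⟨x, hx, hxz⟩ := hi z hz
  obtain ⟨x', hx', hxz'⟩ := hj z hz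
  exact (h i j hij x hx x' hx').not_ge (edist_le_add hxz (edist_le_comm hxz') (by omega))

/-- Enlarging a part by variables at distance at most `p` costs at most `p` in the separation. -/
theorem Far.insert_near {Y : ℕ → Set ℕ} {Z : Set ℕ} {p q q' : ℕ} (h : Far M β Y q')
    (hq : p + q ≤ q') {j : ℕ} (hj : NearAll M p (Y j) Z β) :
    Far M β (Function.update Y j (Y j ∪ Z)) q := by
  have key : ∀ i, i ≠ j → ∀ x ∈ Y i, ∀ z ∈ Y j ∪ Z, (q : ℕ∞) < M.gaifman.edist (β x) (β z) := by
    rintro i hi x hx z (hz | hz)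
    · exact (h.mono (fun _ => subset_rfl) (by omega)) i j hi x hx z hz
    · obtain ⟨x', hx', hxz⟩ := hj z hz
      by_contra hcon
      exact (h i j hi x hx x' hx').not_ge
        (edist_le_add (not_lt.1 hcon) (edist_le_comm hxz) (by omega))
  intro i k hik x hx z hz
  by_cases hi : i = j
  · subst hi
    rw [Function.update_self] at hx
    rw [Function.update_of_ne hik.symm] at hz
    rw [SimpleGraph.edist_comm]
    exact key k hik.symm z hz x hx
  · rw [Function.update_of_ne hi] at hx
    by_cases hk : k = j
    · subst hk
      rw [Function.update_self] at hz
      exact key i hi x hx z hz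
    · rw [Function.update_of_ne hk] at hz
      exact (h.mono (fun _ => subset_rfl) (by omega)) i k hik x hx z hz

/-- If some entry of `Z` is not within `q + 1` of a part then no entry is within `q` of it, as the
entries are within distance one of each other. So failing to be close, as a tuple, is already enough
for separation. -/
theorem Far.insert_far {Y : ℕ → Set ℕ} {Z : Set ℕ} {n q q' : ℕ} (h : Far M β Y q') (hq : q ≤ q')
    (hn : ∀ i, n ≤ i → Y i = ∅) (hZ : ∀ z ∈ Z, ∀ z' ∈ Z, M.gaifman.edist (β z) (β z') ≤ 1)
    (hf : ∀ j < n, ¬ NearAll M (q + 1) (Y j) Z β) :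
    Far M β (Function.update Y n Z) q := by
  have key : ∀ i, ∀ x ∈ Y i, ∀ z ∈ Z, (q : ℕ∞) < M.gaifman.edist (β x) (β z) := by
    intro i x hx z hz
    have hi : i < n := by
      by_contra hi
      rw [hn i (by omega)] at hx
      exact hx
    by_contra hcon
    refine hf i hi fun z' hz' => ⟨x, hx, ?_⟩
    exact edist_le_add (n := 1) (not_lt.1 hcon) (by exact_mod_cast hZ z hz z' hz') le_rfl
  intro i k hik x hx z hz
  by_cases hi : i = n
  · subst hi
    rw [Function.update_self] at hx
    rw [Function.update_of_ne hik.symm] at hz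
    rw [SimpleGraph.edist_comm]
    exact key k z hz x hx
  · rw [Function.update_of_ne hi] at hx
    by_cases hk : k = n
    · subst hk
      rw [Function.update_self] at hz
      exact key i x hx z hz
    · rw [Function.update_of_ne hk] at hz
      exact (h.mono (fun _ => subset_rfl) hq) i k hik x hx z hz

theorem Far.congr {Y : ℕ → Set ℕ} {q : ℕ} {β' : ℕ → A} (h : Far M β Y q)
    (hβ : ∀ i, ∀ x ∈ Y i, β' x = β x) : Far M β' Y q := fun i j hij x hx y hy => by
  rw [hβ i x hx, hβ j y hy]; exact h i j hij x hx y hy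

end Far

/-! ### Scattered sets -/

section Scattered

variable {A : Type}

/-- There are `k` elements of `U` with pairwise distance more than `d`. -/
def Scat (G : SimpleGraph A) (d : ℕ) (U : Set A) (k : ℕ) : Prop :=
  ∃ s : Finset A, s.card = k ∧ (s : Set A) ⊆ U ∧
    ∀ a ∈ s, ∀ b ∈ s, a ≠ b → (d : ℕ∞) < G.edist a b

variable {G : SimpleGraph A} {d : ℕ} {U : Set A}

theorem Scat.mono {k k' : ℕ} (h : Scat G d U k) (hk : k' ≤ k) : Scat G d U k' := by
  obtain ⟨s, rfl, hs, hd⟩ := h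
  obtain ⟨t, ht, rfl⟩ := Finset.exists_subset_card_eq hk
  exact ⟨t, rfl, fun a ha => hs (ht ha), fun a ha b hb => hd a (ht ha) b (ht hb)⟩

/-- Values of distinct variables are distinct elements, since their distance is positive; so
scattered tuples and scattered sets are interchangeable. -/
theorem scat_iff_of_list [Nonempty A] {V : List ℕ} (hV : V.Nodup) :
    (∃ β : ℕ → A, (∀ v ∈ V, β v ∈ U) ∧
      ∀ u ∈ V, ∀ v ∈ V, u ≠ v → (d : ℕ∞) < G.edist (β u) (β v)) ↔ Scat G d U V.length := by
  classical
  constructor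
  · rintro ⟨β, h1, h2⟩
    have hinj : Set.InjOn β V.toFinset := by
      intro u hu v hv huv
      by_contra hne
      have := h2 u (by simpa using hu) v (by simpa using hv) hne
      rw [huv] at this
      simp at this
    refine ⟨V.toFinset.image β, ?_, ?_, ?_⟩
    · rw [Finset.card_image_of_injOn hinj, List.toFinset_card_of_nodup hV]
    · intro a ha
      obtain ⟨v, hv, rfl⟩ := Finset.mem_image.1 ha
      exact h1 v (by simpa using hv)
    · intro a ha b hb hab
      obtain ⟨u, hu, rfl⟩ := Finset.mem_image.1 ha
      obtain ⟨v, hv, rfl⟩ := Finset.mem_image.1 hb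
      exact h2 u (by simpa using hu) v (by simpa using hv) fun h => hab (by rw [h])
  · rintro ⟨s, hs, hU, hd⟩
    have hcard : V.toFinset.card = s.card := by rw [List.toFinset_card_of_nodup hV, hs]
    let e := Finset.equivOfCardEq hcard
    refine ⟨fun v => if h : v ∈ V.toFinset then (e ⟨v, h⟩ : A) else Classical.arbitrary A, ?_, ?_⟩
    · intro v hv
      have : v ∈ V.toFinset := by simpa using hv
      simp only [this, dif_pos]
      exact hU (e ⟨v, this⟩).2
    · intro u hu v hv huv
      have hu : u ∈ V.toFinset := by simpa using hu
      have hv : v ∈ V.toFinset := by simpa using hv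
      simp only [hu, hv, dif_pos]
      refine hd _ (e _).2 _ (e _).2 fun h => huv ?_
      simpa using e.injective (Subtype.ext h)

/-- The elements at distance at most `p` from `C`. -/
def nbhd (G : SimpleGraph A) (p : ℕ) (C : Set A) : Set A := {a | ∃ c ∈ C, G.edist c a ≤ p}

/-- Each element of `C` has at most one scattered element within distance `p`, two of them being at
distance at most `2 * p`. -/
theorem Scat.le_ncard {p k : ℕ} {C : Set A} (hC : C.Finite) (hd : 2 * p ≤ d)
    (h : Scat G d (U ∩ nbhd G p C) k) : k ≤ C.ncard := by
  obtain ⟨s, rfl, hs, hd'⟩ := h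
  have : ∀ a ∈ s, ∃ c ∈ C, G.edist c a ≤ p := fun a ha => (hs ha).2
  choose! f hf hf' using this
  rw [← Set.ncard_coe_finset]
  refine Set.ncard_le_ncard_of_injOn f (fun a ha => hf a ha) ?_ hC
  intro a ha b hb hab
  by_contra hne
  refine (hd' a ha b hb hne).not_ge (edist_le_add (n := p) (edist_le_comm (hf' a ha)) ?_
    (by omega))
  rw [hab]; exact hf' b hb

/-- Elements of `U` far away from `C 0, …, C (n - 1)` exist iff they exist at medium distance or
there is a scattered set that is too large to lie close to these sets. -/
theorem exists_far_iff {n p : ℕ} {C : ℕ → Set A} {κ : ℕ → ℕ}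
    (hC : ∀ i < n, ∀ j < n, i ≠ j → ∀ a ∈ C i, ∀ b ∈ C j, ((4 * p + 1 : ℕ) : ℕ∞) < G.edist a b)
    (hκ : ∀ j < n, Scat G (2 * p + 1) (U ∩ nbhd G p (C j)) (κ j))
    (hκ' : ∀ j < n, ¬ Scat G (2 * p + 1) (U ∩ nbhd G p (C j)) (κ j + 1)) :
    (∃ a ∈ U, ∀ j < n, a ∉ nbhd G p (C j)) ↔
      (∃ j < n, ∃ a ∈ U, a ∈ nbhd G (3 * p + 1) (C j) ∧ a ∉ nbhd G p (C j)) ∨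
        Scat G (2 * p + 1) U (1 + ∑ j ∈ Finset.range n, κ j) := by
  classical
  constructor
  · rintro ⟨a, ha, hfar⟩
    by_cases hring : ∃ j < n, a ∈ nbhd G (3 * p + 1) (C j)
    · obtain ⟨j, hj, h⟩ := hring
      exact .inl ⟨j, hj, a, ha, h, hfar j hj⟩
    · right
      push Not at hring
      choose! s hs hsU hsd using hκ
      have hnear : ∀ j < n, ∀ b ∈ s j, ∃ c ∈ C j, G.edist c b ≤ p := fun j hj b hb =>
        (hsU j hj hb).2
      -- Scattered elements close to different parts keep distance more than `4 * p + 1 - 2 * p`.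
      have hcross : ∀ i < n, ∀ j < n, i ≠ j → ∀ b ∈ s i, ∀ b' ∈ s j,
          ((2 * p + 1 : ℕ) : ℕ∞) < G.edist b b' := by
        intro i hi j hj hij b hb b' hb'
        obtain ⟨c, hc, hcb⟩ := hnear i hi b hb
        obtain ⟨c', hc', hcb'⟩ := hnear j hj b' hb'
        by_contra hcon
        refine (hC i hi j hj hij c hc c' hc').not_ge ?_
        exact edist_le_add (edist_le_add hcb (not_lt.1 hcon) le_rfl) (edist_le_comm hcb')
          (by omega)
      -- The new element has distance more than `3 * p + 1` from the parts, hence more than `2 * p +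
      -- 1` from what is within `p` of them.
      have ha' : ∀ j < n, ∀ b ∈ s j, ((2 * p + 1 : ℕ) : ℕ∞) < G.edist a b := by
        intro j hj b hb
        obtain ⟨c, hc, hcb⟩ := hnear j hj b hb
        by_contra hcon
        exact hring j hj ⟨c, hc, edist_le_add hcb (edist_le_comm (not_lt.1 hcon)) (by omega)⟩
      have hpos : ∀ b b', ((2 * p + 1 : ℕ) : ℕ∞) < G.edist b b' → b ≠ b' := by
        rintro b b' h rfl
        simp at h
      refine ⟨insert a ((Finset.range n).biUnion s), ?_, ?_, ?_⟩
      · rw [Finset.card_insert_of_notMem, Finset.card_biUnion, add_comm]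
        · exact congrArg _ (Finset.sum_congr rfl fun j hj => hs j (Finset.mem_range.1 hj))
        · intro i hi j hj hij
          refine Finset.disjoint_left.2 fun b hb hb' => ?_
          exact hpos _ _ (hcross i (Finset.mem_range.1 hi) j (Finset.mem_range.1 hj) hij b hb b hb')
            rfl
        · intro h
          obtain ⟨j, hj, h⟩ := Finset.mem_biUnion.1 h
          exact hpos _ _ (ha' j (Finset.mem_range.1 hj) a h) rfl
      · intro b hb
        rcases Finset.mem_insert.1 (Finset.mem_coe.1 hb) with rfl | hb
        · exact ha
        · obtain ⟨j, hj, h⟩ := Finset.mem_biUnion.1 hb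
          exact (hsU j (Finset.mem_range.1 hj) h).1
      · intro b hb b' hb' hne
        rcases Finset.mem_insert.1 hb with rfl | hb
        · rcases Finset.mem_insert.1 hb' with rfl | hb'
          · exact absurd rfl hne
          · obtain ⟨j, hj, h⟩ := Finset.mem_biUnion.1 hb'
            exact ha' j (Finset.mem_range.1 hj) _ h
        · obtain ⟨j, hj, h⟩ := Finset.mem_biUnion.1 hb
          rcases Finset.mem_insert.1 hb' with rfl | hb'
          · rw [SimpleGraph.edist_comm]
            exact ha' j (Finset.mem_range.1 hj) _ h
          · obtain ⟨j', hj', h'⟩ := Finset.mem_biUnion.1 hb'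
            by_cases hjj : j = j'
            · subst hjj
              exact hsd j (Finset.mem_range.1 hj) _ h _ h' hne
            · exact hcross j (Finset.mem_range.1 hj) j' (Finset.mem_range.1 hj') hjj _ h _ h'
  · rintro (⟨j, hj, a, ha, ⟨c, hc, hca⟩, hna⟩ | ⟨s, hs, hsU, hsd⟩)
    -- An element at medium distance from part `j` cannot be within `p` of another part, since `p +
    -- (3 * p + 1) = 4 * p + 1`.
    · refine ⟨a, ha, fun i hi h => ?_⟩
      by_cases hij : i = j
      · subst hij; exact hna h
      · obtain ⟨c', hc', hca'⟩ := h
        exact (hC i hi j hj hij c' hc' c hc).not_ge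
          (edist_le_add hca' (edist_le_comm hca) (by omega))
    · by_contra hcon
      push Not at hcon
      -- Pigeonhole: if every element of `U` were close to a part, the scattered set would be
      -- covered by pieces of size at most `κ j`.
      have hle : ∀ j < n, (s.filter fun a => a ∈ nbhd G p (C j)).card ≤ κ j := by
        intro j hj
        by_contra hlt
        refine hκ' j hj (Scat.mono (k := (s.filter fun a => a ∈ nbhd G p (C j)).card)
          ⟨_, rfl, ?_, ?_⟩ (by omega))
        · intro a ha
          have := Finset.mem_filter.1 (Finset.mem_coe.1 ha)
          exact ⟨hsU this.1, this.2⟩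
        · intro a ha b hb
          exact hsd a (Finset.mem_filter.1 ha).1 b (Finset.mem_filter.1 hb).1
      have hsub : s ⊆ (Finset.range n).biUnion fun j => s.filter fun a => a ∈ nbhd G p (C j) := by
        intro a ha
        obtain ⟨j, hj, h⟩ := hcon a (hsU ha)
        exact Finset.mem_biUnion.2 ⟨j, Finset.mem_range.2 hj, Finset.mem_filter.2 ⟨ha, h⟩⟩
      have h1 := (Finset.card_le_card hsub).trans Finset.card_biUnion_le
      have h2 := Finset.sum_le_sum fun j hj => hle j (Finset.mem_range.1 hj)
      omega

end Scattered

end WA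

namespace WA

/-! ### Colourings of variables -/

/-- The colour of a variable: the first entry counts. -/
def col : List (ℕ × ℕ) → ℕ → Option ℕ
  | [], _ => none
  | e :: C, x => if e.1 = x then some e.2 else col C x

def part (C : List (ℕ × ℕ)) (j : ℕ) : Set ℕ := {x | col C x = some j}

theorem mem_part {C : List (ℕ × ℕ)} {j x : ℕ} : x ∈ part C j ↔ col C x = some j := Iff.rfl

theorem exists_mem_of_col {C : List (ℕ × ℕ)} {j x : ℕ} (h : col C x = some j) :
    (x, j) ∈ C := by
  induction C with
  | nil => simp [col] at h
  | cons e C ih =>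
    rw [col] at h
    split_ifs at h with he
    · exact List.mem_cons.2 (.inl (Prod.ext he.symm (Option.some.inj h).symm))
    · exact List.mem_cons_of_mem _ (ih h)

/-- Give the colour `i` to all variables in `zs`. -/
def recol (zs : List ℕ) (i : ℕ) (C : List (ℕ × ℕ)) : List (ℕ × ℕ) :=
  zs.foldr (fun z C => (z, i) :: C) C

theorem col_recol {zs : List ℕ} {i : ℕ} {C : List (ℕ × ℕ)} {x : ℕ} :
    col (recol zs i C) x = if x ∈ zs then some i else col C x := by
  induction zs with
  | nil => simp [recol]
  | cons z zs ih =>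
    rw [recol, List.foldr_cons, col]
    change (if z = x then some i else col (recol zs i C) x) = _
    rw [ih]
    by_cases hz : z = x
    · simp [hz]
    · simp [hz, Ne.symm hz]

/-! ### Formulas for neighbourhoods -/

section NearF

variable {L : Lang}

/-- Some variable in `l` of colour `j` is at distance at most `p` from `z`. -/
noncomputable def nearF (C : List (ℕ × ℕ)) (j p z : ℕ) : List (ℕ × ℕ) → Formula L
  | [] => (Formula.eq z z).neg
  | e :: l => if col C e.1 = some j then (distF p e.1 z).or (nearF C j p z l)
      else nearF C j p z l

/-- Each of `z₀` and the variables in `zs` is at distance at most `p` from some variable of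
colour `j`. -/
noncomputable def nearAllF (C : List (ℕ × ℕ)) (j p z₀ : ℕ) : List ℕ → Formula L
  | [] => nearF C j p z₀ C
  | z :: zs => (nearF C j p z C).and (nearAllF C j p z₀ zs)

theorem isFO_nearF {C : List (ℕ × ℕ)} {j p z : ℕ} {l : List (ℕ × ℕ)} :
    (nearF C j p z l : Formula L).IsFO := by
  induction l with
  | nil => simp [nearF]
  | cons e l ih => rw [nearF]; split_ifs <;> simp [isFO_distF, ih]

theorem free_nearF {C : List (ℕ × ℕ)} {j p z : ℕ} {l : List (ℕ × ℕ)} :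
    ((nearF C j p z l : Formula L).free : Set ℕ) ⊆ part C j ∪ {z} := by
  induction l with
  | nil => simp [nearF]
  | cons e l ih =>
    rw [nearF]
    split_ifs with h
    · rw [free_or, Finset.coe_union, Set.union_subset_iff]
      refine ⟨(Finset.coe_subset.2 free_distF).trans ?_, ih⟩
      rw [Finset.coe_insert, Finset.coe_singleton, Set.insert_subset_iff]
      exact ⟨.inl h, by simp⟩
    · exact ih

theorem sat_nearF {C : List (ℕ × ℕ)} {j p z : ℕ} {A : Type} {M : Str L A} {β : ℕ → A} :
    (nearF C j p z C : Formula L).Sat M β ↔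
      ∃ x ∈ part C j, M.gaifman.edist (β x) (β z) ≤ p := by
  -- The recursion consumes the list `l`, while colours are always read off the full list `C`, where
  -- earlier entries override later ones.
  have : ∀ l : List (ℕ × ℕ), (nearF C j p z l : Formula L).Sat M β ↔
      ∃ e ∈ l, e.1 ∈ part C j ∧ M.gaifman.edist (β e.1) (β z) ≤ p := by
    intro l
    induction l with
    | nil => simp [nearF]
    | cons e l ih =>
      rw [nearF]
      split_ifs with h
      · simp only [sat_or, sat_distF, ih, List.exists_mem_cons_iff, mem_part, h, true_and]
      · simp only [ih, List.exists_mem_cons_iff, mem_part, h, false_and, false_or]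
  rw [this]
  constructor
  · rintro ⟨e, -, h, h'⟩; exact ⟨e.1, h, h'⟩
  · rintro ⟨x, h, h'⟩; exact ⟨(x, j), exists_mem_of_col h, h, h'⟩

theorem loc_nearF {D : Set L.Const} {C : List (ℕ × ℕ)} {j p z : ℕ} {l : List (ℕ × ℕ)} :
    Loc D p (part C j ∪ {z}) (nearF C j p z l) := by
  induction l with
  | nil => exact (loc_eq (by simp) (by simp)).neg
  | cons e l ih =>
    rw [nearF]
    split_ifs with h
    · exact (loc_distF (by omega) (.inl h) (by simp)).or ih
    · exact ih

theorem isNear_nearAllF {C : List (ℕ × ℕ)} {j p z₀ : ℕ} {zs : List ℕ} :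
    IsNear (L := L) p (part C j) {z | z = z₀ ∨ z ∈ zs} (nearAllF C j p z₀ zs) := by
  induction zs with
  | nil =>
    refine ⟨isFO_nearF, ?_, fun A M β => ?_⟩
    · simpa [nearAllF] using free_nearF
    · rw [nearAllF, sat_nearF]; simp
  | cons z zs ih =>
    refine ⟨?_, ?_, fun A M β => ?_⟩
    · rw [nearAllF, isFO_and]; exact ⟨isFO_nearF, ih.isFO⟩
    · rw [nearAllF, free_and, Finset.coe_union, Set.union_subset_iff]
      refine ⟨free_nearF.trans ?_, ih.free.trans ?_⟩
      · exact Set.union_subset_union_right _ (by simp)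
      · refine Set.union_subset_union_right _ ?_
        rintro x (hx | hx)
        · exact .inl hx
        · exact .inr (List.mem_cons_of_mem _ hx)
    · rw [nearAllF, sat_and, sat_nearF, ih.sat_iff]
      constructor
      · rintro ⟨h1, h2⟩ x (hx | hx)
        · exact h2 x (.inl hx)
        · rcases List.mem_cons.1 hx with rfl | hx
          · exact h1
          · exact h2 x (.inr hx)
      · intro h
        exact ⟨h z (.inr (by simp)), fun x hx =>
          h x (hx.imp id fun h => List.mem_cons_of_mem _ h)⟩

end NearF

/-! ### Formulas for scattered tuples -/

section ScatF

variable {L : Lang} {D : Set L.Const}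

/-- `χ` with `v` substituted for `z` -/
def substF (z : ℕ) (χ : Formula L) (v : ℕ) : Formula L := .ex z ((Formula.eq z v).and χ)

/-- Substituting by means of an equation avoids any renaming of bound variables inside `χ`. For `v =
z` the equation would be vacuous. -/
theorem sat_substF {z v : ℕ} (h : v ≠ z) {χ : Formula L} {A : Type} {M : Str L A} {β : ℕ → A} :
    (substF z χ v).Sat M β ↔ χ.Sat M (Function.update β z (β v)) := by
  rw [substF, sat_ex]
  simp only [sat_and, sat_eq, Function.update_self, Function.update_of_ne h]
  constructor
  · rintro ⟨a, rfl, h⟩; exact h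
  · intro h; exact ⟨_, rfl, h⟩

theorem loc_substF {q z v : ℕ} {X : Set ℕ} (hv : v ≠ z) (hz : z ∉ X) (hvX : v ∈ X)
    {χ : Formula L} (hχ : Loc D q {z} χ) : Loc D q X (substF z χ v) where
  isFOW := by simpa [substF] using hχ.isFOW
  constsIn := by simpa [substF] using hχ.constsIn
  free := by
    intro x hx
    have hf := hχ.free
    rw [substF, free_ex, free_and, free_eq] at hx
    simp only [Finset.coe_sdiff, Finset.coe_union, Finset.coe_insert, Finset.coe_singleton,
      Set.mem_sdiff, Set.mem_union, Set.mem_insert_iff, Set.mem_singleton_iff] at hx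
    rcases hx with ⟨(h | h) | h, hne⟩
    · exact absurd h hne
    · rwa [h]
    · exact absurd (hf h) hne
  sat_iff A _ M B β γ hγ hB := by
    rw [sat_substF hv, sat_substF hv]
    refine hχ.sat_iff A M B _ _ ?_ ?_
    · rintro x rfl
      simp [hγ v hvX]
    · refine (ball_mono le_rfl ?_).trans hB
      rintro _ ⟨x, rfl, rfl⟩
      exact ⟨v, hvX, by simp⟩

/-- `χ` holds for `v₀` and all variables in the list. -/
def unF (z : ℕ) (χ : Formula L) (v₀ : ℕ) : List ℕ → Formula L
  | [] => substF z χ v₀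
  | v :: V => (substF z χ v).and (unF z χ v₀ V)

/-- The extra variable `v₀` only serves as the base of the recursion, there being no empty
conjunction. -/
theorem sat_unF {z v₀ : ℕ} {V : List ℕ} (h₀ : v₀ ≠ z) (h : z ∉ V) {χ : Formula L} {A : Type}
    {M : Str L A} {β : ℕ → A} : (unF z χ v₀ V).Sat M β ↔
      ∀ v ∈ v₀ :: V, χ.Sat M (Function.update β z (β v)) := by
  induction V with
  | nil => simp [unF, sat_substF h₀]
  | cons v V ih =>
    have hv : v ≠ z := fun hv => h (by simp [hv])
    rw [unF, sat_and, sat_substF hv, ih fun h' => h (by simp [h'])]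
    simp only [List.forall_mem_cons]
    tauto

theorem loc_unF {q z v₀ : ℕ} {V : List ℕ} {X : Set ℕ} (hz : z ∉ X) (hv₀ : v₀ ∈ X)
    (hV : ∀ v ∈ V, v ∈ X) {χ : Formula L} (hχ : Loc D q {z} χ) :
    Loc D q X (unF z χ v₀ V) := by
  have hne : ∀ v ∈ X, v ≠ z := fun v hv h => hz (h ▸ hv)
  induction V with
  | nil => exact loc_substF (hne _ hv₀) hz hv₀ hχ
  | cons v V ih =>
    exact (loc_substF (hne _ (hV v (by simp))) hz (hV v (by simp)) hχ).and
      (ih fun u hu => hV u (by simp [hu]))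

/-- All pairs in the list have distance more than `d`. -/
noncomputable def farF (d v₀ : ℕ) : List (ℕ × ℕ) → Formula L
  | [] => .eq v₀ v₀
  | e :: F => (distF d e.1 e.2).neg.and (farF d v₀ F)

theorem sat_farF {d v₀ : ℕ} {F : List (ℕ × ℕ)} {A : Type} {M : Str L A} {β : ℕ → A} :
    (farF d v₀ F).Sat M β ↔ ∀ e ∈ F, (d : ℕ∞) < M.gaifman.edist (β e.1) (β e.2) := by
  induction F with
  | nil => simp [farF]
  | cons e F ih => simp [farF, sat_distF, ih]

theorem isFO_farF {d v₀ : ℕ} {F : List (ℕ × ℕ)} : (farF d v₀ F : Formula L).IsFO := by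
  induction F with
  | nil => simp [farF]
  | cons e F ih => simp [farF, isFO_distF, ih]

theorem free_farF {d v₀ : ℕ} {F : List (ℕ × ℕ)} {X : Set ℕ} (h₀ : v₀ ∈ X)
    (hF : ∀ e ∈ F, e.1 ∈ X ∧ e.2 ∈ X) : ((farF d v₀ F : Formula L).free : Set ℕ) ⊆ X := by
  induction F with
  | nil => simp [farF, h₀]
  | cons e F ih =>
    rw [farF, free_and, free_neg, Finset.coe_union, Set.union_subset_iff]
    refine ⟨(Finset.coe_subset.2 free_distF).trans ?_, ih fun e he => hF e (by simp [he])⟩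
    have := hF e (by simp)
    simp [Set.insert_subset_iff, this]

/-- The pairs of entries of a list -/
def pairs : List ℕ → List (ℕ × ℕ)
  | [] => []
  | v :: V => V.map (fun u => (v, u)) ++ pairs V

theorem mem_of_mem_pairs {V : List ℕ} {e : ℕ × ℕ} (h : e ∈ pairs V) : e.1 ∈ V ∧ e.2 ∈ V := by
  induction V with
  | nil => simp [pairs] at h
  | cons v V ih =>
    rw [pairs, List.mem_append, List.mem_map] at h
    rcases h with ⟨u, hu, rfl⟩ | h
    · simp [hu]
    · have := ih h
      exact ⟨List.mem_cons_of_mem _ this.1, List.mem_cons_of_mem _ this.2⟩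

theorem mem_pairs_or {V : List ℕ} {u v : ℕ} (hu : u ∈ V) (hv : v ∈ V) (huv : u ≠ v) :
    (u, v) ∈ pairs V ∨ (v, u) ∈ pairs V := by
  induction V with
  | nil => simp at hu
  | cons w V ih =>
    simp only [pairs, List.mem_append, List.mem_map, Prod.mk.injEq]
    rcases List.mem_cons.1 hu with rfl | hu'
    · rcases List.mem_cons.1 hv with rfl | hv'
      · exact absurd rfl huv
      · exact .inl (.inl ⟨v, hv', rfl, rfl⟩)
    · rcases List.mem_cons.1 hv with rfl | hv'
      · exact .inr (.inl ⟨u, hu', rfl, rfl⟩)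
      · exact (ih hu' hv').imp .inr .inr

theorem ne_of_mem_pairs {V : List ℕ} (hV : V.Nodup) {e : ℕ × ℕ} (h : e ∈ pairs V) :
    e.1 ≠ e.2 := by
  induction V with
  | nil => simp [pairs] at h
  | cons v V ih =>
    rw [List.nodup_cons] at hV
    rw [pairs, List.mem_append, List.mem_map] at h
    rcases h with ⟨u, hu, rfl⟩ | h
    · exact fun h => hV.1 ((show v = u from h) ▸ hu)
    · exact ih hV.2 h

theorem forall_pairs_iff {V : List ℕ} (hV : V.Nodup) {R : ℕ → ℕ → Prop}
    (hR : ∀ u v, R u v → R v u) :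
    (∀ e ∈ pairs V, R e.1 e.2) ↔ ∀ u ∈ V, ∀ v ∈ V, u ≠ v → R u v := by
  constructor
  · intro h u hu v hv huv
    rcases mem_pairs_or hu hv huv with h' | h'
    · exact h _ h'
    · exact hR _ _ (h _ h')
  · intro h e he
    exact h _ (mem_of_mem_pairs he).1 _ (mem_of_mem_pairs he).2 (ne_of_mem_pairs hV he)

/-- `b + k - 1, …, b` -/
def varList (b : ℕ) : ℕ → List ℕ
  | 0 => []
  | k + 1 => (b + k) :: varList b k

theorem mem_varList {b k v : ℕ} : v ∈ varList b k ↔ b ≤ v ∧ v < b + k := by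
  induction k with
  | zero => simp [varList]
  | succ k ih => rw [varList, List.mem_cons, ih]; omega

theorem varList_nodup {b k : ℕ} : (varList b k).Nodup := by
  induction k with
  | zero => simp [varList]
  | succ k ih => rw [varList, List.nodup_cons, mem_varList]; exact ⟨by omega, ih⟩

theorem length_varList {b k : ℕ} : (varList b k).length = k := by
  induction k with
  | zero => rfl
  | succ k ih => simp [varList, ih]

/-- There are `k` elements satisfying `χ` with pairwise distance more than `d`. -/
noncomputable def scatF (z : ℕ) (χ : Formula L) (d b k : ℕ) : Formula L :=
  exs b k ((unF z χ b (varList b k)).and (farF d b (pairs (varList b k))))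

/-- The set `U` has to describe `χ` under all assignments that agree with `β` below `b`, because the
variables from `b` on are overwritten by the scattered tuple. -/
theorem sat_scatF {z : ℕ} {χ : Formula L} {d b k : ℕ} (hz : z < b) (hk : 0 < k) {A : Type}
    [Nonempty A] {M : Str L A} {β : ℕ → A} {U : Set A}
    (hU : ∀ β' : ℕ → A, (∀ x < b, β' x = β x) →
      ∀ a, χ.Sat M (Function.update β' z a) ↔ a ∈ U) :
    (scatF z χ d b k).Sat M β ↔ Scat M.gaifman d U k := by
  have hb : b ∈ varList b k := mem_varList.2 ⟨le_rfl, by omega⟩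
  have hzV : z ∉ varList b k := fun h => by have := mem_varList.1 h; omega
  have hlt : ∀ R : ℕ → Prop, (∀ v ∈ b :: varList b k, R v) ↔ ∀ v ∈ varList b k, R v := by
    intro R; rw [List.forall_mem_cons]; exact ⟨fun h => h.2, fun h => ⟨h b hb, h⟩⟩
  rw [scatF, sat_exs]
  simp only [sat_and, sat_unF (show b ≠ z by omega) hzV, sat_farF, hlt]
  have := scat_iff_of_list (G := M.gaifman) (d := d) (U := U) (varList_nodup (b := b) (k := k))
  rw [length_varList] at this
  rw [← this]
  have hfp : ∀ β' : ℕ → A, (∀ e ∈ pairs (varList b k),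
      (d : ℕ∞) < M.gaifman.edist (β' e.1) (β' e.2)) ↔ ∀ u ∈ varList b k, ∀ v ∈ varList b k,
        u ≠ v → (d : ℕ∞) < M.gaifman.edist (β' u) (β' v) := fun β' =>
    forall_pairs_iff varList_nodup (R := fun u v => (d : ℕ∞) < M.gaifman.edist (β' u) (β' v))
      fun u v h => by rw [SimpleGraph.edist_comm]; exact h
  simp only [hfp]
  constructor
  · rintro ⟨β', h, h1, h2⟩
    exact ⟨β', fun v hv => (hU β' (fun x hx => h x (.inl hx)) _).1 (h1 v hv), h2⟩
  · rintro ⟨β', h1, h2⟩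
    have hβ : ∀ v ∈ varList b k, (if b ≤ v ∧ v < b + k then β' v else β v) = β' v :=
      fun v hv => if_pos (mem_varList.1 hv)
    refine ⟨fun v => if b ≤ v ∧ v < b + k then β' v else β v, fun v hv => if_neg (by omega),
      fun v hv => (hU _ (fun x hx => if_neg (by omega)) _).2 ?_, fun u hu v hv huv => ?_⟩
    · dsimp only; rw [hβ v hv]; exact h1 v hv
    · dsimp only; rw [hβ u hu, hβ v hv]; exact h2 u hu v hv huv

theorem free_unF {z v₀ : ℕ} {V : List ℕ} {χ : Formula L} {x : ℕ}
    (hx : x ∈ (unF z χ v₀ V).free) : x ∈ v₀ :: V ∨ x ∈ χ.free ∧ x ≠ z := by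
  have hs : ∀ v, x ∈ (substF z χ v).free → x = v ∨ x ∈ χ.free ∧ x ≠ z := by
    intro v hv
    simp only [substF, free_ex, free_and, free_eq, Finset.mem_sdiff, Finset.mem_union,
      Finset.mem_insert, Finset.mem_singleton] at hv
    tauto
  induction V with
  | nil => exact (hs v₀ hx).imp (by simp) id
  | cons v V ih =>
    rw [unF, free_and, Finset.mem_union] at hx
    rcases hx with hx | hx
    · exact (hs v hx).imp (by rintro rfl; simp) id
    · refine (ih hx).imp (fun h => ?_) id
      rcases List.mem_cons.1 h with h | h <;> simp [h]

theorem isFOW_unF {z v₀ : ℕ} {V : List ℕ} {χ : Formula L} (h : χ.IsFOW) :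
    (unF z χ v₀ V).IsFOW := by
  induction V with
  | nil => simpa [unF, substF]
  | cons v V ih => simp [unF, substF, ih, h]

theorem over_unF {z v₀ : ℕ} {V : List ℕ} {χ : Formula L} (h : χ.Over D) :
    (unF z χ v₀ V).Over D := by
  induction V with
  | nil => simpa [unF, substF]
  | cons v V ih => simp [unF, substF, ih, h]

/-- Scattered sets can be moved between a structure and a substructure that contains `U`, provided
that the threshold distance is measured alike on elements of `U`; other distances are irrelevant. -/
theorem scat_subtype_iff {A : Type} {B : Set A} {G : SimpleGraph A} {G' : SimpleGraph B} {d : ℕ}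
    {U : Set A} {U' : Set B} {k : ℕ} (hU : ∀ a ∈ U, ∃ h : a ∈ B, (⟨a, h⟩ : B) ∈ U')
    (hU' : ∀ b ∈ U', (b : A) ∈ U)
    (hd : ∀ a ∈ U', ∀ b ∈ U', G'.edist a b ≤ d ↔ G.edist (a : A) b ≤ d) :
    Scat G d U k ↔ Scat G' d U' k := by
  classical
  constructor
  · rintro ⟨s, rfl, hs, hsd⟩
    refine ⟨s.subtype (· ∈ B), ?_, ?_, ?_⟩
    · rw [Finset.card_subtype, Finset.filter_true_of_mem fun a ha => (hU a (hs ha)).1]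
    · intro b hb
      exact (hU b (hs (Finset.mem_subtype.1 hb))).2
    · intro a ha b hb hab
      have ha := Finset.mem_subtype.1 ha
      have hb := Finset.mem_subtype.1 hb
      rw [← not_le, hd a (hU _ (hs ha)).2 b (hU _ (hs hb)).2, not_le]
      exact hsd _ ha _ hb fun h => hab (Subtype.ext h)
  · rintro ⟨s, rfl, hs, hsd⟩
    refine ⟨s.map (Function.Embedding.subtype _), Finset.card_map _, ?_, ?_⟩
    · intro a ha
      obtain ⟨b, hb, rfl⟩ := Finset.mem_map.1 (Finset.mem_coe.1 ha)
      exact hU' b (hs hb)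
    · intro a ha b hb hab
      obtain ⟨a, ha', rfl⟩ := Finset.mem_map.1 ha
      obtain ⟨b, hb', rfl⟩ := Finset.mem_map.1 hb
      rw [← not_le]
      refine fun h => (hsd a ha' b hb' fun h => hab (by rw [h])).not_ge ?_
      exact (hd a (hs ha') b (hs hb')).2 h

/-- The formula that says that there are `k` elements in the `p`-neighbourhood of the variables
of colour `j` that satisfy `χ` and have pairwise distance more than `2 * p + 1`. -/
noncomputable def nearScatF (C : List (ℕ × ℕ)) (j p z : ℕ) (χ : Formula L) (b k : ℕ) :
    Formula L :=
  scatF z ((nearF C j p z C).and χ) (2 * p + 1) b k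

theorem sat_nearScatF {C : List (ℕ × ℕ)} {j p z : ℕ} {χ : Formula L} {b k q : ℕ} (hz : z < b)
    (hzC : z ∉ part C j) (hb : ∀ x ∈ part C j, x < b) (hk : 0 < k) (hχ : Loc D q {z} χ)
    {A : Type} [Finite A] [Nonempty A] {M : Str L A} {β : ℕ → A} :
    (nearScatF C j p z χ b k).Sat M β ↔ Scat M.gaifman (2 * p + 1)
      ({a | χ.Sat M (Function.update β z a)} ∩ nbhd M.gaifman p (β '' part C j)) k := by
  refine sat_scatF hz hk fun β' hβ' a => ?_
  rw [sat_and, sat_nearF, and_comm]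
  refine and_congr ?_ ?_
  · refine hχ.sat_congr ?_
    rintro x rfl
    simp
  · simp only [nbhd, Set.exists_mem_image, Set.mem_ofPred_eq, Function.update_self]
    refine exists_congr fun x => and_congr_right fun hx => ?_
    have hxz : x ≠ z := fun h => hzC (h ▸ hx)
    rw [Function.update_of_ne hxz, hβ' x (hb x hx)]

/-- The quantifiers are not bounded one by one; locality is shown for the notion of a scattered set
instead. The relevant elements are within `p` of the part, so the `(2 * p + 1)`-neighbourhood of the
part contains their `q`-neighbourhoods, needed for `χ`, and their `(p + 1)`-neighbourhoods, needed
for mutual distances. -/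
theorem loc_nearScatF {C : List (ℕ × ℕ)} {j p z : ℕ} {χ : Formula L} {b k q : ℕ} (hz : z < b)
    (hzC : z ∉ part C j) (hb : ∀ x ∈ part C j, x < b) (hk : 0 < k) (hqp : q ≤ p)
    (hχ : Loc D q {z} χ) : Loc D (2 * p + 1) (part C j) (nearScatF C j p z χ b k) where
  isFOW := by
    rw [nearScatF, scatF, isFOW_exs, isFOW_and]
    exact ⟨isFOW_unF (isFOW_and.2 ⟨isFO_nearF.isFOW, hχ.isFOW⟩), isFO_farF.isFOW⟩
  constsIn := by
    rw [nearScatF, scatF, over_exs, over_and]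
    exact ⟨over_unF (over_and.2 ⟨isFO_nearF.over, hχ.constsIn⟩), isFO_farF.over⟩
  free := by
    intro x hx
    have hmem : ∀ v, v ∈ varList b k → v ∈ Finset.Ico b (b + k) := fun v hv => by
      simpa using mem_varList.1 hv
    have hbk : b ∈ Finset.Ico b (b + k) := by simp [hk]
    rw [nearScatF, scatF, free_exs, free_and, Finset.mem_coe, Finset.mem_sdiff,
      Finset.mem_union] at hx
    rcases hx with ⟨h | h, hx⟩
    · rcases free_unF h with h | ⟨h, hne⟩
      · rcases List.mem_cons.1 h with rfl | h
        · exact absurd hbk hx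
        · exact absurd (hmem x h) hx
      · rw [free_and, Finset.mem_union] at h
        rcases h with h | h
        · exact (free_nearF h).resolve_right hne
        · exact absurd (hχ.free h) hne
    · refine absurd (free_farF (X := (Finset.Ico b (b + k) : Finset ℕ)) hbk
        (fun e he => ?_) h) hx
      exact ⟨hmem _ (mem_of_mem_pairs he).1, hmem _ (mem_of_mem_pairs he).2⟩
  sat_iff A _ M B β γ hγ hB := by
    have : Nonempty A := ⟨β 0⟩
    have : Nonempty B := ⟨γ 0⟩
    rw [sat_nearScatF hz hzC hb hk hχ, sat_nearScatF hz hzC hb hk hχ]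
    have hball : ∀ x ∈ part C j, ∀ d, M.gaifman.edist (β x) d ≤ (2 * p + 1 : ℕ) → d ∈ B :=
      fun x hx d hd => hB (mem_ball_self hx hd)
    have hnear : ∀ x ∈ part C j, ∀ b : B,
        (M.induce B).gaifman.edist (γ x) b ≤ p ↔ M.gaifman.edist (β x) (b : A) ≤ p := by
      intro x hx b
      rw [edist_induce_le_iff_of_center (p := 2 * p + 1) (by omega), hγ x hx]
      intro d hd
      exact hball x hx d (by rwa [← hγ x hx])
    have hsat : ∀ b : B, (∃ x ∈ part C j, M.gaifman.edist (β x) (b : A) ≤ p) →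
        (χ.Sat M (Function.update β z (b : A)) ↔
          χ.Sat (M.induce B) (Function.update γ z b)) := by
      rintro b ⟨x, hx, hxb⟩
      refine hχ.sat_iff A M B _ _ ?_ ?_
      · rintro x rfl; simp
      · rintro d ⟨_, ⟨y, rfl, rfl⟩, hd⟩
        rw [Function.update_self] at hd
        exact hball x hx d (edist_le_add hxb hd (by omega))
    refine scat_subtype_iff ?_ ?_ ?_
    · rintro a ⟨ha, _, ⟨x, hx, rfl⟩, hxa⟩
      have haB := hball x hx a (hxa.trans (by exact_mod_cast (by omega : p ≤ 2 * p + 1)))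
      exact ⟨haB, (hsat ⟨a, haB⟩ ⟨x, hx, hxa⟩).1 ha, _, ⟨x, hx, rfl⟩, (hnear x hx _).2 hxa⟩
    · rintro a ⟨ha, _, ⟨x, hx, rfl⟩, hxa⟩
      have hxa' := (hnear x hx _).1 hxa
      exact ⟨(hsat a ⟨x, hx, hxa'⟩).2 ha, _, ⟨x, hx, rfl⟩, hxa'⟩
    · rintro a ⟨-, _, ⟨x, hx, rfl⟩, hxa⟩ b ⟨-, _, ⟨y, hy, rfl⟩, hyb⟩
      -- The threshold satisfies `2 * p + 1 ≤ 2 * (p + 1)`, and `p + (p + 1)` is exactly the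
      -- available radius.
      refine edist_induce_le_iff_of_ends (r := p + 1) (by omega) ?_ ?_
      · exact fun d hd => hball x hx d (edist_le_add ((hnear x hx _).1 hxa) hd (by omega))
      · exact fun d hd => hball y hy d (edist_le_add ((hnear y hy _).1 hyb) hd (by omega))

end ScatF

end WA

namespace WA

/-! ### Counting terms -/

section Counting

variable {L : Lang}

/-- All pairs in the list have distance at most `d`. -/
noncomputable def closeF (d v₀ : ℕ) : List (ℕ × ℕ) → Formula L
  | [] => .eq v₀ v₀
  | e :: E => (distF d e.1 e.2).and (closeF d v₀ E)

theorem sat_closeF {d v₀ : ℕ} {E : List (ℕ × ℕ)} {A : Type} {M : Str L A} {β : ℕ → A} :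
    (closeF d v₀ E).Sat M β ↔ ∀ e ∈ E, M.gaifman.edist (β e.1) (β e.2) ≤ d := by
  induction E with
  | nil => simp [closeF]
  | cons e E ih => simp [closeF, sat_distF, ih]

theorem isFO_closeF {d v₀ : ℕ} {E : List (ℕ × ℕ)} : (closeF d v₀ E : Formula L).IsFO := by
  induction E with
  | nil => simp [closeF]
  | cons e E ih => simp [closeF, isFO_distF, ih]

theorem free_closeF {d v₀ : ℕ} {E : List (ℕ × ℕ)} {X : Set ℕ} (h₀ : v₀ ∈ X)
    (hE : ∀ e ∈ E, e.1 ∈ X ∧ e.2 ∈ X) : ((closeF d v₀ E : Formula L).free : Set ℕ) ⊆ X := by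
  induction E with
  | nil => simp [closeF, h₀]
  | cons e E ih =>
    rw [closeF, free_and, Finset.coe_union, Set.union_subset_iff]
    refine ⟨(Finset.coe_subset.2 free_distF).trans ?_, ih fun e he => hE e (by simp [he])⟩
    have := hE e (by simp)
    simp [Set.insert_subset_iff, this]

variable (one : L.Wt) (harity : L.arW one = 1) (eZ : (L.alg (L.tyW one)).IntIso)

/-- The tuple of variables of `one(v)` -/
def oneVar (v : ℕ) : Fin (L.arW one) ↪ ℕ :=
  ⟨fun _ => v, fun i j _ => Fin.ext (by have := i.2; have := j.2; omega)⟩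

/-- The product of `one(v)` for the variables in `v₀ :: V`. -/
def prodOne (v₀ : ℕ) : List ℕ → WProd L (L.tyW one)
  | [] => .single (.wt one (oneVar one harity v₀))
  | v :: V => .times eZ.isRing (.wt one (oneVar one harity v)) (prodOne v₀ V)

theorem vars_oneVar (v : ℕ) :
    (Factor.wt one (oneVar one harity v) : Factor L _).vars = {v} := by
  have : Nonempty (Fin (L.arW one)) := ⟨⟨0, by omega⟩⟩
  ext x
  simp only [Factor.vars, Finset.mem_map, Finset.mem_univ, true_and, Finset.mem_singleton]
  exact ⟨fun ⟨_, h⟩ => h.symm, fun h => ⟨Classical.arbitrary _, h.symm⟩⟩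

theorem vars_prodOne {v₀ : ℕ} {V : List ℕ} :
    (prodOne one harity eZ v₀ V).vars = (v₀ :: V).toFinset := by
  induction V with
  | nil => simp [prodOne, WProd.vars, vars_oneVar]
  | cons v V ih =>
    rw [prodOne, WProd.vars, ih, vars_oneVar]
    ext x
    simp only [Finset.mem_union, Finset.mem_singleton, List.mem_toFinset, List.mem_cons]
    tauto

theorem over_prodOne {D : Set L.Const} {v₀ : ℕ} {V : List ℕ} :
    (prodOne one harity eZ v₀ V).Over D := by
  induction V with
  | nil => simp [prodOne, WProd.Over, Factor.Over]
  | cons v V ih => exact ⟨by simp [Factor.Over], ih⟩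

theorem val_prodOne {v₀ : ℕ} {V : List ℕ} {A : Type} {M : Str L A} {β : ℕ → A}
    (h : ∀ a, eZ.toInt (M.wt one a) = 1) :
    eZ.toInt ((prodOne one harity eZ v₀ V).val M β) = 1 := by
  induction V with
  | nil => exact h _
  | cons v V ih => rw [prodOne, WProd.val, eZ.map_mul, ih]; simp [Factor.val, h]

/-- The assignments that agree with `β` outside `V` and satisfy `P` -/
def cntSet {A : Type} (β : ℕ → A) (V : List ℕ) (P : (ℕ → A) → Prop) : Set (ℕ → A) :=
  {β' | (∀ x, x ∉ V → β' x = β x) ∧ P β'}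

theorem extend_injective {A : Type} (β : ℕ → A) (V : Finset ℕ) :
    Function.Injective fun a : {y // y ∈ V} → A => Function.extend Subtype.val a β := by
  intro a b h
  funext v
  have := congrFun h v
  simpa [Subtype.val_injective.extend_apply] using this

theorem cntSet_eq_image {A : Type} {β : ℕ → A} {V : List ℕ} {P : (ℕ → A) → Prop} {W : Finset ℕ}
    (hW : W = V.toFinset) :
    cntSet β V P = (fun a : {y // y ∈ W} → A => Function.extend Subtype.val a β) ''
      {a | P (Function.extend Subtype.val a β)} := by
  subst hW
  ext β'
  constructor
  · rintro ⟨h, hP⟩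
    have : Function.extend Subtype.val (fun v : {y // y ∈ V.toFinset} => β' v) β = β' := by
      funext x
      by_cases hx : x ∈ V.toFinset
      · exact Subtype.val_injective.extend_apply _ _ (⟨x, hx⟩ : {y // y ∈ V.toFinset})
      · rw [Function.extend_apply' _ _ _ (by rintro ⟨v, rfl⟩; exact hx v.2)]
        exact (h x (by simpa using hx)).symm
    exact ⟨fun v => β' v, by simpa [this] using hP, this⟩
  · rintro ⟨a, ha, rfl⟩
    refine ⟨fun x hx => ?_, ha⟩
    exact Function.extend_apply' _ _ _
      (by rintro ⟨v, rfl⟩; exact hx (List.mem_toFinset.1 v.2))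

theorem finite_cntSet {A : Type} [Finite A] {β : ℕ → A} {V : List ℕ} {P : (ℕ → A) → Prop} :
    (cntSet β V P).Finite := by
  rw [cntSet_eq_image rfl]
  exact (Set.toFinite _).image _

/-- Every summand is a product of ones, so the sum is the number of satisfying assignments,
transported to the integers. -/
theorem val_sum_prodOne {v₀ : ℕ} {V : List ℕ} {A : Type} [Finite A] {M : Str L A} {β : ℕ → A}
    (h : ∀ a, eZ.toInt (M.wt one a) = 1) {φ : Formula L} :
    eZ.toInt ((Term.sum (prodOne one harity eZ v₀ V) φ).val M β) =
      ((cntSet β (v₀ :: V) (φ.Sat M)).ncard : ℤ) := by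
  classical
  rw [cntSet_eq_image (vars_prodOne one harity eZ), Set.ncard_image_of_injective _
    (extend_injective β _)]
  simp only [Term.val]
  set S := {a : {y // y ∈ (prodOne one harity eZ v₀ V).vars} → A |
    φ.Sat M (Function.extend Subtype.val a β)}
  have hS : S.Finite := Set.toFinite _
  change eZ.toInt (∑ᶠ a ∈ S, _) = _
  rw [finsum_mem_eq_finite_toFinset_sum _ hS, map_sum]
  simp only [val_prodOne one harity eZ h]
  rw [Finset.sum_const, Set.ncard_eq_toFinset_card S hS]
  simp

/-- `g` is a ground connected local term that counts the assignments of `V` that satisfy `P`. -/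
structure IsCount (D : Set L.Const) (p : ℕ) (V : List ℕ)
    (P : (A : Type) → Str L A → (ℕ → A) → Prop) (g : Term L (L.tyW one)) : Prop where
  free : g.free = ∅
  isCl : g.IsCl p
  constsIn : g.Over D
  val : ∀ (A : Type) [Finite A] [Nonempty A] (M : Str L A), M.IsWeighted →
    (∀ a, eZ.toInt (M.wt one a) = 1) → ∀ β : ℕ → A,
      eZ.toInt (g.val M β) = ((cntSet β V (P A M)).ncard : ℤ)

variable {one eZ} {D : Set L.Const} {p : ℕ} {V : List ℕ}
  {P Q R : (A : Type) → Str L A → (ℕ → A) → Prop} {g g' : Term L (L.tyW one)}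

theorem cntSet_ncard_add {A : Type} [Finite A] {β : ℕ → A} {P P₁ P₂ : (ℕ → A) → Prop}
    (h : ∀ β', P β' ↔ P₁ β' ∨ P₂ β') (h' : ∀ β', P₁ β' → ¬ P₂ β') :
    (cntSet β V P).ncard = (cntSet β V P₁).ncard + (cntSet β V P₂).ncard := by
  rw [← Set.ncard_union_eq _ finite_cntSet finite_cntSet]
  · congr 1
    ext β'
    simp only [cntSet, Set.mem_ofPred_eq, Set.mem_union, h]
    tauto
  · rw [Set.disjoint_left]
    rintro β' ⟨-, h1⟩ ⟨-, h2⟩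
    exact h' β' h1 h2

/-- Removes a far condition: drop it, and subtract the assignments for which the pair is close. -/
theorem IsCount.sub (h : IsCount one eZ D p V P g) (h' : IsCount one eZ D p V Q g')
    (hP : ∀ A M β', P A M β' ↔ R A M β' ∨ Q A M β') (hR : ∀ A M β', R A M β' → ¬ Q A M β') :
    IsCount one eZ D p V R (g.sub g') where
  free := by simp [Term.free, h.free, h'.free]
  isCl := by simpa using Term.IsCl.sub h.isCl h'.isCl
  constsIn := by simpa [Term.Over] using ⟨h.constsIn, h'.constsIn⟩
  val A _ _ M hM h1 β := by
    rw [Term.val, map_sub, h.val A M hM h1, h'.val A M hM h1,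
      cntSet_ncard_add (hP A M) (hR A M)]
    push_cast; ring

theorem IsCount.add (h : IsCount one eZ D p V P g) (h' : IsCount one eZ D p V Q g')
    (hP : ∀ A M β', R A M β' ↔ P A M β' ∨ Q A M β') (hR : ∀ A M β', P A M β' → ¬ Q A M β') :
    IsCount one eZ D p V R (g.add g') where
  free := by simp [Term.free, h.free, h'.free]
  isCl := by simpa using Term.IsCl.add h.isCl h'.isCl
  constsIn := by simpa [Term.Over] using ⟨h.constsIn, h'.constsIn⟩
  val A _ _ M hM h1 β := by
    rw [Term.val, map_add, h.val A M hM h1, h'.val A M hM h1,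
      cntSet_ncard_add (hP A M) (hR A M)]
    push_cast; ring

/-- The truth value depends only on the variables in `V`. -/
def OnlyOn (V : List ℕ) (P : (A : Type) → Str L A → (ℕ → A) → Prop) : Prop :=
  ∀ A [Finite A] M β β', (∀ v ∈ V, β v = β' v) → P A M β → P A M β'

/-- Conditions on disjoint sets of variables are independent: an assignment corresponds to the pair
of its restrictions. -/
theorem cntSet_ncard_mul {V₁ V₂ : List ℕ} (hV : ∀ v, v ∈ V ↔ v ∈ V₁ ∨ v ∈ V₂)
    (hd : ∀ v ∈ V₁, v ∉ V₂) {A : Type} [Finite A] {M : Str L A} {β : ℕ → A}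
    (hP : OnlyOn V₁ P) (hQ : OnlyOn V₂ Q) :
    (cntSet β V fun β' => P A M β' ∧ Q A M β').ncard =
      (cntSet β V₁ (P A M)).ncard * (cntSet β V₂ (Q A M)).ncard := by
  classical
  rw [← Set.ncard_prod]
  refine Set.ncard_congr
    (fun β' _ => (fun x => if x ∈ V₁ then β' x else β x, fun x => if x ∈ V₂ then β' x else β x))
    ?_ ?_ ?_
  · rintro β' ⟨h, hP', hQ'⟩
    refine ⟨⟨fun x hx => if_neg hx, ?_⟩, fun x hx => if_neg hx, ?_⟩
    · exact hP A M β' _ (fun v hv => (if_pos hv).symm) hP'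
    · exact hQ A M β' _ (fun v hv => (if_pos hv).symm) hQ'
  · rintro β₁ β₂ ⟨h₁, -⟩ ⟨h₂, -⟩ h
    funext x
    by_cases hx1 : x ∈ V₁
    · simpa [hx1] using congrFun (congrArg Prod.fst h) x
    · by_cases hx2 : x ∈ V₂
      · simpa [hx2] using congrFun (congrArg Prod.snd h) x
      · have : x ∉ V := by rw [hV]; tauto
        rw [h₁ x this, h₂ x this]
  · rintro ⟨β₁, β₂⟩ ⟨⟨h₁, h₁'⟩, h₂, h₂'⟩
    refine ⟨fun x => if x ∈ V₁ then β₁ x else if x ∈ V₂ then β₂ x else β x, ⟨?_, ?_, ?_⟩, ?_⟩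
    · intro x hx
      rw [hV, not_or] at hx
      simp [hx]
    · exact hP A M _ _ (fun v hv => by simp [hv]) h₁'
    · refine hQ A M _ _ (fun v hv => ?_) h₂'
      have : v ∉ V₁ := fun h => hd v h hv
      simp [this, hv]
    · refine Prod.ext (funext fun x => ?_) (funext fun x => ?_)
      · by_cases hx : x ∈ V₁
        · simp [hx]
        · simpa [hx] using (h₁ x hx).symm
      · by_cases hx : x ∈ V₂
        · have : x ∉ V₁ := fun h => hd x h hx
          simp [this, hx]
        · simpa [hx] using (h₂ x hx).symm

theorem IsCount.mul {V₁ V₂ : List ℕ} (hV : ∀ v, v ∈ V ↔ v ∈ V₁ ∨ v ∈ V₂)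
    (hd : ∀ v ∈ V₁, v ∉ V₂) (h : IsCount one eZ D p V₁ P g) (h' : IsCount one eZ D p V₂ Q g')
    (hP : OnlyOn V₁ P) (hQ : OnlyOn V₂ Q) (hR : ∀ A M β', R A M β' ↔ P A M β' ∧ Q A M β') :
    IsCount one eZ D p V R (g.mul eZ.isRing g') where
  free := by simp [Term.free, h.free, h'.free]
  isCl := by simpa using Term.IsCl.mul eZ.isRing h.isCl h'.isCl
  constsIn := by simpa [Term.Over] using ⟨h.constsIn, h'.constsIn⟩
  val A _ _ M hM h1 β := by
    rw [Term.val, eZ.map_mul, h.val A M hM h1, h'.val A M hM h1,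
      show R A M = fun β' => P A M β' ∧ Q A M β' from funext fun β' => propext (hR A M β'),
      cntSet_ncard_mul hV hd hP hQ]
    push_cast; rfl

/-- All elements satisfy `χ`, the pairs in `F` have distance more than `d` and those in `E` at
most `d`. -/
def Pattern (z : ℕ) (χ : Formula L) (d : ℕ) (V : List ℕ) (F E : List (ℕ × ℕ)) (A : Type)
    (M : Str L A) (β : ℕ → A) : Prop :=
  (∀ v ∈ V, χ.Sat M (Function.update β z (β v))) ∧
    (∀ e ∈ F, (d : ℕ∞) < M.gaifman.edist (β e.1) (β e.2)) ∧
    ∀ e ∈ E, M.gaifman.edist (β e.1) (β e.2) ≤ d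

theorem onlyOn_pattern {z q d : ℕ} {χ : Formula L} (hχ : Loc D q {z} χ) {F E : List (ℕ × ℕ)}
    (hF : ∀ e ∈ F, e.1 ∈ V ∧ e.2 ∈ V) (hE : ∀ e ∈ E, e.1 ∈ V ∧ e.2 ∈ V) :
    OnlyOn V (Pattern z χ d V F E) := by
  rintro A _ M β β' h ⟨h1, h2, h3⟩
  refine ⟨fun v hv => ?_, fun e he => ?_, fun e he => ?_⟩
  · refine (hχ.sat_congr ?_).1 (h1 v hv)
    rintro x rfl
    simp [h v hv]
  · rw [← h _ (hF e he).1, ← h _ (hF e he).2]; exact h2 e he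
  · rw [← h _ (hE e he).1, ← h _ (hE e he).2]; exact h3 e he

/-- The entries of the list are attached one after the other to the previous ones by pairs
in `E`. -/
inductive Attached (E : List (ℕ × ℕ)) : List ℕ → Prop
  | single (v : ℕ) : Attached E [v]
  | cons {u v : ℕ} {V : List ℕ} (hV : Attached E V) (hu : u ∈ V)
      (h : (u, v) ∈ E ∨ (v, u) ∈ E) : Attached E (v :: V)

theorem Attached.mono {E E' : List (ℕ × ℕ)} (h : Attached E V) (hE : ∀ e ∈ E, e ∈ E') :
    Attached E' V := by
  induction h with
  | single v => exact .single v
  | cons _ hu h ih => exact .cons ih hu (h.imp (hE _) (hE _))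

/-- Each entry of the list is joined to an earlier one, so the entries stay connected while the list
grows. -/
theorem Attached.reachable {E : List (ℕ × ℕ)} (h : Attached E V) {k : ℕ} {y : Fin k ↪ ℕ}
    (hV : ∀ v ∈ V, ∃ i, y i = v) {G : SimpleGraph (Fin k)}
    (hG : ∀ i j, i ≠ j → (y i, y j) ∈ E → G.Adj i j) :
    ∀ i j, y i ∈ V → y j ∈ V → G.Reachable i j := by
  induction h with
  | single v =>
    intro i j hi hj
    rw [List.mem_singleton] at hi hj
    rw [y.injective (hi.trans hj.symm)]
  | @cons u v V _ hu h ih =>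
    have ih := ih fun w hw => hV w (by simp [hw])
    obtain ⟨l, rfl⟩ := hV u (by simp [hu])
    have key : ∀ i, y i = v → G.Reachable l i := by
      rintro i rfl
      by_cases hli : l = i
      · rw [hli]
      · rcases h with h | h
        · exact (hG l i hli h).reachable
        · exact (hG i l (Ne.symm hli) h).symm.reachable
    intro i j hi hj
    rcases List.mem_cons.1 hi with hi | hi <;> rcases List.mem_cons.1 hj with hj | hj
    · exact (key i hi).symm.trans (key j hj)
    · exact (key i hi).symm.trans (ih l j hu hj)
    · exact (ih i l hi hu).trans (key j hj)
    · exact ih i j hi hj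

/-- A pattern that decides all distances -/
structure Complete (V : List ℕ) (F E : List (ℕ × ℕ)) : Prop where
  cover : ∀ e ∈ pairs V, e ∈ F ∨ e ∈ E ∨ e.swap ∈ E
  disjoint : ∀ e ∈ F, e.1 ≠ e.2 ∧ e ∉ E ∧ e.swap ∉ E

variable (one eZ) in
/-- The basic term that counts assignments with a given pattern -/
noncomputable def patternT (z : ℕ) (χ : Formula L) (d : ℕ) (v₀ : ℕ) (V : List ℕ)
    (F E : List (ℕ × ℕ)) : Term L (L.tyW one) :=
  .sum (prodOne one harity eZ v₀ V)
    ((unF z χ v₀ V).and ((closeF d v₀ E).and (farF d v₀ F)))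

/-- Since every pair of variables is declared close or far, the conditions amount to a distance
pattern, whose graph consists of the pairs in `E`. The list `V'` enumerates the variables in an
order that shows this graph to be connected. The condition on single elements is local because `χ`
is. -/
theorem isCount_patternT {z q v₀ : ℕ} {χ : Formula L} (hχ : Loc D q {z} χ) (hq : q ≤ p)
    {F E : List (ℕ × ℕ)} {V' : List ℕ} (hn : (v₀ :: V).Nodup) (hz : z ∉ v₀ :: V)
    (hF : ∀ e ∈ F, e.1 ∈ v₀ :: V ∧ e.2 ∈ v₀ :: V) (hE : ∀ e ∈ E, e.1 ∈ v₀ :: V ∧ e.2 ∈ v₀ :: V)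
    (hc : Complete (v₀ :: V) F E) (hV' : Attached E V') (hV : ∀ v, v ∈ V' ↔ v ∈ v₀ :: V) :
    IsCount one eZ D p (v₀ :: V) (Pattern z χ (2 * p + 1) (v₀ :: V) F E)
      (patternT one harity eZ z χ (2 * p + 1) v₀ V F E) := by
  have hv₀ : v₀ ≠ z := fun h => hz (by simp [h])
  have hzV : z ∉ V := fun h => hz (by simp [h])
  have hloc : Loc D p {x | x ∈ v₀ :: V} (unF z χ v₀ V) :=
    loc_unF hz (by simp) (fun v hv => by simp [hv]) (hχ.mono hq subset_rfl)
  have hfc := free_closeF (L := L) (d := 2 * p + 1) (v₀ := v₀) (E := E) (X := {x | x ∈ v₀ :: V})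
    (by simp) hE
  have hff := free_farF (L := L) (d := 2 * p + 1) (v₀ := v₀) (F := F) (X := {x | x ∈ v₀ :: V})
    (by simp) hF
  let y : Fin (v₀ :: V).length ↪ ℕ := ⟨(v₀ :: V).get, List.nodup_iff_injective_get.1 hn⟩
  have hy : ∀ x, x ∈ Finset.univ.map y ↔ x ∈ v₀ :: V := by
    intro x
    simp only [Finset.mem_map, Finset.mem_univ, true_and, List.mem_iff_get (a := x)]
    rfl
  have hyset : ((Finset.univ.map y : Finset ℕ) : Set ℕ) = {x | x ∈ v₀ :: V} :=
    Set.ext fun x => hy x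
  refine ⟨?_, .basic ⟨_, y, prodOne one harity eZ v₀ V, unF z χ v₀ V,
    (closeF (2 * p + 1) v₀ E).and (farF (2 * p + 1) v₀ F),
    { Adj := fun i j => i ≠ j ∧ ((y i, y j) ∈ E ∨ (y j, y i) ∈ E)
      symm := ⟨fun i j h => ⟨h.1.symm, h.2.symm⟩⟩
      loopless := ⟨fun i h => h.1 rfl⟩ },
    by simp, rfl, ?_, hloc.isFOW, ?_, ?_, ?_, ?_, ?_, ?_⟩, ?_, ?_⟩
  · rw [patternT, Term.free, Finset.sdiff_eq_empty_iff_subset, vars_prodOne]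
    intro x hx
    rw [free_and, free_and, Finset.mem_union, Finset.mem_union] at hx
    rw [List.mem_toFinset]
    rcases hx with h | h | h
    · exact hloc.free h
    · exact hfc h
    · exact hff h
  · intro x hx
    rw [vars_prodOne, List.mem_toFinset] at hx
    exact (hy x).2 hx
  · exact fun x hx => (hy x).2 (hloc.free hx)
  · rw [← hyset] at hloc; exact hloc.isLocal
  -- Connectedness is read off the order in `V'`, which has the same members as the list of
  -- summation variables.
  · have : Nonempty (Fin (v₀ :: V).length) := ⟨⟨0, by simp⟩⟩
    refine SimpleGraph.Connected.mk fun i j => ?_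
    refine hV'.reachable (y := y) (fun v hv => ?_) (fun i j hij h => ?_) i j ?_ ?_
    · have := (hy v).2 ((hV v).1 hv)
      simpa using this
    · exact ⟨hij, .inl h⟩
    · exact (hV _).2 ((hy _).1 (by simp))
    · exact (hV _).2 ((hy _).1 (by simp))
  · simp [isFO_closeF, isFO_farF]
  · intro x hx
    rw [free_and, Finset.mem_union] at hx
    exact (hy x).2 (hx.elim (fun h => hfc h) fun h => hff h)
  · intro A _ _ M _ β
    rw [sat_and, sat_closeF, sat_farF]
    have hcomm : ∀ u v, M.gaifman.edist (β u) (β v) = M.gaifman.edist (β v) (β u) :=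
      fun _ _ => SimpleGraph.edist_comm
    constructor
    · rintro ⟨h1, h2⟩ i j hij
      constructor
      · rintro ⟨-, h | h⟩
        · exact h1 _ h
        · rw [hcomm]; exact h1 _ h
      · intro h
        refine ⟨hij, ?_⟩
        have hne : y i ≠ y j := fun h => hij (y.injective h)
        rcases mem_pairs_or ((hy _).1 (by simp)) ((hy (y j)).1 (by simp)) hne with h' | h'
        · rcases hc.cover _ h' with h' | h' | h'
          · exact absurd h (h2 _ h').not_ge
          · exact .inl h'
          · exact .inr h'
        · rcases hc.cover _ h' with h' | h' | h'
          · rw [hcomm] at h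
            exact absurd h (h2 _ h').not_ge
          · exact .inr h'
          · exact .inl h'
    · intro h
      have hget : ∀ x, x ∈ v₀ :: V → ∃ i, y i = x := fun x hx => by simpa using (hy x).2 hx
      refine ⟨fun e he => ?_, fun e he => ?_⟩
      · obtain ⟨i, hi⟩ := hget _ (hE e he).1
        obtain ⟨j, hj⟩ := hget _ (hE e he).2
        by_cases hij : i = j
        · rw [← hi, ← hj, hij]; simp
        · rw [← hi, ← hj]
          exact (h i j hij).1 ⟨hij, .inl (by rw [hi, hj]; exact he)⟩
      · obtain ⟨i, hi⟩ := hget _ (hF e he).1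
        obtain ⟨j, hj⟩ := hget _ (hF e he).2
        obtain ⟨hne, h1, h2⟩ := hc.disjoint e he
        have hij : i ≠ j := by rintro rfl; exact hne (hi.symm.trans hj)
        rw [← not_le, ← hi, ← hj, ← h i j hij]
        rintro ⟨-, h' | h'⟩
        · exact h1 (by rw [hi, hj] at h'; exact h')
        · exact h2 (by rw [hi, hj] at h'; exact h')
  · simp only [patternT, Term.Over]
    exact ⟨over_prodOne one harity eZ, over_and.2 ⟨hloc.constsIn,
      over_and.2 ⟨isFO_closeF.over, isFO_farF.over⟩⟩⟩
  · intro A _ _ M _ h1 β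
    rw [patternT, val_sum_prodOne one harity eZ h1]
    congr 2
    ext β'
    refine and_congr_right fun _ => ?_
    rw [sat_and, sat_and, sat_closeF, sat_farF, sat_unF hv₀ hzV]
    simp only [Pattern]
    tauto

/-- The counted assignments are the enumerations of scattered sets of size `k`, and a natural number
is at least one iff the counted set is nonempty. -/
theorem IsCount.one_le_iff {z q d k b : ℕ} {χ : Formula L} (hχ : Loc D q {z} χ)
    (hg : IsCount one eZ D p (varList b k)
      (Pattern z χ d (varList b k) (pairs (varList b k)) []) g)
    {A : Type} [Finite A] [Nonempty A] {M : Str L A} (hM : M.IsWeighted)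
    (h1 : ∀ a, eZ.toInt (M.wt one a) = 1) {β : ℕ → A} :
    1 ≤ eZ.toInt (g.val M β) ↔
      Scat M.gaifman d {a | χ.Sat M (Function.update β z a)} k := by
  rw [hg.val A M hM h1]
  have : (1 : ℤ) ≤ ((cntSet β (varList b k) (Pattern z χ d (varList b k)
      (pairs (varList b k)) [] A M)).ncard : ℤ) ↔ (cntSet β (varList b k) (Pattern z χ d
        (varList b k) (pairs (varList b k)) [] A M)).Nonempty := by
    rw [← Set.ncard_pos finite_cntSet]
    omega
  rw [this]
  have hs := scat_iff_of_list (G := M.gaifman) (d := d)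
    (U := {a | χ.Sat M (Function.update β z a)}) (varList_nodup (b := b) (k := k))
  rw [length_varList] at hs
  rw [← hs]
  have hfp : ∀ β' : ℕ → A, (∀ e ∈ pairs (varList b k),
      (d : ℕ∞) < M.gaifman.edist (β' e.1) (β' e.2)) ↔ ∀ u ∈ varList b k, ∀ v ∈ varList b k,
        u ≠ v → (d : ℕ∞) < M.gaifman.edist (β' u) (β' v) := fun β' =>
    forall_pairs_iff varList_nodup (R := fun u v => (d : ℕ∞) < M.gaifman.edist (β' u) (β' v))
      fun u v h => by rw [SimpleGraph.edist_comm]; exact h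
  have hsat : ∀ (β' : ℕ → A) a, χ.Sat M (Function.update β' z a) ↔
      χ.Sat M (Function.update β z a) := fun β' a => hχ.sat_congr (by rintro x rfl; simp)
  constructor
  · rintro ⟨β', -, h, h2, -⟩
    exact ⟨β', fun v hv => (hsat _ _).1 (h v hv), (hfp β').1 h2⟩
  · rintro ⟨β', h, h2⟩
    -- Counted assignments agree with `β` outside the summation variables, so the given tuple is
    -- completed by `β`.
    refine ⟨fun x => if x ∈ varList b k then β' x else β x, fun x hx => if_neg hx, ?_, ?_, ?_⟩
    · intro v hv
      simp only [hv, if_true]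
      exact (hsat _ _).2 (h v hv)
    · refine (hfp fun x => if x ∈ varList b k then β' x else β x).2 ?_
      intro u hu v hv huv
      simp only [hu, hv, if_true]
      exact h2 u hu v hv huv
    · simp

end Counting

end WA

namespace WA

/-! ### Decision trees -/

/-- The weight symbol `one` of integer type, and names for symbols and constants. -/
structure Ctx (L : Lang) where
  one : L.Wt
  harity : L.arW one = 1
  eZ : (L.alg (L.tyW one)).IntIso
  N : Coding L

section Trees

variable {L : Lang}

/-- Truth values as numbers -/
noncomputable def tv (P : Prop) : ℕ := by classical exact if P then 1 else 0

theorem tv_true {P : Prop} (h : P) : tv P = 1 := by simp [tv, h]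

theorem tv_false {P : Prop} (h : ¬ P) : tv P = 0 := by simp [tv, h]

theorem tv_congr {P Q : Prop} (h : P ↔ Q) : tv P = tv Q := by rw [propext h]

theorem tv_eq_one {P : Prop} : tv P = 1 ↔ P := by
  by_cases h : P <;> simp [tv, h]

/-- The tests of decision trees: local formulas around one of the parts of a colouring,
aggregation sentences, and statements `g ≥ 1` with the radius of `g`. -/
inductive Atom (K : Ctx L) : Type
  | loc (i : ℕ) (ψ : Formula L) : Atom K
  | aggr (χ : Formula L) : Atom K
  | ge (ρ : ℕ) (g : Term L (L.tyW K.one)) : Atom K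

inductive Tree (K : Ctx L) : Type
  | leaf (v : ℕ) : Tree K
  | node (a : Atom K) (t e : Tree K) : Tree K

variable {K : Ctx L}

def Atom.Holds {A : Type} (M : Str L A) (β : ℕ → A) : Atom K → Prop
  | loc _ ψ => ψ.Sat M β
  | aggr χ => χ.Sat M β
  | ge _ g => 1 ≤ K.eZ.toInt (g.val M β)

def Atom.code : Atom K → ℕ
  | loc i ψ => Nat.pair 0 (Nat.pair i (ψ.code K.N))
  | aggr χ => Nat.pair 1 (χ.code K.N)
  | ge ρ g => Nat.pair 2 (Nat.pair ρ (g.code K.N))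

/-- A local test names the part `i` it belongs to. Ground terms keep their own radius, independent
of `q`, because it has to be output. -/
def Atom.Good (Y : ℕ → Set ℕ) (q : ℕ) : Atom K → Prop
  | loc i ψ => Loc K.N.dom q (Y i) ψ
  | aggr χ => ∃ (w : L.Wt) (s : L.El (L.tyW w)) (y : Fin (L.arW w) ↪ ℕ) (lam : Formula L),
      χ = .agg w s y lam ∧ Finite (L.El (L.tyW w)) ∧ Loc K.N.dom q (Set.range y) lam
  | ge ρ g => g.free = ∅ ∧ g.IsCl ρ ∧ g.Over K.N.dom

namespace Tree

def code : Tree K → ℕ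
  | leaf v => Nat.pair 0 v
  | node a t e => Nat.pair 1 (Nat.pair a.code (Nat.pair t.code e.code))

open Classical in
noncomputable def eval {A : Type} (M : Str L A) (β : ℕ → A) : Tree K → ℕ
  | leaf v => v
  | node a t e => if a.Holds M β then t.eval M β else e.eval M β

def Good (Y : ℕ → Set ℕ) (q : ℕ) : Tree K → Prop
  | leaf _ => True
  | node a t e => a.Good Y q ∧ t.Good Y q ∧ e.Good Y q

/-- All labels belong to `S`. -/
def LabelsIn (S : Set ℕ) : Tree K → Prop
  | leaf v => v ∈ S
  | node _ t e => t.LabelsIn S ∧ e.LabelsIn S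

end Tree

theorem Tree.eval_pos {A : Type} {M : Str L A} {β : ℕ → A} {a : Atom K} {t e : Tree K}
    (h : a.Holds M β) : (node a t e).eval M β = t.eval M β := by rw [eval, if_pos h]

theorem Tree.eval_neg {A : Type} {M : Str L A} {β : ℕ → A} {a : Atom K} {t e : Tree K}
    (h : ¬ a.Holds M β) : (node a t e).eval M β = e.eval M β := by rw [eval, if_neg h]

theorem Atom.Good.mono {a : Atom K} {Y Y' : ℕ → Set ℕ} {q q' : ℕ} (h : a.Good Y q)
    (hY : ∀ i, Y i ⊆ Y' i) (hq : q ≤ q') : a.Good Y' q' := by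
  cases a with
  | loc i ψ => exact Loc.mono h hq (hY i)
  | aggr χ =>
    obtain ⟨w, s, y, lam, h1, h2, h3⟩ := h
    exact ⟨w, s, y, lam, h1, h2, h3.mono hq subset_rfl⟩
  | ge ρ g => exact h

theorem Tree.Good.mono {T : Tree K} {Y Y' : ℕ → Set ℕ} {q q' : ℕ} (h : T.Good Y q)
    (hY : ∀ i, Y i ⊆ Y' i) (hq : q ≤ q') : T.Good Y' q' := by
  induction T with
  | leaf v => trivial
  | node a t e iht ihe => exact ⟨h.1.mono hY hq, iht h.2.1, ihe h.2.2⟩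

/-- Weighted structures in which `one` is interpreted as expected -/
structure Adm (K : Ctx L) {A : Type} (M : Str L A) : Prop where
  isWeighted : M.IsWeighted
  one_eq : ∀ a, K.eZ.toInt (M.wt K.one a) = 1

/-- The tree `T` computes `F` if the parts of `Y` are far apart. -/
structure Rep (Y : ℕ → Set ℕ) (q : ℕ) (T : Tree K)
    (F : (A : Type) → Str L A → (ℕ → A) → ℕ) : Prop where
  good : T.Good Y q
  eval_eq : ∀ (A : Type) [Finite A] [Nonempty A] (M : Str L A), Adm K M → ∀ β : ℕ → A,
    Far M β Y q → T.eval M β = F A M β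

variable {Y : ℕ → Set ℕ} {q : ℕ} {T T₁ T₂ : Tree K}
  {F F₁ F₂ : (A : Type) → Str L A → (ℕ → A) → ℕ}

theorem Rep.leaf {v : ℕ}
    (h : ∀ (A : Type) [Finite A] [Nonempty A] (M : Str L A), Adm K M → ∀ β : ℕ → A,
      Far M β Y q → F A M β = v) : Rep Y q (Tree.leaf v : Tree K) F :=
  ⟨trivial, fun A _ _ M hM β hβ => (h A M hM β hβ).symm⟩

theorem Rep.congr (h : Rep Y q T F₁)
    (h' : ∀ (A : Type) [Finite A] [Nonempty A] (M : Str L A), Adm K M → ∀ β : ℕ → A,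
      Far M β Y q → F₁ A M β = F A M β) : Rep Y q T F :=
  ⟨h.good, fun A _ _ M hM β hβ => (h.eval_eq A M hM β hβ).trans (h' A M hM β hβ)⟩

theorem Rep.mono {Y' : ℕ → Set ℕ} {q' : ℕ} (h : Rep Y q T F) (hY : ∀ i, Y i ⊆ Y' i)
    (hq : q ≤ q') : Rep Y' q' T F :=
  ⟨h.good.mono hY hq, fun A _ _ M hM β hβ => h.eval_eq A M hM β (hβ.mono hY hq)⟩

theorem Rep.node {a : Atom K} (ha : a.Good Y q) (h₁ : T₁.Good Y q) (h₂ : T₂.Good Y q)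
    (h : ∀ (A : Type) [Finite A] [Nonempty A] (M : Str L A), Adm K M → ∀ β : ℕ → A,
      Far M β Y q → (a.Holds M β → T₁.eval M β = F A M β) ∧
        (¬ a.Holds M β → T₂.eval M β = F A M β)) :
    Rep Y q (Tree.node a T₁ T₂) F := by
  refine ⟨⟨ha, h₁, h₂⟩, fun A _ _ M hM β hβ => ?_⟩
  rw [Tree.eval]
  split_ifs with h'
  · exact (h A M hM β hβ).1 h'
  · exact (h A M hM β hβ).2 h'

/-- A test whose truth value is computed -/
theorem Rep.test {a : Atom K} (ha : a.Good Y q)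
    {P : (A : Type) → Str L A → (ℕ → A) → Prop}
    (h : ∀ (A : Type) [Finite A] [Nonempty A] (M : Str L A), Adm K M → ∀ β : ℕ → A,
      Far M β Y q → (a.Holds M β ↔ P A M β)) :
    Rep Y q (Tree.node a (.leaf 1) (.leaf 0)) fun A M β => tv (P A M β) := by
  refine .node ha trivial trivial fun A _ _ M hM β hβ => ⟨fun h' => ?_, fun h' => ?_⟩
  · exact (tv_true ((h A M hM β hβ).1 h')).symm
  · exact (tv_false fun h'' => h' ((h A M hM β hβ).2 h'')).symm

/-- `T` combines `T₁` and `T₂` by the operation whose graph is `g`. -/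
structure IsComb (g : List (ℕ × ℕ × ℕ)) (T₁ T₂ T : Tree K) : Prop where
  good : ∀ Y q, T₁.Good Y q → T₂.Good Y q → T.Good Y q
  eval_mem : ∀ (A : Type) (M : Str L A) (β : ℕ → A),
    (T₁.eval M β, T₂.eval M β, T.eval M β) ∈ g

theorem IsComb.leaf {g : List (ℕ × ℕ × ℕ)} {a b c : ℕ} (h : (a, b, c) ∈ g) :
    IsComb (K := K) g (.leaf a) (.leaf b) (.leaf c) :=
  ⟨fun _ _ _ _ => trivial, fun _ _ _ => h⟩

theorem IsComb.left {g : List (ℕ × ℕ × ℕ)} {a : Atom K} {t e t' e' : Tree K}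
    (h₁ : IsComb g t T₂ t') (h₂ : IsComb g e T₂ e') : IsComb g (.node a t e) T₂ (.node a t' e') :=
  ⟨fun Y q h h' => ⟨h.1, h₁.good Y q h.2.1 h', h₂.good Y q h.2.2 h'⟩, fun A M β => by
    simp only [Tree.eval]
    split_ifs
    · exact h₁.eval_mem A M β
    · exact h₂.eval_mem A M β⟩

theorem IsComb.right {g : List (ℕ × ℕ × ℕ)} {a : Atom K} {t e t' e' : Tree K}
    (h₁ : IsComb g T₁ t t') (h₂ : IsComb g T₁ e e') : IsComb g T₁ (.node a t e) (.node a t' e') :=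
  ⟨fun Y q h h' => ⟨h'.1, h₁.good Y q h h'.2.1, h₂.good Y q h h'.2.2⟩, fun A M β => by
    simp only [Tree.eval]
    split_ifs
    · exact h₁.eval_mem A M β
    · exact h₂.eval_mem A M β⟩

/-- The graph `g` need not be a function in general: it is enough that the third entry is determined
for the pairs of values that actually occur. -/
theorem Rep.comb {g : List (ℕ × ℕ × ℕ)} (h : IsComb g T₁ T₂ T) (h₁ : Rep Y q T₁ F₁)
    (h₂ : Rep Y q T₂ F₂) (hg : ∀ (A : Type) [Finite A] [Nonempty A] (M : Str L A), Adm K M →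
      ∀ β : ℕ → A, Far M β Y q → ∀ c, (F₁ A M β, F₂ A M β, c) ∈ g → c = F A M β) :
    Rep Y q T F :=
  ⟨h.good Y q h₁.good h₂.good, fun A _ _ M hM β hβ => by
    have := h.eval_mem A M β
    rw [h₁.eval_eq A M hM β hβ, h₂.eval_eq A M hM β hβ] at this
    exact hg A M hM β hβ _ this⟩

end Trees

/-! ### Labels for the values of quantifiers -/

section Labels

variable {L : Lang}

/-- For sums the label is the name of the value. For `∃` the number of witnesses is cut off at `1`,
which leaves finitely many labels and turns addition into disjunction. -/
noncomputable def Kind.lab (K : Ctx L) : (κ : Kind L) → κ.V → ℕ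
  | .ex, v => min 1 (show ℕ from v)
  | .sum w, e => K.N.el ⟨L.tyW w, e⟩

open Classical in
noncomputable def elems (w : L.Wt) : List (L.El (L.tyW w)) :=
  if h : Finite (L.El (L.tyW w)) then (@Finset.univ _ (@Fintype.ofFinite _ h)).toList else []

theorem mem_elems {w : L.Wt} (hw : Finite (L.El (L.tyW w))) (e : L.El (L.tyW w)) :
    e ∈ elems w := by
  rw [elems, dif_pos hw, Finset.mem_toList]
  exact @Finset.mem_univ _ (@Fintype.ofFinite _ hw) e

/-- Values that are tested one after the other -/
noncomputable def Kind.vals : (κ : Kind L) → List κ.V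
  | .ex => [(1 : ℕ)]
  | .sum w => elems w

variable {K : Ctx L}

theorem el_inj {w : L.Wt} (hw : Finite (L.El (L.tyW w))) {e e' : L.El (L.tyW w)}
    (h : K.N.el ⟨_, e⟩ = K.N.el ⟨_, e'⟩) : e = e' := by
  simpa using K.N.el_injOn (K.N.fin_mem w hw e) (K.N.fin_mem w hw e') h

theorem Kind.lab_eq_of_holds {κ : Kind L} {e v : κ.V} (he : e ∈ κ.vals) (h : κ.Holds e v) :
    κ.lab K e = κ.lab K v := by
  cases κ with
  | ex =>
    rw [show e = (1 : ℕ) from List.mem_singleton.1 he]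
    exact (show ∀ v : ℕ, v ≠ 0 → min 1 1 = min 1 v by omega) v h
  | sum w => rw [show e = v from h]

/-- For sums the hypothesis is contradictory, since all values are tested; for `∃` it says that
there is no witness. -/
theorem Kind.lab_eq_zero {κ : Kind L} (hκ : κ.Fin') {v : κ.V}
    (h : ∀ e ∈ κ.vals, ¬ κ.Holds e v) : κ.lab K v = κ.lab K 0 := by
  cases κ with
  | ex =>
    have : v = (0 : ℕ) := by
      by_contra hv
      exact h (1 : ℕ) (List.mem_singleton.2 rfl) hv
    rw [this]; rfl
  | sum w => exact absurd rfl (h v (mem_elems hκ v))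

theorem Kind.valIn {κ : Kind L} (hκ : κ.Fin') (e : κ.V) : κ.ValIn K.N.dom e := by
  cases κ with
  | ex => trivial
  | sum w => exact K.N.fin_mem w hκ e

def orE : List (ℕ × ℕ × ℕ) := [(0, 0, 0), (0, 1, 1), (1, 0, 1), (1, 1, 1)]

/-- Unary operations on trees are treated as binary ones whose second argument is the constant tree
`0`. -/
def notE : List (ℕ × ℕ × ℕ) := [(0, 0, 1), (1, 0, 0)]

/-- The addition table in terms of labels; it is finite because the type is. -/
noncomputable def Kind.plusE (K : Ctx L) : Kind L → List (ℕ × ℕ × ℕ)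
  | .ex => orE
  | .sum w => (elems w).flatMap fun a => (elems w).map fun b =>
      (K.N.el ⟨_, a⟩, K.N.el ⟨_, b⟩, K.N.el ⟨_, a + b⟩)

noncomputable def minusE (K : Ctx L) (w : L.Wt) : List (ℕ × ℕ × ℕ) :=
  (elems w).flatMap fun a => (elems w).map fun b =>
    (K.N.el ⟨_, a⟩, K.N.el ⟨_, b⟩, K.N.el ⟨_, a - b⟩)

noncomputable def Kind.eqE (K : Ctx L) : (κ : Kind L) → κ.V → List (ℕ × ℕ × ℕ)
  | .ex, _ => [(0, 0, 0), (1, 0, 1)]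
  | .sum w, e => (elems w).map fun a => (K.N.el ⟨_, a⟩, 0, tv (e = a))

theorem orE_spec {P Q : Prop} {c : ℕ} (h : (tv P, tv Q, c) ∈ orE) : c = tv (P ∨ Q) := by
  by_cases hP : P <;> by_cases hQ : Q <;> simpa [orE, tv, hP, hQ] using h

theorem notE_spec {P : Prop} {c : ℕ} (h : (tv P, 0, c) ∈ notE) : c = tv ¬ P := by
  by_cases hP : P <;> simpa [notE, tv, hP] using h

theorem Kind.plusE_spec {κ : Kind L} (hκ : κ.Fin') {u v : κ.V} {c : ℕ}
    (h : (κ.lab K u, κ.lab K v, c) ∈ κ.plusE K) : c = κ.lab K (u + v) := by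
  cases κ with
  | ex =>
    have : ∀ u v : ℕ, (min 1 u, min 1 v, c) ∈ orE → c = min 1 (u + v) := by
      intro u v h
      rcases u with _ | u <;> rcases v with _ | v <;> simp [orE] at h ⊢ <;> omega
    exact this u v h
  | sum w =>
    simp only [Kind.plusE, List.mem_flatMap, List.mem_map, Prod.mk.injEq] at h
    obtain ⟨a, -, b, -, ha, hb, rfl⟩ := h
    rw [el_inj hκ ha, el_inj hκ hb]
    rfl

theorem minusE_spec {w : L.Wt} (hw : Finite (L.El (L.tyW w))) {u v : L.El (L.tyW w)} {c : ℕ}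
    (h : (K.N.el ⟨_, u⟩, K.N.el ⟨_, v⟩, c) ∈ minusE K w) : c = K.N.el ⟨_, u - v⟩ := by
  simp only [minusE, List.mem_flatMap, List.mem_map, Prod.mk.injEq] at h
  obtain ⟨a, -, b, -, ha, hb, rfl⟩ := h
  rw [el_inj hw ha, el_inj hw hb]

theorem Kind.eqE_spec {κ : Kind L} (hκ : κ.Fin') {e v : κ.V} {c : ℕ}
    (h : (κ.lab K v, 0, c) ∈ κ.eqE K e) : c = tv (κ.Holds e v) := by
  cases κ with
  | ex =>
    have : ∀ v : ℕ, (min 1 v, 0, c) ∈ [(0, 0, 0), (1, 0, 1)] → c = tv (v ≠ 0) := by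
      intro v h
      rcases v with _ | v <;> simp [tv] at h ⊢ <;> omega
    exact this v h
  | sum w =>
    simp only [Kind.eqE, List.mem_map, Prod.mk.injEq] at h
    obtain ⟨a, -, ha, -, rfl⟩ := h
    rw [el_inj hκ ha]
    rfl

/-- The tree that finds the label of a value by testing the possible values -/
noncomputable def nest (κ : Kind L) (mk : κ.V → Atom K) : List κ.V → Tree K
  | [] => .leaf (κ.lab K 0)
  | e :: l => .node (mk e) (.leaf (κ.lab K e)) (nest κ mk l)

/-- The first successful test reveals the value. If all tests fail, the default leaf is right by
`Kind.lab_eq_zero`. -/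
theorem Rep.nest {κ : Kind L} (hκ : κ.Fin') {mk : κ.V → Atom K} {Y : ℕ → Set ℕ} {q : ℕ}
    (hmk : ∀ e, (mk e).Good Y q) {v : (A : Type) → Str L A → (ℕ → A) → κ.V}
    (h : ∀ (A : Type) [Finite A] [Nonempty A] (M : Str L A), Adm K M → ∀ β : ℕ → A,
      Far M β Y q → ∀ e, (mk e).Holds M β ↔ κ.Holds e (v A M β)) :
    Rep Y q (nest κ mk κ.vals) fun A M β => κ.lab K (v A M β) := by
  have hgood : ∀ l, (WA.nest κ mk l).Good Y q := by
    intro l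
    induction l with
    | nil => trivial
    | cons e l ih => exact ⟨hmk e, trivial, ih⟩
  refine ⟨hgood _, fun A _ _ M hM β hβ => ?_⟩
  have key : ∀ l : List κ.V, (∀ e ∈ l, e ∈ κ.vals) →
      (WA.nest κ mk l).eval M β = κ.lab K (v A M β) ∨
        (∀ e ∈ l, ¬ κ.Holds e (v A M β)) ∧ (WA.nest κ mk l).eval M β = κ.lab K 0 := by
    intro l hl
    induction l with
    | nil => exact .inr ⟨by simp, rfl⟩
    | cons e l ih =>
      rw [WA.nest, Tree.eval]
      split_ifs with he
      · exact .inl (Kind.lab_eq_of_holds (hl e (by simp)) ((h A M hM β hβ e).1 he))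
      · rcases ih fun e he => hl e (by simp [he]) with ih | ih
        · exact .inl ih
        · refine .inr ⟨?_, ih.2⟩
          intro e' he'
          rcases List.mem_cons.1 he' with rfl | he'
          · exact fun hc => he ((h A M hM β hβ _).2 hc)
          · exact ih.1 e' he'
  rcases key κ.vals fun _ h => h with h1 | ⟨h1, h2⟩
  · exact h1
  · rw [h2, Kind.lab_eq_zero hκ h1]

end Labels

end WA

namespace WA

/-! ### Elimination of a quantifier -/

section Elimination

variable {L : Lang} {K : Ctx L} {κ : Kind L} {y : Fin κ.ar ↪ ℕ} {C : List (ℕ × ℕ)} {n q : ℕ}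

/-- The parts of a colouring without the quantified variables -/
def rest (y : Fin κ.ar ↪ ℕ) (C : List (ℕ × ℕ)) (j : ℕ) : Set ℕ := part C j \ Set.range y

/-- The first quantified variable -/
def Kind.fst (κ : Kind L) (y : Fin κ.ar ↪ ℕ) : ℕ := y ⟨0, κ.ar_pos⟩

/-- The colouring `C` with the quantified variables coloured by `i` -/
def recolY (y : Fin κ.ar ↪ ℕ) (C : List (ℕ × ℕ)) (i : ℕ) : List (ℕ × ℕ) :=
  recol (List.ofFn y) i C

theorem disjoint_rest {j : ℕ} : Disjoint (rest y C j) (Set.range y) := Set.disjoint_sdiff_left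

theorem part_recolY_self {i : ℕ} : part (recolY y C i) i = rest y C i ∪ Set.range y := by
  ext x
  simp only [mem_part, recolY, col_recol, rest, Set.mem_union, Set.mem_sdiff,
    List.mem_ofFn' (f := y) (a := x)]
  by_cases hx : x ∈ Set.range y
  · simp only [hx, if_true, or_true]
  · simp only [hx, if_false, or_false, not_false_eq_true, and_true]

theorem part_recolY_of_ne {i j : ℕ} (h : j ≠ i) : part (recolY y C i) j = rest y C j := by
  ext x
  simp only [mem_part, recolY, col_recol, rest, Set.mem_sdiff, List.mem_ofFn' (f := y) (a := x)]
  by_cases hx : x ∈ Set.range y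
  · simp only [hx, if_true, not_true_eq_false, and_false, iff_false]
    exact fun h' => h (Option.some.inj h').symm
  · simp only [hx, if_false, not_false_eq_true, and_true]

theorem part_recolY {i : ℕ} : part (recolY y C i) =
    Function.update (rest y C) i (rest y C i ∪ Set.range y) := by
  funext j
  by_cases h : j = i
  · subst h; rw [part_recolY_self, Function.update_self]
  · rw [part_recolY_of_ne h, Function.update_of_ne h]

/-- All colours are less than `n`. -/
def ColLt (C : List (ℕ × ℕ)) (n : ℕ) : Prop := ∀ x j, col C x = some j → j < n

theorem rest_eq_empty (hC : ColLt C n) {j : ℕ} (hj : n ≤ j) : rest y C j = ∅ := by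
  rw [Set.eq_empty_iff_forall_notMem]
  rintro x ⟨hx, -⟩
  have := hC x j hx
  omega

theorem part_recolY_fresh (hC : ColLt C n) : part (recolY y C n) n = Set.range y := by
  rw [part_recolY_self, rest_eq_empty hC le_rfl, Set.empty_union]

theorem colLt_recolY (hC : ColLt C n) {i m : ℕ} (hi : i < m) (hnm : n ≤ m) :
    ColLt (recolY y C i) m := by
  intro x j h
  rw [recolY, col_recol] at h
  split_ifs at h
  · have := Option.some.inj h; omega
  · have := hC x j h; omega

/-- The condition on the quantified variables: for `i < n` they are close to part `i`, otherwise
far from all parts. -/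
def Guard (y : Fin κ.ar ↪ ℕ) (C : List (ℕ × ℕ)) (n p i : ℕ) {A : Type} (M : Str L A)
    (β : ℕ → A) : Prop :=
  if i < n then NearAll M p (rest y C i) (Set.range y) β
  else ∀ j < n, ¬ NearAll M p (rest y C j) (Set.range y) β

theorem far_extend {A : Type} {M : Str L A} {β : ℕ → A} {r : ℕ} (h : Far M β (rest y C) r)
    (a : Fin κ.ar → A) : Far M (Function.extend y a β) (rest y C) r :=
  h.congr fun _ _ hx => extend_apply_of_disjoint disjoint_rest hx

/-- Close tuples join part `i`, far tuples form the new part `n`. In both cases the enlarged family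
stays separated by `q`, as the induction hypothesis demands. Nonzero weight is needed to have small
diameter in the far case. -/
theorem far_of_guard (hC : ColLt C n) {A : Type} {M : Str L A} (hM : M.IsWeighted) {β : ℕ → A}
    (h : Far M β (rest y C) (4 * q + 5)) {a : Fin κ.ar → A} (ha : κ.wt M a ≠ 0) {i : ℕ}
    (hi : i ≤ n) (hg : Guard y C n (q + 1) i M (Function.extend y a β)) :
    Far M (Function.extend y a β) (part (recolY y C i)) q := by
  have h' := far_extend h a
  rw [part_recolY]
  rcases Nat.lt_or_eq_of_le hi with hi | rfl
  · rw [Guard, if_pos hi] at hg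
    exact h'.insert_near (by omega) hg
  · rw [Guard, if_neg (lt_irrefl _)] at hg
    rw [rest_eq_empty hC le_rfl, Set.empty_union]
    refine h'.insert_far (by omega) (fun j hj => rest_eq_empty hC hj) ?_ hg
    rintro _ ⟨l, rfl⟩ _ ⟨l', rfl⟩
    rw [y.injective.extend_apply, y.injective.extend_apply]
    exact κ.edist_le_one_of_wt_ne hM ha l l'

theorem nearAll_unique {A : Type} {M : Str L A} {β : ℕ → A}
    (h : Far M β (rest y C) (4 * q + 5)) (i j : ℕ) (hij : i ≠ j) (a : Fin κ.ar → A)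
    (hi : NearAll M (q + 1) (rest y C i) (Set.range y) (Function.extend y a β)) :
    ¬ NearAll M (q + 1) (rest y C j) (Set.range y) (Function.extend y a β) :=
  (far_extend h a).nearAll_unique (by omega) (Set.range_nonempty_iff_nonempty.2 ⟨⟨0, κ.ar_pos⟩⟩)
    hij hi

/-! #### Summation over a neighbourhood -/

/-- The formula saying that the quantified variables are close to part `i` -/
noncomputable def nearYF (y : Fin κ.ar ↪ ℕ) (C : List (ℕ × ℕ)) (n p i : ℕ) : Formula L :=
  nearAllF (recolY y C n) i p (κ.fst y) (List.ofFn y)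

theorem isNear_nearYF {p i : ℕ} (hi : i < n) :
    IsNear (L := L) p (rest y C i) (Set.range y) (nearYF y C n p i) := by
  rw [← part_recolY_of_ne (i := n) (by omega)]
  have : Set.range y = {z | z = κ.fst y ∨ z ∈ List.ofFn y} := by
    ext z
    simp only [Set.mem_ofPred_eq, List.mem_ofFn]
    refine ⟨.inr, ?_⟩
    rintro (rfl | h)
    · exact ⟨_, rfl⟩
    · exact h
  rw [this]
  exact isNear_nearAllF

/-- The tree for the sum over the neighbourhood of part `i` of the tuples that satisfy `acc` -/
noncomputable def nearTree (K : Ctx L) (y : Fin κ.ar ↪ ℕ) (C : List (ℕ × ℕ)) (n q i : ℕ)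
    (acc : Formula L) : Tree K :=
  nest κ (fun e => .loc i (κ.form e y ((nearYF y C n (q + 1) i).and acc))) κ.vals

/-- Bounded quantification has radius `(q + 1) + q`, which does not exceed `4 * q + 5`. -/
theorem rep_nearTree (hκ : κ.Fin') {i : ℕ} (hi : i < n) {acc : Formula L}
    (hacc : Loc K.N.dom q (part (recolY y C i) i) acc) :
    Rep (rest y C) (4 * q + 5) (nearTree K y C n q i acc) fun _ M β =>
      κ.lab K (qval κ M y β fun β' =>
        NearAll M (q + 1) (rest y C i) (Set.range y) β' ∧ acc.Sat M β') := by
  rw [part_recolY_self] at hacc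
  have hν := isNear_nearYF (L := L) (y := y) (C := C) (p := q + 1) hi
  refine Rep.nest hκ (fun e => ?_) fun _ _ _ M _ β _ e => ?_
  · exact (loc_form hκ (Kind.valIn hκ e) disjoint_rest hν hacc).mono (by omega) subset_rfl
  · simp only [Atom.Holds]
    rw [sat_form]
    congr! 2
    funext β'
    rw [sat_and, hν.sat_iff]
    rfl

/-- The trivially true condition with which the collection of tests starts; it is available since
the quantified tuple is not empty. -/
theorem loc_self {r : ℕ} {i : ℕ} :
    Loc K.N.dom r (part (recolY y C i) i) (.eq (κ.fst y) (κ.fst y)) := by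
  have : κ.fst y ∈ part (recolY y C i) i := by
    rw [part_recolY_self]; exact .inr ⟨_, rfl⟩
  exact loc_eq this this

/-! #### Summation over the complement of all neighbourhoods -/

theorem rep_sum_succ (hκ : κ.Fin') {r j : ℕ} {Y : ℕ → Set ℕ} {T₁ T₂ T : Tree K}
    {v : (A : Type) → Str L A → (ℕ → A) → ℕ → κ.V} (h : IsComb (κ.plusE K) T₁ T₂ T)
    (h₁ : Rep Y r T₁ fun A M β => κ.lab K (∑ i ∈ Finset.range j, v A M β i))
    (h₂ : Rep Y r T₂ fun A M β => κ.lab K (v A M β j)) :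
    Rep Y r T fun A M β => κ.lab K (∑ i ∈ Finset.range (j + 1), v A M β i) :=
  .comb h h₁ h₂ fun A _ _ M _ β _ c hc => by
    rw [Kind.plusE_spec hκ hc, Finset.sum_range_succ]

/-- Subtraction is possible because the values of a weight form a group. The sum over all tuples is
a local aggregation sentence: the fresh part consists of the quantified variables only, so `acc` is
local around them. -/
theorem rep_farSum {w : L.Wt} {y : Fin (Kind.sum w).ar ↪ ℕ} (hw : (Kind.sum w).Fin')
    (hC : ColLt C n) {acc : Formula L}
    (hacc : Loc K.N.dom q (part (recolY y C n) n) acc) {T₁ T : Tree K}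
    (h : IsComb (minusE K w)
      (nest (.sum w) (fun e => .aggr ((Kind.sum w).form e y acc)) (Kind.sum w).vals) T₁ T)
    (h₁ : Rep (rest y C) (4 * q + 5) T₁ fun _ M β => (Kind.sum w).lab K
      (∑ j ∈ Finset.range n, qval (.sum w) M y β fun β' =>
        NearAll M (q + 1) (rest y C j) (Set.range y) β' ∧ acc.Sat M β')) :
    Rep (rest y C) (4 * q + 5) T fun _ M β => (Kind.sum w).lab K
      (qval (.sum w) M y β fun β' => Guard y C n (q + 1) n M β' ∧ acc.Sat M β') := by
  rw [part_recolY_fresh hC] at hacc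
  have h₂ : Rep (rest y C) (4 * q + 5)
      (nest (.sum w) (fun e => .aggr ((Kind.sum w).form e y acc)) (Kind.sum w).vals : Tree K)
      fun _ M β => (Kind.sum w).lab K (qval (.sum w) M y β (acc.Sat M)) := by
    refine Rep.nest hw (fun e => ?_) fun A _ _ M _ β _ e => ?_
    · exact ⟨w, e, y, acc, rfl, hw, hacc.mono (by omega) subset_rfl⟩
    · simp only [Atom.Holds]; exact sat_form
  refine .comb h h₂ h₁ fun A _ _ M hM β hβ c hc => ?_
  have := minusE_spec hw hc
  rw [this]
  change K.N.el _ = K.N.el _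
  congr 2
  -- The total splits into the sums close to the parts, which are disjoint cases, and the sum over
  -- the far tuples.
  refine (sub_eq_iff_eq_add' (G := L.El (L.tyW w))).2 ?_
  refine (qval_decomp (n := n)
    (Q := fun j β' => NearAll M (q + 1) (rest y C j) (Set.range y) β')
    fun i _ j _ hij a => nearAll_unique hβ i j hij a).trans ?_
  refine congrArg₂ (fun a b : L.El (L.tyW w) => a + b) rfl ?_
  refine qval_congr fun a _ => ?_
  rw [Guard, if_neg (lt_irrefl _)]

/-! #### Existence far away from all parts -/

theorem qval_ex_ne_zero_iff {A : Type} [Finite A] {M : Str L A} {y : Fin (Kind.ex (L := L)).ar ↪ ℕ}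
    {β : ℕ → A} {P : (ℕ → A) → Prop} :
    Kind.ex.lab K (qval .ex M y β P) = tv (∃ a, P (Function.update β (Kind.ex.fst y) a)) := by
  classical
  have := Fintype.ofFinite A
  rw [qval_eq_sum]
  change min 1 (∑ a : Fin 1 → A, if P (Function.extend y a β) then 1 else 0 : ℕ) = _
  rw [Finset.sum_boole, Nat.cast_id]
  have hupd : ∀ a, Function.update β (Kind.ex.fst y) a = Function.extend y (fun _ => a) β :=
    fun a => update_eq_extend y β a
  by_cases h : ∃ a, P (Function.update β (Kind.ex.fst y) a)
  · rw [tv_true h]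
    obtain ⟨a, ha⟩ := h
    rw [hupd] at ha
    have : 0 < (Finset.univ.filter fun a : Fin 1 → A => P (Function.extend y a β)).card :=
      Finset.card_pos.2 ⟨fun _ => a, Finset.mem_filter.2 ⟨Finset.mem_univ _, ha⟩⟩
    omega
  · rw [tv_false h, Finset.card_eq_zero.2]
    · rfl
    · rw [Finset.filter_eq_empty_iff]
      intro a _ ha
      refine h ⟨a 0, ?_⟩
      rw [hupd]
      have : (fun _ : Fin 1 => a 0) = a := funext fun i => by rw [Subsingleton.elim i 0]
      exact this ▸ ha

variable {y : Fin (Kind.ex (L := L)).ar ↪ ℕ} {acc : Formula L}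

theorem range_ex : Set.range y = {Kind.ex.fst y} := by
  ext x
  simp only [Set.mem_range, Set.mem_singleton_iff]
  constructor
  · rintro ⟨i, rfl⟩
    exact congrArg y (Subsingleton.elim (α := Fin 1) i 0)
  · rintro rfl; exact ⟨_, rfl⟩

/-- Some element at distance between `p + 1` and `3 * p + 1` from part `j` satisfies `acc`. -/
noncomputable def ringF (y : Fin (Kind.ex (L := L)).ar ↪ ℕ) (C : List (ℕ × ℕ)) (n p j : ℕ)
    (acc : Formula L) : Formula L :=
  Kind.ex.form (1 : ℕ) y ((nearYF y C n (3 * p + 1) j).and (acc.and (nearYF y C n p j).neg))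

/-- The elements that satisfy `acc` -/
def accSet (y : Fin (Kind.ex (L := L)).ar ↪ ℕ) (acc : Formula L) {A : Type} (M : Str L A)
    (β : ℕ → A) : Set A := {a | acc.Sat M (Function.update β (Kind.ex.fst y) a)}

theorem nearAll_update_iff {p j : ℕ} {A : Type} {M : Str L A} {β : ℕ → A} {a : A} :
    NearAll M p (rest y C j) (Set.range y) (Function.update β (Kind.ex.fst y) a) ↔
      a ∈ nbhd M.gaifman p (β '' rest y C j) := by
  rw [range_ex]
  simp only [NearAll, Set.mem_singleton_iff, forall_eq, Function.update_self, nbhd,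
    Set.mem_ofPred_eq, Set.exists_mem_image]
  refine exists_congr fun x => and_congr_right fun hx => ?_
  have : x ≠ Kind.ex.fst y := by
    rintro rfl
    exact Set.disjoint_left.1 disjoint_rest hx ⟨_, rfl⟩
  rw [Function.update_of_ne this]

theorem sat_ringF {p j : ℕ} (hj : j < n) {A : Type} [Finite A] {M : Str L A} {β : ℕ → A} :
    (ringF y C n p j acc).Sat M β ↔ ∃ a ∈ accSet y acc M β,
      a ∈ nbhd M.gaifman (3 * p + 1) (β '' rest y C j) ∧
        a ∉ nbhd M.gaifman p (β '' rest y C j) := by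
  have h1 := isNear_nearYF (L := L) (y := y) (C := C) (p := 3 * p + 1) hj
  have h2 := isNear_nearYF (L := L) (y := y) (C := C) (p := p) hj
  refine sat_ex.trans (exists_congr fun a => ?_)
  change (Formula.and _ _).Sat M (Function.update β (Kind.ex.fst y) a) ↔ _
  rw [sat_and, sat_and, sat_neg, h1.sat_iff, h2.sat_iff]
  have e1 := nearAll_update_iff (y := y) (C := C) (p := 3 * p + 1) (j := j) (M := M) (β := β)
    (a := a)
  have e2 := nearAll_update_iff (y := y) (C := C) (p := p) (j := j) (M := M) (β := β) (a := a)
  rw [← e1, ← e2]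
  exact ⟨fun h => ⟨h.2.1, h.1, h.2.2⟩, fun h => ⟨h.2.1, h.1, h.2.2⟩⟩

theorem loc_nearYF {D : Set L.Const} {p j : ℕ} (hj : j < n) :
    Loc D p (rest y C j ∪ Set.range y) (nearYF y C n p j) := by
  have hfst : List.ofFn y = [Kind.ex.fst y] := rfl
  rw [nearYF, hfst, range_ex, ← part_recolY_of_ne (y := y) (C := C) (i := n) (by omega)]
  exact (loc_nearF.and loc_nearF)

/-- The radius is used up completely: `3 * (q + 1) + 1` for the bound on the element and `q + 1` for
testing that it is not close. -/
theorem loc_ringF (hC : ColLt C n) {j : ℕ} (hj : j < n)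
    (hacc : Loc K.N.dom q (part (recolY y C n) n) acc) :
    Loc K.N.dom (4 * q + 5) (rest y C j) (ringF y C n (q + 1) j acc) := by
  rw [part_recolY_fresh hC] at hacc
  refine (loc_form (κ := .ex) trivial trivial disjoint_rest (isNear_nearYF hj)
    (q := q + 1) ((hacc.mono (by omega) Set.subset_union_right).and
      (loc_nearYF hj).neg)).mono (by omega) subset_rfl

theorem rep_ring_succ (hC : ColLt C n) (hacc : Loc K.N.dom q (part (recolY y C n) n) acc) {j : ℕ}
    (hj : j < n) {T : Tree K}
    (h : Rep (rest y C) (4 * q + 5) T fun _ M β => tv (∃ i < j, ∃ a ∈ accSet y acc M β,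
      a ∈ nbhd M.gaifman (3 * (q + 1) + 1) (β '' rest y C i) ∧
        a ∉ nbhd M.gaifman (q + 1) (β '' rest y C i))) :
    Rep (rest y C) (4 * q + 5) (.node (.loc j (ringF y C n (q + 1) j acc)) (.leaf 1) T)
      fun _ M β => tv (∃ i < j + 1, ∃ a ∈ accSet y acc M β,
        a ∈ nbhd M.gaifman (3 * (q + 1) + 1) (β '' rest y C i) ∧
          a ∉ nbhd M.gaifman (q + 1) (β '' rest y C i)) := by
  refine .node (loc_ringF hC hj hacc) trivial h.good fun A _ _ M hM β hβ => ?_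
  simp only [Atom.Holds]
  rw [sat_ringF hj, h.eval_eq A M hM β hβ]
  refine ⟨fun h' => (tv_true ⟨j, by omega, h'⟩).symm, fun h' => tv_congr ?_⟩
  constructor
  · rintro ⟨i, hi, hh⟩; exact ⟨i, by omega, hh⟩
  · rintro ⟨i, hi, hh⟩
    rcases Nat.lt_succ_iff_lt_or_eq.1 hi with hi | rfl
    · exact ⟨i, hi, hh⟩
    · exact absurd hh h'

/-- `k j` is the maximal size of a scattered set close to part `j`. -/
def MaxScat (y : Fin (Kind.ex (L := L)).ar ↪ ℕ) (C : List (ℕ × ℕ)) (p : ℕ) (acc : Formula L)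
    {A : Type} (M : Str L A) (β : ℕ → A) (j k : ℕ) : Prop :=
  Scat M.gaifman (2 * p + 1) (accSet y acc M β ∩ nbhd M.gaifman p (β '' rest y C j)) k ∧
    ¬ Scat M.gaifman (2 * p + 1) (accSet y acc M β ∩ nbhd M.gaifman p (β '' rest y C j)) (k + 1)

theorem MaxScat.unique {p : ℕ} {A : Type} {M : Str L A} {β : ℕ → A} {j k k' : ℕ}
    (h : MaxScat y C p acc M β j k) (h' : MaxScat y C p acc M β j k') : k = k' := by
  rcases lt_trichotomy k k' with hk | hk | hk
  · exact absurd (h'.1.mono hk) h.2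
  · exact hk
  · exact absurd (h.1.mono hk) h'.2

/-- Each variable of the part accounts for at most one scattered element, and all variables of the
part occur in the list `C`. -/
theorem scat_le_length {p : ℕ} {A : Type} {M : Str L A} {β : ℕ → A} {j k : ℕ} {U : Set A}
    (h : Scat M.gaifman (2 * p + 1) (U ∩ nbhd M.gaifman p (β '' rest y C j)) k) :
    k ≤ C.length := by
  classical
  have hsub : rest y C j ⊆ ((C.map Prod.fst).toFinset : Set ℕ) := by
    rintro x ⟨hx, -⟩
    simp only [List.coe_toFinset, List.mem_map, Set.mem_ofPred_eq]
    exact ⟨_, exists_mem_of_col hx, rfl⟩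
  have hfin : (rest y C j).Finite := (Finset.finite_toSet _).subset hsub
  refine (h.le_ncard (hfin.image β) (by omega)).trans ((Set.ncard_image_le hfin).trans ?_)
  refine (Set.ncard_le_ncard hsub (Finset.finite_toSet _)).trans ?_
  rw [Set.ncard_coe_finset]
  exact (List.toFinset_card_le _).trans (by simp)

theorem exists_maxScat {p : ℕ} {A : Type} {M : Str L A} {β : ℕ → A} (j : ℕ) :
    ∃ k, MaxScat y C p acc M β j k := by
  classical
  let S := fun k => Scat M.gaifman (2 * p + 1)
    (accSet y acc M β ∩ nbhd M.gaifman p (β '' rest y C j)) k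
  have h0 : S 0 := ⟨∅, rfl, by simp, by simp⟩
  have hk := Nat.findGreatest_spec (P := S) (Nat.zero_le C.length) h0
  refine ⟨_, hk, fun h => ?_⟩
  have := Nat.le_findGreatest (P := S) (scat_le_length h) h
  omega

/-- The statement that is decided by counting: there is a scattered set that is larger than
`k` and the scattered sets close to the parts below `j` together. -/
def Large (y : Fin (Kind.ex (L := L)).ar ↪ ℕ) (C : List (ℕ × ℕ)) (p : ℕ) (acc : Formula L)
    (j k : ℕ) {A : Type} (M : Str L A) (β : ℕ → A) : Prop :=
  ∀ f : ℕ → ℕ, (∀ i < j, MaxScat y C p acc M β i (f i)) →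
    Scat M.gaifman (2 * p + 1) (accSet y acc M β) (1 + k + ∑ i ∈ Finset.range j, f i)

/-- Once the maximal size `l` close to part `j` is known, it moves from the unknown sum into the
constant `k`. -/
theorem large_succ_iff {p j k l : ℕ} {A : Type} {M : Str L A} {β : ℕ → A}
    (h : MaxScat y C p acc M β j l) :
    Large y C p acc (j + 1) k M β ↔ Large y C p acc j (k + l) M β := by
  classical
  constructor
  · intro h' f hf
    have := h' (Function.update f j l) fun i hi => by
      rcases Nat.lt_succ_iff_lt_or_eq.1 hi with hi | rfl
      · rw [Function.update_of_ne (by omega)]; exact hf i hi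
      · rw [Function.update_self]; exact h
    rw [Finset.sum_range_succ, Function.update_self] at this
    have hsum : ∑ i ∈ Finset.range j, Function.update f j l i = ∑ i ∈ Finset.range j, f i :=
      Finset.sum_congr rfl fun i hi =>
        Function.update_of_ne (Nat.ne_of_lt (Finset.mem_range.1 hi)) _ _
    rw [hsum] at this
    convert this using 1
    omega
  · intro h' f hf
    have := h' f fun i hi => hf i (by omega)
    rw [Finset.sum_range_succ, (hf j (by omega)).unique h]
    convert this using 1
    omega

/-- Trees that decide `Large` for the first `j` parts, where `l` is known to be a lower bound for
the size of scattered sets close to the last of these parts (and `l = 0` if there is none) -/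
def RepLarge (K : Ctx L) (y : Fin (Kind.ex (L := L)).ar ↪ ℕ) (C : List (ℕ × ℕ)) (q : ℕ)
    (acc : Formula L) (j l k : ℕ) (T : Tree K) : Prop :=
  T.Good (rest y C) (4 * q + 5) ∧
    ∀ (A : Type) [Finite A] [Nonempty A] (M : Str L A), Adm K M → ∀ β : ℕ → A,
      Far M β (rest y C) (4 * q + 5) → (∀ i, i + 1 = j → Scat M.gaifman (2 * (q + 1) + 1)
        (accSet y acc M β ∩ nbhd M.gaifman (q + 1) (β '' rest y C i)) l) →
      T.eval M β = tv (Large y C (q + 1) acc j k M β)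

/-- With no parts left, a scattered set of fixed size `k + 1` is asked for, and this is a statement
`g ≥ 1`. -/
theorem repLarge_zero {b k : ℕ} (hC : ColLt C n)
    (hacc : Loc K.N.dom q (part (recolY y C n) n) acc) {g : Term L (L.tyW K.one)}
    (hg : IsCount K.one K.eZ K.N.dom (q + 1) (varList b (k + 1)) (Pattern (Kind.ex.fst y) acc
      (2 * (q + 1) + 1) (varList b (k + 1)) (pairs (varList b (k + 1))) []) g) :
    RepLarge K y C q acc 0 0 k (.node (.ge (q + 1) g) (.leaf 1) (.leaf 0)) := by
  rw [part_recolY_fresh hC, range_ex] at hacc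
  have := Rep.test (K := K) (Y := rest y C) (q := 4 * q + 5) (a := .ge (q + 1) g)
    (P := fun _ M β => Large y C (q + 1) acc 0 k M β) ⟨hg.free, hg.isCl, hg.constsIn⟩
    fun A _ _ M hM β _ => by
      simp only [Atom.Holds]
      rw [hg.one_le_iff hacc hM.isWeighted hM.one_eq]
      simp only [Large, Finset.range_zero, Finset.sum_empty, Nat.add_zero, accSet]
      rw [add_comm k 1]
      exact ⟨fun h _ _ => h, fun h => h (fun _ => 0) (by simp)⟩
  exact ⟨this.good, fun A _ _ M hM β hβ _ => this.eval_eq A M hM β hβ⟩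

/-- The maximal size close to part `j` is searched for from below: if `l + 1` is attained the search
goes on with this bound, otherwise the maximum is `l` and the next part is treated. -/
theorem repLarge_node {b j l k : ℕ} (hC : ColLt C n) (hj : j < n)
    (hacc : Loc K.N.dom q (part (recolY y C n) n) acc) (hb : Kind.ex.fst y < b)
    (hb' : ∀ x ∈ part (recolY y C n) j, x < b) {T₁ T₂ : Tree K}
    (h₁ : RepLarge K y C q acc (j + 1) (l + 1) k T₁) (h₂ : RepLarge K y C q acc j 0 (k + l) T₂) :
    RepLarge K y C q acc (j + 1) l k (.node
      (.loc j (nearScatF (recolY y C n) j (q + 1) (Kind.ex.fst y) acc b (l + 1))) T₁ T₂) := by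
  rw [part_recolY_fresh hC, range_ex] at hacc
  have hpart : part (recolY y C n) j = rest y C j := part_recolY_of_ne (by omega)
  have hzj : Kind.ex.fst y ∉ part (recolY y C n) j := by
    rw [hpart]
    exact fun h => Set.disjoint_left.1 disjoint_rest h ⟨_, rfl⟩
  refine ⟨⟨?_, h₁.1, h₂.1⟩, fun A _ _ M hM β hβ hl => ?_⟩
  · have := loc_nearScatF (p := q + 1) hb hzj hb' (Nat.succ_pos l) (by omega) hacc
    rw [hpart] at this
    exact this.mono (by omega) subset_rfl
  · have hsat := sat_nearScatF (p := q + 1) (M := M) (β := β) hb hzj hb' (Nat.succ_pos l) hacc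
    rw [hpart] at hsat
    by_cases hs : Atom.Holds M β (.loc j
        (nearScatF (recolY y C n) j (q + 1) (Kind.ex.fst y) acc b (l + 1)) : Atom K)
    · rw [Tree.eval_pos hs]
      have hs := hsat.1 hs
      exact h₁.2 A M hM β hβ fun i hi => by
        obtain rfl : i = j := by omega
        exact hs
    · rw [Tree.eval_neg hs, h₂.2 A M hM β hβ fun i _ => ⟨∅, rfl, by simp, by simp⟩]
      exact (tv_congr (large_succ_iff ⟨hl j rfl, fun h => hs (hsat.2 h)⟩)).symm

/-- The search for the maximum ends here, since `l` is attained and no scattered set close to a part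
is larger than the list `C`. -/
theorem repLarge_stop {j l k : ℕ} (hl : C.length ≤ l) {T : Tree K}
    (h : RepLarge K y C q acc j 0 (k + l) T) : RepLarge K y C q acc (j + 1) l k T := by
  refine ⟨h.1, fun A _ _ M hM β hβ hs => ?_⟩
  rw [h.2 A M hM β hβ fun i _ => ⟨∅, rfl, by simp, by simp⟩]
  refine (tv_congr (large_succ_iff ⟨hs j rfl, fun h => ?_⟩)).symm
  have := scat_le_length h
  omega

/-- The two alternatives of `exists_far_iff` are decided by separate trees; the maximal sizes exist
and are unique, so `Large` speaks about the right sum. -/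
theorem rep_farEx {T₁ T₂ T : Tree K} (h : IsComb orE T₁ T₂ T)
    (h₁ : Rep (rest y C) (4 * q + 5) T₁ fun _ M β => tv (∃ i < n, ∃ a ∈ accSet y acc M β,
      a ∈ nbhd M.gaifman (3 * (q + 1) + 1) (β '' rest y C i) ∧
        a ∉ nbhd M.gaifman (q + 1) (β '' rest y C i)))
    (h₂ : RepLarge K y C q acc n 0 0 T₂) :
    Rep (rest y C) (4 * q + 5) T fun _ M β => Kind.ex.lab K
      (qval .ex M y β fun β' => Guard y C n (q + 1) n M β' ∧ acc.Sat M β') := by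
  have h₂' : Rep (rest y C) (4 * q + 5) T₂ fun A M β =>
      tv (Large y C (q + 1) acc n 0 M β) :=
    ⟨h₂.1, fun A _ _ M hM β hβ =>
      h₂.2 A M hM β hβ fun i _ => ⟨∅, rfl, by simp, by simp⟩⟩
  refine .comb h h₁ h₂' fun A _ _ M hM β hβ c hc => ?_
  rw [orE_spec hc, qval_ex_ne_zero_iff]
  refine tv_congr ?_
  choose f hf using fun j => exists_maxScat (y := y) (C := C) (p := q + 1) (acc := acc) (M := M)
    (β := β) j
  have key := exists_far_iff (G := M.gaifman) (U := accSet y acc M β) (n := n) (p := q + 1)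
    (C := fun j => β '' rest y C j) (κ := f) ?_ (fun j _ => (hf j).1) (fun j _ => (hf j).2)
  · have hlarge : Large y C (q + 1) acc n 0 M β ↔ Scat M.gaifman (2 * (q + 1) + 1)
        (accSet y acc M β) (1 + ∑ j ∈ Finset.range n, f j) := by
      constructor
      · intro h; exact h f fun i _ => hf i
      · intro h g hg
        rw [Finset.sum_congr rfl fun i hi =>
          (hg i (Finset.mem_range.1 hi)).unique (hf i)]
        exact h
    rw [hlarge, ← key]
    refine exists_congr fun a => ?_
    rw [Guard, if_neg (lt_irrefl _)]
    simp only [nearAll_update_iff]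
    exact and_comm
  -- The required separation is `4 * p + 1` with `p = q + 1`; this determines the number `4 * q +
  -- 5`.
  · rintro i _ j _ hij _ ⟨x, hx, rfl⟩ _ ⟨x', hx', rfl⟩
    refine lt_of_le_of_lt ?_ (hβ i j hij x hx x' hx')
    exact_mod_cast (by omega : 4 * (q + 1) + 1 ≤ 4 * q + 5)

end Elimination

/-! ### Quantification over decision trees -/

section Quantification

variable {L : Lang} {K : Ctx L} {κ : Kind L} {y : Fin κ.ar ↪ ℕ} {C : List (ℕ × ℕ)} {n q i : ℕ}

theorem rep_near_of_lt (hi : i < n) {acc : Formula L} {T : Tree K}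
    (h : Rep (rest y C) (4 * q + 5) T fun _ M β => κ.lab K (qval κ M y β fun β' =>
        NearAll M (q + 1) (rest y C i) (Set.range y) β' ∧ acc.Sat M β')) :
    Rep (rest y C) (4 * q + 5) T fun _ M β => κ.lab K (qval κ M y β fun β' =>
        Guard y C n (q + 1) i M β' ∧ acc.Sat M β') := by
  simpa only [Guard, if_pos hi] using h

/-- `T'` computes the value of the quantifier applied to the tuples that satisfy the guard and
`acc` and for which `T` yields `1`. -/
def RepQuant (K : Ctx L) (y : Fin κ.ar ↪ ℕ) (C : List (ℕ × ℕ)) (n q i : ℕ) (acc : Formula L)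
    (T T' : Tree K) : Prop :=
  Rep (rest y C) (4 * q + 5) T' fun _ M β => κ.lab K (qval κ M y β fun β' =>
    Guard y C n (q + 1) i M β' ∧ acc.Sat M β' ∧ T.eval M β' = 1)

variable {acc : Formula L} {T T₁ T₂ T' T₁' T₂' : Tree K}

theorem repQuant_one (h : Rep (rest y C) (4 * q + 5) T' fun _ M β => κ.lab K
      (qval κ M y β fun β' => Guard y C n (q + 1) i M β' ∧ acc.Sat M β')) :
    RepQuant K y C n q i acc (.leaf 1) T' := by
  simpa only [RepQuant, Tree.eval, and_true] using h

theorem repQuant_zero : RepQuant K y C n q i acc (.leaf 0) (.leaf (κ.lab K 0)) :=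
  .leaf fun A _ _ M _ β _ => by rw [qval_false]; simp [Tree.eval]

/-- A test around the part of the quantified variables depends on the summation index. The index set
is split by it, and the outcome is recorded in `acc`. -/
theorem repQuant_own (hκ : κ.Fin') {ψ : Formula L} (h : IsComb (κ.plusE K) T₁' T₂' T')
    (h₁ : RepQuant K y C n q i (acc.and ψ) T₁ T₁')
    (h₂ : RepQuant K y C n q i (acc.and ψ.neg) T₂ T₂') {j : ℕ} :
    RepQuant K y C n q i acc (.node (.loc j ψ) T₁ T₂) T' := by
  refine .comb h h₁ h₂ fun A _ _ M _ β _ c hc => ?_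
  rw [Kind.plusE_spec hκ hc, qval_split (P := fun β' => Guard y C n (q + 1) i M β' ∧
    acc.Sat M β' ∧ (Tree.node (.loc j ψ) T₁ T₂ : Tree K).eval M β' = 1) (R := ψ.Sat M)]
  congr 2
  · refine qval_congr fun a _ => ?_
    rw [sat_and]
    constructor
    · rintro ⟨h1, ⟨h2, h3⟩, h4⟩
      exact ⟨⟨h1, h2, (Tree.eval_pos (a := .loc j ψ) h3).trans h4⟩, h3⟩
    · rintro ⟨⟨h1, h2, h4⟩, h3⟩
      exact ⟨h1, ⟨h2, h3⟩, (Tree.eval_pos (a := .loc j ψ) h3).symm.trans h4⟩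
  · refine qval_congr fun a _ => ?_
    rw [sat_and, sat_neg]
    constructor
    · rintro ⟨h1, ⟨h2, h3⟩, h4⟩
      exact ⟨⟨h1, h2, (Tree.eval_neg (a := .loc j ψ) h3).trans h4⟩, h3⟩
    · rintro ⟨⟨h1, h2, h4⟩, h3⟩
      exact ⟨h1, ⟨h2, h3⟩, (Tree.eval_neg (a := .loc j ψ) h3).symm.trans h4⟩

/-- A test that is unaffected by the quantified variables has one outcome for the whole sum, so it
may be asked before summing. -/
theorem repQuant_other {a : Atom K} (ha : a.Good (rest y C) (4 * q + 5))
    (ha' : ∀ (A : Type) [Finite A] (M : Str L A) (β : ℕ → A) (b : Fin κ.ar → A),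
      a.Holds M (Function.extend y b β) ↔ a.Holds M β)
    (h₁ : RepQuant K y C n q i acc T₁ T₁') (h₂ : RepQuant K y C n q i acc T₂ T₂') :
    RepQuant K y C n q i acc (.node a T₁ T₂) (.node a T₁' T₂') := by
  refine .node ha h₁.good h₂.good fun A _ _ M hM β hβ => ⟨fun h => ?_, fun h => ?_⟩
  · rw [h₁.eval_eq A M hM β hβ]
    congr 1
    refine qval_congr fun b _ => ?_
    rw [Tree.eval_pos ((ha' A M β b).2 h)]
  · rw [h₂.eval_eq A M hM β hβ]
    congr 1
    refine qval_congr fun b _ => ?_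
    rw [Tree.eval_neg fun h' => h ((ha' A M β b).1 h')]

theorem repQuant_loc {j : ℕ} (hj : j ≠ i) {ψ : Formula L}
    (hψ : Loc K.N.dom q (part (recolY y C i) j) ψ)
    (h₁ : RepQuant K y C n q i acc T₁ T₁') (h₂ : RepQuant K y C n q i acc T₂ T₂') :
    RepQuant K y C n q i acc (.node (.loc j ψ) T₁ T₂) (.node (.loc j ψ) T₁' T₂') := by
  rw [part_recolY_of_ne hj] at hψ
  refine repQuant_other (hψ.mono (by omega) subset_rfl) (fun A _ M β b => ?_) h₁ h₂
  exact hψ.sat_congr fun x hx => extend_apply_of_disjoint disjoint_rest hx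

/-- The value of the quantifier if the quantified variables are close to part `i` or, for
`i = n`, far from all parts -/
theorem rep_guard (hC : ColLt C n) (hi : i ≤ n) {φ : Formula L}
    (h : RepQuant K y C n q i (.eq (κ.fst y) (κ.fst y)) T T')
    (hT : Rep (part (recolY y C i)) q T fun _ M β => tv (φ.Sat M β)) :
    Rep (rest y C) (4 * q + 5) T' fun _ M β => κ.lab K (qval κ M y β fun β' =>
      Guard y C n (q + 1) i M β' ∧ φ.Sat M β') := by
  refine Rep.congr h fun A _ _ M hM β hβ => congrArg _ (qval_congr fun a ha => ?_)
  refine and_congr_right fun hg => ?_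
  -- The tree `T` computes `φ` only for separated parts; the guard ensures this for every tuple of
  -- nonzero weight.
  rw [hT.eval_eq A M hM _ (far_of_guard hC hM.isWeighted hβ ha hi hg), tv_eq_one]
  simp

/-- The sums over the `n` close cases and over the far case add up to the full sum, whose label is
then compared with that of `e`. -/
theorem rep_form (hκ : κ.Fin') {φ : Formula L} {e : κ.V} {T₃ : Tree K}
    (h : IsComb (κ.plusE K) T₁ T₂ T) (h' : IsComb (κ.eqE K e) T (.leaf 0) T₃)
    (h₁ : Rep (rest y C) (4 * q + 5) T₁ fun _ M β => κ.lab K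
      (∑ j ∈ Finset.range n, qval κ M y β fun β' =>
        Guard y C n (q + 1) j M β' ∧ φ.Sat M β'))
    (h₂ : Rep (rest y C) (4 * q + 5) T₂ fun _ M β => κ.lab K (qval κ M y β fun β' =>
      Guard y C n (q + 1) n M β' ∧ φ.Sat M β')) :
    Rep (part C) (4 * q + 5) T₃ fun _ M β => tv ((κ.form e y φ).Sat M β) := by
  have h₃ : Rep (rest y C) (4 * q + 5) T fun A M β =>
      κ.lab K (qval κ M y β (φ.Sat M)) := by
    refine .comb h h₁ h₂ fun A _ _ M hM β hβ c hc => ?_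
    rw [Kind.plusE_spec hκ hc]
    congr 1
    refine ((qval_decomp (n := n)
      (Q := fun j β' => NearAll M (q + 1) (rest y C j) (Set.range y) β')
      fun i _ j _ hij a => nearAll_unique hβ i j hij a).trans ?_).symm
    congr 1
    · refine Finset.sum_congr rfl fun j hj => ?_
      simp only [Guard, if_pos (Finset.mem_range.1 hj)]
    · simp only [Guard, if_neg (lt_irrefl n)]
  have h₄ : Rep (rest y C) (4 * q + 5) (.leaf 0 : Tree K) fun _ _ _ => 0 :=
    .leaf fun _ _ _ _ _ _ _ => rfl
  -- The quantified variables may be coloured already; dropping them from the parts only weakens the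
  -- separation assumption that is needed.
  refine Rep.mono (.comb h' h₃ h₄ fun A _ _ M hM β hβ c hc => ?_)
    (fun j => Set.sdiff_subset) le_rfl
  rw [Kind.eqE_spec hκ hc]
  exact tv_congr sat_form.symm

end Quantification

end WA

namespace WA

/-! ### Primitive recursive functions on codes -/

attribute [fun_prop] Primrec Primrec.id Primrec.const Primrec.comp Primrec.fst Primrec.snd
  Primrec.pair

section Primrec

variable {α β σ : Type} [Primcodable α] [Primcodable β] [Primcodable σ]

@[fun_prop] theorem primrec_natPair {f g : α → ℕ} (hf : Primrec f) (hg : Primrec g) :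
    Primrec fun a => Nat.pair (f a) (g a) := Primrec₂.natPair.comp hf hg

@[fun_prop] theorem primrec_add {f g : α → ℕ} (hf : Primrec f) (hg : Primrec g) :
    Primrec fun a => f a + g a := Primrec.nat_add.comp hf hg

@[fun_prop] theorem primrec_sub {f g : α → ℕ} (hf : Primrec f) (hg : Primrec g) :
    Primrec fun a => f a - g a := Primrec.nat_sub.comp hf hg

@[fun_prop] theorem primrec_mul {f g : α → ℕ} (hf : Primrec f) (hg : Primrec g) :
    Primrec fun a => f a * g a := Primrec.nat_mul.comp hf hg

@[fun_prop] theorem primrec_cons {f : α → β} {g : α → List β} (hf : Primrec f)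
    (hg : Primrec g) : Primrec fun a => f a :: g a := Primrec.list_cons.comp hf hg

@[fun_prop] theorem primrec_append {f g : α → List β} (hf : Primrec f) (hg : Primrec g) :
    Primrec fun a => f a ++ g a := Primrec.list_append.comp hf hg

@[fun_prop] theorem primrec_some {f : α → β} (hf : Primrec f) : Primrec fun a => some (f a) :=
  Primrec.option_some.comp hf

@[fun_prop] theorem primrec_headI {f : α → List ℕ} (hf : Primrec f) :
    Primrec fun a => (f a).headI := Primrec.list_headI.comp hf

@[fun_prop] theorem primrec_encode {f : α → β} (hf : Primrec f) :
    Primrec fun a => Encodable.encode (f a) := Primrec.encode.comp hf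

@[fun_prop] theorem primrec_decide_eq [DecidableEq β] {f g : α → β} (hf : Primrec f)
    (hg : Primrec g) : Primrec fun a => decide (f a = g a) :=
  (primrecRel_iff_primrec_decide.1 (Primrec.eq (α := β))).comp hf hg

@[fun_prop] theorem primrec_and {f g : α → Bool} (hf : Primrec f) (hg : Primrec g) :
    Primrec fun a => f a && g a := Primrec.and.comp hf hg

@[fun_prop] theorem primrec_or {f g : α → Bool} (hf : Primrec f) (hg : Primrec g) :
    Primrec fun a => f a || g a := Primrec.or.comp hf hg

@[fun_prop] theorem primrec_not {f : α → Bool} (hf : Primrec f) :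
    Primrec fun a => !f a := Primrec.not.comp hf

@[fun_prop] theorem primrec_ite {c : α → Prop} [DecidablePred c] {f g : α → σ}
    (hc : Primrec fun a => decide (c a)) (hf : Primrec f) (hg : Primrec g) :
    Primrec fun a => if c a then f a else g a :=
  Primrec.ite (primrecPred_iff_primrec_decide.2 hc) hf hg

@[fun_prop] theorem primrec_foldr {f : α → List β} {g : α → σ} {h : α → β → σ → σ}
    (hf : Primrec f) (hg : Primrec g) (hh : Primrec fun q : α × β × σ => h q.1 q.2.1 q.2.2) :
    Primrec fun a => (f a).foldr (h a) (g a) :=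
  Primrec.list_foldr (h := fun a q => h a q.1 q.2) hf hg hh

@[fun_prop] theorem primrec_foldl {f : α → List β} {g : α → σ} {h : α → σ → β → σ}
    (hf : Primrec f) (hg : Primrec g) (hh : Primrec fun q : α × σ × β => h q.1 q.2.1 q.2.2) :
    Primrec fun a => (f a).foldl (h a) (g a) :=
  Primrec.list_foldl (h := fun a q => h a q.1 q.2) hf hg hh

@[fun_prop] theorem primrec_map {f : α → List β} {g : α → β → σ} (hf : Primrec f)
    (hg : Primrec fun q : α × β => g q.1 q.2) : Primrec fun a => (f a).map (g a) :=
  Primrec.list_map hf hg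

@[fun_prop] theorem primrec_all {f : α → List β} {p : α → β → Bool} (hf : Primrec f)
    (hp : Primrec fun q : α × β => p q.1 q.2) : Primrec fun a => (f a).all (p a) := by
  have : Primrec fun a => (f a).foldr (fun b s => p a b && s) true := by fun_prop
  exact this.of_eq fun a => by
    induction f a with
    | nil => rfl
    | cons b l ih => simp [ih]

@[fun_prop] theorem primrec_any {f : α → List β} {p : α → β → Bool} (hf : Primrec f)
    (hp : Primrec fun q : α × β => p q.1 q.2) : Primrec fun a => (f a).any (p a) := by
  have : Primrec fun a => (f a).foldr (fun b s => p a b || s) false := by fun_prop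
  exact this.of_eq fun a => by
    induction f a with
    | nil => rfl
    | cons b l ih => simp [ih]

@[fun_prop] theorem primrec_ofFn {k : ℕ} {f : α → Fin k → σ} (hf : ∀ i, Primrec fun a => f a i) :
    Primrec fun a => List.ofFn (f a) := Primrec.list_ofFn hf

/-- Membership as a Boolean -/
def memB {γ : Type} [DecidableEq γ] (a : γ) (l : List γ) : Bool := l.any fun b => decide (b = a)

@[simp] theorem memB_iff {γ : Type} [DecidableEq γ] {a : γ} {l : List γ} : memB a l = true ↔ a ∈ l := by
  simp [memB]

@[fun_prop] theorem primrec_memB [DecidableEq β] {f : α → β} {g : α → List β} (hf : Primrec f)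
    (hg : Primrec g) : Primrec fun a => memB (f a) (g a) := by
  unfold memB; fun_prop

def nodupB : List ℕ → Bool
  | [] => true
  | v :: V => !memB v V && nodupB V

@[simp] theorem nodupB_iff {V : List ℕ} : nodupB V = true ↔ V.Nodup := by
  induction V with
  | nil => simp [nodupB]
  | cons v V ih => simp [nodupB, ih, ← memB_iff]

@[fun_prop] theorem primrec_nodupB {f : α → List ℕ} (hf : Primrec f) :
    Primrec fun a => nodupB (f a) := by
  have h : Primrec fun q : α × ℕ × List ℕ × Bool => !memB q.2.1 q.2.2.1 && q.2.2.2 := by fun_prop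
  exact (Primrec.list_rec (h := fun _ q => !memB q.1 q.2.1 && q.2.2) hf (Primrec.const true)
    h).of_eq fun a => by
      induction f a with
      | nil => rfl
      | cons b l ih => exact congrArg (fun s => !memB b l && s) ih

@[fun_prop] theorem primrec_pairs {f : α → List ℕ} (hf : Primrec f) :
    Primrec fun a => pairs (f a) := by
  have h : Primrec fun q : α × ℕ × List ℕ × List (ℕ × ℕ) =>
      q.2.2.1.map (fun u => (q.2.1, u)) ++ q.2.2.2 := by fun_prop
  exact (Primrec.list_rec (h := fun _ q => q.2.1.map (fun u => (q.1, u)) ++ q.2.2) hf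
    (Primrec.const []) h).of_eq fun a => by
      induction f a with
      | nil => rfl
      | cons b l ih => exact congrArg (fun s => l.map (fun u => (b, u)) ++ s) ih

@[fun_prop] theorem primrec_varList {f g : α → ℕ} (hf : Primrec f) (hg : Primrec g) :
    Primrec fun a => varList (f a) (g a) := by
  have h : Primrec fun q : α × ℕ × List ℕ => (f q.1 + q.2.1) :: q.2.2 := by fun_prop
  exact (Primrec.nat_rec' (h := fun a q => (f a + q.1) :: q.2) hg (Primrec.const []) h).of_eq
    fun a => by
      induction g a with
      | zero => rfl
      | succ k ih => exact congrArg (fun s => (f a + k) :: s) ih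

@[fun_prop] theorem primrec_recol {f : α → List ℕ} {g : α → ℕ} {h : α → List (ℕ × ℕ)}
    (hf : Primrec f) (hg : Primrec g) (hh : Primrec h) :
    Primrec fun a => recol (f a) (g a) (h a) := by
  unfold recol; fun_prop

@[fun_prop] theorem primrec_col {f : α → List (ℕ × ℕ)} {g : α → ℕ} (hf : Primrec f)
    (hg : Primrec g) : Primrec fun a => col (f a) (g a) := by
  have : Primrec fun a => (f a).foldr (fun e s => if e.1 = g a then some e.2 else s) none := by
    fun_prop
  exact this.of_eq fun a => by
    induction f a with
    | nil => rfl
    | cons e l ih => simp only [List.foldr_cons, ih, col]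

/-- A number larger than `z` and all variables in the list -/
def varBound (z : ℕ) (C : List (ℕ × ℕ)) : ℕ := C.foldr (fun e s => e.1 + s) (z + 1)

theorem lt_varBound {z : ℕ} {C : List (ℕ × ℕ)} :
    z < varBound z C ∧ ∀ j, ∀ x ∈ part C j, x < varBound z C := by
  have h : z < varBound z C ∧ ∀ e ∈ C, e.1 < varBound z C := by
    induction C with
    | nil => simp [varBound]
    | cons e C ih =>
      have he : varBound z (e :: C) = e.1 + varBound z C := rfl
      rw [he]
      refine ⟨by omega, fun e' he' => ?_⟩
      rcases List.mem_cons.1 he' with rfl | he'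
      · omega
      · have := ih.2 e' he'; omega
  exact ⟨h.1, fun j x hx => h.2 _ (exists_mem_of_col hx)⟩

@[fun_prop] theorem primrec_varBound {f : α → ℕ} {g : α → List (ℕ × ℕ)} (hf : Primrec f)
    (hg : Primrec g) : Primrec fun a => varBound (f a) (g a) := by
  unfold varBound; fun_prop

/-- The function on codes -/
def natFn (f : α → β) (n : ℕ) : ℕ :=
  ((Encodable.decode n : Option α).map fun a => Encodable.encode (f a)).getD 0

theorem natFn_encode (f : α → β) (a : α) :
    natFn f (Encodable.encode a) = Encodable.encode (f a) := by simp [natFn]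

theorem primrec_natFn {f : α → β} (hf : Primrec f) : Primrec (natFn f) :=
  Primrec.option_getD.comp (Primrec.option_map Primrec.decode
    ((Primrec.encode.comp hf).comp Primrec.snd)) (Primrec.const 0)

/-- Application of a function to the object coded by a pattern -/
def Pat.fn (f : α → β) (hf : Primrec f) (a : Pat) : Pat :=
  .app (fun n _ => natFn f n) ((primrec_natFn hf).comp Primrec.fst) a a

end Primrec

/-! ### Codes of formulas and terms -/

def negC (a : ℕ) : ℕ := Nat.pair 3 a

def orC (a b : ℕ) : ℕ := Nat.pair 4 (Nat.pair a b)

def andC (a b : ℕ) : ℕ := negC (orC (negC a) (negC b))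

def exC (x a : ℕ) : ℕ := Nat.pair 5 (Nat.pair x a)

def eqC (x y : ℕ) : ℕ := Nat.pair 0 (Nat.pair x y)

def exsC (m k a : ℕ) : ℕ := (varList m k).foldl (fun a v => exC v a) a

def substC (z a v : ℕ) : ℕ := exC z (andC (eqC z v) a)

def unC (z a v₀ : ℕ) (V : List ℕ) : ℕ :=
  V.foldr (fun v s => andC (substC z a v) s) (substC z a v₀)

def padC (x : List ℕ) (a : ℕ) : ℕ := x.foldr (fun v s => andC (eqC v v) s) a

/-- Add the variables in `x` to the free variables. -/
def padF {L : Lang} (x : List ℕ) (φ : Formula L) : Formula L :=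
  x.foldr (fun v ψ => (Formula.eq v v).and ψ) φ

section Codes

variable {α : Type} [Primcodable α]

@[fun_prop] theorem primrec_negC {f : α → ℕ} (hf : Primrec f) : Primrec fun a => negC (f a) := by
  unfold negC; fun_prop

@[fun_prop] theorem primrec_orC {f g : α → ℕ} (hf : Primrec f) (hg : Primrec g) :
    Primrec fun a => orC (f a) (g a) := by unfold orC; fun_prop

@[fun_prop] theorem primrec_andC {f g : α → ℕ} (hf : Primrec f) (hg : Primrec g) :
    Primrec fun a => andC (f a) (g a) := by unfold andC; fun_prop

@[fun_prop] theorem primrec_exC {f g : α → ℕ} (hf : Primrec f) (hg : Primrec g) :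
    Primrec fun a => exC (f a) (g a) := by unfold exC; fun_prop

@[fun_prop] theorem primrec_eqC {f g : α → ℕ} (hf : Primrec f) (hg : Primrec g) :
    Primrec fun a => eqC (f a) (g a) := by unfold eqC; fun_prop

@[fun_prop] theorem primrec_exsC {f g h : α → ℕ} (hf : Primrec f) (hg : Primrec g)
    (hh : Primrec h) : Primrec fun a => exsC (f a) (g a) (h a) := by unfold exsC; fun_prop

@[fun_prop] theorem primrec_substC {f g h : α → ℕ} (hf : Primrec f) (hg : Primrec g)
    (hh : Primrec h) : Primrec fun a => substC (f a) (g a) (h a) := by unfold substC; fun_prop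

@[fun_prop] theorem primrec_unC {f g h : α → ℕ} {k : α → List ℕ} (hf : Primrec f)
    (hg : Primrec g) (hh : Primrec h) (hk : Primrec k) :
    Primrec fun a => unC (f a) (g a) (h a) (k a) := by unfold unC; fun_prop

@[fun_prop] theorem primrec_padC {f : α → List ℕ} {g : α → ℕ} (hf : Primrec f)
    (hg : Primrec g) : Primrec fun a => padC (f a) (g a) := by unfold padC; fun_prop

variable {L : Lang} (N : Coding L)

@[simp] theorem code_eq {x y : ℕ} : (Formula.eq x y : Formula L).code N = eqC x y := by
  simp only [Formula.code, eqC]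

@[simp] theorem code_neg {φ : Formula L} : φ.neg.code N = negC (φ.code N) := by
  simp only [Formula.code, negC]

@[simp] theorem code_or {φ ψ : Formula L} : (φ.or ψ).code N = orC (φ.code N) (ψ.code N) := by
  simp only [Formula.code, orC]

@[simp] theorem code_and {φ ψ : Formula L} : (φ.and ψ).code N = andC (φ.code N) (ψ.code N) := by
  simp only [Formula.and, code_neg, code_or, andC]

@[simp] theorem code_ex {x : ℕ} {φ : Formula L} : (Formula.ex x φ).code N = exC x (φ.code N) := by
  simp only [Formula.code, exC]

@[simp] theorem code_exs {m k : ℕ} {φ : Formula L} :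
    (exs m k φ).code N = exsC m k (φ.code N) := by
  induction k generalizing φ with
  | zero => rfl
  | succ k ih => rw [exs, ih, code_ex]; rfl

@[simp] theorem code_substF {z v : ℕ} {φ : Formula L} :
    (substF z φ v).code N = substC z (φ.code N) v := by
  simp only [substF, code_ex, code_and, code_eq, substC]

@[simp] theorem code_unF {z v₀ : ℕ} {V : List ℕ} {φ : Formula L} :
    (unF z φ v₀ V).code N = unC z (φ.code N) v₀ V := by
  induction V with
  | nil => simp [unF, unC]
  | cons v V ih => simp only [unF, code_and, code_substF, ih, unC, List.foldr_cons]

theorem code_padF {x : List ℕ} {φ : Formula L} : (padF x φ).code N = padC x (φ.code N) := by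
  induction x with
  | nil => rfl
  | cons v x ih =>
    exact (code_and N).trans (congrArg₂ andC (code_eq N) ih)

/-- The positions `s` are fixed, so the arity is a constant and the tuple has a fixed number of
entries. -/
theorem primrec_posF (s : Σ R : L.Rel, Fin (L.arR R) × Fin (L.arR R)) {f g : α → ℕ}
    (hf : Primrec f) (hg : Primrec g) : Primrec fun a => (posF (f a) (g a) s).code N := by
  have h : Primrec fun a => Encodable.encode (List.ofFn fun l : Fin (L.arR s.1) =>
      if l = s.2.1 then f a else if l = s.2.2 then g a else f a + g a + 1 + l) := by
    refine primrec_encode (primrec_ofFn fun l => ?_)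
    split_ifs <;> fun_prop
  have h' : Primrec fun a => exsC (f a + g a + 1) (L.arR s.1) (Nat.pair 1 (Nat.pair (N.rel s.1)
      (Encodable.encode (List.ofFn fun l : Fin (L.arR s.1) =>
      if l = s.2.1 then f a else if l = s.2.2 then g a else f a + g a + 1 + l)))) := by
    fun_prop
  exact h'.of_eq fun a => by rw [posF, code_exs, Formula.code, tupleCode]

@[fun_prop] theorem primrec_stepF {f g : α → ℕ} (hf : Primrec f) (hg : Primrec g) :
    Primrec fun a => (stepF (f a) (g a) : Formula L).code N := by
  unfold stepF
  generalize positions L = l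
  induction l with
  | nil => simp only [List.foldr_nil, code_eq]; fun_prop
  | cons s l ih =>
    simp only [List.foldr_cons, code_or]
    have := primrec_posF N s hf hg
    fun_prop

@[fun_prop] theorem primrec_distF {f g h : α → ℕ} (hf : Primrec f) (hg : Primrec g)
    (hh : Primrec h) : Primrec fun a => (distF (f a) (g a) (h a) : Formula L).code N := by
  -- In `distF` the first variable changes from `x` to `x + y + 1` with each step. Here `x a i` is
  -- its value after `i` steps in closed form, so that the code can be built from the innermost
  -- subformula outwards.
  let x : α → ℕ → ℕ := fun a i => g a + i * (h a + 1)
  have hx : ∀ a i, x a (i + 1) = x a i + h a + 1 := fun a i => by simp only [x]; ring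
  have hstep : Primrec fun q : α × ℕ × ℕ => exC (x q.1 (f q.1 - q.2.1))
      (andC ((stepF (x q.1 (f q.1 - q.2.1 - 1)) (x q.1 (f q.1 - q.2.1)) : Formula L).code N)
        q.2.2) := by
    simp only [x]; fun_prop
  have h0 : Primrec fun a => eqC (x a (f a)) (h a) := by simp only [x]; fun_prop
  refine (Primrec.nat_rec' (h := fun a q => exC (x a (f a - q.1))
      (andC ((stepF (x a (f a - q.1 - 1)) (x a (f a - q.1)) : Formula L).code N)
        q.2)) hf h0 hstep).of_eq fun a => ?_
  -- After `j` steps of the recursion the subformula for distance `j` is reached, whose first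
  -- variable has been changed `f a - j` times.
  have key : ∀ j ≤ f a, (Nat.rec (eqC (x a (f a)) (h a)) (fun n s => exC (x a (f a - n))
      (andC ((stepF (x a (f a - n - 1)) (x a (f a - n)) : Formula L).code N) s)) j : ℕ) =
      (distF j (x a (f a - j)) (h a) : Formula L).code N := by
    intro j hj
    induction j with
    | zero => simp [distF]
    | succ j ih =>
      have e1 : f a - (j + 1) = f a - j - 1 := by omega
      have e2 : x a (f a - j) = x a (f a - j - 1) + h a + 1 := by
        rw [← hx]; congr 1; omega
      simp only
      rw [ih (by omega), distF, code_ex, code_and, e1, ← e2]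
  rw [key (f a) le_rfl]
  simp [x]

@[fun_prop] theorem primrec_nearF {C : α → List (ℕ × ℕ)} {j p z : α → ℕ}
    (hC : Primrec C) (hj : Primrec j) (hp : Primrec p) (hz : Primrec z) :
    Primrec fun a => (nearF (C a) (j a) (p a) (z a) (C a) : Formula L).code N := by
  have h : Primrec fun a => (C a).foldr (fun e s => if col (C a) e.1 = some (j a) then
      orC ((distF (p a) e.1 (z a) : Formula L).code N) s else s) (negC (eqC (z a) (z a))) := by
    fun_prop
  refine h.of_eq fun a => ?_
  have : ∀ l, (l.foldr (fun e s => if col (C a) e.1 = some (j a) then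
      orC ((distF (p a) e.1 (z a) : Formula L).code N) s else s) (negC (eqC (z a) (z a)))) =
      (nearF (C a) (j a) (p a) (z a) l : Formula L).code N := by
    intro l
    induction l with
    | nil => simp [nearF]
    | cons e l ih =>
      rw [List.foldr_cons, ih, nearF]
      split_ifs <;> simp
  exact this _

@[fun_prop] theorem primrec_nearAllF {C : α → List (ℕ × ℕ)} {j p z : α → ℕ} {zs : α → List ℕ}
    (hC : Primrec C) (hj : Primrec j) (hp : Primrec p) (hz : Primrec z) (hzs : Primrec zs) :
    Primrec fun a => (nearAllF (C a) (j a) (p a) (z a) (zs a) : Formula L).code N := by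
  have h : Primrec fun a => (zs a).foldr (fun z s =>
      andC ((nearF (C a) (j a) (p a) z (C a) : Formula L).code N) s)
      ((nearF (C a) (j a) (p a) (z a) (C a) : Formula L).code N) := by
    fun_prop
  refine h.of_eq fun a => ?_
  induction zs a with
  | nil => simp [nearAllF]
  | cons e l ih => rw [List.foldr_cons, ih, nearAllF, code_and]

@[fun_prop] theorem primrec_farF {d v : α → ℕ} {F : α → List (ℕ × ℕ)} (hd : Primrec d)
    (hv : Primrec v) (hF : Primrec F) :
    Primrec fun a => (farF (d a) (v a) (F a) : Formula L).code N := by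
  have h : Primrec fun a => (F a).foldr (fun e s =>
      andC (negC ((distF (d a) e.1 e.2 : Formula L).code N)) s) (eqC (v a) (v a)) := by
    fun_prop
  refine h.of_eq fun a => ?_
  induction F a with
  | nil => simp [farF]
  | cons e l ih => rw [List.foldr_cons, ih, farF, code_and, code_neg]

@[fun_prop] theorem primrec_closeF {d v : α → ℕ} {F : α → List (ℕ × ℕ)} (hd : Primrec d)
    (hv : Primrec v) (hF : Primrec F) :
    Primrec fun a => (closeF (d a) (v a) (F a) : Formula L).code N := by
  have h : Primrec fun a => (F a).foldr (fun e s =>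
      andC ((distF (d a) e.1 e.2 : Formula L).code N) s) (eqC (v a) (v a)) := by
    fun_prop
  refine h.of_eq fun a => ?_
  induction F a with
  | nil => simp [closeF]
  | cons e l ih => rw [List.foldr_cons, ih, closeF, code_and]

/-- The code of `nearScatF` as a function of the code of `χ` -/
noncomputable def nearScatC (C : List (ℕ × ℕ)) (j p z a b k : ℕ) : ℕ :=
  exsC b k (andC (unC z (andC ((nearF C j p z C : Formula L).code N) a) b (varList b k))
    ((farF (2 * p + 1) b (pairs (varList b k)) : Formula L).code N))

theorem code_nearScatF {C : List (ℕ × ℕ)} {j p z b k : ℕ} {χ : Formula L} :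
    (nearScatF C j p z χ b k).code N = nearScatC N C j p z (χ.code N) b k := by
  simp only [nearScatF, scatF, code_exs, code_and, code_unF, nearScatC]

theorem primrec_nearScatC {C : α → List (ℕ × ℕ)} {j p z a b k : α → ℕ} (hC : Primrec C)
    (hj : Primrec j) (hp : Primrec p) (hz : Primrec z) (ha : Primrec a) (hb : Primrec b)
    (hk : Primrec k) : Primrec fun s =>
      nearScatC N (C s) (j s) (p s) (z s) (a s) (b s) (k s) := by
  unfold nearScatC; fun_prop

variable (K : Ctx L)

theorem primrec_prodOne {v : α → ℕ} {V : α → List ℕ} (hv : Primrec v) (hV : Primrec V) :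
    Primrec fun a => (prodOne K.one K.harity K.eZ (v a) (V a)).code K.N := by
  have hone : ∀ {γ : Type} [Primcodable γ] {u : γ → ℕ}, Primrec u → Primrec fun a =>
      (Factor.wt K.one (oneVar K.one K.harity (u a)) : Factor L _).code K.N := by
    intro γ _ u hu
    have h : Primrec fun a => Nat.pair 1 (Nat.pair (K.N.wt K.one)
        (Encodable.encode (List.ofFn fun _ : Fin (L.arW K.one) => u a))) := by
      have := primrec_ofFn (k := L.arW K.one) (f := fun a _ => u a) fun _ => hu
      fun_prop
    exact h.of_eq fun a => rfl
  have h1 := hone hv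
  have h2 := hone (γ := α × ℕ × ℕ) (u := fun q => q.2.1) (by fun_prop)
  have h : Primrec fun a => (V a).foldr (fun u s => Nat.pair 1 (Nat.pair
      ((Factor.wt K.one (oneVar K.one K.harity u) : Factor L _).code K.N) s))
      (Nat.pair 0 ((Factor.wt K.one (oneVar K.one K.harity (v a)) : Factor L _).code K.N)) :=
    primrec_foldr hV (by fun_prop) (by fun_prop)
  refine h.of_eq fun a => ?_
  induction V a with
  | nil => rfl
  | cons u l ih => rw [List.foldr_cons, ih]; rfl

/-- The code of `patternT` as a function of the code of `χ` -/
noncomputable def patternC (z a d v₀ : ℕ) (V : List ℕ) (F E : List (ℕ × ℕ)) : ℕ :=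
  Nat.pair 5 (Nat.pair ((prodOne K.one K.harity K.eZ v₀ V).code K.N)
    (andC (unC z a v₀ V) (andC ((closeF d v₀ E : Formula L).code K.N)
      ((farF d v₀ F : Formula L).code K.N))))

theorem code_patternT {z d v₀ : ℕ} {V : List ℕ} {F E : List (ℕ × ℕ)} {χ : Formula L} :
    (patternT K.one K.harity K.eZ z χ d v₀ V F E).code K.N =
      patternC K z (χ.code K.N) d v₀ V F E := by
  simp only [patternT, Term.code, code_and, code_unF, patternC]

theorem primrec_patternC {z b d v : α → ℕ} {V : α → List ℕ} {F E : α → List (ℕ × ℕ)}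
    (hz : Primrec z) (hb : Primrec b) (hd : Primrec d) (hv : Primrec v) (hV : Primrec V)
    (hF : Primrec F) (hE : Primrec E) :
    Primrec fun a => patternC K (z a) (b a) (d a) (v a) (V a) (F a) (E a) := by
  have := primrec_prodOne K hv hV
  unfold patternC; fun_prop

end Codes

end WA

namespace WA

/-! ### The rules of the algorithm -/

section Functions

variable {L : Lang} (K : Ctx L)

/-- All variables in the list have colour `i`. -/
def sameColB (q : List ℕ × List (ℕ × ℕ) × ℕ) : Bool :=
  q.1.all fun x => decide (col q.2.1 x = some q.2.2)

/-- Not all variables in the list have the same colour. -/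
def mixedB (q : List ℕ × List (ℕ × ℕ)) : Bool :=
  q.1.any fun x => q.1.any fun y => !decide (col q.2 x = col q.2 y)

def neB (q : ℕ × ℕ) : Bool := !decide (q.1 = q.2)

def ltB (q : ℕ × ℕ) : Bool := decide (q.1 - q.2 = 0) && !decide (q.1 = q.2)

def graphB (q : (ℕ × ℕ × ℕ) × List (ℕ × ℕ × ℕ)) : Bool := memB q.1 q.2

/-- `v` can be attached to `V`. -/
def attachB (q : (ℕ × ℕ) × List ℕ × List (ℕ × ℕ)) : Bool :=
  memB q.1.1 q.2.1 && (memB q.1 q.2.2 || memB (q.1.2, q.1.1) q.2.2)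

def inB (E : List (ℕ × ℕ)) (V : List ℕ) : Bool := E.all fun e => memB e.1 V && memB e.2 V

/-- The variables `V` and the pairs `E` are split into two parts. -/
def splitB (q : (List ℕ × List ℕ × List ℕ) × List (ℕ × ℕ) × List (ℕ × ℕ) × List (ℕ × ℕ)) : Bool :=
  q.1.1.all (fun v => memB v q.1.2.1 || memB v q.1.2.2) &&
    q.1.2.1.all (fun v => memB v q.1.1 && !memB v q.1.2.2) &&
    q.1.2.2.all (fun v => memB v q.1.1) &&
    q.2.1.all (fun e => memB e q.2.2.1 || memB e q.2.2.2) &&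
    q.2.2.1.all (fun e => memB e q.2.1) && q.2.2.2.all (fun e => memB e q.2.1) &&
    inB q.2.2.1 q.1.2.1 && inB q.2.2.2 q.1.2.2

/-- The pattern is complete, and `V'` lists the variables. -/
def completeB (q : (ℕ × List ℕ × List ℕ) × List (ℕ × ℕ) × List (ℕ × ℕ)) : Bool :=
  nodupB q.1.2.1 && !memB q.1.1 q.1.2.1 && q.1.2.1.all (fun v => memB v q.1.2.2) &&
    q.1.2.2.all (fun v => memB v q.1.2.1) && inB q.2.1 q.1.2.1 && inB q.2.2 q.1.2.1 &&
    (pairs q.1.2.1).all (fun e => memB e q.2.1 || (memB e q.2.2 || memB (e.2, e.1) q.2.2)) &&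
    q.2.1.all fun e => !decide (e.1 = e.2) && (!memB e q.2.2 && !memB (e.2, e.1) q.2.2)

theorem primrec_sameColB : Primrec sameColB := by unfold sameColB; fun_prop

theorem primrec_mixedB : Primrec mixedB := by unfold mixedB; fun_prop

theorem primrec_neB : Primrec neB := by unfold neB; fun_prop

theorem primrec_ltB : Primrec ltB := by unfold ltB; fun_prop

theorem primrec_graphB : Primrec graphB := by unfold graphB; fun_prop

theorem primrec_attachB : Primrec attachB := by unfold attachB; fun_prop

theorem primrec_splitB : Primrec splitB := by unfold splitB inB; fun_prop

theorem primrec_completeB : Primrec completeB := by unfold completeB inB; fun_prop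

def recolFn (q : List ℕ × ℕ × List (ℕ × ℕ)) : List (ℕ × ℕ) := recol q.1 q.2.1 q.2.2

noncomputable def nearFn (q : List (ℕ × ℕ) × ℕ × ℕ × List ℕ) : ℕ :=
  (nearAllF q.1 q.2.1 q.2.2.1 q.2.2.2.headI q.2.2.2 : Formula L).code K.N

noncomputable def scatFn (q : (List (ℕ × ℕ) × ℕ × ℕ) × List ℕ × ℕ × ℕ) : ℕ :=
  nearScatC K.N q.1.1 q.1.2.1 q.1.2.2 q.2.1.headI q.2.2.1 (varBound q.2.1.headI q.1.1) q.2.2.2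

noncomputable def patternFn (q : (ℕ × ℕ × ℕ) × List ℕ × List (ℕ × ℕ) × List (ℕ × ℕ)) : ℕ :=
  patternC K q.1.1 q.1.2.2 (2 * q.1.2.1 + 1) q.2.1.headI q.2.1.tail q.2.2.1 q.2.2.2

/-- `k + 1` variables other than the first one in the list -/
def varsFn (q : List ℕ × ℕ) : List ℕ := varList (q.1.headI + 1) (q.2 + 1)

def pairsFn (q : List ℕ × ℕ) : List (ℕ × ℕ) := pairs (varsFn q)

def padFn (q : List ℕ × ℕ) : ℕ := padC q.1 q.2

def appendFn (q : List ℕ × List ℕ) : List ℕ := q.1 ++ q.2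

theorem primrec_recolFn : Primrec recolFn := by unfold recolFn; fun_prop

theorem primrec_nearFn : Primrec (nearFn K) := by unfold nearFn; fun_prop

theorem primrec_scatFn : Primrec (scatFn K) := by
  unfold scatFn
  exact primrec_nearScatC K.N (by fun_prop) (by fun_prop) (by fun_prop) (by fun_prop)
    (by fun_prop) (by fun_prop) (by fun_prop)

theorem primrec_patternFn : Primrec (patternFn K) := by
  unfold patternFn
  exact primrec_patternC K (by fun_prop) (by fun_prop) (by fun_prop) (by fun_prop)
    (Primrec.list_tail.comp (by fun_prop)) (by fun_prop) (by fun_prop)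

theorem primrec_varsFn : Primrec varsFn := by unfold varsFn; fun_prop

theorem primrec_pairsFn : Primrec pairsFn := by unfold pairsFn varsFn; fun_prop

theorem primrec_padFn : Primrec padFn := by unfold padFn; fun_prop

theorem primrec_appendFn : Primrec appendFn := by unfold appendFn; fun_prop

end Functions

/-! #### Patterns -/

namespace Pat

def succ (a : Pat) : Pat :=
  .app (fun n _ => n + 1) (by exact Primrec.succ.comp Primrec.fst) a a

def add (a b : Pat) : Pat := .app (fun n m => n + m) Primrec.nat_add a b

def max (a b : Pat) : Pat := .app (fun n m => Max.max n m) Primrec.nat_max a b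

/-- `4 * q + 5` -/
def rad (a : Pat) : Pat :=
  .app (fun n _ => 4 * n + 5) (show Primrec fun q : ℕ × ℕ => 4 * q.1 + 5 by fun_prop) a a

/-- `3 * (q + 1) + 1` -/
def rad' (a : Pat) : Pat :=
  .app (fun n _ => 3 * (n + 1) + 1) (show Primrec fun q : ℕ × ℕ => 3 * (q.1 + 1) + 1 by fun_prop)
    a a

/-- The code of a nonempty list is the successor of a pair; accordingly `lit 0` stands for the empty
list. -/
def cons (a l : Pat) : Pat := succ (pair a l)

def leaf (a : Pat) : Pat := pair (lit 0) a

def node (a t e : Pat) : Pat := pair (lit 1) (pair a (pair t e))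

def loc (i a : Pat) : Pat := pair (lit 0) (pair i a)

def aggr (a : Pat) : Pat := pair (lit 1) a

def ge (r g : Pat) : Pat := pair (lit 2) (pair r g)

/-- Formulas and Boolean combinations use the same tags for negation and disjunction, so the
patterns for connectives serve both. -/
def neg (a : Pat) : Pat := pair (lit 3) a

def or (a b : Pat) : Pat := pair (lit 4) (pair a b)

def and (a b : Pat) : Pat := neg (or (neg a) (neg b))

def head (zs : Pat) : Pat :=
  fn (fun l : List ℕ => l.headI) (by fun_prop) zs

/-- `x = x` for the first entry of the list -/
def self (zs : Pat) : Pat := pair (lit 0) (pair (head zs) (head zs))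

def recol (zs i c : Pat) : Pat := fn recolFn primrec_recolFn (pair zs (pair i c))

section

variable {L : Lang} (K : Ctx L)

noncomputable def near (c n i p zs : Pat) : Pat :=
  fn (nearFn K) (primrec_nearFn K) (pair (recol zs n c) (pair i (pair p zs)))

noncomputable def scat (c n i p zs a k : Pat) : Pat :=
  fn (scatFn K) (primrec_scatFn K) (pair (pair (recol zs n c) (pair i p)) (pair zs (pair a k)))

noncomputable def pattern (z p a V F E : Pat) : Pat :=
  fn (patternFn K) (primrec_patternFn K) (pair (pair z (pair p a)) (pair V (pair F E)))

/-- `∃ y.φ` or `(e = ∑ w(y).φ)` -/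
noncomputable def form : (κ : Kind L) → κ.V → Pat → Pat → Pat
  | .ex, _, zs, a => pair (lit 5) (pair (head zs) a)
  | .sum w, e, zs, a =>
      pair (lit 6) (pair (lit (K.N.wt w)) (pair (lit (K.N.el ⟨L.tyW w, e⟩)) (pair zs a)))

noncomputable def nest (κ : Kind L) (mk : κ.V → Pat) : List κ.V → Pat
  | [] => lit (Nat.pair 0 (κ.lab K 0))
  | e :: l => node (mk e) (lit (Nat.pair 0 (κ.lab K e))) (nest κ mk l)

noncomputable def nearTree (κ : Kind L) (zs c n q i a : Pat) : Pat :=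
  nest K κ (fun e => loc i (form K κ e zs (and (near K c n i (succ q) zs) a))) κ.vals

end

end Pat

open Pat

/-- Conditions that are tested by a primitive recursive function -/
def cond {α : Type} [Primcodable α] (f : α → Bool) (hf : Primrec f) (a : Pat) : List Pat :=
  [lit 2, fn f hf a]

/-- Numbers for quantifiers -/
def Kind.id {L : Lang} (K : Ctx L) : Kind L → ℕ
  | .ex => 0
  | .sum w => K.N.wt w + 1

def graphCode (g : List (ℕ × ℕ × ℕ)) : Pat := lit (Encodable.encode g)

section Clauses

variable {L : Lang} (K : Ctx L)

/-- Only `[2, 1]` can be concluded, so a premise `[2, f x]` is a side condition that a Boolean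
function has the value true. -/
def condClauses : List Clause := [⟨[lit 2, lit 1], []⟩]

/-- Attached lists of variables: `[3, E, V]` -/
def attachedClauses : List Clause := [
  ⟨[lit 3, var 0, cons (var 1) (lit 0)], []⟩,
  ⟨[lit 3, var 0, cons (var 2) (var 3)], [[lit 3, var 0, var 3],
    cond attachB primrec_attachB (pair (pair (var 1) (var 2)) (pair (var 3) (var 0)))]⟩]

/-- Counting terms: `[4, z, p, χ, V, F, E, g]` -/
noncomputable def countClauses : List Clause := [
  ⟨[lit 4, var 0, var 1, var 2, var 3, cons (var 4) (var 5), var 6,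
      pair (lit 3) (pair (var 7) (var 8))],
    [[lit 4, var 0, var 1, var 2, var 3, var 5, var 6, var 7],
      [lit 4, var 0, var 1, var 2, var 3, var 5, cons (var 4) (var 6), var 8]]⟩,
  ⟨[lit 4, var 0, var 1, var 2, var 3, var 4, var 5, pair (lit 2) (pair (var 7) (var 8))],
    [[lit 4, var 0, var 1, var 2, var 3, var 4, cons (var 6) (var 5), var 7],
      [lit 4, var 0, var 1, var 2, var 3, cons (var 6) (var 4), var 5, var 8]]⟩,
  ⟨[lit 4, var 0, var 1, var 2, var 3, lit 0, var 4, pair (lit 4) (pair (var 9) (var 10))],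
    [[lit 4, var 0, var 1, var 2, var 5, lit 0, var 6, var 9],
      [lit 4, var 0, var 1, var 2, var 7, lit 0, var 8, var 10],
      cond splitB primrec_splitB (pair (pair (var 3) (pair (var 5) (var 7)))
        (pair (var 4) (pair (var 6) (var 8))))]⟩,
  ⟨[lit 4, var 0, var 1, var 2, cons (var 3) (var 4), var 5, var 6,
      pattern K (var 0) (var 1) (var 2) (cons (var 3) (var 4)) (var 5) (var 6)],
    [[lit 3, var 6, var 7],
      cond completeB primrec_completeB (pair (pair (var 0) (pair (cons (var 3) (var 4)) (var 7)))
        (pair (var 5) (var 6)))]⟩]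

/-- Combination of trees: `[5, g, t₁, t₂, t]` -/
def combClauses : List Clause := [
  ⟨[lit 5, var 0, leaf (var 1), leaf (var 2), leaf (var 3)],
    [cond graphB primrec_graphB (pair (pair (var 1) (pair (var 2) (var 3))) (var 0))]⟩,
  ⟨[lit 5, var 0, node (var 1) (var 2) (var 3), var 4, node (var 1) (var 5) (var 6)],
    [[lit 5, var 0, var 2, var 4, var 5], [lit 5, var 0, var 3, var 4, var 6]]⟩,
  ⟨[lit 5, var 0, var 4, node (var 1) (var 2) (var 3), node (var 1) (var 5) (var 6)],
    [[lit 5, var 0, var 4, var 2, var 5], [lit 5, var 0, var 4, var 3, var 6]]⟩]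

/-- Terms and tuples of terms whose variables have colour `i`: `[6, c, i, t]` and `[7, c, i, ts]` -/
def termClauses : List Clause := [
  ⟨[lit 6, var 0, var 1, pair (lit 0) (var 2)], []⟩,
  ⟨[lit 6, var 0, var 1, pair (lit 1) (pair (var 2) (var 3))],
    [cond sameColB primrec_sameColB (pair (var 3) (pair (var 0) (var 1)))]⟩,
  ⟨[lit 6, var 0, var 1, pair (lit 2) (pair (var 2) (var 3))],
    [[lit 6, var 0, var 1, var 2], [lit 6, var 0, var 1, var 3]]⟩,
  ⟨[lit 6, var 0, var 1, pair (lit 3) (pair (var 2) (var 3))],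
    [[lit 6, var 0, var 1, var 2], [lit 6, var 0, var 1, var 3]]⟩,
  ⟨[lit 6, var 0, var 1, pair (lit 4) (pair (var 2) (var 3))],
    [[lit 6, var 0, var 1, var 2], [lit 6, var 0, var 1, var 3]]⟩,
  ⟨[lit 7, var 0, var 1, lit 0], []⟩,
  ⟨[lit 7, var 0, var 1, cons (var 2) (var 3)],
    [[lit 6, var 0, var 1, var 2], [lit 7, var 0, var 1, var 3]]⟩]

/-- A tree that tests a formula around part `i` -/
def testP (i a : Pat) : Pat := node (loc i a) (leaf (lit 1)) (leaf (lit 0))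

/-- Normal forms of atomic formulas and Boolean combinations: `[8, φ, n, c, q, t]` -/
def formulaClauses : List Clause := [
  ⟨[lit 8, pair (lit 0) (pair (var 0) (var 1)), var 2, var 3, lit 1,
      testP (var 4) (pair (lit 0) (pair (var 0) (var 1)))],
    [cond sameColB primrec_sameColB
      (pair (cons (var 0) (cons (var 1) (lit 0))) (pair (var 3) (var 4)))]⟩,
  ⟨[lit 8, pair (lit 0) (pair (var 0) (var 1)), var 2, var 3, lit 1, leaf (lit 0)],
    [cond mixedB primrec_mixedB (pair (cons (var 0) (cons (var 1) (lit 0))) (var 3))]⟩,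
  ⟨[lit 8, pair (lit 1) (pair (var 0) (var 1)), var 2, var 3, lit 1,
      testP (var 4) (pair (lit 1) (pair (var 0) (var 1)))],
    [cond sameColB primrec_sameColB (pair (var 1) (pair (var 3) (var 4)))]⟩,
  ⟨[lit 8, pair (lit 1) (pair (var 0) (var 1)), var 2, var 3, lit 1, leaf (lit 0)],
    [cond mixedB primrec_mixedB (pair (var 1) (var 3))]⟩,
  ⟨[lit 8, pair (lit 2) (pair (var 0) (pair (var 1) (var 2))), var 3, var 4, lit 1,
      testP (var 5) (pair (lit 2) (pair (var 0) (pair (var 1) (var 2))))],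
    [cond sameColB primrec_sameColB (pair (var 2) (pair (var 4) (var 5)))]⟩,
  ⟨[lit 8, pair (lit 2) (pair (var 0) (pair (var 1) (var 2))), var 3, var 4, lit 1,
      leaf (var 5)],
    [cond mixedB primrec_mixedB (pair (var 2) (var 4)), [lit 0, var 1, var 5]]⟩,
  ⟨[lit 8, pair (lit 7) (pair (var 0) (var 1)), var 2, var 3, lit 1,
      testP (var 4) (pair (lit 7) (pair (var 0) (var 1)))],
    [[lit 7, var 3, var 4, var 1]]⟩,
  ⟨[lit 8, neg (var 0), var 1, var 2, var 3, var 5],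
    [[lit 8, var 0, var 1, var 2, var 3, var 4],
      [lit 5, graphCode notE, var 4, leaf (lit 0), var 5]]⟩,
  ⟨[lit 8, or (var 0) (var 1), var 2, var 3, max (var 4) (var 5), var 8],
    [[lit 8, var 0, var 2, var 3, var 4, var 6], [lit 8, var 1, var 2, var 3, var 5, var 7],
      [lit 5, graphCode orE, var 6, var 7, var 8]]⟩]

/-- Quantification over a tree: `[10, κ, zs, c, n, q, i, acc, t, t']`, the sum over the tuples that
satisfy `acc` being `[11, κ, zs, c, n, q, i, acc, t]` -/
def quantClauses : List Clause := [
  ⟨[lit 10, var 0, var 1, var 2, var 3, var 4, var 5, var 6, leaf (lit 1), var 7],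
    [[lit 11, var 0, var 1, var 2, var 3, var 4, var 5, var 6, var 7]]⟩,
  ⟨[lit 10, var 0, var 1, var 2, var 3, var 4, var 5, var 6,
      node (loc (var 7) (var 8)) (var 9) (var 10), node (loc (var 7) (var 8)) (var 11) (var 12)],
    [[lit 10, var 0, var 1, var 2, var 3, var 4, var 5, var 6, var 9, var 11],
      [lit 10, var 0, var 1, var 2, var 3, var 4, var 5, var 6, var 10, var 12],
      cond neB primrec_neB (pair (var 7) (var 5))]⟩,
  ⟨[lit 10, var 0, var 1, var 2, var 3, var 4, var 5, var 6,
      node (aggr (var 8)) (var 9) (var 10), node (aggr (var 8)) (var 11) (var 12)],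
    [[lit 10, var 0, var 1, var 2, var 3, var 4, var 5, var 6, var 9, var 11],
      [lit 10, var 0, var 1, var 2, var 3, var 4, var 5, var 6, var 10, var 12]]⟩,
  ⟨[lit 10, var 0, var 1, var 2, var 3, var 4, var 5, var 6,
      node (ge (var 7) (var 8)) (var 9) (var 10), node (ge (var 7) (var 8)) (var 11) (var 12)],
    [[lit 10, var 0, var 1, var 2, var 3, var 4, var 5, var 6, var 9, var 11],
      [lit 10, var 0, var 1, var 2, var 3, var 4, var 5, var 6, var 10, var 12]]⟩]

/-- Rules that depend on the quantifier.  The sum over the neighbourhoods of the parts less than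
`i` is `[9, κ, zs, c, n, q, φ, i, t]`, restricted to tuples that satisfy `acc` it is
`[12, κ, zs, c, n, q, acc, i, t]`. -/
noncomputable def kindClauses (κ : Kind L) : List Clause := [
  ⟨[lit 9, lit (κ.id K), var 1, var 2, var 3, var 4, var 5, lit 0,
      lit (Nat.pair 0 (κ.lab K 0))], []⟩,
  ⟨[lit 9, lit (κ.id K), var 1, var 2, var 3, var 4, var 5, succ (var 6), var 10],
    [[lit 9, lit (κ.id K), var 1, var 2, var 3, var 4, var 5, var 6, var 7],
      [lit 8, var 5, var 3, Pat.recol (var 1) (var 6) (var 2), var 4, var 8],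
      [lit 10, lit (κ.id K), var 1, var 2, var 3, var 4, var 6, self (var 1), var 8, var 9],
      [lit 5, graphCode (κ.plusE K), var 7, var 9, var 10],
      cond ltB primrec_ltB (pair (var 6) (var 3))]⟩,
  ⟨[lit 10, lit (κ.id K), var 1, var 2, var 3, var 4, var 5, var 6, leaf (lit 0),
      lit (Nat.pair 0 (κ.lab K 0))], []⟩,
  ⟨[lit 10, lit (κ.id K), var 1, var 2, var 3, var 4, var 5, var 6,
      node (loc (var 5) (var 8)) (var 9) (var 10), var 13],
    [[lit 10, lit (κ.id K), var 1, var 2, var 3, var 4, var 5, and (var 6) (var 8), var 9,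
        var 11],
      [lit 10, lit (κ.id K), var 1, var 2, var 3, var 4, var 5, and (var 6) (neg (var 8)),
        var 10, var 12],
      [lit 5, graphCode (κ.plusE K), var 11, var 12, var 13]]⟩,
  ⟨[lit 11, lit (κ.id K), var 1, var 2, var 3, var 4, var 5, var 6,
      Pat.nearTree K κ (var 1) (var 2) (var 3) (var 4) (var 5) (var 6)],
    [cond ltB primrec_ltB (pair (var 5) (var 3))]⟩,
  ⟨[lit 12, lit (κ.id K), var 1, var 2, var 3, var 4, var 5, lit 0,
      lit (Nat.pair 0 (κ.lab K 0))], []⟩,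
  ⟨[lit 12, lit (κ.id K), var 1, var 2, var 3, var 4, var 5, succ (var 6), var 8],
    [[lit 12, lit (κ.id K), var 1, var 2, var 3, var 4, var 5, var 6, var 7],
      [lit 5, graphCode (κ.plusE K), var 7,
        Pat.nearTree K κ (var 1) (var 2) (var 3) (var 4) (var 6) (var 5), var 8],
      cond ltB primrec_ltB (pair (var 6) (var 3))]⟩]

/-- The normal form of `∃ y.φ` or `(e = ∑ w(y).φ)`, where `a` is the code of the formula and `zs`
the tuple of quantified variables -/
noncomputable def formClause (κ : Kind L) (e : κ.V) (a zs : Pat) : Clause :=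
  ⟨[lit 8, a, var 2, var 3, rad (var 4), var 9],
    [[lit 9, lit (κ.id K), zs, var 3, var 2, var 4, var 1, var 2, var 5],
      [lit 8, var 1, succ (var 2), Pat.recol zs (var 2) (var 3), var 4, var 6],
      [lit 10, lit (κ.id K), zs, var 3, var 2, var 4, var 2, self zs, var 6, var 7],
      [lit 5, graphCode (κ.plusE K), var 5, var 7, var 8],
      [lit 5, graphCode (κ.eqE K e), var 8, leaf (lit 0), var 9]]⟩

/-- Sums over the complement of all neighbourhoods -/
noncomputable def sumClauses (w : L.Wt) : List Clause :=
  ⟨[lit 11, lit ((Kind.sum w).id K), var 1, var 2, var 3, var 4, var 3, var 6, var 8],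
    [[lit 12, lit ((Kind.sum w).id K), var 1, var 2, var 3, var 4, var 6, var 3, var 7],
      [lit 5, graphCode (minusE K w), Pat.nest K (.sum w)
        (fun e => aggr (form K (.sum w) e (var 1) (var 6))) (Kind.sum w).vals, var 7, var 8]]⟩ ::
  (elems w).map fun e => formClause K (.sum w) e (form K (.sum w) e (var 0) (var 1)) (var 0)

/-- Existence far away from all parts: tests for large scattered sets
`[13, zs, c, n, q, acc, j, l, k, t]` and for elements at medium distance
`[14, zs, c, n, q, acc, j, t]` -/
noncomputable def existsClauses : List Clause := [
  formClause K .ex (1 : ℕ) (pair (lit 5) (pair (var 0) (var 1))) (cons (var 0) (lit 0)),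
  ⟨[lit 11, lit 0, var 1, var 2, var 3, var 4, var 3, var 6, var 9],
    [[lit 14, var 1, var 2, var 3, var 4, var 6, var 3, var 7],
      [lit 13, var 1, var 2, var 3, var 4, var 6, var 3, lit 0, lit 0, var 8],
      [lit 5, graphCode orE, var 7, var 8, var 9]]⟩,
  ⟨[lit 13, var 1, var 2, var 3, var 4, var 5, lit 0, lit 0, var 6,
      node (ge (succ (var 4)) (var 7)) (leaf (lit 1)) (leaf (lit 0))],
    [[lit 4, head (var 1), succ (var 4), var 5, fn varsFn primrec_varsFn (pair (var 1) (var 6)),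
      fn pairsFn primrec_pairsFn (pair (var 1) (var 6)), lit 0, var 7]]⟩,
  ⟨[lit 13, var 1, var 2, var 3, var 4, var 5, succ (var 6), var 7, var 8,
      node (loc (var 6) (scat K (var 2) (var 3) (var 6) (succ (var 4)) (var 1) (var 5)
        (succ (var 7)))) (var 9) (var 10)],
    [[lit 13, var 1, var 2, var 3, var 4, var 5, succ (var 6), succ (var 7), var 8, var 9],
      [lit 13, var 1, var 2, var 3, var 4, var 5, var 6, lit 0, add (var 8) (var 7), var 10],
      cond ltB primrec_ltB (pair (var 6) (var 3))]⟩,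
  ⟨[lit 13, var 1, var 2, var 3, var 4, var 5, succ (var 6), var 2, var 8, var 9],
    [[lit 13, var 1, var 2, var 3, var 4, var 5, var 6, lit 0, add (var 8) (var 2), var 9]]⟩,
  ⟨[lit 14, var 1, var 2, var 3, var 4, var 5, lit 0, leaf (lit 0)], []⟩,
  ⟨[lit 14, var 1, var 2, var 3, var 4, var 5, succ (var 6),
      node (loc (var 6) (form K .ex (1 : ℕ) (var 1)
        (and (near K (var 2) (var 3) (var 6) (rad' (var 4)) (var 1))
          (and (var 5) (neg (near K (var 2) (var 3) (var 6) (succ (var 4)) (var 1)))))))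
        (leaf (lit 1)) (var 7)],
    [[lit 14, var 1, var 2, var 3, var 4, var 5, var 6, var 7],
      cond ltB primrec_ltB (pair (var 6) (var 3))]⟩]

/-- `∑ one(0).(χ ∧ 0 = 0)` for a sentence `χ` -/
noncomputable def sentenceP (q a : Pat) : Pat :=
  pattern K (lit 1) q a (cons (lit 0) (lit 0)) (lit 0) (lit 0)

/-- Boolean combinations have no constants. The count of all elements is at least one in every
nonempty structure, which serves as the true statement. -/
noncomputable def truthP : Pat :=
  pair (lit 2) (sentenceP K (lit 0) (pair (lit 0) (pair (lit 1) (lit 1))))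

/-- The output: `[16, x, q, a, θ, ρ]` for the tests of a tree, `[15, x, q, t, θ, ρ]` for trees -/
noncomputable def outputClauses : List Clause := [
  ⟨[lit 16, cons (var 0) (var 1), var 2, loc (var 3) (var 4),
    pair (lit 0) (fn padFn primrec_padFn (pair (cons (var 0) (var 1)) (var 4))), lit 0], []⟩,
  ⟨[lit 16, lit 0, var 2, loc (var 3) (var 4), pair (lit 2) (sentenceP K (var 2) (var 4)),
    cons (var 2) (lit 0)], []⟩,
  ⟨[lit 16, var 0, var 2, aggr (var 4), pair (lit 1) (var 4), lit 0], []⟩,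
  ⟨[lit 16, var 0, var 2, ge (var 3) (var 4), pair (lit 2) (var 4), cons (var 3) (lit 0)], []⟩,
  ⟨[lit 15, var 0, var 2, leaf (lit 1), truthP K, cons (lit 0) (lit 0)], []⟩,
  ⟨[lit 15, var 0, var 2, leaf (lit 0), neg (truthP K), cons (lit 0) (lit 0)], []⟩,
  ⟨[lit 15, var 0, var 2, node (var 3) (var 4) (var 5),
      or (and (var 6) (var 7)) (and (neg (var 6)) (var 8)),
      fn appendFn primrec_appendFn (pair (fn appendFn primrec_appendFn (pair (var 9) (var 10)))
        (fn appendFn primrec_appendFn (pair (var 9) (var 11))))],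
    [[lit 16, var 0, var 2, var 3, var 6, var 9], [lit 15, var 0, var 2, var 4, var 7, var 10],
      [lit 15, var 0, var 2, var 5, var 8, var 11]]⟩,
  ⟨[lit 1, var 0, var 1, pair (var 4) (pair (var 5) (var 2))],
    [[lit 8, var 0, lit 1, Pat.recol (var 1) (lit 0) (lit 0), var 2, var 3],
      [lit 15, var 1, var 2, var 3, var 4, var 5]]⟩]

open Classical in
/-- The weight symbols of finite type -/
noncomputable def finWts (L : Lang) : List L.Wt :=
  haveI := L.wt_finite
  haveI := Fintype.ofFinite L.Wt
  Finset.univ.toList.filter fun w => Finite (L.El (L.tyW w))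

theorem mem_finWts {w : L.Wt} : w ∈ finWts L ↔ Finite (L.El (L.tyW w)) := by simp [finWts]

/-- All rules -/
noncomputable def clauses : List Clause :=
  condClauses ++ attachedClauses ++ countClauses K ++ combClauses ++ termClauses ++
    formulaClauses ++ quantClauses ++ existsClauses K ++ outputClauses K ++ kindClauses K .ex ++
    (finWts L).flatMap fun w => kindClauses K (.sum w) ++ sumClauses K w

end Clauses

end WA

namespace WA

/-! ### Meaning of the judgements -/

/-- Evaluation of patterns under an assignment -/
def Pat.ev (x : ℕ → ℕ) : Pat → ℕ
  | .var k => x k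
  | .lit n => n
  | .pair a b => Nat.pair (a.ev x) (b.ev x)
  | .app f _ a b => f (a.ev x) (b.ev x)

theorem Pat.eval_eq_ev (v : List ℕ) (p : Pat) : p.eval v = p.ev fun k => v.getD k 0 := by
  induction p with
  | var k => rfl
  | lit n => rfl
  | pair a b iha ihb => rw [eval, ev, iha, ihb]
  | app f _ a b iha ihb => rw [eval, ev, iha, ihb]

/-- All premises hold. -/
def Premises (S : List ℕ → Prop) (x : ℕ → ℕ) : List (List Pat) → Prop
  | [] => True
  | b :: l => S (b.map (Pat.ev x)) ∧ Premises S x l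

theorem premises_of_forall {S : List ℕ → Prop} {x : ℕ → ℕ} {l : List (List Pat)}
    (h : ∀ b ∈ l, S (b.map (Pat.ev x))) : Premises S x l := by
  induction l with
  | nil => trivial
  | cons b l ih => exact ⟨h b (by simp), ih fun b hb => h b (by simp [hb])⟩

/-- The clause preserves `S`. -/
def Clause.Valid (S : List ℕ → Prop) (c : Clause) : Prop :=
  ∀ x, Premises S x c.body → S (c.head.map (Pat.ev x))

/-- Soundness is checked rule by rule, by induction on derivations. -/
theorem Der.of_valid {P : List Clause} {O : ℕ → ℕ} {S : List ℕ → Prop}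
    (hO : ∀ s, S [0, s, O s]) (hP : ∀ c ∈ P, c.Valid S) {j : List ℕ} (h : Der P O j) : S j := by
  induction h with
  | graph s => exact hO s
  | rule c hc v _ ih =>
    have he : Pat.eval v = Pat.ev fun k => v.getD k 0 := funext (Pat.eval_eq_ev v)
    rw [he] at ih ⊢
    exact hP c hc _ (premises_of_forall ih)

section Meaning

variable {L : Lang} (K : Ctx L)

/-- All judgements speak about arbitrary objects with the given codes. Numbers that code nothing
satisfy them vacuously, so the rules need no tests of well-formedness. -/
def AttachedM (E V : ℕ) : Prop :=
  ∀ (E' : List (ℕ × ℕ)) (V' : List ℕ), Encodable.encode E' = E → Encodable.encode V' = V →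
    Attached E' V'

def CountM (z p a V F E g : ℕ) : Prop :=
  ∀ (χ : Formula L) (q : ℕ), χ.code K.N = a → Loc K.N.dom q {z} χ → q ≤ p →
    ∀ (V' : List ℕ) (F' E' : List (ℕ × ℕ)), Encodable.encode V' = V → Encodable.encode F' = F →
      Encodable.encode E' = E → ∃ g' : Term L (L.tyW K.one), g'.code K.N = g ∧
        IsCount K.one K.eZ K.N.dom p V' (Pattern z χ (2 * p + 1) V' F' E') g'

def CombM (g t₁ t₂ t : ℕ) : Prop :=
  ∀ (G : List (ℕ × ℕ × ℕ)) (T₁ T₂ : Tree K), Encodable.encode G = g → T₁.code = t₁ →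
    T₂.code = t₂ → ∃ T : Tree K, T.code = t ∧ IsComb G T₁ T₂ T

def TermM (c i t : ℕ) : Prop :=
  ∀ (C : List (ℕ × ℕ)) (s : Σ j, Term L j), Encodable.encode C = c → s.2.code K.N = t →
    s.2.IsFOW → (s.2.free : Set ℕ) ⊆ part C i

def TupleM (c i ts : ℕ) : Prop :=
  ∀ (C : List (ℕ × ℕ)) (l : List (Σ j, Term L j)), Encodable.encode C = c →
    Encodable.encode (l.map fun s => s.2.code K.N) = ts → ∀ s ∈ l, s.2.IsFOW →
      (s.2.free : Set ℕ) ⊆ part C i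

/-- Formulas with constants in the domain whose free variables are coloured -/
structure Coloured (C : List (ℕ × ℕ)) (φ : Formula L) : Prop where
  isFOW : φ.IsFOW
  constsIn : φ.Over K.N.dom
  col : ∀ x ∈ φ.free, ∃ j, col C x = some j

def FormulaM (a n c q t : ℕ) : Prop :=
  ∀ (φ : Formula L) (C : List (ℕ × ℕ)), φ.code K.N = a → Encodable.encode C = c → ColLt C n →
    Coloured K C φ → ∃ T : Tree K, T.code = t ∧ Rep (part C) q T fun _ M β => tv (φ.Sat M β)

/-- The data in judgements about quantifiers -/
structure Setup (k zs c n : ℕ) (κ : Kind L) (y : Fin κ.ar ↪ ℕ) (C : List (ℕ × ℕ)) : Prop where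
  id_eq : κ.id K = k
  tuple_eq : tupleCode y = zs
  col_eq : Encodable.encode C = c
  fin : κ.Fin'
  colLt : ColLt C n

def NearM (k zs c n q a i t : ℕ) : Prop :=
  ∀ (κ : Kind L) (y : Fin κ.ar ↪ ℕ) (C : List (ℕ × ℕ)), Setup K k zs c n κ y C →
    ∀ φ : Formula L, φ.code K.N = a → i ≤ n → (∀ j, Coloured K (recolY y C j) φ) →
      ∃ T : Tree K, T.code = t ∧ Rep (rest y C) (4 * q + 5) T fun _ M β => κ.lab K
        (∑ j ∈ Finset.range i, qval κ M y β fun β' => Guard y C n (q + 1) j M β' ∧ φ.Sat M β')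

/-- The tree `T` need not compute a formula here: the recursion on trees passes to subtrees, which
compute nothing meaningful by themselves. -/
def QuantM (k zs c n q i a t t' : ℕ) : Prop :=
  ∀ (κ : Kind L) (y : Fin κ.ar ↪ ℕ) (C : List (ℕ × ℕ)), Setup K k zs c n κ y C →
    ∀ acc : Formula L, acc.code K.N = a → Loc K.N.dom q (part (recolY y C i) i) acc → i ≤ n →
      ∀ T : Tree K, T.code = t → T.Good (part (recolY y C i)) q →
        ∃ T' : Tree K, T'.code = t' ∧ RepQuant K y C n q i acc T T'

def BaseM (k zs c n q i a t : ℕ) : Prop :=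
  ∀ (κ : Kind L) (y : Fin κ.ar ↪ ℕ) (C : List (ℕ × ℕ)), Setup K k zs c n κ y C →
    ∀ acc : Formula L, acc.code K.N = a → Loc K.N.dom q (part (recolY y C i) i) acc → i ≤ n →
      ∃ T : Tree K, T.code = t ∧ Rep (rest y C) (4 * q + 5) T fun _ M β => κ.lab K
        (qval κ M y β fun β' => Guard y C n (q + 1) i M β' ∧ acc.Sat M β')

def AccM (k zs c n q a i t : ℕ) : Prop :=
  ∀ (κ : Kind L) (y : Fin κ.ar ↪ ℕ) (C : List (ℕ × ℕ)), Setup K k zs c n κ y C →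
    ∀ acc : Formula L, acc.code K.N = a → Loc K.N.dom q (part (recolY y C n) n) acc → i ≤ n →
      ∃ T : Tree K, T.code = t ∧ Rep (rest y C) (4 * q + 5) T fun _ M β => κ.lab K
        (∑ j ∈ Finset.range i, qval κ M y β fun β' =>
          NearAll M (q + 1) (rest y C j) (Set.range y) β' ∧ acc.Sat M β')

def LargeM (zs c n q a j l k t : ℕ) : Prop :=
  ∀ (y : Fin (Kind.ex (L := L)).ar ↪ ℕ) (C : List (ℕ × ℕ)), Setup K 0 zs c n .ex y C →
    ∀ acc : Formula L, acc.code K.N = a → Loc K.N.dom q (part (recolY y C n) n) acc → j ≤ n →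
      ∃ T : Tree K, T.code = t ∧ RepLarge K y C q acc j l k T

def RingM (zs c n q a j t : ℕ) : Prop :=
  ∀ (y : Fin (Kind.ex (L := L)).ar ↪ ℕ) (C : List (ℕ × ℕ)), Setup K 0 zs c n .ex y C →
    ∀ acc : Formula L, acc.code K.N = a → Loc K.N.dom q (part (recolY y C n) n) acc → j ≤ n →
      ∃ T : Tree K, T.code = t ∧ Rep (rest y C) (4 * q + 5) T fun _ M β =>
        tv (∃ i < j, ∃ a ∈ accSet y acc M β,
          a ∈ nbhd M.gaifman (3 * (q + 1) + 1) (β '' rest y C i) ∧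
            a ∉ nbhd M.gaifman (q + 1) (β '' rest y C i))

/-- A Boolean combination of the required form that is equivalent to `P` -/
structure IsOutput (x : List ℕ) (q : ℕ) (θ : ClForm L (L.tyW K.one)) (radii : List ℕ)
    (P : (A : Type) → Str L A → (ℕ → A) → Prop) : Prop where
  isNormal : θ.IsNormal x q
  constsIn : θ.Over K.N.dom
  radii : List.Forall₂ (fun ρ g => Term.IsCl ρ g) radii θ.groundTerms
  sat_iff : ∀ (A : Type) [Finite A] [Nonempty A] (M : Str L A), Adm K M → ∀ β : ℕ → A,
    θ.Sat K.eZ M β ↔ P A M β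

def OutM (x q t θ ρ : ℕ) : Prop :=
  ∀ (x' : List ℕ) (T : Tree K), Encodable.encode x' = x → T.code = t →
    T.Good (part (recol x' 0 [])) q → ∃ (θ' : ClForm L (L.tyW K.one)) (radii : List ℕ),
      θ'.code K.N = θ ∧ Encodable.encode radii = ρ ∧
        IsOutput K x' q θ' radii fun _ M β => T.eval M β = 1

def OutAtomM (x q a θ ρ : ℕ) : Prop :=
  ∀ (x' : List ℕ) (a' : Atom K), Encodable.encode x' = x → a'.code = a →
    a'.Good (part (recol x' 0 [])) q → ∃ (θ' : ClForm L (L.tyW K.one)) (radii : List ℕ),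
      θ'.code K.N = θ ∧ Encodable.encode radii = ρ ∧
        IsOutput K x' q θ' radii fun _ M β => a'.Holds M β

def ResultM (a x b : ℕ) : Prop :=
  ∀ (φ : Formula L) (x' : List ℕ), φ.code K.N = a → Encodable.encode x' = x → φ.IsFOW →
    φ.Over K.N.dom → φ.free ⊆ x'.toFinset →
    ∃ (θ : ClForm L (L.tyW K.one)) (radii : List ℕ) (r : ℕ),
      Nat.pair (θ.code K.N) (Nat.pair (Encodable.encode radii) r) = b ∧
        IsOutput K x' r θ radii fun _ M β => φ.Sat M β

/-- The first entry is the name of the judgement. Lists of other shapes impose no condition. -/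
def Meaning : List ℕ → Prop
  | [0, s, b] => b = K.N.zeroTest s
  | [1, a, x, b] => ResultM K a x b
  | [2, b] => b = 1
  | [3, E, V] => AttachedM E V
  | [4, z, p, a, V, F, E, g] => CountM K z p a V F E g
  | [5, g, t₁, t₂, t] => CombM K g t₁ t₂ t
  | [6, c, i, t] => TermM K c i t
  | [7, c, i, ts] => TupleM K c i ts
  | [8, a, n, c, q, t] => FormulaM K a n c q t
  | [9, k, zs, c, n, q, a, i, t] => NearM K k zs c n q a i t
  | [10, k, zs, c, n, q, i, a, t, t'] => QuantM K k zs c n q i a t t'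
  | [11, k, zs, c, n, q, i, a, t] => BaseM K k zs c n q i a t
  | [12, k, zs, c, n, q, a, i, t] => AccM K k zs c n q a i t
  | [13, zs, c, n, q, a, j, l, k, t] => LargeM K zs c n q a j l k t
  | [14, zs, c, n, q, a, j, t] => RingM K zs c n q a j t
  | [15, x, q, t, θ, ρ] => OutM K x q t θ ρ
  | [16, x, q, a, θ, ρ] => OutAtomM K x q a θ ρ
  | _ => True

end Meaning

/-! ### Inversion of codes -/

section Inversion

variable {L : Lang} {N : Coding L} {φ : Formula L} {a b c : ℕ}

theorem Formula.code_eq_zero (h : φ.code N = Nat.pair 0 (Nat.pair a b)) : φ = .eq a b := by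
  cases φ <;> simp_all [Formula.code, Nat.pair_eq_pair]

theorem Formula.code_eq_one (h : φ.code N = Nat.pair 1 (Nat.pair a b)) :
    ∃ R x, φ = .rel R x ∧ tupleCode x = b := by
  cases φ <;> simp [Formula.code, Nat.pair_eq_pair] at h
  exact ⟨_, _, rfl, h.2⟩

/-- Names determine constants only inside the domain of the coding, so the inversion returns an
equality of names instead of constants. -/
theorem Formula.code_eq_two (h : φ.code N = Nat.pair 2 (Nat.pair a (Nat.pair b c))) :
    ∃ w s x, φ = .weq w s x ∧ N.el ⟨_, s⟩ = b ∧ tupleCode x = c := by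
  cases φ <;> simp [Formula.code, Nat.pair_eq_pair] at h
  exact ⟨_, _, _, rfl, h.2⟩

theorem Formula.code_eq_three (h : φ.code N = Nat.pair 3 a) : ∃ ψ, φ = .neg ψ ∧ ψ.code N = a := by
  cases φ <;> simp [Formula.code, Nat.pair_eq_pair] at h
  exact ⟨_, rfl, h⟩

theorem Formula.code_eq_four (h : φ.code N = Nat.pair 4 (Nat.pair a b)) :
    ∃ ψ χ, φ = .or ψ χ ∧ ψ.code N = a ∧ χ.code N = b := by
  cases φ <;> simp [Formula.code, Nat.pair_eq_pair] at h
  exact ⟨_, _, rfl, h⟩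

theorem Formula.code_eq_five (h : φ.code N = Nat.pair 5 (Nat.pair a b)) :
    ∃ ψ, φ = .ex a ψ ∧ ψ.code N = b := by
  cases φ <;> simp [Formula.code, Nat.pair_eq_pair] at h
  exact ⟨_, by rw [h.1], h.2⟩

theorem Formula.code_eq_six {d : ℕ}
    (h : φ.code N = Nat.pair 6 (Nat.pair a (Nat.pair b (Nat.pair c d)))) :
    ∃ w s y ψ, φ = .agg w s y ψ ∧ N.wt w = a ∧ N.el ⟨_, s⟩ = b ∧ tupleCode y = c ∧
      ψ.code N = d := by
  cases φ <;> simp [Formula.code, Nat.pair_eq_pair] at h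
  exact ⟨_, _, _, _, rfl, h⟩

theorem Formula.code_eq_seven (h : φ.code N = Nat.pair 7 (Nat.pair a b)) :
    ∃ P t, φ = .pred P t ∧ (tupleCode fun j => (t j).code N) = b := by
  cases φ <;> simp [Formula.code, Nat.pair_eq_pair] at h
  exact ⟨_, _, rfl, h.2⟩

variable {K : Ctx L} {T : Tree K} {A : Atom K}

theorem Tree.code_eq_leaf (h : T.code = Nat.pair 0 a) : T = .leaf a := by
  cases T <;> simp_all [Tree.code, Nat.pair_eq_pair]

theorem Tree.code_eq_node (h : T.code = Nat.pair 1 (Nat.pair a (Nat.pair b c))) :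
    ∃ A t e, T = .node A t e ∧ A.code = a ∧ t.code = b ∧ e.code = c := by
  cases T <;> simp [Tree.code, Nat.pair_eq_pair] at h
  exact ⟨_, _, _, rfl, h⟩

theorem Atom.code_eq_loc (h : A.code = Nat.pair 0 (Nat.pair a b)) :
    ∃ ψ, A = .loc a ψ ∧ ψ.code K.N = b := by
  cases A <;> simp [Atom.code, Nat.pair_eq_pair] at h
  exact ⟨_, by rw [h.1], h.2⟩

theorem Atom.code_eq_aggr (h : A.code = Nat.pair 1 a) : ∃ χ, A = .aggr χ ∧ χ.code K.N = a := by
  cases A <;> simp [Atom.code, Nat.pair_eq_pair] at h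
  exact ⟨_, rfl, h⟩

theorem Atom.code_eq_ge (h : A.code = Nat.pair 2 (Nat.pair a b)) :
    ∃ g, A = .ge a g ∧ g.code K.N = b := by
  cases A <;> simp [Atom.code, Nat.pair_eq_pair] at h
  exact ⟨_, by rw [h.1], h.2⟩

theorem encode_eq_cons {α : Type} [Encodable α] {l : List α}
    (h : Encodable.encode l = Nat.pair a b + 1) :
    ∃ x l', l = x :: l' ∧ Encodable.encode x = a ∧ Encodable.encode l' = b := by
  cases l with
  | nil => simp at h
  | cons x l =>
    rw [Encodable.encode_list_cons, Nat.succ_eq_add_one, Nat.add_right_cancel_iff,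
      Nat.pair_eq_pair] at h
    exact ⟨x, l, rfl, h⟩

theorem encode_eq_nil {α : Type} [Encodable α] {l : List α} (h : Encodable.encode l = 0) :
    l = [] := by
  cases l with
  | nil => rfl
  | cons x l => simp at h

theorem exists_encode_eq {α : Type} [Denumerable α] (n : ℕ) : ∃ x : α, Encodable.encode x = n :=
  ⟨Denumerable.ofNat α n, Denumerable.encode_ofNat n⟩

theorem natFn_bool {α : Type} [Primcodable α] {f : α → Bool} {x : α}
    (h : natFn f (Encodable.encode x) = 1) : f x = true := by
  rw [natFn_encode] at h
  cases hf : f x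
  · rw [hf] at h; simp at h
  · rfl

theorem Kind.id_injective : Function.Injective (Kind.id K) := by
  intro κ κ' h
  cases κ <;> cases κ' <;> simp [Kind.id] at h ⊢
  exact K.N.wt_inj h

end Inversion

end WA

namespace WA

/-! ### Validity of the rules -/

section Valid

variable {L : Lang} (K : Ctx L)

open Encodable (encode)

theorem valid_condClauses : ∀ c ∈ condClauses, c.Valid (Meaning K) := by
  simp only [condClauses, List.forall_mem_singleton]
  rintro x -
  exact (rfl : 1 = 1)

theorem valid_attachedClauses : ∀ c ∈ attachedClauses, c.Valid (Meaning K) := by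
  simp only [attachedClauses, List.forall_mem_cons, List.not_mem_nil, false_imp_iff,
    implies_true, and_true]
  refine ⟨?_, ?_⟩
  · rintro x -
    change AttachedM (x 0) (Nat.pair (x 1) 0 + 1)
    intro E V _ hV
    obtain ⟨v, V, rfl, -, hV⟩ := encode_eq_cons hV
    rw [encode_eq_nil hV]
    exact .single v
  · rintro x ⟨h1, h2, -⟩
    replace h1 : AttachedM (x 0) (x 3) := h1
    replace h2 : natFn attachB (Nat.pair (Nat.pair (x 1) (x 2)) (Nat.pair (x 3) (x 0))) = 1 := h2
    change AttachedM (x 0) (Nat.pair (x 2) (x 3) + 1)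
    intro E V hE hV
    obtain ⟨v, V, rfl, hv, hV⟩ := encode_eq_cons hV
    replace hv : v = x 2 := hv
    have := natFn_bool (f := attachB) (x := ((x 1, v), V, E))
      (by simpa [Encodable.encode_prod_val, hE, hV, hv] using h2)
    simp only [attachB, Bool.and_eq_true, Bool.or_eq_true, memB_iff] at this
    exact .cons (h1 E V hE hV) this.1 this.2

theorem valid_combClauses : ∀ c ∈ combClauses, c.Valid (Meaning K) := by
  simp only [combClauses, List.forall_mem_cons, List.not_mem_nil, false_imp_iff,
    implies_true, and_true]
  refine ⟨?_, ?_, ?_⟩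
  · rintro x ⟨h, -⟩
    replace h : natFn graphB (Nat.pair (Nat.pair (x 1) (Nat.pair (x 2) (x 3))) (x 0)) = 1 := h
    change CombM K (x 0) (Nat.pair 0 (x 1)) (Nat.pair 0 (x 2)) (Nat.pair 0 (x 3))
    intro G T₁ T₂ hG h₁ h₂
    rw [Tree.code_eq_leaf h₁, Tree.code_eq_leaf h₂]
    have := natFn_bool (f := graphB) (x := ((x 1, x 2, x 3), G))
      (by simpa [Encodable.encode_prod_val, hG] using h)
    exact ⟨.leaf (x 3), rfl, .leaf (by simpa [graphB] using this)⟩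
  · rintro x ⟨h1, h2, -⟩
    replace h1 : CombM K (x 0) (x 2) (x 4) (x 5) := h1
    replace h2 : CombM K (x 0) (x 3) (x 4) (x 6) := h2
    change CombM K (x 0) (Nat.pair 1 (Nat.pair (x 1) (Nat.pair (x 2) (x 3)))) (x 4)
      (Nat.pair 1 (Nat.pair (x 1) (Nat.pair (x 5) (x 6))))
    intro G T₁ T₂ hG h₁ h₂
    obtain ⟨A, t, e, rfl, hA, ht, he⟩ := Tree.code_eq_node h₁
    obtain ⟨t', ht', h3⟩ := h1 G t T₂ hG ht h₂
    obtain ⟨e', he', h4⟩ := h2 G e T₂ hG he h₂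
    exact ⟨.node A t' e', by rw [Tree.code, hA, ht', he'], h3.left h4⟩
  · rintro x ⟨h1, h2, -⟩
    replace h1 : CombM K (x 0) (x 4) (x 2) (x 5) := h1
    replace h2 : CombM K (x 0) (x 4) (x 3) (x 6) := h2
    change CombM K (x 0) (x 4) (Nat.pair 1 (Nat.pair (x 1) (Nat.pair (x 2) (x 3))))
      (Nat.pair 1 (Nat.pair (x 1) (Nat.pair (x 5) (x 6))))
    intro G T₁ T₂ hG h₁ h₂
    obtain ⟨A, t, e, rfl, hA, ht, he⟩ := Tree.code_eq_node h₂
    obtain ⟨t', ht', h3⟩ := h1 G T₁ t hG h₁ ht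
    obtain ⟨e', he', h4⟩ := h2 G T₁ e hG h₁ he
    exact ⟨.node A t' e', by rw [Tree.code, hA, ht', he'], h3.right h4⟩

theorem sameColB_iff {l : List ℕ} {C : List (ℕ × ℕ)} {i : ℕ} :
    sameColB (l, C, i) = true ↔ ∀ x ∈ l, x ∈ part C i := by
  simp [sameColB, mem_part]

theorem valid_termClauses : ∀ c ∈ termClauses, c.Valid (Meaning K) := by
  simp only [termClauses, List.forall_mem_cons, List.not_mem_nil, false_imp_iff,
    implies_true, and_true]
  refine ⟨?_, ?_, ?_, ?_, ?_, ?_, ?_⟩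
  · rintro x -
    change TermM K (x 0) (x 1) (Nat.pair 0 (x 2))
    rintro C ⟨j, s⟩ hC hs -
    cases s <;> simp [Term.code, Nat.pair_eq_pair] at hs
    simp [Term.free]
  · rintro x ⟨h, -⟩
    replace h : natFn sameColB (Nat.pair (x 3) (Nat.pair (x 0) (x 1))) = 1 := h
    change TermM K (x 0) (x 1) (Nat.pair 1 (Nat.pair (x 2) (x 3)))
    rintro C ⟨j, s⟩ hC hs -
    cases s <;> simp [Term.code, Nat.pair_eq_pair] at hs
    rename_i w y
    have := natFn_bool (f := sameColB) (x := (List.ofFn y, C, x 1))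
      (by simpa [Encodable.encode_prod_val, hC, ← hs.2, tupleCode] using h)
    rw [sameColB_iff] at this
    simp only [Term.free]
    intro v hv
    simp only [Finset.coe_map, Finset.coe_univ, Set.image_univ, Set.mem_range] at hv
    exact this v (by simpa [List.mem_ofFn] using hv)
  · rintro x ⟨h1, h2, -⟩
    replace h1 : TermM K (x 0) (x 1) (x 2) := h1
    replace h2 : TermM K (x 0) (x 1) (x 3) := h2
    change TermM K (x 0) (x 1) (Nat.pair 2 (Nat.pair (x 2) (x 3)))
    rintro C ⟨j, s⟩ hC hs hf
    cases s <;> simp [Term.code, Nat.pair_eq_pair] at hs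
    simp only [Term.IsFOW] at hf
    simpa [Term.free] using ⟨h1 C ⟨_, _⟩ hC hs.1 hf.1, h2 C ⟨_, _⟩ hC hs.2 hf.2⟩
  · rintro x ⟨h1, h2, -⟩
    replace h1 : TermM K (x 0) (x 1) (x 2) := h1
    replace h2 : TermM K (x 0) (x 1) (x 3) := h2
    change TermM K (x 0) (x 1) (Nat.pair 3 (Nat.pair (x 2) (x 3)))
    rintro C ⟨j, s⟩ hC hs hf
    cases s <;> simp [Term.code, Nat.pair_eq_pair] at hs
    simp only [Term.IsFOW] at hf
    simpa [Term.free] using ⟨h1 C ⟨_, _⟩ hC hs.1 hf.1, h2 C ⟨_, _⟩ hC hs.2 hf.2⟩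
  · rintro x ⟨h1, h2, -⟩
    replace h1 : TermM K (x 0) (x 1) (x 2) := h1
    replace h2 : TermM K (x 0) (x 1) (x 3) := h2
    change TermM K (x 0) (x 1) (Nat.pair 4 (Nat.pair (x 2) (x 3)))
    rintro C ⟨j, s⟩ hC hs hf
    cases s <;> simp [Term.code, Nat.pair_eq_pair] at hs
    simp only [Term.IsFOW] at hf
    simpa [Term.free] using ⟨h1 C ⟨_, _⟩ hC hs.1 hf.1, h2 C ⟨_, _⟩ hC hs.2 hf.2⟩
  · rintro x -
    change TupleM K (x 0) (x 1) 0
    rintro C l hC hl s hs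
    rw [List.map_eq_nil_iff.1 (encode_eq_nil hl)] at hs
    simp at hs
  · rintro x ⟨h1, h2, -⟩
    replace h1 : TermM K (x 0) (x 1) (x 2) := h1
    replace h2 : TupleM K (x 0) (x 1) (x 3) := h2
    change TupleM K (x 0) (x 1) (Nat.pair (x 2) (x 3) + 1)
    rintro C l hC hl s hs hf
    obtain ⟨a, l', hl', ha, hl⟩ := encode_eq_cons hl
    obtain ⟨s', l'', rfl, rfl, rfl⟩ := List.map_eq_cons_iff.1 hl'
    rcases List.mem_cons.1 hs with rfl | hs
    · exact h1 C s hC ha hf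
    · exact h2 C l'' hC hl s hs hf

/-- A pair of variables of different parts -/
theorem exists_far_of_mixedB {l : List ℕ} {C : List (ℕ × ℕ)} (h : mixedB (l, C) = true)
    (hl : ∀ x ∈ l, ∃ j, col C x = some j) {A : Type} {M : Str L A} {β : ℕ → A} {q : ℕ}
    (hβ : Far M β (part C) q) :
    ∃ u ∈ l, ∃ v ∈ l, (q : ℕ∞) < M.gaifman.edist (β u) (β v) := by
  simp only [mixedB, List.any_eq_true, Bool.not_eq_true', decide_eq_false_iff_not] at h
  obtain ⟨u, hu, v, hv, huv⟩ := h
  obtain ⟨i, hi⟩ := hl u hu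
  obtain ⟨j, hj⟩ := hl v hv
  exact ⟨u, hu, v, hv, hβ i j (fun hij => huv (by rw [hi, hj, hij])) u hi v hj⟩

variable {K}

theorem rep_testP {i a q : ℕ} {Y : ℕ → Set ℕ} {φ : Formula L} (ha : φ.code K.N = a)
    (h : Loc K.N.dom q (Y i) φ) : ∃ T : Tree K,
      T.code = Nat.pair 1 (Nat.pair (Nat.pair 0 (Nat.pair i a)) (Nat.pair (Nat.pair 0 1)
        (Nat.pair 0 0))) ∧ Rep Y q T fun _ M β => tv (φ.Sat M β) :=
  ⟨.node (.loc i φ) (.leaf 1) (.leaf 0), by simp [Tree.code, Atom.code, ha],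
    .test (a := .loc i φ) h fun _ _ _ _ _ _ _ => Iff.rfl⟩

variable (K)

theorem valid_formulaClauses : ∀ c ∈ formulaClauses, c.Valid (Meaning K) := by
  simp only [formulaClauses, List.forall_mem_cons, List.not_mem_nil, false_imp_iff,
    implies_true, and_true]
  refine ⟨?_, ?_, ?_, ?_, ?_, ?_, ?_, ?_, ?_⟩
  · rintro x ⟨h, -⟩
    replace h : natFn sameColB (Nat.pair (Nat.pair (x 0) (Nat.pair (x 1) 0 + 1) + 1)
      (Nat.pair (x 3) (x 4))) = 1 := h
    change FormulaM K (Nat.pair 0 (Nat.pair (x 0) (x 1))) (x 2) (x 3) 1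
      (Nat.pair 1 (Nat.pair (Nat.pair 0 (Nat.pair (x 4) (Nat.pair 0 (Nat.pair (x 0) (x 1))))) (Nat.pair (Nat.pair 0 1) (Nat.pair 0 0))))
    intro φ C hφ hC _ _
    obtain rfl := Formula.code_eq_zero hφ
    have := natFn_bool (f := sameColB) (x := ([x 0, x 1], C, x 4))
      (by simpa [Encodable.encode_prod_val, hC] using h)
    rw [sameColB_iff] at this
    exact rep_testP hφ (loc_eq (this _ (by simp)) (this _ (by simp)))
  · rintro x ⟨h, -⟩
    replace h : natFn mixedB (Nat.pair (Nat.pair (x 0) (Nat.pair (x 1) 0 + 1) + 1)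
      (x 3)) = 1 := h
    change FormulaM K (Nat.pair 0 (Nat.pair (x 0) (x 1))) (x 2) (x 3) 1
      (Nat.pair 0 0)
    intro φ C hφ hC _ hcol
    obtain rfl := Formula.code_eq_zero hφ
    have := natFn_bool (f := mixedB) (x := ([x 0, x 1], C))
      (by simpa [Encodable.encode_prod_val, hC] using h)
    -- Variables of different parts have positive distance and so cannot be equal.
    refine ⟨.leaf 0, rfl, .leaf fun A _ _ M _ β hβ => tv_false fun hs => ?_⟩
    obtain ⟨u, hu, v, hv, huv⟩ := exists_far_of_mixedB this
      (fun y hy => hcol.col y (by simpa using hy)) hβ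
    rw [sat_eq] at hs
    have : β u = β v := by
      simp only [List.mem_cons, List.not_mem_nil, or_false] at hu hv
      rcases hu with rfl | rfl <;> rcases hv with rfl | rfl <;> simp [hs]
    simp [this] at huv
  · rintro x ⟨h, -⟩
    replace h : natFn sameColB (Nat.pair (x 1) (Nat.pair (x 3) (x 4))) = 1 := h
    change FormulaM K (Nat.pair 1 (Nat.pair (x 0) (x 1))) (x 2) (x 3) 1
      (Nat.pair 1 (Nat.pair (Nat.pair 0 (Nat.pair (x 4) (Nat.pair 1 (Nat.pair (x 0) (x 1))))) (Nat.pair (Nat.pair 0 1) (Nat.pair 0 0))))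
    intro φ C hφ hC _ _
    obtain ⟨R, y, rfl, hy⟩ := Formula.code_eq_one hφ
    have := natFn_bool (f := sameColB) (x := (List.ofFn y, C, x 4))
      (by simpa [Encodable.encode_prod_val, hC, ← hy, tupleCode] using h)
    rw [sameColB_iff] at this
    exact rep_testP hφ (loc_rel fun l => this _ (by simp))
  · rintro x ⟨h, -⟩
    replace h : natFn mixedB (Nat.pair (x 1) (x 3)) = 1 := h
    change FormulaM K (Nat.pair 1 (Nat.pair (x 0) (x 1))) (x 2) (x 3) 1
      (Nat.pair 0 0)
    intro φ C hφ hC _ hcol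
    obtain ⟨R, y, rfl, hy⟩ := Formula.code_eq_one hφ
    have := natFn_bool (f := mixedB) (x := (List.ofFn y, C))
      (by simpa [Encodable.encode_prod_val, hC, ← hy, tupleCode] using h)
    refine ⟨.leaf 0, rfl, .leaf fun A _ _ M _ β hβ => tv_false fun hs => ?_⟩
    obtain ⟨u, hu, v, hv, huv⟩ := exists_far_of_mixedB this
      (fun y hy => hcol.col y (by simpa [Formula.free] using hy)) hβ
    obtain ⟨i, rfl⟩ := (List.mem_ofFn' y _).1 hu
    obtain ⟨j, rfl⟩ := (List.mem_ofFn' y _).1 hv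
    simp only [Formula.Sat] at hs
    exact absurd (edist_le_one_iff.2 (.inr ⟨R, _, hs, ⟨i, rfl⟩, ⟨j, rfl⟩⟩)) (not_le.2 huv)
  · rintro x ⟨h, -⟩
    replace h : natFn sameColB (Nat.pair (x 2) (Nat.pair (x 4) (x 5))) = 1 := h
    change FormulaM K (Nat.pair 2 (Nat.pair (x 0) (Nat.pair (x 1) (x 2)))) (x 3) (x 4) 1
      (Nat.pair 1 (Nat.pair (Nat.pair 0 (Nat.pair (x 5) (Nat.pair 2 (Nat.pair (x 0) (Nat.pair (x 1) (x 2)))))) (Nat.pair (Nat.pair 0 1) (Nat.pair 0 0))))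
    intro φ C hφ hC _ hcol
    obtain ⟨w, s, y, rfl, hs, hy⟩ := Formula.code_eq_two hφ
    have := natFn_bool (f := sameColB) (x := (List.ofFn y, C, x 5))
      (by simpa [Encodable.encode_prod_val, hC, ← hy, tupleCode] using h)
    rw [sameColB_iff] at this
    exact rep_testP hφ (loc_weq (by simpa [Formula.Over] using hcol.constsIn)
      fun l => this _ (by simp))
  · rintro x ⟨h, h0, -⟩
    replace h : natFn mixedB (Nat.pair (x 2) (x 4)) = 1 := h
    replace h0 : x 5 = K.N.zeroTest (x 1) := h0
    change FormulaM K (Nat.pair 2 (Nat.pair (x 0) (Nat.pair (x 1) (x 2)))) (x 3) (x 4) 1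
      (Nat.pair 0 (x 5))
    intro φ C hφ hC _ hcol
    obtain ⟨w, s, y, rfl, hs, hy⟩ := Formula.code_eq_two hφ
    have := natFn_bool (f := mixedB) (x := (List.ofFn y, C))
      (by simpa [Encodable.encode_prod_val, hC, ← hy, tupleCode] using h)
    have hdom : (⟨_, s⟩ : L.Const) ∈ K.N.dom := by simpa [Formula.Over] using hcol.constsIn
    -- The oracle answers for a name; since `s` is in the domain, no other element of the domain has
    -- this name.
    have hz : K.N.zeroTest (x 1) = tv (s = 0) := by
      rw [Coding.zeroTest, tv]
      congr 1
      refine propext ⟨?_, fun h => ⟨_, hdom, hs, h⟩⟩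
      rintro ⟨c, hc, hcx, h⟩
      obtain rfl := K.N.el_injOn hc hdom (hcx.trans hs.symm)
      exact h
    refine ⟨.leaf (x 5), rfl, .leaf fun A _ _ M hM β hβ => ?_⟩
    rw [h0, hz]
    refine tv_congr ?_
    simp only [Formula.Sat]
    suffices hw : M.wt w (fun j => β (y j)) = 0 by rw [hw]
    -- A nonzero weight would force all entries within distance one, but two of them lie in
    -- different parts.
    by_contra hne
    obtain ⟨u, hu, v, hv, huv⟩ := exists_far_of_mixedB this
      (fun y hy => hcol.col y (by simpa [Formula.free] using hy)) hβ
    obtain ⟨i, rfl⟩ := (List.mem_ofFn' y _).1 hu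
    obtain ⟨j, rfl⟩ := (List.mem_ofFn' y _).1 hv
    exact absurd (Kind.edist_le_one_of_wt_ne (κ := .sum w) hM.isWeighted hne i j) (not_le.2 huv)
  · rintro x ⟨h, -⟩
    replace h : TupleM K (x 3) (x 4) (x 1) := h
    change FormulaM K (Nat.pair 7 (Nat.pair (x 0) (x 1))) (x 2) (x 3) 1
      (Nat.pair 1 (Nat.pair (Nat.pair 0 (Nat.pair (x 4) (Nat.pair 7 (Nat.pair (x 0) (x 1))))) (Nat.pair (Nat.pair 0 1) (Nat.pair 0 0))))
    intro φ C hφ hC _ hcol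
    obtain ⟨P, t, rfl, ht⟩ := Formula.code_eq_seven hφ
    have hf := hcol.isFOW
    simp only [Formula.IsFOW] at hf
    refine rep_testP hφ (loc_pred hcol.isFOW hcol.constsIn fun j => ?_)
    exact h C (List.ofFn fun j => ⟨_, t j⟩) hC (by rw [List.map_ofFn]; exact ht) ⟨_, t j⟩
      ((List.mem_ofFn' _ _).2 ⟨j, rfl⟩) (hf.2 j)
  · rintro x ⟨h1, h2, -⟩
    replace h1 : FormulaM K (x 0) (x 1) (x 2) (x 3) (x 4) := h1
    replace h2 : CombM K (encode notE) (x 4) (Nat.pair 0 0) (x 5) := h2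
    change FormulaM K (Nat.pair 3 (x 0)) (x 1) (x 2) (x 3) (x 5)
    intro φ C hφ hC hlt hcol
    obtain ⟨ψ, rfl, hψ⟩ := Formula.code_eq_three hφ
    obtain ⟨T, hT, hr⟩ := h1 ψ C hψ hC hlt
      ⟨by simpa using hcol.isFOW, by simpa using hcol.constsIn, by simpa using hcol.col⟩
    obtain ⟨T', hT', hc⟩ := h2 notE T (.leaf 0) rfl hT rfl
    refine ⟨T', hT', .comb hc hr (F₂ := fun _ _ _ => 0) (.leaf fun _ _ _ _ _ _ _ => rfl) ?_⟩
    intro A _ _ M _ β _ c hc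
    simpa using notE_spec hc
  · rintro x ⟨h1, h2, h3, -⟩
    replace h1 : FormulaM K (x 0) (x 2) (x 3) (x 4) (x 6) := h1
    replace h2 : FormulaM K (x 1) (x 2) (x 3) (x 5) (x 7) := h2
    replace h3 : CombM K (encode orE) (x 6) (x 7) (x 8) := h3
    change FormulaM K (Nat.pair 4 (Nat.pair (x 0) (x 1))) (x 2) (x 3) (max (x 4) (x 5)) (x 8)
    intro φ C hφ hC hlt hcol
    obtain ⟨ψ, χ, rfl, hψ, hχ⟩ := Formula.code_eq_four hφ
    have hf := isFOW_or.1 hcol.isFOW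
    have ho := over_or.1 hcol.constsIn
    obtain ⟨T₁, hT₁, hr₁⟩ := h1 ψ C hψ hC hlt
      ⟨hf.1, ho.1, fun v hv => hcol.col v (by simp [hv])⟩
    obtain ⟨T₂, hT₂, hr₂⟩ := h2 χ C hχ hC hlt
      ⟨hf.2, ho.2, fun v hv => hcol.col v (by simp [hv])⟩
    obtain ⟨T', hT', hc⟩ := h3 orE T₁ T₂ rfl hT₁ hT₂
    refine ⟨T', hT', .comb hc (hr₁.mono (fun _ => subset_rfl) (le_max_left _ _))
      (hr₂.mono (fun _ => subset_rfl) (le_max_right _ _)) ?_⟩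
    intro A _ _ M _ β _ c hc
    simpa using orE_spec hc

end Valid

end WA

namespace WA

-- Dependence on free variables only

section Congruence

variable {L : Lang} {A : Type} {M : Str L A}

theorem Factor.val_congr {i : L.Ty} {f : Factor L i} {β β' : ℕ → A}
    (h : ∀ x ∈ f.vars, β x = β' x) : f.val M β = f.val M β' := by
  cases f with
  | const => rfl
  | wt w y =>
    simp only [Factor.val]
    congr 1
    funext j
    exact h _ (by simp [Factor.vars])

theorem WProd.val_congr {i : L.Ty} {p : WProd L i} {β β' : ℕ → A}
    (h : ∀ x ∈ p.vars, β x = β' x) : p.val M β = p.val M β' := by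
  induction p with
  | single f => exact Factor.val_congr h
  | times hr f p ih =>
    simp only [WProd.vars, Finset.mem_union] at h
    rw [WProd.val, WProd.val, Factor.val_congr fun x hx => h x (.inl hx),
      ih fun x hx => h x (.inr hx)]

theorem extend_congr {ι : Type} {y : ι → ℕ} (hy : Function.Injective y) {a : ι → A}
    {β β' : ℕ → A} {x : ℕ} (h : (∀ i, y i ≠ x) → β x = β' x) :
    Function.extend y a β x = Function.extend y a β' x := by
  by_cases hx : ∃ i, y i = x
  · obtain ⟨i, rfl⟩ := hx
    rw [hy.extend_apply, hy.extend_apply]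
  · rw [Function.extend_apply' _ _ _ hx, Function.extend_apply' _ _ _ hx]
    exact h (not_exists.1 hx)

-- Needed in this generality for the closed tests: aggregation sentences and ground terms, the
-- latter containing sums, must not react to a change of the quantified variables.
mutual

theorem Formula.sat_congr : ∀ (φ : Formula L) {β β' : ℕ → A}, (∀ x ∈ φ.free, β x = β' x) →
    (φ.Sat M β ↔ φ.Sat M β')
  | .eq x y, β, β', h => by simp only [free_eq] at h; simp [h x (by simp), h y (by simp)]
  | .rel R x, β, β', h => by
    simp only [Formula.Sat]
    have : (fun j => β (x j)) = fun j => β' (x j) :=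
      funext fun j => h _ (by simp [Formula.free])
    rw [this]
  | .weq w s x, β, β', h => by
    simp only [Formula.Sat]
    have : (fun j => β (x j)) = fun j => β' (x j) :=
      funext fun j => h _ (by simp [Formula.free])
    rw [this]
  | .neg φ, β, β', h => by
    rw [sat_neg, sat_neg, φ.sat_congr (by simpa using h)]
  | .or φ ψ, β, β', h => by
    rw [sat_or, sat_or, φ.sat_congr fun x hx => h x (by simp [hx]),
      ψ.sat_congr fun x hx => h x (by simp [hx])]
  | .ex y φ, β, β', h => by
    rw [sat_ex, sat_ex]
    refine exists_congr fun a => φ.sat_congr fun x hx => ?_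
    by_cases hxy : x = y
    · rw [hxy, Function.update_self, Function.update_self]
    · rw [Function.update_of_ne hxy, Function.update_of_ne hxy]
      exact h x (by simp [hx, hxy])
  | .agg w s y φ, β, β', h => by
    simp only [Formula.Sat]
    have : ∀ a, φ.Sat M (Function.extend y a β) ↔ φ.Sat M (Function.extend y a β') := fun a =>
      φ.sat_congr fun x hx => extend_congr y.injective fun hy =>
        h x (by simpa [Formula.free, hx] using hy)
    simp only [this]
  | .pred P t, β, β', h => by
    simp only [Formula.Sat]
    have : (fun j => (t j).val M β) = fun j => (t j).val M β' :=
      funext fun j => (t j).val_congr fun x hx => h x (by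
        simp only [Formula.free, Finset.mem_biUnion, Finset.mem_univ, true_and]; exact ⟨j, hx⟩)
    rw [this]

theorem Term.val_congr : ∀ {i : L.Ty} (t : Term L i) {β β' : ℕ → A},
    (∀ x ∈ t.free, β x = β' x) → t.val M β = t.val M β'
  | _, .const i s, β, β', h => by simp only [Term.val]
  | _, .wt w x, β, β', h => by
    simp only [Term.val]
    congr 1
    funext j
    exact h _ (by simp [Term.free])
  | _, .add s t, β, β', h => by
    simp only [Term.free, Finset.mem_union] at h
    simp only [Term.val]
    rw [s.val_congr fun x hx => h x (.inl hx), t.val_congr fun x hx => h x (.inr hx)]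
  | _, .sub s t, β, β', h => by
    simp only [Term.free, Finset.mem_union] at h
    simp only [Term.val]
    rw [s.val_congr fun x hx => h x (.inl hx), t.val_congr fun x hx => h x (.inr hx)]
  | _, .mul hr s t, β, β', h => by
    simp only [Term.free, Finset.mem_union] at h
    simp only [Term.val]
    rw [s.val_congr fun x hx => h x (.inl hx), t.val_congr fun x hx => h x (.inr hx)]
  | _, .sum p φ, β, β', h => by
    simp only [Term.free, Finset.mem_sdiff] at h
    simp only [Term.val]
    refine finsum_congr fun a => ?_
    have h1 : φ.Sat M (Function.extend Subtype.val a β) ↔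
        φ.Sat M (Function.extend Subtype.val a β') :=
      φ.sat_congr fun x hx => extend_congr Subtype.val_injective fun hy =>
        h x ⟨hx, fun hp => hy ⟨x, hp⟩ rfl⟩
    have h2 : p.val M (Function.extend Subtype.val a β) =
        p.val M (Function.extend Subtype.val a β') :=
      WProd.val_congr fun x hx => extend_congr Subtype.val_injective fun hy =>
        absurd rfl (hy ⟨x, hx⟩)
    rw [h2]
    simp only [h1]

end

end Congruence

-- Soundness of the rules for counting terms and for passing through tests

section Valid

variable {L : Lang} (K : Ctx L)

open Encodable (encode)

theorem splitB_iff {V V₁ V₂ : List ℕ} {E E₁ E₂ : List (ℕ × ℕ)}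
    : splitB ((V, V₁, V₂), E, E₁, E₂) = true ↔
    (∀ v, v ∈ V ↔ v ∈ V₁ ∨ v ∈ V₂) ∧ (∀ v ∈ V₁, v ∉ V₂) ∧ (∀ e, e ∈ E ↔ e ∈ E₁ ∨ e ∈ E₂) ∧
      (∀ e ∈ E₁, e.1 ∈ V₁ ∧ e.2 ∈ V₁) ∧ ∀ e ∈ E₂, e.1 ∈ V₂ ∧ e.2 ∈ V₂ := by
  simp only [splitB, inB, Bool.and_eq_true, List.all_eq_true, Bool.or_eq_true, memB_iff,
    Bool.not_eq_true', ← Bool.not_eq_true]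
  constructor
  · rintro ⟨⟨⟨⟨⟨⟨⟨h1, h2⟩, h3⟩, h4⟩, h5⟩, h6⟩, h7⟩, h8⟩
    exact ⟨fun v => ⟨h1 v, fun h => h.elim (fun h => (h2 v h).1) (h3 v)⟩,
      fun v hv => (h2 v hv).2, fun e => ⟨h4 e, fun h => h.elim (h5 e) (h6 e)⟩, h7, h8⟩
  · rintro ⟨h1, h2, h3, h4, h5⟩
    exact ⟨⟨⟨⟨⟨⟨⟨fun v => (h1 v).1, fun v hv => ⟨(h1 v).2 (.inl hv), h2 v hv⟩⟩,
      fun v hv => (h1 v).2 (.inr hv)⟩, fun e => (h3 e).1⟩, fun e he => (h3 e).2 (.inl he)⟩,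
      fun e he => (h3 e).2 (.inr he)⟩, h4⟩, h5⟩

theorem completeB_iff {z : ℕ} {V V' : List ℕ} {F E : List (ℕ × ℕ)} :
    completeB ((z, V, V'), F, E) = true ↔ V.Nodup ∧ z ∉ V ∧ (∀ v, v ∈ V' ↔ v ∈ V) ∧
      (∀ e ∈ F, e.1 ∈ V ∧ e.2 ∈ V) ∧ (∀ e ∈ E, e.1 ∈ V ∧ e.2 ∈ V) ∧ Complete V F E := by
  simp only [completeB, inB, Bool.and_eq_true, List.all_eq_true, Bool.or_eq_true, memB_iff,
    Bool.not_eq_true', ← Bool.not_eq_true, nodupB_iff, decide_eq_true_eq]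
  constructor
  · rintro ⟨⟨⟨⟨⟨⟨⟨h1, h2⟩, h3⟩, h4⟩, h5⟩, h6⟩, h7⟩, h8⟩
    exact ⟨h1, h2, fun v => ⟨h4 v, h3 v⟩, h5, h6, ⟨h7, h8⟩⟩
  · rintro ⟨h1, h2, h3, h5, h6, h7, h8⟩
    exact ⟨⟨⟨⟨⟨⟨⟨h1, h2⟩, fun v => (h3 v).2⟩, fun v => (h3 v).1⟩, h5⟩, h6⟩, h7⟩, h8⟩

theorem valid_countClauses : ∀ c ∈ countClauses K, c.Valid (Meaning K) := by
  simp only [countClauses, List.forall_mem_cons, List.not_mem_nil, false_imp_iff,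
    implies_true, and_true]
  refine ⟨?_, ?_, ?_, ?_⟩
  · rintro x ⟨h1, h2, -⟩
    replace h1 : CountM K (x 0) (x 1) (x 2) (x 3) (x 5) (x 6) (x 7) := h1
    replace h2 : CountM K (x 0) (x 1) (x 2) (x 3) (x 5) (Nat.pair (x 4) (x 6) + 1) (x 8) := h2
    change CountM K (x 0) (x 1) (x 2) (x 3) (Nat.pair (x 4) (x 5) + 1) (x 6)
      (Nat.pair 3 (Nat.pair (x 7) (x 8)))
    intro χ q hχ hl hq V F E hV hF hE
    obtain ⟨e, F, rfl, he, hF⟩ := encode_eq_cons hF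
    obtain ⟨g, hg, hc⟩ := h1 χ q hχ hl hq V F E hV hF hE
    obtain ⟨g', hg', hc'⟩ := h2 χ q hχ hl hq V F (e :: E) hV hF
      (by rw [Encodable.encode_list_cons, he, hE])
    refine ⟨g.sub g', by simp only [Term.code, hg, hg'], hc.sub hc' ?_ ?_⟩
    · intro A M β
      simp only [Pattern, List.forall_mem_cons]
      rcases lt_or_ge ((2 * x 1 + 1 : ℕ) : ℕ∞) (M.gaifman.edist (β e.1) (β e.2)) with h | h
      · have := not_le.2 h; tauto
      · have := not_lt.2 h; tauto
    · intro A M β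
      simp only [Pattern, List.forall_mem_cons, ← not_le]
      tauto
  · rintro x ⟨h1, h2, -⟩
    replace h1 : CountM K (x 0) (x 1) (x 2) (x 3) (x 4) (Nat.pair (x 6) (x 5) + 1) (x 7) := h1
    replace h2 : CountM K (x 0) (x 1) (x 2) (x 3) (Nat.pair (x 6) (x 4) + 1) (x 5) (x 8) := h2
    change CountM K (x 0) (x 1) (x 2) (x 3) (x 4) (x 5) (Nat.pair 2 (Nat.pair (x 7) (x 8)))
    intro χ q hχ hl hq V F E hV hF hE
    -- The pair to be decided occurs in the premises only, so nothing is known about its code; but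
    -- every number codes a pair.
    obtain ⟨e, he⟩ := exists_encode_eq (α := ℕ × ℕ) (x 6)
    obtain ⟨g, hg, hc⟩ := h1 χ q hχ hl hq V F (e :: E) hV hF
      (by rw [Encodable.encode_list_cons, he, hE])
    obtain ⟨g', hg', hc'⟩ := h2 χ q hχ hl hq V (e :: F) E hV
      (by rw [Encodable.encode_list_cons, he, hF]) hE
    refine ⟨g.add g', by simp only [Term.code, hg, hg'], hc.add hc' ?_ ?_⟩
    · intro A M β
      simp only [Pattern, List.forall_mem_cons]
      rcases lt_or_ge ((2 * x 1 + 1 : ℕ) : ℕ∞) (M.gaifman.edist (β e.1) (β e.2)) with h | h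
      · have := not_le.2 h; tauto
      · have := not_lt.2 h; tauto
    · intro A M β
      simp only [Pattern, List.forall_mem_cons, ← not_le]
      tauto
  · rintro x ⟨h1, h2, h3, -⟩
    replace h1 : CountM K (x 0) (x 1) (x 2) (x 5) 0 (x 6) (x 9) := h1
    replace h2 : CountM K (x 0) (x 1) (x 2) (x 7) 0 (x 8) (x 10) := h2
    replace h3 : natFn splitB (Nat.pair (Nat.pair (x 3) (Nat.pair (x 5) (x 7)))
      (Nat.pair (x 4) (Nat.pair (x 6) (x 8)))) = 1 := h3
    change CountM K (x 0) (x 1) (x 2) (x 3) 0 (x 4) (Nat.pair 4 (Nat.pair (x 9) (x 10)))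
    intro χ q hχ hl hq V F E hV hF hE
    obtain rfl := encode_eq_nil hF
    obtain ⟨V₁, hV₁⟩ := exists_encode_eq (α := List ℕ) (x 5)
    obtain ⟨V₂, hV₂⟩ := exists_encode_eq (α := List ℕ) (x 7)
    obtain ⟨E₁, hE₁⟩ := exists_encode_eq (α := List (ℕ × ℕ)) (x 6)
    obtain ⟨E₂, hE₂⟩ := exists_encode_eq (α := List (ℕ × ℕ)) (x 8)
    have h := natFn_bool (f := splitB) (x := ((V, V₁, V₂), E, E₁, E₂))
      (by simpa only [Encodable.encode_prod_val, hV, hV₁, hV₂, hE, hE₁, hE₂] using h3)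
    rw [splitB_iff] at h
    obtain ⟨g, hg, hc⟩ := h1 χ q hχ hl hq V₁ [] E₁ hV₁ rfl hE₁
    obtain ⟨g', hg', hc'⟩ := h2 χ q hχ hl hq V₂ [] E₂ hV₂ rfl hE₂
    refine ⟨g.mul K.eZ.isRing g', by simp only [Term.code, hg, hg'], hc.mul h.1 h.2.1 hc'
      (onlyOn_pattern hl (by simp) h.2.2.2.1) (onlyOn_pattern hl (by simp) h.2.2.2.2) ?_⟩
    intro A M β
    simp only [Pattern, h.1, h.2.2.1, or_imp, forall_and, List.not_mem_nil, false_imp_iff,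
      implies_true, true_and]
    tauto
  · rintro x ⟨h1, h2, -⟩
    replace h1 : AttachedM (x 6) (x 7) := h1
    replace h2 : natFn completeB (Nat.pair (Nat.pair (x 0) (Nat.pair (Nat.pair (x 3) (x 4) + 1)
      (x 7))) (Nat.pair (x 5) (x 6))) = 1 := h2
    change CountM K (x 0) (x 1) (x 2) (Nat.pair (x 3) (x 4) + 1) (x 5) (x 6)
      (natFn (patternFn K) (Nat.pair (Nat.pair (x 0) (Nat.pair (x 1) (x 2)))
        (Nat.pair (Nat.pair (x 3) (x 4) + 1) (Nat.pair (x 5) (x 6)))))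
    intro χ q hχ hl hq V F E hV hF hE
    rw [← hV] at h2 ⊢
    obtain ⟨v₀, V, rfl, -, -⟩ := encode_eq_cons hV
    obtain ⟨V', hV'⟩ := exists_encode_eq (α := List ℕ) (x 7)
    have h := natFn_bool (f := completeB) (x := ((x 0, v₀ :: V, V'), F, E))
      (by simpa only [Encodable.encode_prod_val, hV', hF, hE, Encodable.encode_nat] using h2)
    rw [completeB_iff] at h
    refine ⟨_, ?_, isCount_patternT K.harity hl hq h.1 h.2.1 h.2.2.2.1 h.2.2.2.2.1 h.2.2.2.2.2
      (h1 E V' hE hV') h.2.2.1⟩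
    have := natFn_encode (patternFn K) ((x 0, x 1, x 2), v₀ :: V, F, E)
    simp only [Encodable.encode_prod_val, hF, hE, Encodable.encode_nat] at this
    rw [this, code_patternT, hχ]
    rfl

-- Tests other than local formulas are sentences or ground terms and have no free variables.
variable {K} in
theorem Atom.Holds_congr_of_closed {Y : ℕ → Set ℕ} {q : ℕ} {a : Atom K} (ha : a.Good Y q)
    (hloc : ∀ i ψ, a ≠ .loc i ψ) {A : Type} [Finite A] {M : Str L A} {β β' : ℕ → A} :
    a.Holds M β ↔ a.Holds M β' := by
  cases a with
  | loc i ψ => exact absurd rfl (hloc i ψ)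
  | aggr χ =>
    obtain ⟨w, s, y, lam, rfl, -, hl⟩ := ha
    refine Formula.sat_congr _ fun x hx => ?_
    simp only [Formula.free, Finset.mem_sdiff, Finset.mem_map, Finset.mem_univ, true_and] at hx
    exact absurd (hl.free hx.1) hx.2
  | ge ρ g =>
    simp only [Atom.Holds]
    rw [g.val_congr (β' := β') (by simp [ha.1])]

variable {K} in
theorem Atom.Good.of_closed {Y Y' : ℕ → Set ℕ} {q q' : ℕ} {a : Atom K} (ha : a.Good Y q)
    (hloc : ∀ i ψ, a ≠ .loc i ψ) (hq : q ≤ q') : a.Good Y' q' := by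
  cases a with
  | loc i ψ => exact absurd rfl (hloc i ψ)
  | aggr χ =>
    obtain ⟨w, s, y, lam, h1, h2, hl⟩ := ha
    exact ⟨w, s, y, lam, h1, h2, hl.mono hq subset_rfl⟩
  | ge ρ g => exact ha

/-- Covers both kinds of closed tests. They also stay good when the parts of the colouring change,
as their goodness does not involve the parts. -/
theorem quantM_node_closed {k zs c n q i acc a t e t' e' : ℕ}
    (h1 : QuantM K k zs c n q i acc t t') (h2 : QuantM K k zs c n q i acc e e')
    (ha : ∀ a' : Atom K, a'.code = a → ∀ j ψ, a' ≠ .loc j ψ) :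
    QuantM K k zs c n q i acc (Nat.pair 1 (Nat.pair a (Nat.pair t e)))
      (Nat.pair 1 (Nat.pair a (Nat.pair t' e'))) := by
  intro κ y C hs acc' hacc hloc hi T hT hgood
  obtain ⟨A, T₁, T₂, rfl, hA, hT₁, hT₂⟩ := Tree.code_eq_node hT
  obtain ⟨T₁', hc₁, hr₁⟩ := h1 κ y C hs acc' hacc hloc hi T₁ hT₁ hgood.2.1
  obtain ⟨T₂', hc₂, hr₂⟩ := h2 κ y C hs acc' hacc hloc hi T₂ hT₂ hgood.2.2
  refine ⟨.node A T₁' T₂', by rw [Tree.code, hA, hc₁, hc₂], repQuant_other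
    (hgood.1.of_closed (ha A hA) (by omega)) (fun _ _ _ _ _ => ?_) hr₁ hr₂⟩
  exact Atom.Holds_congr_of_closed hgood.1 (ha A hA)

theorem valid_quantClauses : ∀ c ∈ quantClauses, c.Valid (Meaning K) := by
  simp only [quantClauses, List.forall_mem_cons, List.not_mem_nil, false_imp_iff,
    implies_true, and_true]
  refine ⟨?_, ?_, ?_, ?_⟩
  · rintro x ⟨h, -⟩
    replace h : BaseM K (x 0) (x 1) (x 2) (x 3) (x 4) (x 5) (x 6) (x 7) := h
    change QuantM K (x 0) (x 1) (x 2) (x 3) (x 4) (x 5) (x 6) (Nat.pair 0 1) (x 7)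
    intro κ y C hs acc hacc hloc hi T hT _
    obtain rfl := Tree.code_eq_leaf hT
    obtain ⟨T', hT', hr⟩ := h κ y C hs acc hacc hloc hi
    exact ⟨T', hT', repQuant_one hr⟩
  · rintro x ⟨h1, h2, h3, -⟩
    replace h1 : QuantM K (x 0) (x 1) (x 2) (x 3) (x 4) (x 5) (x 6) (x 9) (x 11) := h1
    replace h2 : QuantM K (x 0) (x 1) (x 2) (x 3) (x 4) (x 5) (x 6) (x 10) (x 12) := h2
    replace h3 : natFn neB (encode (x 7, x 5)) = 1 := h3
    change QuantM K (x 0) (x 1) (x 2) (x 3) (x 4) (x 5) (x 6)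
      (Nat.pair 1 (Nat.pair (Nat.pair 0 (Nat.pair (x 7) (x 8))) (Nat.pair (x 9) (x 10))))
      (Nat.pair 1 (Nat.pair (Nat.pair 0 (Nat.pair (x 7) (x 8))) (Nat.pair (x 11) (x 12))))
    intro κ y C hs acc hacc hloc hi T hT hgood
    obtain ⟨A, T₁, T₂, rfl, hA, hT₁, hT₂⟩ := Tree.code_eq_node hT
    obtain ⟨ψ, rfl, hψ⟩ := Atom.code_eq_loc hA
    obtain ⟨T₁', hc₁, hr₁⟩ := h1 κ y C hs acc hacc hloc hi T₁ hT₁ hgood.2.1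
    obtain ⟨T₂', hc₂, hr₂⟩ := h2 κ y C hs acc hacc hloc hi T₂ hT₂ hgood.2.2
    refine ⟨.node (.loc (x 7) ψ) T₁' T₂', by rw [Tree.code, hA, hc₁, hc₂],
      repQuant_loc ?_ hgood.1 hr₁ hr₂⟩
    simpa [neB] using natFn_bool h3
  · rintro x ⟨h1, h2, -⟩
    refine quantM_node_closed K h1 h2 fun a ha j ψ h => ?_
    rw [h] at ha
    obtain ⟨χ, h', -⟩ := Atom.code_eq_aggr ha
    cases h'
  · rintro x ⟨h1, h2, -⟩
    refine quantM_node_closed K h1 h2 fun a ha j ψ h => ?_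
    rw [h] at ha
    obtain ⟨χ, h', -⟩ := Atom.code_eq_ge ha
    cases h'

end Valid

end WA

namespace WA

-- Patterns in the rules evaluate to the intended codes

section Evaluation

variable {L : Lang} {K : Ctx L} {κ : Kind L} {y : Fin κ.ar ↪ ℕ} {C : List (ℕ × ℕ)}
  {x : ℕ → ℕ}

open Encodable (encode)

theorem headI_ofFn : (List.ofFn y).headI = κ.fst y := by
  have h : ∀ (k : ℕ) (hk : 0 < k) (f : Fin k → ℕ), (List.ofFn f).headI = f ⟨0, hk⟩ := by
    intro k hk f
    cases k with
    | zero => omega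
    | succ k => simp [List.ofFn_succ]
  exact h _ κ.ar_pos y

theorem ev_head {zs : Pat} (hz : zs.ev x = tupleCode y) : (Pat.head zs).ev x = κ.fst y := by
  change natFn (fun l : List ℕ => l.headI) (zs.ev x) = _
  rw [hz, tupleCode, natFn_encode]
  exact headI_ofFn

theorem ev_self {zs : Pat} (hz : zs.ev x = tupleCode y) :
    (Pat.self zs).ev x = (Formula.eq (κ.fst y) (κ.fst y) : Formula L).code K.N := by
  change Nat.pair 0 (Nat.pair ((Pat.head zs).ev x) ((Pat.head zs).ev x)) = _
  rw [ev_head hz, Formula.code]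

theorem ev_recol {zs i c : Pat} (hz : zs.ev x = tupleCode y) (hc : c.ev x = encode C) :
    (Pat.recol zs i c).ev x = encode (recolY y C (i.ev x)) := by
  change natFn recolFn (Nat.pair (zs.ev x) (Nat.pair (i.ev x) (c.ev x))) = _
  have := natFn_encode recolFn (List.ofFn y, i.ev x, C)
  simp only [Encodable.encode_prod_val, Encodable.encode_nat] at this
  rw [hz, hc, tupleCode, this]
  rfl

theorem ev_near {c n i p zs : Pat} (hz : zs.ev x = tupleCode y) (hc : c.ev x = encode C) :
    (Pat.near K c n i p zs).ev x =
      (nearYF y C (n.ev x) (p.ev x) (i.ev x) : Formula L).code K.N := by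
  change natFn (nearFn K) (Nat.pair ((Pat.recol zs n c).ev x)
    (Nat.pair (i.ev x) (Nat.pair (p.ev x) (zs.ev x)))) = _
  have := natFn_encode (nearFn K) (recolY y C (n.ev x), i.ev x, p.ev x, List.ofFn y)
  simp only [Encodable.encode_prod_val, Encodable.encode_nat] at this
  rw [ev_recol hz hc, hz, tupleCode, this, nearFn, nearYF, headI_ofFn]

theorem ev_scat {c n i p zs a k : Pat} {acc : Formula L} (hz : zs.ev x = tupleCode y)
    (hc : c.ev x = encode C) (ha : a.ev x = acc.code K.N) :
    (Pat.scat K c n i p zs a k).ev x = (nearScatF (recolY y C (n.ev x)) (i.ev x) (p.ev x)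
      (κ.fst y) acc (varBound (κ.fst y) (recolY y C (n.ev x))) (k.ev x)).code K.N := by
  change natFn (scatFn K) (Nat.pair (Nat.pair ((Pat.recol zs n c).ev x)
    (Nat.pair (i.ev x) (p.ev x))) (Nat.pair (zs.ev x) (Nat.pair (a.ev x) (k.ev x)))) = _
  have := natFn_encode (scatFn K) ((recolY y C (n.ev x), i.ev x, p.ev x), List.ofFn y,
    acc.code K.N, k.ev x)
  simp only [Encodable.encode_prod_val, Encodable.encode_nat] at this
  rw [ev_recol hz hc, hz, ha, tupleCode, this, scatFn, code_nearScatF, headI_ofFn]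

theorem ev_form {e : κ.V} {zs a : Pat} {φ : Formula L} (hz : zs.ev x = tupleCode y)
    (ha : a.ev x = φ.code K.N) : (Pat.form K κ e zs a).ev x = (κ.form e y φ).code K.N := by
  cases κ with
  | ex =>
    change Nat.pair 5 (Nat.pair ((Pat.head zs).ev x) (a.ev x)) = _
    rw [ev_head hz, ha]
    change _ = (Formula.ex (Kind.ex.fst y) φ).code K.N
    simp only [Formula.code]
  | sum w =>
    change Nat.pair 6 (Nat.pair (K.N.wt w) (Nat.pair (K.N.el ⟨_, e⟩)
      (Nat.pair (zs.ev x) (a.ev x)))) = _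
    rw [hz, ha]
    change _ = (Formula.agg w e y φ).code K.N
    simp only [Formula.code]
    rfl

theorem ev_and {a b : Pat} {φ ψ : Formula L} (ha : a.ev x = φ.code K.N)
    (hb : b.ev x = ψ.code K.N) : (Pat.and a b).ev x = (φ.and ψ).code K.N := by
  change Nat.pair 3 (Nat.pair 4 (Nat.pair (Nat.pair 3 (a.ev x)) (Nat.pair 3 (b.ev x)))) = _
  rw [ha, hb]
  simp only [Formula.and, Formula.code]

theorem ev_neg {a : Pat} {φ : Formula L} (ha : a.ev x = φ.code K.N) :
    (Pat.neg a).ev x = φ.neg.code K.N := by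
  change Nat.pair 3 (a.ev x) = _
  rw [ha]
  simp only [Formula.code]

theorem ev_nest {mk : κ.V → Pat} {mk' : κ.V → Atom K} (h : ∀ e, (mk e).ev x = (mk' e).code)
    (l : List κ.V) : (Pat.nest K κ mk l).ev x = (nest κ mk' l).code := by
  induction l with
  | nil => rfl
  | cons e l ih =>
    change Nat.pair 1 (Nat.pair ((mk e).ev x) (Nat.pair (Nat.pair 0 (κ.lab K e))
      ((Pat.nest K κ mk l).ev x))) = _
    rw [h, ih]
    rfl

theorem ev_nearTree {zs c n q i a : Pat} {acc : Formula L} (hz : zs.ev x = tupleCode y)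
    (hc : c.ev x = encode C) (ha : a.ev x = acc.code K.N) :
    (Pat.nearTree K κ zs c n q i a).ev x =
      (nearTree K y C (n.ev x) (q.ev x) (i.ev x) acc).code := by
  refine ev_nest (fun e => ?_) _
  change Nat.pair 0 (Nat.pair (i.ev x) ((Pat.form K κ e zs _).ev x)) = _
  rw [ev_form hz (ev_and (ev_near hz hc) ha)]
  rfl

end Evaluation

-- Soundness of the rules for quantifiers

section Valid

variable {L : Lang} (K : Ctx L)

open Encodable (encode)

variable {K} in
theorem lt_of_natFn {a b : ℕ} (h : natFn ltB (Nat.pair a b) = 1) : a < b := by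
  have := natFn_bool (f := ltB) (x := (a, b)) h
  simp [ltB] at this
  omega

theorem valid_kindClauses (κ : Kind L) : ∀ c ∈ kindClauses K κ, c.Valid (Meaning K) := by
  simp only [kindClauses, List.forall_mem_cons, List.not_mem_nil, false_imp_iff,
    implies_true, and_true]
  refine ⟨?_, ?_, ?_, ?_, ?_, ?_, ?_⟩
  · rintro x -
    change NearM K (κ.id K) (x 1) (x 2) (x 3) (x 4) (x 5) 0 (Nat.pair 0 (κ.lab K 0))
    intro κ' y C hs φ hφ hi hcol
    obtain rfl := Kind.id_injective hs.id_eq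
    exact ⟨.leaf (κ'.lab K 0), rfl, .leaf fun _ _ _ _ _ _ _ => by simp⟩
  · rintro x ⟨h1, h2, h3, h4, h5, -⟩
    replace h1 : NearM K (κ.id K) (x 1) (x 2) (x 3) (x 4) (x 5) (x 6) (x 7) := h1
    replace h2 : FormulaM K (x 5) (x 3) ((Pat.recol (.var 1) (.var 6) (.var 2)).ev x) (x 4)
      (x 8) := h2
    replace h3 : QuantM K (κ.id K) (x 1) (x 2) (x 3) (x 4) (x 6) ((Pat.self (.var 1)).ev x)
      (x 8) (x 9) := h3
    replace h4 : CombM K (encode (κ.plusE K)) (x 7) (x 9) (x 10) := h4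
    replace h5 : natFn ltB (Nat.pair (x 6) (x 3)) = 1 := h5
    change NearM K (κ.id K) (x 1) (x 2) (x 3) (x 4) (x 5) (x 6 + 1) (x 10)
    intro κ' y C hs φ hφ hi hcol
    obtain rfl := Kind.id_injective hs.id_eq
    have hz : (Pat.var 1).ev x = tupleCode y := hs.tuple_eq.symm
    have hC : (Pat.var 2).ev x = encode C := hs.col_eq.symm
    have hlt := lt_of_natFn h5
    rw [ev_recol hz hC] at h2
    rw [ev_self (K := K) hz] at h3
    obtain ⟨T₁, hT₁, hr₁⟩ := h1 κ' y C hs φ hφ hlt.le hcol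
    obtain ⟨T₂, hT₂, hr₂⟩ := h2 φ _ hφ rfl (colLt_recolY hs.colLt hlt le_rfl) (hcol _)
    obtain ⟨T₃, hT₃, hr₃⟩ := h3 κ' y C hs _ rfl loc_self hlt.le T₂ hT₂ hr₂.good
    obtain ⟨T, hT, hc⟩ := h4 _ T₁ T₃ rfl hT₁ hT₃
    exact ⟨T, hT, rep_sum_succ hs.fin hc hr₁ (rep_guard hs.colLt hlt.le hr₃ hr₂)⟩
  · rintro x -
    change QuantM K (κ.id K) (x 1) (x 2) (x 3) (x 4) (x 5) (x 6) (Nat.pair 0 0)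
      (Nat.pair 0 (κ.lab K 0))
    intro κ' y C hs acc hacc hloc hi T hT _
    obtain rfl := Kind.id_injective hs.id_eq
    obtain rfl := Tree.code_eq_leaf hT
    exact ⟨.leaf (κ'.lab K 0), rfl, repQuant_zero⟩
  · rintro x ⟨h1, h2, h3, -⟩
    replace h1 : QuantM K (κ.id K) (x 1) (x 2) (x 3) (x 4) (x 5)
      ((Pat.and (.var 6) (.var 8)).ev x) (x 9) (x 11) := h1
    replace h2 : QuantM K (κ.id K) (x 1) (x 2) (x 3) (x 4) (x 5)
      ((Pat.and (.var 6) (.neg (.var 8))).ev x) (x 10) (x 12) := h2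
    replace h3 : CombM K (encode (κ.plusE K)) (x 11) (x 12) (x 13) := h3
    change QuantM K (κ.id K) (x 1) (x 2) (x 3) (x 4) (x 5) (x 6) (Nat.pair 1
      (Nat.pair (Nat.pair 0 (Nat.pair (x 5) (x 8))) (Nat.pair (x 9) (x 10)))) (x 13)
    intro κ' y C hs acc hacc hloc hi T hT hgood
    obtain rfl := Kind.id_injective hs.id_eq
    obtain ⟨A, T₁, T₂, rfl, hA, hT₁, hT₂⟩ := Tree.code_eq_node hT
    obtain ⟨ψ, rfl, hψ⟩ := Atom.code_eq_loc hA
    have ha : (Pat.var 6).ev x = acc.code K.N := hacc.symm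
    have hψ' : (Pat.var 8).ev x = ψ.code K.N := hψ.symm
    obtain ⟨T₁', hc₁, hr₁⟩ := h1 κ' y C hs _ (ev_and ha hψ').symm (hloc.and hgood.1) hi T₁ hT₁
      hgood.2.1
    obtain ⟨T₂', hc₂, hr₂⟩ := h2 κ' y C hs _ (ev_and ha (ev_neg hψ')).symm
      (hloc.and (Loc.neg hgood.1)) hi T₂ hT₂ hgood.2.2
    obtain ⟨T, hT, hc⟩ := h3 _ T₁' T₂' rfl hc₁ hc₂
    exact ⟨T, hT, repQuant_own hs.fin hc hr₁ hr₂⟩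
  · rintro x ⟨h, -⟩
    replace h : natFn ltB (Nat.pair (x 5) (x 3)) = 1 := h
    change BaseM K (κ.id K) (x 1) (x 2) (x 3) (x 4) (x 5) (x 6)
      ((Pat.nearTree K κ (.var 1) (.var 2) (.var 3) (.var 4) (.var 5) (.var 6)).ev x)
    intro κ' y C hs acc hacc hloc hi
    obtain rfl := Kind.id_injective hs.id_eq
    rw [ev_nearTree (zs := .var 1) (c := .var 2) (a := .var 6) hs.tuple_eq.symm hs.col_eq.symm
      hacc.symm]
    exact ⟨_, rfl, rep_near_of_lt (lt_of_natFn h) (rep_nearTree hs.fin (lt_of_natFn h) hloc)⟩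
  · rintro x -
    change AccM K (κ.id K) (x 1) (x 2) (x 3) (x 4) (x 5) 0 (Nat.pair 0 (κ.lab K 0))
    intro κ' y C hs acc hacc hloc hi
    obtain rfl := Kind.id_injective hs.id_eq
    exact ⟨.leaf (κ'.lab K 0), rfl, .leaf fun _ _ _ _ _ _ _ => by simp⟩
  · rintro x ⟨h1, h2, h3, -⟩
    replace h1 : AccM K (κ.id K) (x 1) (x 2) (x 3) (x 4) (x 5) (x 6) (x 7) := h1
    replace h2 : CombM K (encode (κ.plusE K)) (x 7)
      ((Pat.nearTree K κ (.var 1) (.var 2) (.var 3) (.var 4) (.var 6) (.var 5)).ev x)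
      (x 8) := h2
    replace h3 : natFn ltB (Nat.pair (x 6) (x 3)) = 1 := h3
    change AccM K (κ.id K) (x 1) (x 2) (x 3) (x 4) (x 5) (x 6 + 1) (x 8)
    intro κ' y C hs acc hacc hloc hi
    obtain rfl := Kind.id_injective hs.id_eq
    have hlt := lt_of_natFn h3
    rw [ev_nearTree (zs := .var 1) (c := .var 2) (a := .var 5) hs.tuple_eq.symm hs.col_eq.symm
      hacc.symm] at h2
    obtain ⟨T₁, hT₁, hr₁⟩ := h1 κ' y C hs acc hacc hloc hlt.le
    obtain ⟨T, hT, hc⟩ := h2 _ T₁ _ rfl hT₁ rfl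
    refine ⟨T, hT, rep_sum_succ hs.fin hc hr₁ (rep_nearTree hs.fin hlt (hloc.mono le_rfl ?_))⟩
    -- The condition is local around the quantified variables alone, hence also around every part
    -- that contains them.
    rw [part_recolY_fresh hs.colLt, part_recolY_self]
    exact Set.subset_union_right

/-- A colouring of the free variables of a quantified formula extends to the formula. -/
theorem Coloured.of_form {κ : Kind L} {e : κ.V} {y : Fin κ.ar ↪ ℕ} {φ : Formula L}
    {C : List (ℕ × ℕ)} (h : Coloured K C (κ.form e y φ)) :
    κ.Fin' ∧ ∀ j, Coloured K (recolY y C j) φ := by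
  have key : κ.Fin' ∧ φ.IsFOW ∧ φ.Over K.N.dom ∧
      ∀ v ∈ φ.free, v ∉ Set.range y → v ∈ (κ.form e y φ).free := by
    have h1 := h.isFOW
    have h2 := h.constsIn
    cases κ with
    | ex =>
      simp only [Kind.form, isFOW_ex, over_ex] at h1 h2
      refine ⟨trivial, h1, h2, fun v hv hy => ?_⟩
      simp only [Kind.form, free_ex, Finset.mem_sdiff, Finset.mem_singleton]
      exact ⟨hv, fun h => hy ⟨_, h.symm⟩⟩
    | sum w =>
      simp only [Kind.form, Formula.IsFOW, Formula.Over] at h1 h2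
      refine ⟨h1.1, h1.2, h2.2, fun v hv hy => ?_⟩
      simp only [Kind.form, Formula.free, Finset.mem_sdiff]
      refine ⟨hv, fun h => hy ?_⟩
      obtain ⟨i, -, hi⟩ := Finset.mem_map.1 h
      exact ⟨i, hi⟩
  refine ⟨key.1, fun j => ⟨key.2.1, key.2.2.1, fun v hv => ?_⟩⟩
  by_cases hy : v ∈ Set.range y
  · exact ⟨j, by rw [recolY, col_recol, if_pos ((List.mem_ofFn' y v).2 hy)]⟩
  · obtain ⟨i, hi⟩ := h.col v (key.2.2.2 v hv hy)
    exact ⟨i, by rw [recolY, col_recol, if_neg fun h => hy ((List.mem_ofFn' y v).1 h), hi]⟩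

/-- The hypothesis is an inversion principle: whatever has the code described by `a` is a quantified
formula with the tuple and the matrix that the premises refer to. The matrix is used with colours
`0, …, n`, the last one being fresh. -/
theorem valid_formClause (κ : Kind L) (e : κ.V) {a zs : Pat}
    (h : ∀ (x : ℕ → ℕ) (φ : Formula L), φ.code K.N = a.ev x → ∃ (y : Fin κ.ar ↪ ℕ)
      (ψ : Formula L), φ = κ.form e y ψ ∧ tupleCode y = zs.ev x ∧ ψ.code K.N = x 1) :
    (formClause K κ e a zs).Valid (Meaning K) := by
  rintro x ⟨h1, h2, h3, h4, h5, -⟩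
  replace h1 : NearM K (κ.id K) (zs.ev x) (x 3) (x 2) (x 4) (x 1) (x 2) (x 5) := h1
  replace h2 : FormulaM K (x 1) (x 2 + 1) ((Pat.recol zs (.var 2) (.var 3)).ev x) (x 4)
    (x 6) := h2
  replace h3 : QuantM K (κ.id K) (zs.ev x) (x 3) (x 2) (x 4) (x 2) ((Pat.self zs).ev x)
    (x 6) (x 7) := h3
  replace h4 : CombM K (encode (κ.plusE K)) (x 5) (x 7) (x 8) := h4
  replace h5 : CombM K (encode (κ.eqE K e)) (x 8) (Nat.pair 0 0) (x 9) := h5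
  change FormulaM K (a.ev x) (x 2) (x 3) (4 * x 4 + 5) (x 9)
  intro φ C hφ hC hlt hcol
  obtain ⟨y, ψ, rfl, hy, hψ⟩ := h x φ hφ
  obtain ⟨hfin, hcol⟩ := hcol.of_form
  have hs : Setup K (κ.id K) (zs.ev x) (x 3) (x 2) κ y C := ⟨rfl, hy, hC, hfin, hlt⟩
  rw [ev_recol hy.symm (c := .var 3) hC.symm] at h2
  rw [ev_self (K := K) hy.symm] at h3
  obtain ⟨T₁, hT₁, hr₁⟩ := h1 κ y C hs ψ hψ le_rfl hcol
  obtain ⟨T₂, hT₂, hr₂⟩ := h2 ψ _ hψ rfl (colLt_recolY hlt (Nat.lt_succ_self _)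
    (Nat.le_succ _)) (hcol _)
  obtain ⟨T₃, hT₃, hr₃⟩ := h3 κ y C hs _ rfl loc_self le_rfl T₂ hT₂ hr₂.good
  obtain ⟨T₄, hT₄, hc₄⟩ := h4 _ T₁ T₃ rfl hT₁ hT₃
  obtain ⟨T, hT, hc⟩ := h5 _ T₄ (.leaf 0) rfl hT₄ rfl
  exact ⟨T, hT, rep_form hfin hc₄ hc hr₁ (rep_guard hlt le_rfl hr₃ hr₂)⟩

theorem valid_sumClauses (w : L.Wt) (hw : Finite (L.El (L.tyW w))) :
    ∀ c ∈ sumClauses K w, c.Valid (Meaning K) := by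
  rw [sumClauses, List.forall_mem_cons]
  refine ⟨?_, fun c hc => ?_⟩
  · rintro x ⟨h1, h2, -⟩
    replace h1 : AccM K ((Kind.sum w).id K) (x 1) (x 2) (x 3) (x 4) (x 6) (x 3) (x 7) := h1
    replace h2 : CombM K (encode (minusE K w)) ((Pat.nest K (.sum w)
      (fun e => .aggr (.form K (.sum w) e (.var 1) (.var 6))) (Kind.sum w).vals).ev x) (x 7)
      (x 8) := h2
    change BaseM K ((Kind.sum w).id K) (x 1) (x 2) (x 3) (x 4) (x 3) (x 6) (x 8)
    intro κ y C hs acc hacc hloc hi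
    obtain rfl := Kind.id_injective hs.id_eq
    have hmk : ∀ e : (Kind.sum w).V, (Pat.aggr (.form K (.sum w) e (.var 1) (.var 6))).ev x =
        (Atom.aggr ((Kind.sum w).form e y acc) : Atom K).code := fun e => congrArg
      (Nat.pair 1) (ev_form (zs := .var 1) (a := .var 6) hs.tuple_eq.symm hacc.symm)
    rw [ev_nest hmk] at h2
    obtain ⟨T₁, hT₁, hr₁⟩ := h1 _ y C hs acc hacc hloc le_rfl
    obtain ⟨T, hT, hc⟩ := h2 _ _ T₁ rfl rfl hT₁
    exact ⟨T, hT, rep_farSum hs.fin hs.colLt hloc hc hr₁⟩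
  · obtain ⟨e, -, rfl⟩ := List.mem_map.1 hc
    refine valid_formClause K (.sum w) e fun x φ hφ => ?_
    replace hφ : φ.code K.N = Nat.pair 6 (Nat.pair (K.N.wt w) (Nat.pair (K.N.el ⟨_, e⟩)
      (Nat.pair (x 0) (x 1)))) := hφ
    obtain ⟨w', s, y, ψ, rfl, hw', hs, hy, hψ⟩ := Formula.code_eq_six hφ
    obtain rfl := K.N.wt_inj hw'
    obtain rfl := el_inj hw hs
    exact ⟨y, ψ, rfl, hy, hψ⟩

theorem valid_existsClauses : ∀ c ∈ existsClauses K, c.Valid (Meaning K) := by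
  simp only [existsClauses, List.forall_mem_cons, List.not_mem_nil, false_imp_iff,
    implies_true, and_true]
  refine ⟨?_, ?_, ?_, ?_, ?_, ?_, ?_⟩
  · refine valid_formClause K .ex _ fun x φ hφ => ?_
    replace hφ : φ.code K.N = Nat.pair 5 (Nat.pair (x 0) (x 1)) := hφ
    obtain ⟨ψ, rfl, hψ⟩ := Formula.code_eq_five hφ
    exact ⟨⟨fun _ => x 0, fun i j _ => Subsingleton.elim (α := Fin 1) i j⟩, ψ, rfl, rfl, hψ⟩
  · rintro x ⟨h1, h2, h3, -⟩
    replace h1 : RingM K (x 1) (x 2) (x 3) (x 4) (x 6) (x 3) (x 7) := h1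
    replace h2 : LargeM K (x 1) (x 2) (x 3) (x 4) (x 6) (x 3) 0 0 (x 8) := h2
    replace h3 : CombM K (encode orE) (x 7) (x 8) (x 9) := h3
    change BaseM K 0 (x 1) (x 2) (x 3) (x 4) (x 3) (x 6) (x 9)
    intro κ y C hs acc hacc hloc _
    obtain rfl := Kind.id_injective (a₂ := Kind.ex) hs.id_eq
    obtain ⟨T₁, hT₁, hr₁⟩ := h1 y C hs acc hacc hloc le_rfl
    obtain ⟨T₂, hT₂, hr₂⟩ := h2 y C hs acc hacc hloc le_rfl
    obtain ⟨T, hT, hc⟩ := h3 _ T₁ T₂ rfl hT₁ hT₂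
    exact ⟨T, hT, rep_farEx hc hr₁ hr₂⟩
  · rintro x ⟨h, -⟩
    replace h : CountM K ((Pat.head (.var 1)).ev x) (x 4 + 1) (x 5)
      (natFn varsFn (Nat.pair (x 1) (x 6))) (natFn pairsFn (Nat.pair (x 1) (x 6))) 0 (x 7) := h
    change LargeM K (x 1) (x 2) (x 3) (x 4) (x 5) 0 0 (x 6) (Nat.pair 1 (Nat.pair
      (Nat.pair 2 (Nat.pair (x 4 + 1) (x 7))) (Nat.pair (Nat.pair 0 1) (Nat.pair 0 0))))
    intro y C hs acc hacc hloc _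
    have h1 : natFn varsFn (Nat.pair (x 1) (x 6)) =
        encode (varList (Kind.ex.fst y + 1) (x 6 + 1)) := by
      rw [← hs.tuple_eq, ← headI_ofFn]
      exact natFn_encode varsFn (List.ofFn y, x 6)
    have h2 : natFn pairsFn (Nat.pair (x 1) (x 6)) =
        encode (pairs (varList (Kind.ex.fst y + 1) (x 6 + 1))) := by
      rw [← hs.tuple_eq, ← headI_ofFn]
      exact natFn_encode pairsFn (List.ofFn y, x 6)
    rw [ev_head (zs := .var 1) hs.tuple_eq.symm, h1, h2] at h
    obtain ⟨g, hg, hc⟩ := h acc (x 4) hacc (by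
      rwa [part_recolY_fresh hs.colLt, range_ex] at hloc) (by omega) _ _ [] rfl rfl rfl
    refine ⟨_, ?_, repLarge_zero hs.colLt hloc hc⟩
    simp only [Tree.code, Atom.code, hg]
  · rintro x ⟨h1, h2, h3, -⟩
    replace h1 : LargeM K (x 1) (x 2) (x 3) (x 4) (x 5) (x 6 + 1) (x 7 + 1) (x 8) (x 9) := h1
    replace h2 : LargeM K (x 1) (x 2) (x 3) (x 4) (x 5) (x 6) 0 (x 8 + x 7) (x 10) := h2
    replace h3 : natFn ltB (Nat.pair (x 6) (x 3)) = 1 := h3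
    change LargeM K (x 1) (x 2) (x 3) (x 4) (x 5) (x 6 + 1) (x 7) (x 8) (Nat.pair 1 (Nat.pair
      (Nat.pair 0 (Nat.pair (x 6) ((Pat.scat K (.var 2) (.var 3) (.var 6) (.succ (.var 4)) (.var 1)
        (.var 5) (.succ (.var 7))).ev x))) (Nat.pair (x 9) (x 10))))
    intro y C hs acc hacc hloc hj
    have hlt := lt_of_natFn h3
    rw [ev_scat (zs := .var 1) (c := .var 2) (a := .var 5) hs.tuple_eq.symm hs.col_eq.symm
      hacc.symm]
    obtain ⟨T₁, hT₁, hr₁⟩ := h1 y C hs acc hacc hloc hj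
    obtain ⟨T₂, hT₂, hr₂⟩ := h2 y C hs acc hacc hloc hlt.le
    refine ⟨_, ?_, repLarge_node hs.colLt hlt hloc lt_varBound.1 (lt_varBound.2 _) hr₁ hr₂⟩
    simp only [Tree.code, Atom.code, hT₁, hT₂]
    rfl
  · rintro x ⟨h, -⟩
    replace h : LargeM K (x 1) (x 2) (x 3) (x 4) (x 5) (x 6) 0 (x 8 + x 2) (x 9) := h
    change LargeM K (x 1) (x 2) (x 3) (x 4) (x 5) (x 6 + 1) (x 2) (x 8) (x 9)
    intro y C hs acc hacc hloc hj
    obtain ⟨T, hT, hr⟩ := h y C hs acc hacc hloc (by omega)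
    -- The rule stops at the code of `C`, which is at hand in the judgement and bounds the length of
    -- `C`.
    exact ⟨T, hT, repLarge_stop (hs.col_eq ▸ Encodable.length_le_encode C) hr⟩
  · rintro x -
    change RingM K (x 1) (x 2) (x 3) (x 4) (x 5) 0 (Nat.pair 0 0)
    intro y C hs acc hacc hloc hj
    exact ⟨.leaf 0, rfl, .leaf fun _ _ _ _ _ _ _ => tv_false (by simp)⟩
  · rintro x ⟨h1, h2, -⟩
    replace h1 : RingM K (x 1) (x 2) (x 3) (x 4) (x 5) (x 6) (x 7) := h1
    replace h2 : natFn ltB (Nat.pair (x 6) (x 3)) = 1 := h2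
    intro y C hs acc hacc hloc hj
    have hz : (Pat.var 1).ev x = tupleCode y := hs.tuple_eq.symm
    have hC : (Pat.var 2).ev x = encode C := hs.col_eq.symm
    have hev : (Pat.form K .ex (1 : ℕ) (.var 1)
        (.and (.near K (.var 2) (.var 3) (.var 6) (.rad' (.var 4)) (.var 1))
          (.and (.var 5) (.neg (.near K (.var 2) (.var 3) (.var 6) (.succ (.var 4))
            (.var 1)))))).ev x = (ringF y C (x 3) (x 4 + 1) (x 6) acc).code K.N :=
      ev_form hz (ev_and (ev_near hz hC) (ev_and (a := .var 5) hacc.symm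
        (ev_neg (ev_near hz hC))))
    obtain ⟨T, hT, hr⟩ := h1 y C hs acc hacc hloc ((Nat.le_succ _).trans hj)
    refine ⟨_, ?_, rep_ring_succ hs.colLt hloc (lt_of_natFn h2) hr⟩
    simp only [Tree.code, Atom.code, hT]
    exact congrArg (fun t => Nat.pair 1 (Nat.pair (Nat.pair 0 (Nat.pair (x 6) t))
      (Nat.pair (Nat.pair 0 1) (x 7)))) hev.symm

end Valid

end WA

namespace WA

-- Soundness of the output rules

section Output

variable {L : Lang} {K : Ctx L}

open Encodable (encode)

theorem mem_of_mem_part_recol {x : List ℕ} {i v : ℕ} (h : v ∈ part (recol x 0 []) i) :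
    v ∈ x ∧ i = 0 := by
  rw [mem_part, col_recol] at h
  split_ifs at h with hv
  · exact ⟨hv, (Option.some.inj h).symm⟩
  · simp [col] at h

/-- There is only one colour, so there are no two nonempty parts to be separated. -/
theorem far_recol {x : List ℕ} {A : Type} {M : Str L A} {β : ℕ → A} {q : ℕ} :
    Far M β (part (recol x 0 [])) q := fun _ _ hij _ hu _ hv =>
  absurd ((mem_of_mem_part_recol hu).2.trans (mem_of_mem_part_recol hv).2.symm) hij

theorem sat_padF {x : List ℕ} {ψ : Formula L} {A : Type} {M : Str L A} {β : ℕ → A} :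
    (padF x ψ).Sat M β ↔ ψ.Sat M β := by
  induction x with
  | nil => rfl
  | cons v x ih => exact sat_and.trans ⟨fun h => ih.1 h.2, fun h => ⟨sat_eq.2 rfl, ih.2 h⟩⟩

theorem free_padF {x : List ℕ} {ψ : Formula L} : (padF x ψ).free = x.toFinset ∪ ψ.free := by
  induction x with
  | nil => simp [padF]
  | cons v x ih =>
    have : (padF (v :: x) ψ).free = {v, v} ∪ (padF x ψ).free := by
      rw [← free_eq (L := L), ← free_and]; rfl
    rw [this, ih]
    ext u
    simp

theorem loc_padF {x : List ℕ} {ψ : Formula L} {D : Set L.Const} {q : ℕ} {X : Set ℕ}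
    (h : Loc D q X ψ) (hx : ∀ v ∈ x, v ∈ X) : Loc D q X (padF x ψ) := by
  induction x with
  | nil => exact h
  | cons v x ih =>
    exact (loc_eq (hx v (by simp)) (hx v (by simp))).and (ih fun v hv => hx v (by simp [hv]))

/-- Conjunctions with `v = v` produce exactly the prescribed free variables without affecting truth
or locality. -/
theorem isOutput_loc {x : List ℕ} (hx : x ≠ []) {q i : ℕ} {ψ : Formula L}
    (h : Loc K.N.dom q (part (recol x 0 []) i) ψ) :
    IsOutput K x q (.loc (padF x ψ)) [] fun _ M β => ψ.Sat M β := by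
  have hsub : part (recol x 0 []) i ⊆ (x.toFinset : Set ℕ) := fun v hv => by
    simpa using (mem_of_mem_part_recol hv).1
  have hl : Loc K.N.dom q (x.toFinset : Set ℕ) (padF x ψ) :=
    loc_padF (h.mono le_rfl hsub) fun v hv => by simpa using hv
  refine ⟨⟨hx, hl.isFOW, ?_, hl.isLocal⟩, hl.constsIn, .nil, fun _ _ _ _ _ _ => sat_padF⟩
  rw [free_padF, Finset.union_eq_left]
  exact Finset.coe_subset.1 (h.free.trans hsub)

theorem isOutput_ge {x : List ℕ} {q ρ : ℕ} {g : Term L (L.tyW K.one)} (h : g.free = ∅)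
    (h' : g.IsCl ρ) (ho : g.Over K.N.dom) {P : (A : Type) → Str L A → (ℕ → A) → Prop}
    (hP : ∀ (A : Type) [Finite A] [Nonempty A] (M : Str L A), Adm K M → ∀ β : ℕ → A,
      1 ≤ K.eZ.toInt (g.val M β) ↔ P A M β) :
    IsOutput K x q (.geOne g) [ρ] P :=
  ⟨⟨h, ρ, h'⟩, ho, .cons h' .nil, hP⟩

/-- The variables `0` for summation and `1` for substitution are chosen once and for all. With a
single summation variable there are no distances to prescribe, and the count is positive iff some
element satisfies `χ`. -/
theorem isOutput_sentence {x : List ℕ} {q p : ℕ} {χ : Formula L} (h : Loc K.N.dom p {1} χ)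
    {P : (A : Type) → Str L A → (ℕ → A) → Prop}
    (hP : ∀ (A : Type) [Finite A] [Nonempty A] (M : Str L A) (β : ℕ → A),
      (∃ a, χ.Sat M (Function.update β 1 a)) ↔ P A M β) :
    IsOutput K x q (.geOne (patternT K.one K.harity K.eZ 1 χ (2 * p + 1) 0 [] [] [])) [p] P := by
  have hc := isCount_patternT (D := K.N.dom) (eZ := K.eZ) K.harity h le_rfl (v₀ := 0) (V := [])
    (F := []) (E := []) (by simp) (by simp) (by simp) (by simp) ⟨by simp [pairs], by simp⟩
    (.single 0) (by simp)
  refine isOutput_ge hc.free hc.isCl hc.constsIn fun A _ _ M hM β => ?_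
  rw [IsCount.one_le_iff (b := 0) (k := 1) h hc hM.isWeighted hM.one_eq, ← hP A M β]
  constructor
  · rintro ⟨s, hs, hsub, -⟩
    obtain ⟨a, rfl⟩ := Finset.card_eq_one.1 hs
    exact ⟨a, hsub (by simp)⟩
  · rintro ⟨a, ha⟩
    exact ⟨{a}, by simp, by simpa using ha, by simp⟩

theorem code_sentence {χ : Formula L} {p : ℕ} :
    natFn (patternFn K) (Nat.pair (Nat.pair 1 (Nat.pair p (χ.code K.N)))
      (Nat.pair (Nat.pair 0 0 + 1) (Nat.pair 0 0))) =
    (patternT K.one K.harity K.eZ 1 χ (2 * p + 1) 0 [] [] []).code K.N := by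
  have := natFn_encode (patternFn K) ((1, p, χ.code K.N), [0], [], [])
  simp only [Encodable.encode_prod_val, Encodable.encode_nat, Encodable.encode_list_cons,
    Encodable.encode_list_nil] at this
  rw [code_patternT]
  exact this

theorem IsOutput.neg {x : List ℕ} {q : ℕ} {θ : ClForm L (L.tyW K.one)} {radii : List ℕ}
    {P : (A : Type) → Str L A → (ℕ → A) → Prop} (h : IsOutput K x q θ radii P) :
    IsOutput K x q (.neg θ) radii fun A M β => ¬ P A M β :=
  ⟨h.isNormal, h.constsIn, h.radii, fun A _ _ M hM β => not_congr (h.sat_iff A M hM β)⟩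

theorem IsOutput.or {x : List ℕ} {q : ℕ} {θ η : ClForm L (L.tyW K.one)} {ρ ρ' : List ℕ}
    {P Q : (A : Type) → Str L A → (ℕ → A) → Prop} (h : IsOutput K x q θ ρ P)
    (h' : IsOutput K x q η ρ' Q) :
    IsOutput K x q (.or θ η) (ρ ++ ρ') fun A M β => P A M β ∨ Q A M β :=
  ⟨⟨h.isNormal, h'.isNormal⟩, ⟨h.constsIn, h'.constsIn⟩, List.rel_append h.radii h'.radii,
    fun A _ _ M hM β => or_congr (h.sat_iff A M hM β) (h'.sat_iff A M hM β)⟩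

theorem IsOutput.congr {x : List ℕ} {q : ℕ} {θ : ClForm L (L.tyW K.one)} {ρ : List ℕ}
    {P Q : (A : Type) → Str L A → (ℕ → A) → Prop} (h : IsOutput K x q θ ρ P)
    (hP : ∀ A M β, P A M β ↔ Q A M β) : IsOutput K x q θ ρ Q :=
  ⟨h.isNormal, h.constsIn, h.radii, fun A _ _ M hM β => (h.sat_iff A M hM β).trans (hP A M β)⟩

variable (K)

theorem isOutput_truth (x : List ℕ) (q : ℕ) : IsOutput K x q
    (.geOne (patternT K.one K.harity K.eZ 1 (.eq 1 1) (2 * 0 + 1) 0 [] [] [])) [0]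
      fun _ _ _ => True :=
  isOutput_sentence (loc_eq rfl rfl) fun A _ _ M β => by simp

theorem code_truth (x : ℕ → ℕ) : (truthP K).ev x = ClForm.code K.N
    (.geOne (patternT K.one K.harity K.eZ 1 (.eq 1 1) (2 * 0 + 1) 0 [] [] [])) := by
  have := code_sentence (K := K) (χ := .eq 1 1) (p := 0)
  rw [ClForm.code, ← this]
  simp only [Formula.code]
  rfl

theorem valid_outputClauses : ∀ c ∈ outputClauses K, c.Valid (Meaning K) := by
  simp only [outputClauses, List.forall_mem_cons, List.not_mem_nil, false_imp_iff,
    implies_true, and_true]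
  refine ⟨?_, ?_, ?_, ?_, ?_, ?_, ?_, ?_⟩
  · rintro x -
    change OutAtomM K (Nat.pair (x 0) (x 1) + 1) (x 2) (Nat.pair 0 (Nat.pair (x 3) (x 4)))
      (Nat.pair 0 (natFn padFn (Nat.pair (Nat.pair (x 0) (x 1) + 1) (x 4)))) 0
    intro l a hl ha hgood
    obtain ⟨ψ, rfl, hψ⟩ := Atom.code_eq_loc ha
    have hne : l ≠ [] := by rintro rfl; simp at hl
    refine ⟨_, _, ?_, rfl, isOutput_loc hne hgood⟩
    have := natFn_encode padFn (l, x 4)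
    simp only [Encodable.encode_prod_val, Encodable.encode_nat] at this
    rw [← hl, this, ClForm.code, code_padF, hψ]
    rfl
  · rintro x -
    change OutAtomM K 0 (x 2) (Nat.pair 0 (Nat.pair (x 3) (x 4))) (Nat.pair 2
      (natFn (patternFn K) (Nat.pair (Nat.pair 1 (Nat.pair (x 2) (x 4)))
        (Nat.pair (Nat.pair 0 0 + 1) (Nat.pair 0 0))))) (Nat.pair (x 2) 0 + 1)
    intro l a hl ha hgood
    obtain rfl := encode_eq_nil hl
    obtain ⟨ψ, rfl, hψ⟩ := Atom.code_eq_loc ha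
    -- Without variables no part is inhabited, so the test is local around the empty set. Its truth
    -- value is independent of the assignment, and it can be expressed by a count.
    replace hgood : Loc K.N.dom (x 2) ∅ ψ := Loc.mono hgood le_rfl fun v hv =>
      absurd (mem_of_mem_part_recol hv).1 (by simp)
    refine ⟨_, _, ?_, rfl, isOutput_sentence (hgood.mono le_rfl (Set.empty_subset _))
      fun A _ _ M β => ?_⟩
    · rw [← hψ, code_sentence, ClForm.code]
    · have : ∀ a, ψ.Sat M (Function.update β 1 a) ↔ ψ.Sat M β := fun a =>
        hgood.sat_congr (by simp)
      simp only [this, exists_const]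
      rfl
  · rintro x -
    change OutAtomM K (x 0) (x 2) (Nat.pair 1 (x 4)) (Nat.pair 1 (x 4)) 0
    intro l a hl ha hgood
    obtain ⟨χ, rfl, hχ⟩ := Atom.code_eq_aggr ha
    refine ⟨.aggr χ, [], by rw [ClForm.code, hχ], rfl, ?_, ?_, .nil, fun _ _ _ _ _ _ => Iff.rfl⟩
    · obtain ⟨w, s, y, lam, rfl, hw, hlam⟩ := hgood
      have hmap : ((Finset.univ.map y : Finset ℕ) : Set ℕ) = Set.range y := by simp
      refine ⟨by simp only [Formula.IsFOW]; exact ⟨hw, hlam.isFOW⟩, w, s, y, lam, rfl, ?_, ?_⟩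
      · rw [← Finset.coe_subset, hmap]; exact hlam.free
      · rw [← hmap] at hlam; exact hlam.isLocal
    · obtain ⟨w, s, y, lam, rfl, hw, hlam⟩ := hgood
      simp only [ClForm.Over, Formula.Over]
      exact ⟨K.N.fin_mem w hw s, hlam.constsIn⟩
  · rintro x -
    change OutAtomM K (x 0) (x 2) (Nat.pair 2 (Nat.pair (x 3) (x 4))) (Nat.pair 2 (x 4))
      (Nat.pair (x 3) 0 + 1)
    intro l a hl ha hgood
    obtain ⟨g, rfl, hg⟩ := Atom.code_eq_ge ha
    exact ⟨.geOne g, [x 3], by rw [ClForm.code, hg], rfl,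
      isOutput_ge hgood.1 hgood.2.1 hgood.2.2 fun _ _ _ _ _ _ => Iff.rfl⟩
  · rintro x -
    change OutM K (x 0) (x 2) (Nat.pair 0 1) ((truthP K).ev x) (Nat.pair 0 0 + 1)
    intro l T hl hT _
    obtain rfl := Tree.code_eq_leaf hT
    exact ⟨_, _, (code_truth K x).symm, rfl, (isOutput_truth K l (x 2)).congr fun _ _ _ => by
      simp [Tree.eval]⟩
  · rintro x -
    change OutM K (x 0) (x 2) (Nat.pair 0 0) (Nat.pair 3 ((truthP K).ev x)) (Nat.pair 0 0 + 1)
    intro l T hl hT _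
    obtain rfl := Tree.code_eq_leaf hT
    refine ⟨.neg _, _, ?_, rfl, (isOutput_truth K l (x 2)).neg.congr fun _ _ _ => by
      simp [Tree.eval]⟩
    rw [ClForm.code, code_truth]
  · rintro x ⟨h1, h2, h3, -⟩
    replace h1 : OutAtomM K (x 0) (x 2) (x 3) (x 6) (x 9) := h1
    replace h2 : OutM K (x 0) (x 2) (x 4) (x 7) (x 10) := h2
    replace h3 : OutM K (x 0) (x 2) (x 5) (x 8) (x 11) := h3
    change OutM K (x 0) (x 2) (Nat.pair 1 (Nat.pair (x 3) (Nat.pair (x 4) (x 5))))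
      (Nat.pair 4 (Nat.pair
        (Nat.pair 3 (Nat.pair 4 (Nat.pair (Nat.pair 3 (x 6)) (Nat.pair 3 (x 7)))))
        (Nat.pair 3 (Nat.pair 4 (Nat.pair (Nat.pair 3 (Nat.pair 3 (x 6))) (Nat.pair 3 (x 8)))))))
      (natFn appendFn (Nat.pair (natFn appendFn (Nat.pair (x 9) (x 10)))
        (natFn appendFn (Nat.pair (x 9) (x 11)))))
    intro l T hl hT hgood
    obtain ⟨a, T₁, T₂, rfl, ha, hT₁, hT₂⟩ := Tree.code_eq_node hT
    obtain ⟨θ, ρ, hθ, hρ, ho⟩ := h1 l a hl ha hgood.1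
    obtain ⟨θ₁, ρ₁, hθ₁, hρ₁, ho₁⟩ := h2 l T₁ hl hT₁ hgood.2.1
    obtain ⟨θ₂, ρ₂, hθ₂, hρ₂, ho₂⟩ := h3 l T₂ hl hT₂ hgood.2.2
    -- A node becomes "test and first subtree, or not test and second subtree". The test is written
    -- twice, hence its radii are listed twice.
    refine ⟨_, _, ?_, ?_, ((ho.neg.or ho₁.neg).neg.or (ho.neg.neg.or ho₂.neg).neg).congr
      fun A M β => ?_⟩
    · simp only [ClForm.code, hθ, hθ₁, hθ₂]
    · have happ : ∀ l l' : List ℕ, natFn appendFn (Nat.pair (encode l) (encode l')) =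
          encode (l ++ l') := fun l l' => natFn_encode appendFn (l, l')
      rw [← hρ, ← hρ₁, ← hρ₂, happ, happ, happ]
    · by_cases h : a.Holds M β
      · rw [Tree.eval_pos h]; tauto
      · rw [Tree.eval_neg h]; tauto
  · rintro x ⟨h1, h2, -⟩
    replace h1 : FormulaM K (x 0) 1 (natFn recolFn (Nat.pair (x 1) (Nat.pair 0 0))) (x 2)
      (x 3) := h1
    replace h2 : OutM K (x 1) (x 2) (x 3) (x 4) (x 5) := h2
    change ResultM K (x 0) (x 1) (Nat.pair (x 4) (Nat.pair (x 5) (x 2)))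
    intro φ l hφ hl hf ho hfree
    have hc : natFn recolFn (Nat.pair (x 1) (Nat.pair 0 0)) = encode (recol l 0 []) := by
      rw [← hl]
      exact natFn_encode recolFn (l, 0, [])
    rw [hc] at h1
    obtain ⟨T, hT, hr⟩ := h1 φ _ hφ rfl
      (fun v j hj => by have := (mem_of_mem_part_recol (x := l) (i := j) hj).2; omega)
      ⟨hf, ho, fun v hv => ⟨0, by rw [col_recol, if_pos (by simpa using hfree hv)]⟩⟩
    obtain ⟨θ, ρ, hθ, hρ, hout⟩ := h2 l T hl hT hr.good
    refine ⟨θ, ρ, x 2, by rw [hθ, hρ], hout.isNormal, hout.constsIn, hout.radii,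
      fun A _ _ M hM β => ?_⟩
    rw [hout.sat_iff A M hM β, hr.eval_eq A M hM β far_recol, tv_eq_one]

/-- Soundness of the whole system. The rules for a sum are present only for weights of finite type,
as their validity requires. -/
theorem meaning_of_der {j : List ℕ} (h : Der (clauses K) K.N.zeroTest j) : Meaning K j := by
  refine h.of_valid (fun _ => rfl) fun c hc => ?_
  simp only [clauses, List.mem_append, List.mem_flatMap] at hc
  rcases hc with ((((((((((hc | hc) | hc) | hc) | hc) | hc) | hc) | hc) | hc) | hc) |
    ⟨w, hw, hc | hc⟩)
  · exact valid_condClauses K c hc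
  · exact valid_attachedClauses K c hc
  · exact valid_countClauses K c hc
  · exact valid_combClauses K c hc
  · exact valid_termClauses K c hc
  · exact valid_formulaClauses K c hc
  · exact valid_quantClauses K c hc
  · exact valid_existsClauses K c hc
  · exact valid_outputClauses K c hc
  · exact valid_kindClauses K _ c hc
  · exact valid_kindClauses K _ c hc
  · exact valid_sumClauses K w (mem_finWts.1 hw) c hc

end Output

end WA

namespace WA

/-! ### Derivations exist -/

section Rules

variable {L : Lang} {K : Ctx L}

open Encodable (encode)

variable (K) in
/-- Derivability by the rules of the algorithm -/
def Derivable (j : List ℕ) : Prop := Der (clauses K) K.N.zeroTest j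

/-- The assignment given by a list -/
def asg (v : List ℕ) (k : ℕ) : ℕ := v.getD k 0

theorem Derivable.of_mem {c : Clause} (hc : c ∈ clauses K) (v : List ℕ)
    (h : Premises (Derivable K) (asg v) c.body) :
    Derivable K (c.head.map (Pat.ev (asg v))) := by
  have he : Pat.eval v = Pat.ev (asg v) := funext (Pat.eval_eq_ev v)
  have key : ∀ bs : List (List Pat), Premises (Derivable K) (asg v) bs →
      ∀ b ∈ bs, Der (clauses K) K.N.zeroTest (b.map (Pat.eval v)) := by
    intro bs h
    induction bs with
    | nil => simp
    | cons b bs ih =>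
      rw [List.forall_mem_cons, he]
      exact ⟨h.1, he ▸ ih h.2⟩
  have := Der.rule (O := K.N.zeroTest) c hc v (key _ h)
  rwa [he] at this

/-- Rules are addressed by their position in their list, and the valuation is given as a list in the
order of the variables. -/
theorem Derivable.rule {l : List Clause} (hl : ∀ c ∈ l, c ∈ clauses K) (i : ℕ) {c : Clause}
    (hc : l[i]? = some c) (v : List ℕ) (h : Premises (Derivable K) (asg v) c.body) :
    Derivable K (c.head.map (Pat.ev (asg v))) :=
  .of_mem (hl c (List.mem_of_getElem? hc)) v h

theorem mem_clauses_of_cond {c : Clause} (h : c ∈ condClauses) : c ∈ clauses K := by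
  simp [clauses, h]

theorem mem_clauses_of_attached {c : Clause} (h : c ∈ attachedClauses) : c ∈ clauses K := by
  simp [clauses, h]

theorem mem_clauses_of_count {c : Clause} (h : c ∈ countClauses K) : c ∈ clauses K := by
  simp [clauses, h]

theorem mem_clauses_of_comb {c : Clause} (h : c ∈ combClauses) : c ∈ clauses K := by
  simp [clauses, h]

theorem mem_clauses_of_term {c : Clause} (h : c ∈ termClauses) : c ∈ clauses K := by
  simp [clauses, h]

theorem mem_clauses_of_formula {c : Clause} (h : c ∈ formulaClauses) : c ∈ clauses K := by
  simp [clauses, h]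

theorem mem_clauses_of_quant {c : Clause} (h : c ∈ quantClauses) : c ∈ clauses K := by
  simp [clauses, h]

theorem mem_clauses_of_exists {c : Clause} (h : c ∈ existsClauses K) : c ∈ clauses K := by
  simp [clauses, h]

theorem mem_clauses_of_output {c : Clause} (h : c ∈ outputClauses K) : c ∈ clauses K := by
  simp [clauses, h]

theorem mem_clauses_of_kind {κ : Kind L} (hκ : κ.Fin') {c : Clause} (h : c ∈ kindClauses K κ) :
    c ∈ clauses K := by
  cases κ with
  | ex => simp [clauses, h]
  | sum w =>
    have : ∃ w ∈ finWts L, c ∈ kindClauses K (.sum w) ∨ c ∈ sumClauses K w :=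
      ⟨w, mem_finWts.2 hκ, .inl h⟩
    simp [clauses, this]

theorem mem_clauses_of_sum {w : L.Wt} (hw : Finite (L.El (L.tyW w))) {c : Clause}
    (h : c ∈ sumClauses K w) : c ∈ clauses K := by
  have : ∃ w ∈ finWts L, c ∈ kindClauses K (.sum w) ∨ c ∈ sumClauses K w :=
    ⟨w, mem_finWts.2 hw, .inr h⟩
  simp [clauses, this]

theorem der_cond {α : Type} [Primcodable α] {f : α → Bool} {x : α} (h : f x = true) {m : ℕ}
    (hm : encode x = m) : Derivable K [2, natFn f m] := by
  have : natFn f m = 1 := by rw [← hm, natFn_encode, h]; rfl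
  rw [this]
  have := Derivable.rule (K := K) (fun _ => mem_clauses_of_cond) 0 rfl [] trivial
  exact this

theorem der_attached {E : List (ℕ × ℕ)} {V : List ℕ} (h : Attached E V) :
    Derivable K [3, encode E, encode V] := by
  induction h with
  | single v =>
    have := Derivable.rule (K := K) (fun _ => mem_clauses_of_attached) 0 rfl [encode E, v]
      trivial
    exact this
  | @cons u v V _ hu h ih =>
    have hc : attachB ((u, v), V, E) = true := by simp [attachB, hu, h]
    have := Derivable.rule (K := K) (fun _ => mem_clauses_of_attached) 1 rfl
      [encode E, u, v, encode V] ⟨ih, der_cond hc rfl, trivial⟩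
    exact this

end Rules

/-! #### Counting terms -/

section Count

variable {L : Lang} {K : Ctx L} {z p : ℕ} {χ : Formula L} {V : List ℕ} {F E : List (ℕ × ℕ)}

open Encodable (encode)

variable (K) in
/-- A counting term is derivable. -/
def CountDer (z p : ℕ) (χ : Formula L) (V : List ℕ) (F E : List (ℕ × ℕ)) : Prop :=
  ∃ g : Term L (L.tyW K.one), Derivable K
    [4, z, p, χ.code K.N, encode V, encode F, encode E, g.code K.N]

theorem CountDer.far {e : ℕ × ℕ} (h : CountDer K z p χ V F E)
    (h' : CountDer K z p χ V F (e :: E)) : CountDer K z p χ V (e :: F) E := by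
  obtain ⟨g, hg⟩ := h
  obtain ⟨g', hg'⟩ := h'
  refine ⟨g.sub g', ?_⟩
  have := Derivable.rule (K := K) (fun _ => mem_clauses_of_count) 0 rfl
    [z, p, χ.code K.N, encode V, encode e, encode F, encode E, g.code K.N, g'.code K.N]
    ⟨hg, hg', trivial⟩
  simp only [Term.code]
  exact this

theorem CountDer.decide {e : ℕ × ℕ} (h : CountDer K z p χ V F (e :: E))
    (h' : CountDer K z p χ V (e :: F) E) : CountDer K z p χ V F E := by
  obtain ⟨g, hg⟩ := h
  obtain ⟨g', hg'⟩ := h'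
  refine ⟨g.add g', ?_⟩
  have := Derivable.rule (K := K) (fun _ => mem_clauses_of_count) 1 rfl
    [z, p, χ.code K.N, encode V, encode F, encode E, encode e, g.code K.N, g'.code K.N]
    ⟨hg, hg', trivial⟩
  simp only [Term.code]
  exact this

theorem CountDer.split {V₁ V₂ : List ℕ} {E₁ E₂ : List (ℕ × ℕ)} (h₁ : CountDer K z p χ V₁ [] E₁)
    (h₂ : CountDer K z p χ V₂ [] E₂) (h : splitB ((V, V₁, V₂), E, E₁, E₂) = true) :
    CountDer K z p χ V [] E := by
  obtain ⟨g, hg⟩ := h₁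
  obtain ⟨g', hg'⟩ := h₂
  refine ⟨g.mul K.eZ.isRing g', ?_⟩
  have := Derivable.rule (K := K) (fun _ => mem_clauses_of_count) 2 rfl
    [z, p, χ.code K.N, encode V, encode E, encode V₁, encode E₁, encode V₂, encode E₂,
      g.code K.N, g'.code K.N] ⟨hg, hg', der_cond h rfl, trivial⟩
  simp only [Term.code]
  exact this

theorem CountDer.pattern {V' : List ℕ} {v₀ : ℕ} (h : Attached E V')
    (hc : completeB ((z, v₀ :: V, V'), F, E) = true) : CountDer K z p χ (v₀ :: V) F E := by
  refine ⟨patternT K.one K.harity K.eZ z χ (2 * p + 1) v₀ V F E, ?_⟩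
  have := Derivable.rule (K := K) (fun _ => mem_clauses_of_count) 3 rfl
    [z, p, χ.code K.N, v₀, encode V, encode F, encode E, encode V']
    ⟨der_attached h, der_cond hc rfl, trivial⟩
  rw [code_patternT]
  have hp := natFn_encode (patternFn K) ((z, p, χ.code K.N), v₀ :: V, F, E)
  simp only [Encodable.encode_prod_val, Encodable.encode_nat, Encodable.encode_list_cons] at hp
  rw [patternFn] at hp
  simp only [List.headI, List.tail] at hp
  rw [← hp]
  exact this

theorem swap_not_mem_pairs (hV : V.Nodup) {e : ℕ × ℕ} (he : e ∈ pairs V) : e.swap ∉ pairs V := by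
  induction V with
  | nil => simp [pairs] at he
  | cons v V ih =>
    rw [List.nodup_cons] at hV
    simp only [pairs, List.mem_append, List.mem_map] at he ⊢
    rintro (⟨u, hu, h⟩ | h)
    · rcases he with ⟨u', hu', rfl⟩ | he
      · simp only [Prod.swap, Prod.mk.injEq] at h
        exact hV.1 (h.1 ▸ hu')
      · have := (mem_of_mem_pairs he).2
        have h1 : e.2 = v := by rw [← Prod.fst_swap, ← h]
        exact hV.1 (h1 ▸ this)
    · rcases he with ⟨u', hu', rfl⟩ | he
      · exact hV.1 (mem_of_mem_pairs h).2
      · exact ih hV.2 he h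

/-- If the edges in `E` connect all variables, the undecided pairs `U` are decided one after the
other. -/
theorem countDer_of_attached (hV : V.Nodup) (hz : z ∉ V) {V' : List ℕ} (hV' : Attached E V')
    (hmem : ∀ v, v ∈ V' ↔ v ∈ V) (hF : ∀ e ∈ F, e ∈ pairs V)
    (hE : ∀ e ∈ E, e.1 ∈ V ∧ e.2 ∈ V) (hFE : ∀ e ∈ F, e ∉ E ∧ e.swap ∉ E)
    (U : List (ℕ × ℕ)) (hU : ∀ e ∈ U, e ∈ pairs V)
    (hcov : ∀ e ∈ pairs V, e ∈ U ∨ e ∈ F ∨ e ∈ E ∨ e.swap ∈ E) : CountDer K z p χ V F E := by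
  induction U generalizing F E with
  | nil =>
    have hc : Complete V F E := ⟨fun e he => (hcov e he).resolve_left (by simp),
      fun e he => ⟨ne_of_mem_pairs hV (hF e he), hFE e he⟩⟩
    cases V with
    | nil =>
      have hw : ∃ w, w ∈ V' := by cases hV' <;> simp
      obtain ⟨w, hw⟩ := hw
      exact absurd ((hmem w).1 hw) (by simp)
    | cons v₀ V =>
      exact .pattern hV' (completeB_iff.2 ⟨hV, hz, hmem,
        fun e he => mem_of_mem_pairs (hF e he), hE, hc⟩)
  | cons e U ih =>
    have heV := hU e (by simp)
    by_cases hd : e ∈ F ∨ e ∈ E ∨ e.swap ∈ E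
    · refine ih hV' hF hE hFE (fun e he => hU e (by simp [he])) fun e' he' => ?_
      rcases hcov e' he' with h | h
      · rcases List.mem_cons.1 h with rfl | h
        · exact .inr hd
        · exact .inl h
      · exact .inr h
    · simp only [not_or] at hd
      -- The pair is declared close in one term and far in the other. In both cases `E` still
      -- connects all variables, and one undecided pair less remains.
      refine .decide (e := e) ?_ ?_
      · refine ih (hV'.mono fun e he => by simp [he]) hF ?_ ?_ (fun e he => hU e (by simp [he])) ?_
        · rw [List.forall_mem_cons]
          exact ⟨mem_of_mem_pairs heV, hE⟩
        · intro f hf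
          simp only [List.mem_cons, not_or]
          refine ⟨⟨fun h => hd.1 (h ▸ hf), (hFE f hf).1⟩, fun h => ?_, (hFE f hf).2⟩
          exact swap_not_mem_pairs hV (hF f hf) (h ▸ heV)
        · intro e' he'
          rcases hcov e' he' with h | h | h | h
          · rcases List.mem_cons.1 h with rfl | h
            · exact .inr (.inr (.inl (by simp)))
            · exact .inl h
          · exact .inr (.inl h)
          · exact .inr (.inr (.inl (by simp [h])))
          · exact .inr (.inr (.inr (by simp [h])))
      · refine ih hV' ?_ hE ?_ (fun e he => hU e (by simp [he])) ?_
        · rw [List.forall_mem_cons]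
          exact ⟨heV, hF⟩
        · rw [List.forall_mem_cons]
          exact ⟨hd.2, hFE⟩
        · intro e' he'
          rcases hcov e' he' with h | h | h
          · rcases List.mem_cons.1 h with rfl | h
            · exact .inr (.inl (by simp))
            · exact .inl h
          · exact .inr (.inl (by simp [h]))
          · exact .inr (.inr h)

/-- As long as an edge leads out of the attached list, the list can be extended; its length is
bounded by that of `V`. -/
theorem exists_component {W : List ℕ} (hW : Attached E W) (hn : W.Nodup) (hWV : W ⊆ V) :
    ∃ W, Attached E W ∧ W.Nodup ∧ W ⊆ V ∧
      ∀ u ∈ W, ∀ v ∈ V, v ∉ W → (u, v) ∉ E ∧ (v, u) ∉ E := by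
  induction hm : V.length - W.length using Nat.strong_induction_on generalizing W with
  | _ m ih =>
    by_cases h : ∀ u ∈ W, ∀ v ∈ V, v ∉ W → (u, v) ∉ E ∧ (v, u) ∉ E
    · exact ⟨W, hW, hn, hWV, h⟩
    · push Not at h
      obtain ⟨u, hu, v, hv, hvW, h⟩ := h
      have hn' : (v :: W).Nodup := List.nodup_cons.2 ⟨hvW, hn⟩
      have hsub : (v :: W) ⊆ V := List.cons_subset.2 ⟨hv, hWV⟩
      have hlen := (List.subperm_of_subset hn' hsub).length_le
      refine ih _ ?_ (.cons hW hu ?_) hn' hsub rfl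
      · simp only [List.length_cons] at hlen ⊢
        omega
      · by_cases h1 : (u, v) ∈ E
        · exact .inl h1
        · exact .inr (h h1)

/-- If `E` connects the variables, the remaining pairs are decided. Otherwise a connected component
is split off: with no far conditions around, no condition links it to the rest, and both factors
have fewer variables. -/
theorem countDer_nil (hV : V.Nodup) (hne : V ≠ []) (hz : z ∉ V)
    (hE : ∀ e ∈ E, e.1 ∈ V ∧ e.2 ∈ V) : CountDer K z p χ V [] E := by
  induction hm : V.length using Nat.strong_induction_on generalizing V E with
  | _ m ih =>
    obtain ⟨v₀, V₀, rfl⟩ := List.exists_cons_of_ne_nil hne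
    obtain ⟨W, hW, hn, hWV, hcl⟩ := exists_component (V := v₀ :: V₀) (E := E) (.single v₀)
      (by simp) (by simp)
    by_cases hall : ∀ v ∈ v₀ :: V₀, v ∈ W
    · exact countDer_of_attached hV hz hW (fun v => ⟨fun h => hWV h, hall v⟩) (by simp) hE
        (by simp) _ (fun e he => he) fun e he => .inl he
    · push Not at hall
      obtain ⟨v, hv, hvW⟩ := hall
      have hWne : ∃ w, w ∈ W := by cases hW <;> simp
      obtain ⟨w, hw⟩ := hWne
      have h1 : W.length < (v₀ :: V₀).length := by
        have := (List.subperm_of_subset (List.nodup_cons.2 ⟨hvW, hn⟩)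
          (List.cons_subset.2 ⟨hv, hWV⟩)).length_le
        simpa using this
      have h2 : ((v₀ :: V₀).filter (· ∉ W)).length < (v₀ :: V₀).length :=
        List.length_filter_lt_length_iff_exists.2 ⟨w, hWV hw, by simpa using hw⟩
      have hsep : ∀ e ∈ E, e.1 ∈ W ↔ e.2 ∈ W := by
        intro e he
        constructor
        · intro h
          by_contra h'
          exact (hcl _ h _ (hE e he).2 h').1 he
        · intro h
          by_contra h'
          exact (hcl _ h _ (hE e he).1 h').2 he
      refine .split (V₁ := W) (V₂ := (v₀ :: V₀).filter (· ∉ W)) (E₁ := E.filter (·.1 ∈ W))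
        (E₂ := E.filter (·.1 ∉ W)) (ih _ (hm ▸ h1) hn (List.ne_nil_of_mem hw)
          (fun h => hz (hWV h)) ?_ rfl) (ih _ (hm ▸ h2) (hV.filter _)
          (List.ne_nil_of_mem (a := v) (List.mem_filter.2 ⟨hv, by simpa using hvW⟩))
          (fun h => hz (List.mem_filter.1 h).1) ?_ rfl) (splitB_iff.2 ⟨?_, ?_, ?_, ?_, ?_⟩)
      · intro e he
        simp only [List.mem_filter, decide_eq_true_eq] at he
        exact ⟨he.2, (hsep e he.1).1 he.2⟩
      · intro e he
        simp only [List.mem_filter, decide_eq_true_eq] at he ⊢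
        exact ⟨⟨(hE e he.1).1, he.2⟩, (hE e he.1).2, fun h => he.2 ((hsep e he.1).2 h)⟩
      · intro u
        simp only [List.mem_filter, decide_eq_true_eq]
        have := @hWV u
        tauto
      · intro u hu
        simp [hu]
      · intro e
        simp only [List.mem_filter, decide_eq_true_eq]
        tauto
      · intro e he
        simp only [List.mem_filter, decide_eq_true_eq] at he
        exact ⟨he.2, (hsep e he.1).1 he.2⟩
      · intro e he
        simp only [List.mem_filter, decide_eq_true_eq] at he ⊢
        exact ⟨⟨(hE e he.1).1, he.2⟩, (hE e he.1).2, fun h => he.2 ((hsep e he.1).2 h)⟩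

/-- All far conditions are first traded for close ones by subtraction, because a far condition
between two components would obstruct the factorization. New far conditions appear later only within
connected patterns. -/
theorem countDer_all (hV : V.Nodup) (hne : V ≠ []) (hz : z ∉ V)
    (hF : ∀ e ∈ F, e.1 ∈ V ∧ e.2 ∈ V) (hE : ∀ e ∈ E, e.1 ∈ V ∧ e.2 ∈ V) :
    CountDer K z p χ V F E := by
  induction F generalizing E with
  | nil => exact countDer_nil hV hne hz hE
  | cons e F ih =>
    rw [List.forall_mem_cons] at hF
    refine .far (ih hF.2 hE) (ih hF.2 ?_)
    rw [List.forall_mem_cons]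
    exact ⟨hF.1, hE⟩

end Count

end WA

namespace WA

-- Existence of derivations: combination of trees

section Comb

variable {L : Lang} {K : Ctx L}

open Encodable (encode)

/-- The second tree is grafted onto the leaves of the first. Control over the labels ensures that
the table has an entry for every pair of leaves that may meet. -/
theorem exists_comb {G : List (ℕ × ℕ × ℕ)} {S₁ S₂ S : Set ℕ}
    (hG : ∀ a ∈ S₁, ∀ b ∈ S₂, ∃ c ∈ S, (a, b, c) ∈ G) {T₁ T₂ : Tree K} (h₁ : T₁.LabelsIn S₁)
    (h₂ : T₂.LabelsIn S₂) : ∃ T : Tree K, T.LabelsIn S ∧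
      Derivable K [5, encode G, T₁.code, T₂.code, T.code] := by
  induction T₁ with
  | leaf a =>
    induction T₂ with
    | leaf b =>
      obtain ⟨c, hc, h⟩ := hG a h₁ b h₂
      have hb : graphB ((a, b, c), G) = true := by simpa [graphB] using h
      have := Derivable.rule (K := K) (fun _ => mem_clauses_of_comb) 0 rfl [encode G, a, b, c]
        ⟨der_cond hb rfl, trivial⟩
      exact ⟨.leaf c, hc, this⟩
    | node A t e iht ihe =>
      obtain ⟨t', ht', hdt⟩ := iht h₂.1
      obtain ⟨e', he', hde⟩ := ihe h₂.2
      have := Derivable.rule (K := K) (fun _ => mem_clauses_of_comb) 2 rfl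
        [encode G, A.code, t.code, e.code, Nat.pair 0 a, t'.code, e'.code] ⟨hdt, hde, trivial⟩
      exact ⟨.node A t' e', ⟨ht', he'⟩, this⟩
  | node A t e iht ihe =>
    obtain ⟨t', ht', hdt⟩ := iht h₁.1
    obtain ⟨e', he', hde⟩ := ihe h₁.2
    have := Derivable.rule (K := K) (fun _ => mem_clauses_of_comb) 1 rfl
      [encode G, A.code, t.code, e.code, T₂.code, t'.code, e'.code] ⟨hdt, hde, trivial⟩
    exact ⟨.node A t' e', ⟨ht', he'⟩, this⟩

/-- Labels of trees that compute truth values -/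
def bits : Set ℕ := {0, 1}

variable (K) in
/-- Labels of trees that compute the value of a quantifier -/
def Kind.labels (κ : Kind L) : Set ℕ := Set.range (κ.lab K)

theorem labels_ex : (Kind.ex : Kind L).labels K = bits := by
  ext a
  constructor
  · rintro ⟨v, rfl⟩
    have : ∀ v : ℕ, min 1 v ∈ bits := by
      rintro (_ | v)
      · exact .inl rfl
      · exact .inr (by simp)
    exact this v
  · rintro (rfl | rfl)
    · exact ⟨(0 : ℕ), rfl⟩
    · exact ⟨(1 : ℕ), rfl⟩

theorem orE_total : ∀ a ∈ bits, ∀ b ∈ bits, ∃ c ∈ bits, (a, b, c) ∈ orE := by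
  rintro a (rfl | rfl) b (rfl | rfl)
  · exact ⟨0, .inl rfl, by simp [orE]⟩
  all_goals exact ⟨1, .inr rfl, by simp [orE]⟩

theorem notE_total : ∀ a ∈ bits, ∀ b ∈ ({0} : Set ℕ), ∃ c ∈ bits, (a, b, c) ∈ notE := by
  rintro a (rfl | rfl) b rfl
  · exact ⟨1, .inr rfl, by simp [notE]⟩
  · exact ⟨0, .inl rfl, by simp [notE]⟩

theorem plusE_total {κ : Kind L} (hκ : κ.Fin') : ∀ a ∈ κ.labels K, ∀ b ∈ κ.labels K,
    ∃ c ∈ κ.labels K, (a, b, c) ∈ κ.plusE K := by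
  cases κ with
  | ex => rw [labels_ex]; exact orE_total
  | sum w =>
    rintro _ ⟨a, rfl⟩ _ ⟨b, rfl⟩
    refine ⟨_, ⟨a + b, rfl⟩, ?_⟩
    simp only [Kind.plusE, List.mem_flatMap, List.mem_map]
    exact ⟨a, mem_elems hκ a, b, mem_elems hκ b, rfl⟩

theorem minusE_total {w : L.Wt} (hw : Finite (L.El (L.tyW w))) :
    ∀ a ∈ (Kind.sum w).labels K, ∀ b ∈ (Kind.sum w).labels K,
      ∃ c ∈ (Kind.sum w).labels K, (a, b, c) ∈ minusE K w := by
  rintro _ ⟨a, rfl⟩ _ ⟨b, rfl⟩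
  refine ⟨_, ⟨(show L.El (L.tyW w) from a) - (show L.El (L.tyW w) from b), rfl⟩, ?_⟩
  simp only [minusE, List.mem_flatMap, List.mem_map]
  exact ⟨a, mem_elems hw a, b, mem_elems hw b, rfl⟩

theorem eqE_total {κ : Kind L} (hκ : κ.Fin') (e : κ.V) : ∀ a ∈ κ.labels K,
    ∀ b ∈ ({0} : Set ℕ), ∃ c ∈ bits, (a, b, c) ∈ κ.eqE K e := by
  cases κ with
  | ex =>
    rw [labels_ex]
    rintro a (rfl | rfl) b rfl
    · exact ⟨0, .inl rfl, by simp [Kind.eqE]⟩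
    · exact ⟨1, .inr rfl, by simp [Kind.eqE]⟩
  | sum w =>
    rintro _ ⟨a, rfl⟩ b rfl
    refine ⟨tv (e = a), ?_, ?_⟩
    · by_cases h : e = a
      · rw [tv_true h]; exact .inr rfl
      · rw [tv_false h]; exact .inl rfl
    · simp only [Kind.eqE, List.mem_map]
      exact ⟨a, mem_elems hκ a, rfl⟩

theorem labelsIn_nest {κ : Kind L} {mk : κ.V → Atom K} (l : List κ.V) :
    (nest κ mk l).LabelsIn (κ.labels K) := by
  induction l with
  | nil => exact ⟨0, rfl⟩
  | cons e l ih => exact ⟨⟨e, rfl⟩, ih⟩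

end Comb

-- Existence of derivations: quantifiers

section Quantifiers

variable {L : Lang} {K : Ctx L} {κ : Kind L} {y : Fin κ.ar ↪ ℕ} {C : List (ℕ × ℕ)} {n q : ℕ}

open Encodable (encode)

theorem ltB_of_lt {a b : ℕ} (h : a < b) : ltB (a, b) = true := by
  simp [ltB]; omega

theorem exists_acc (hκ : κ.Fin') (acc : Formula L) {i : ℕ} (hi : i ≤ n) :
    ∃ T : Tree K, T.LabelsIn (κ.labels K) ∧ Derivable K
      [12, κ.id K, tupleCode y, encode C, n, q, acc.code K.N, i, T.code] := by
  induction i with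
  | zero =>
    have := Derivable.rule (K := K) (fun _ => mem_clauses_of_kind hκ) 5 rfl
      [0, tupleCode y, encode C, n, q, acc.code K.N] trivial
    exact ⟨.leaf (κ.lab K 0), ⟨0, rfl⟩, this⟩
  | succ i ih =>
    obtain ⟨T, hT, hd⟩ := ih (by omega)
    obtain ⟨T', hT', hd'⟩ := exists_comb (plusE_total (K := K) hκ) hT
      (labelsIn_nest (K := K) (mk := fun e => .loc i (κ.form e y
        ((nearYF y C n (q + 1) i).and acc))) κ.vals)
    refine ⟨T', hT', ?_⟩
    have hev : (Pat.nearTree K κ (.var 1) (.var 2) (.var 3) (.var 4) (.var 6) (.var 5)).ev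
        (asg [0, tupleCode y, encode C, n, q, acc.code K.N, i, T.code, T'.code]) =
        (nearTree K y C n q i acc).code := ev_nearTree rfl rfl rfl
    have hd'' : Derivable K [5, encode (κ.plusE K), T.code,
        (nearTree K y C n q i acc).code, T'.code] := hd'
    rw [← hev] at hd''
    have := Derivable.rule (K := K) (fun _ => mem_clauses_of_kind hκ) 6 rfl
      [0, tupleCode y, encode C, n, q, acc.code K.N, i, T.code, T'.code]
      ⟨hd, hd'', der_cond (ltB_of_lt (show i < n by omega)) rfl, trivial⟩
    exact this

theorem exists_ring {y : Fin (Kind.ex (L := L)).ar ↪ ℕ} (acc : Formula L) {j : ℕ} (hj : j ≤ n) :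
    ∃ T : Tree K, T.LabelsIn bits ∧ Derivable K
      [14, tupleCode y, encode C, n, q, acc.code K.N, j, T.code] := by
  induction j with
  | zero =>
    have := Derivable.rule (K := K) (fun _ => mem_clauses_of_exists) 5 rfl
      [0, tupleCode y, encode C, n, q, acc.code K.N] trivial
    exact ⟨.leaf 0, .inl rfl, this⟩
  | succ j ih =>
    obtain ⟨T, hT, hd⟩ := ih (by omega)
    refine ⟨.node (.loc j (ringF y C n (q + 1) j acc)) (.leaf 1) T, ⟨.inr rfl, hT⟩, ?_⟩
    have hev : (Pat.form K .ex (1 : ℕ) (.var 1)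
        (.and (.near K (.var 2) (.var 3) (.var 6) (.rad' (.var 4)) (.var 1))
          (.and (.var 5) (.neg (.near K (.var 2) (.var 3) (.var 6) (.succ (.var 4))
            (.var 1)))))).ev (asg [0, tupleCode y, encode C, n, q, acc.code K.N, j, T.code]) =
        (ringF y C n (q + 1) j acc).code K.N :=
      ev_form rfl (ev_and (ev_near rfl rfl) (ev_and rfl (ev_neg (ev_near rfl rfl))))
    have := Derivable.rule (K := K) (fun _ => mem_clauses_of_exists) 6 rfl
      [0, tupleCode y, encode C, n, q, acc.code K.N, j, T.code]
      ⟨hd, der_cond (ltB_of_lt (show j < n by omega)) rfl, trivial⟩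
    rw [Tree.code, Atom.code, ← hev]
    exact this

/-- A double recursion: over the parts, and for each part over the candidate `l` for the maximal
size. The accumulated size `k` varies along the way. -/
theorem exists_large {y : Fin (Kind.ex (L := L)).ar ↪ ℕ} (acc : Formula L) {j : ℕ} (hj : j ≤ n)
    (k : ℕ) : ∃ T : Tree K, T.LabelsIn bits ∧ Derivable K
      [13, tupleCode y, encode C, n, q, acc.code K.N, j, 0, k, T.code] := by
  induction j generalizing k with
  | zero =>
    obtain ⟨g, hg⟩ : CountDer K (Kind.ex.fst y) (q + 1) acc
        (varList (Kind.ex.fst y + 1) (k + 1)) (pairs (varList (Kind.ex.fst y + 1) (k + 1))) [] :=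
      countDer_all varList_nodup (by simp [varList]) (by simp [mem_varList])
        (fun e he => mem_of_mem_pairs he) (by simp)
    have h0 : (Pat.head (.var 1)).ev (asg [0, tupleCode y, encode C, n, q, acc.code K.N, k,
        g.code K.N]) = Kind.ex.fst y := ev_head rfl
    have h1 : natFn varsFn (Nat.pair (tupleCode y) k) =
        encode (varList (Kind.ex.fst y + 1) (k + 1)) := by
      rw [← headI_ofFn]
      exact natFn_encode varsFn (List.ofFn y, k)
    have h2 : natFn pairsFn (Nat.pair (tupleCode y) k) =
        encode (pairs (varList (Kind.ex.fst y + 1) (k + 1))) := by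
      rw [← headI_ofFn]
      exact natFn_encode pairsFn (List.ofFn y, k)
    rw [← h1, ← h2, ← h0] at hg
    have := Derivable.rule (K := K) (fun _ => mem_clauses_of_exists) 2 rfl
      [0, tupleCode y, encode C, n, q, acc.code K.N, k, g.code K.N] ⟨hg, trivial⟩
    exact ⟨.node (.ge (q + 1) g) (.leaf 1) (.leaf 0), ⟨.inr rfl, .inl rfl⟩, this⟩
  | succ j ih =>
    -- The number `d` counts the steps until the candidate reaches the code of `C`, where the
    -- stopping rule applies.
    suffices h : ∀ d l, l + d = encode C → ∀ k, ∃ T : Tree K, T.LabelsIn bits ∧ Derivable K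
        [13, tupleCode y, encode C, n, q, acc.code K.N, j + 1, l, k, T.code] from
      h (encode C) 0 (by omega) k
    intro d
    induction d with
    | zero =>
      rintro l hl k
      obtain rfl : l = encode C := by omega
      obtain ⟨T, hT, hd⟩ := ih (by omega) (k + encode C)
      have := Derivable.rule (K := K) (fun _ => mem_clauses_of_exists) 4 rfl
        [0, tupleCode y, encode C, n, q, acc.code K.N, j, 0, k, T.code] ⟨hd, trivial⟩
      exact ⟨T, hT, this⟩
    | succ d ihd =>
      intro l hl k
      obtain ⟨T₁, hT₁, hd₁⟩ := ihd (l + 1) (by omega) k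
      obtain ⟨T₂, hT₂, hd₂⟩ := ih (by omega) (k + l)
      refine ⟨.node (.loc j (nearScatF (recolY y C n) j (q + 1) (Kind.ex.fst y) acc
        (varBound (Kind.ex.fst y) (recolY y C n)) (l + 1))) T₁ T₂, ⟨hT₁, hT₂⟩, ?_⟩
      have hev : (Pat.scat K (.var 2) (.var 3) (.var 6) (.succ (.var 4)) (.var 1) (.var 5)
          (.succ (.var 7))).ev (asg [0, tupleCode y, encode C, n, q, acc.code K.N, j, l, k,
            T₁.code, T₂.code]) = (nearScatF (recolY y C n) j (q + 1) (Kind.ex.fst y) acc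
          (varBound (Kind.ex.fst y) (recolY y C n)) (l + 1)).code K.N := ev_scat rfl rfl rfl
      have := Derivable.rule (K := K) (fun _ => mem_clauses_of_exists) 3 rfl
        [0, tupleCode y, encode C, n, q, acc.code K.N, j, l, k, T₁.code, T₂.code]
        ⟨hd₁, hd₂, der_cond (ltB_of_lt (show j < n by omega)) rfl, trivial⟩
      rw [Tree.code, Atom.code, ← hev]
      exact this

theorem exists_base (hκ : κ.Fin') (acc : Formula L) {i : ℕ} (hi : i ≤ n) :
    ∃ T : Tree K, T.LabelsIn (κ.labels K) ∧ Derivable K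
      [11, κ.id K, tupleCode y, encode C, n, q, i, acc.code K.N, T.code] := by
  rcases Nat.lt_or_eq_of_le hi with hi | rfl
  · refine ⟨nearTree K y C n q i acc, labelsIn_nest _, ?_⟩
    have hev : (Pat.nearTree K κ (.var 1) (.var 2) (.var 3) (.var 4) (.var 5) (.var 6)).ev
        (asg [0, tupleCode y, encode C, n, q, i, acc.code K.N]) =
        (nearTree K y C n q i acc).code := ev_nearTree rfl rfl rfl
    have := Derivable.rule (K := K) (fun _ => mem_clauses_of_kind hκ) 4 rfl
      [0, tupleCode y, encode C, n, q, i, acc.code K.N]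
      ⟨der_cond (ltB_of_lt hi) rfl, trivial⟩
    rw [← hev]
    exact this
  · cases κ with
    | ex =>
      obtain ⟨T₁, hT₁, hd₁⟩ := exists_ring (K := K) (y := y) (C := C) (q := q) acc (le_refl i)
      obtain ⟨T₂, hT₂, hd₂⟩ := exists_large (K := K) (y := y) (C := C) (q := q) acc (le_refl i) 0
      obtain ⟨T, hT, hd⟩ := exists_comb orE_total hT₁ hT₂
      have := Derivable.rule (K := K) (fun _ => mem_clauses_of_exists) 1 rfl
        [0, tupleCode y, encode C, i, q, 0, acc.code K.N, T₁.code, T₂.code, T.code]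
        ⟨hd₁, hd₂, hd, trivial⟩
      exact ⟨T, by rwa [labels_ex], this⟩
    | sum w =>
      obtain ⟨T₁, hT₁, hd₁⟩ := exists_acc (K := K) (y := y) (C := C) (q := q) hκ acc (le_refl i)
      obtain ⟨T, hT, hd⟩ := exists_comb (minusE_total (K := K) hκ)
        (labelsIn_nest (K := K) (mk := fun e => .aggr ((Kind.sum w).form e y acc))
          (Kind.sum w).vals) hT₁
      have hmk : ∀ e : (Kind.sum w).V, (Pat.aggr (.form K (.sum w) e (.var 1) (.var 6))).ev
          (asg [0, tupleCode y, encode C, i, q, 0, acc.code K.N, T₁.code, T.code]) =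
          (Atom.aggr ((Kind.sum w).form e y acc) : Atom K).code := fun e => congrArg
        (Nat.pair 1) (ev_form rfl rfl)
      rw [← ev_nest hmk] at hd
      have := Derivable.rule (K := K) (fun _ => mem_clauses_of_sum hκ) 0 rfl
        [0, tupleCode y, encode C, i, q, 0, acc.code K.N, T₁.code, T.code]
        ⟨hd₁, hd, trivial⟩
      exact ⟨T, hT, this⟩

/-- The condition `acc` is kept arbitrary in the induction on the tree, since tests at the own part
extend it differently in the two subtrees. -/
theorem exists_quant (hκ : κ.Fin') {i : ℕ} (hi : i ≤ n) {T : Tree K} (hT : T.LabelsIn bits)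
    (acc : Formula L) : ∃ T' : Tree K, T'.LabelsIn (κ.labels K) ∧ Derivable K
      [10, κ.id K, tupleCode y, encode C, n, q, i, acc.code K.N, T.code, T'.code] := by
  induction T generalizing acc with
  | leaf v =>
    rcases hT with rfl | rfl
    · have := Derivable.rule (K := K) (fun _ => mem_clauses_of_kind hκ) 2 rfl
        [0, tupleCode y, encode C, n, q, i, acc.code K.N] trivial
      exact ⟨.leaf (κ.lab K 0), ⟨0, rfl⟩, this⟩
    · obtain ⟨T', hT', hd⟩ := exists_base (K := K) (y := y) (C := C) (q := q) hκ acc hi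
      have := Derivable.rule (K := K) (fun _ => mem_clauses_of_quant) 0 rfl
        [κ.id K, tupleCode y, encode C, n, q, i, acc.code K.N, T'.code] ⟨hd, trivial⟩
      exact ⟨T', hT', this⟩
  | node a t e iht ihe =>
    cases a with
    | loc j ψ =>
      by_cases hj : j = i
      · subst hj
        obtain ⟨t', ht', hdt⟩ := iht hT.1 (acc.and ψ)
        obtain ⟨e', he', hde⟩ := ihe hT.2 (acc.and ψ.neg)
        obtain ⟨T', hT', hd⟩ := exists_comb (plusE_total (K := K) hκ) ht' he'
        have h1 : (Pat.and (.var 6) (.var 8)).ev (asg [0, tupleCode y, encode C, n, q, j,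
            acc.code K.N, 0, ψ.code K.N, t.code, e.code, t'.code, e'.code, T'.code]) =
            (acc.and ψ).code K.N := ev_and rfl rfl
        have h2 : (Pat.and (.var 6) (.neg (.var 8))).ev (asg [0, tupleCode y, encode C, n, q, j,
            acc.code K.N, 0, ψ.code K.N, t.code, e.code, t'.code, e'.code, T'.code]) =
            (acc.and ψ.neg).code K.N := ev_and rfl (ev_neg rfl)
        rw [← h1] at hdt
        rw [← h2] at hde
        have := Derivable.rule (K := K) (fun _ => mem_clauses_of_kind hκ) 3 rfl
          [0, tupleCode y, encode C, n, q, j, acc.code K.N, 0, ψ.code K.N, t.code, e.code,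
            t'.code, e'.code, T'.code] ⟨hdt, hde, hd, trivial⟩
        exact ⟨T', hT', this⟩
      · obtain ⟨t', ht', hdt⟩ := iht hT.1 acc
        obtain ⟨e', he', hde⟩ := ihe hT.2 acc
        have hb : neB (j, i) = true := by simpa [neB] using hj
        have := Derivable.rule (K := K) (fun _ => mem_clauses_of_quant) 1 rfl
          [κ.id K, tupleCode y, encode C, n, q, i, acc.code K.N, j, ψ.code K.N, t.code, e.code,
            t'.code, e'.code] ⟨hdt, hde, der_cond hb rfl, trivial⟩
        exact ⟨.node (.loc j ψ) t' e', ⟨ht', he'⟩, this⟩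
    | aggr χ =>
      obtain ⟨t', ht', hdt⟩ := iht hT.1 acc
      obtain ⟨e', he', hde⟩ := ihe hT.2 acc
      have := Derivable.rule (K := K) (fun _ => mem_clauses_of_quant) 2 rfl
        [κ.id K, tupleCode y, encode C, n, q, i, acc.code K.N, 0, χ.code K.N, t.code, e.code,
          t'.code, e'.code] ⟨hdt, hde, trivial⟩
      exact ⟨.node (.aggr χ) t' e', ⟨ht', he'⟩, this⟩
    | ge ρ g =>
      obtain ⟨t', ht', hdt⟩ := iht hT.1 acc
      obtain ⟨e', he', hde⟩ := ihe hT.2 acc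
      have := Derivable.rule (K := K) (fun _ => mem_clauses_of_quant) 3 rfl
        [κ.id K, tupleCode y, encode C, n, q, i, acc.code K.N, ρ, g.code K.N, t.code, e.code,
          t'.code, e'.code] ⟨hdt, hde, trivial⟩
      exact ⟨.node (.ge ρ g) t' e', ⟨ht', he'⟩, this⟩

variable (K) in
/-- The normal form of a formula can be derived with radius `q`. -/
def FormulaDer (φ : Formula L) (q : ℕ) : Prop :=
  ∀ (C : List (ℕ × ℕ)) (n : ℕ), (∀ v ∈ φ.free, ∃ j, col C v = some j) →
    ∃ T : Tree K, T.LabelsIn bits ∧ Derivable K [8, φ.code K.N, n, encode C, q, T.code]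

theorem exists_near (hκ : κ.Fin') {φ : Formula L} (hφ : FormulaDer K φ q)
    (hcol : ∀ j, ∀ v ∈ φ.free, ∃ i, col (recolY y C j) v = some i) {i : ℕ} (hi : i ≤ n) :
    ∃ T : Tree K, T.LabelsIn (κ.labels K) ∧ Derivable K
      [9, κ.id K, tupleCode y, encode C, n, q, φ.code K.N, i, T.code] := by
  induction i with
  | zero =>
    have := Derivable.rule (K := K) (fun _ => mem_clauses_of_kind hκ) 0 rfl
      [0, tupleCode y, encode C, n, q, φ.code K.N] trivial
    exact ⟨.leaf (κ.lab K 0), ⟨0, rfl⟩, this⟩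
  | succ i ih =>
    obtain ⟨T₁, hT₁, hd₁⟩ := ih (by omega)
    obtain ⟨T₂, hT₂, hd₂⟩ := hφ (recolY y C i) n (hcol i)
    obtain ⟨T₃, hT₃, hd₃⟩ := exists_quant (y := y) (C := C) (q := q) hκ
      (show i ≤ n by omega) hT₂ (.eq (κ.fst y) (κ.fst y))
    obtain ⟨T, hT, hd⟩ := exists_comb (plusE_total (K := K) hκ) hT₁ hT₃
    have h1 : (Pat.recol (.var 1) (.var 6) (.var 2)).ev (asg [0, tupleCode y, encode C, n, q,
        φ.code K.N, i, T₁.code, T₂.code, T₃.code, T.code]) = encode (recolY y C i) :=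
      ev_recol rfl rfl
    have h2 : (Pat.self (.var 1)).ev (asg [0, tupleCode y, encode C, n, q, φ.code K.N, i,
        T₁.code, T₂.code, T₃.code, T.code]) =
        (Formula.eq (κ.fst y) (κ.fst y) : Formula L).code K.N := ev_self rfl
    rw [← h1] at hd₂
    rw [← h2] at hd₃
    have := Derivable.rule (K := K) (fun _ => mem_clauses_of_kind hκ) 1 rfl
      [0, tupleCode y, encode C, n, q, φ.code K.N, i, T₁.code, T₂.code, T₃.code, T.code]
      ⟨hd₁, hd₂, hd₃, hd, der_cond (ltB_of_lt (show i < n by omega)) rfl, trivial⟩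
    exact ⟨T, hT, this⟩

/-- The patterns `a` and `zs` may depend only on the first two entries of the valuation; so they can
be evaluated before the trees that complete the valuation are known. -/
theorem exists_form (hκ : κ.Fin') {e : κ.V} {φ : Formula L} (hφ : FormulaDer K φ q)
    (hcol : ∀ j, ∀ v ∈ φ.free, ∃ i, col (recolY y C j) v = some i) {a zs : Pat} {x₀ : ℕ}
    (hc : formClause K κ e a zs ∈ clauses K)
    (ha : ∀ v : List ℕ, a.ev (asg (x₀ :: φ.code K.N :: v)) = (κ.form e y φ).code K.N)
    (hz : ∀ v : List ℕ, zs.ev (asg (x₀ :: φ.code K.N :: v)) = tupleCode y) :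
    ∃ T : Tree K, T.LabelsIn bits ∧ Derivable K
      [8, (κ.form e y φ).code K.N, n, encode C, 4 * q + 5, T.code] := by
  obtain ⟨T₁, hT₁, hd₁⟩ := exists_near (y := y) (C := C) hκ hφ hcol (le_refl n)
  obtain ⟨T₂, hT₂, hd₂⟩ := hφ (recolY y C n) (n + 1) (hcol n)
  obtain ⟨T₃, hT₃, hd₃⟩ := exists_quant (y := y) (C := C) (q := q) hκ
    (le_refl n) hT₂ (.eq (κ.fst y) (κ.fst y))
  obtain ⟨T₄, hT₄, hd₄⟩ := exists_comb (plusE_total (K := K) hκ) hT₁ hT₃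
  obtain ⟨T, hT, hd⟩ := exists_comb (T₂ := .leaf 0) (eqE_total (K := K) hκ e) hT₄ rfl
  let v := [x₀, φ.code K.N, n, encode C, q, T₁.code, T₂.code, T₃.code, T₄.code, T.code]
  have hzv : zs.ev (asg v) = tupleCode y := hz _
  have h1 : (Pat.recol zs (.var 2) (.var 3)).ev (asg v) = encode (recolY y C n) :=
    ev_recol hzv rfl
  have h2 : (Pat.self zs).ev (asg v) =
      (Formula.eq (κ.fst y) (κ.fst y) : Formula L).code K.N := ev_self hzv
  rw [← hzv] at hd₁
  rw [← h1] at hd₂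
  rw [← h2, ← hzv] at hd₃
  have := Derivable.of_mem hc v ⟨hd₁, hd₂, hd₃, hd₄, hd, trivial⟩
  have hav : a.ev (asg v) = (κ.form e y φ).code K.N := ha _
  rw [← hav]
  exact ⟨T, hT, this⟩

end Quantifiers

end WA

namespace WA

-- Existence of derivations: terms and formulas

section Terms

variable {L : Lang} {K : Ctx L} {C : List (ℕ × ℕ)} {n : ℕ}

open Encodable (encode)

/-- An empty list counts as having one colour, and any colour will do for it. -/
theorem sameColB_or_mixedB {l : List ℕ} (h : ∀ v ∈ l, ∃ j, col C v = some j) :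
    (∃ i, sameColB (l, C, i) = true) ∨ mixedB (l, C) = true := by
  by_cases hm : mixedB (l, C) = true
  · exact .inr hm
  · left
    cases l with
    | nil => exact ⟨0, by simp [sameColB]⟩
    | cons x l =>
      obtain ⟨i, hi⟩ := h x (by simp)
      refine ⟨i, sameColB_iff.2 fun v hv => ?_⟩
      rw [mem_part, ← hi]
      by_contra hne
      refine hm ?_
      simp only [mixedB, List.any_eq_true]
      exact ⟨v, hv, x, by simp, by simpa using hne⟩

theorem der_term {i : ℕ} : {τ : L.Ty} → (t : Term L τ) → t.IsFOW →
    (∀ v ∈ t.free, col C v = some i) → Derivable K [6, encode C, i, t.code K.N]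
  | _, .const τ s, _, _ => by
    have := Derivable.rule (K := K) (fun _ => mem_clauses_of_term) 0 rfl
      [encode C, i, K.N.el ⟨τ, s⟩] trivial
    simp only [Term.code]
    exact this
  | _, .wt w x, _, hf => by
    have hb : sameColB (List.ofFn x, C, i) = true := sameColB_iff.2 fun v hv =>
      hf v (by simpa [Term.free, List.mem_ofFn] using hv)
    have := Derivable.rule (K := K) (fun _ => mem_clauses_of_term) 1 rfl
      [encode C, i, K.N.wt w, tupleCode x] ⟨der_cond hb rfl, trivial⟩
    simp only [Term.code]
    exact this
  | _, .add s t, h, hf => by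
    simp only [Term.IsFOW] at h
    have := Derivable.rule (K := K) (fun _ => mem_clauses_of_term) 2 rfl
      [encode C, i, s.code K.N, t.code K.N]
      ⟨der_term s h.1 fun v hv => hf v (by simp [Term.free, hv]),
        der_term t h.2 fun v hv => hf v (by simp [Term.free, hv]), trivial⟩
    simp only [Term.code]
    exact this
  | _, .sub s t, h, hf => by
    simp only [Term.IsFOW] at h
    have := Derivable.rule (K := K) (fun _ => mem_clauses_of_term) 3 rfl
      [encode C, i, s.code K.N, t.code K.N]
      ⟨der_term s h.1 fun v hv => hf v (by simp [Term.free, hv]),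
        der_term t h.2 fun v hv => hf v (by simp [Term.free, hv]), trivial⟩
    simp only [Term.code]
    exact this
  | _, .mul _ s t, h, hf => by
    simp only [Term.IsFOW] at h
    have := Derivable.rule (K := K) (fun _ => mem_clauses_of_term) 4 rfl
      [encode C, i, s.code K.N, t.code K.N]
      ⟨der_term s h.1 fun v hv => hf v (by simp [Term.free, hv]),
        der_term t h.2 fun v hv => hf v (by simp [Term.free, hv]), trivial⟩
    simp only [Term.code]
    exact this
  | _, .sum _ _, h, _ => by simp [Term.IsFOW] at h

theorem der_tuple {i : ℕ} {l : List ℕ} (h : ∀ a ∈ l, Derivable K [6, encode C, i, a]) :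
    Derivable K [7, encode C, i, encode l] := by
  induction l with
  | nil =>
    have := Derivable.rule (K := K) (fun _ => mem_clauses_of_term) 5 rfl [encode C, i] trivial
    exact this
  | cons a l ih =>
    rw [List.forall_mem_cons] at h
    have := Derivable.rule (K := K) (fun _ => mem_clauses_of_term) 6 rfl
      [encode C, i, a, encode l] ⟨h.1, ih h.2, trivial⟩
    exact this

/-- A tree that tests a formula around part `i` -/
def testT (i : ℕ) (φ : Formula L) : Tree K := .node (.loc i φ) (.leaf 1) (.leaf 0)

theorem labelsIn_testT {i : ℕ} {φ : Formula L} : (testT i φ : Tree K).LabelsIn bits :=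
  ⟨.inr rfl, .inl rfl⟩

theorem formulaDer_eq (x y : ℕ) : FormulaDer K (.eq x y) 1 := by
  intro C n hcol
  rcases sameColB_or_mixedB (C := C) (l := [x, y])
    (fun v hv => hcol v (by simpa [Formula.free] using hv)) with ⟨i, hb⟩ | hb
  · have := Derivable.rule (K := K) (fun _ => mem_clauses_of_formula) 0 rfl
      [x, y, n, encode C, i] ⟨der_cond hb rfl, trivial⟩
    refine ⟨testT i (.eq x y), labelsIn_testT, ?_⟩
    simp only [testT, Tree.code, Atom.code, Formula.code]
    exact this
  · have := Derivable.rule (K := K) (fun _ => mem_clauses_of_formula) 1 rfl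
      [x, y, n, encode C] ⟨der_cond hb rfl, trivial⟩
    refine ⟨.leaf 0, .inl rfl, ?_⟩
    simp only [Tree.code, Formula.code]
    exact this

theorem formulaDer_rel (R : L.Rel) (x : Fin (L.arR R) → ℕ) : FormulaDer K (.rel R x) 1 := by
  intro C n hcol
  rcases sameColB_or_mixedB (C := C) (l := List.ofFn x)
    (fun v hv => hcol v (by simpa [Formula.free, List.mem_ofFn] using hv)) with ⟨i, hb⟩ | hb
  · have := Derivable.rule (K := K) (fun _ => mem_clauses_of_formula) 2 rfl
      [K.N.rel R, tupleCode x, n, encode C, i] ⟨der_cond hb rfl, trivial⟩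
    refine ⟨testT i (.rel R x), labelsIn_testT, ?_⟩
    simp only [testT, Tree.code, Atom.code, Formula.code]
    exact this
  · have := Derivable.rule (K := K) (fun _ => mem_clauses_of_formula) 3 rfl
      [K.N.rel R, tupleCode x, n, encode C] ⟨der_cond hb rfl, trivial⟩
    refine ⟨.leaf 0, .inl rfl, ?_⟩
    simp only [Tree.code, Formula.code]
    exact this

theorem formulaDer_weq (w : L.Wt) (s : L.El (L.tyW w)) (x : Fin (L.arW w) ↪ ℕ) :
    FormulaDer K (.weq w s x) 1 := by
  intro C n hcol
  rcases sameColB_or_mixedB (C := C) (l := List.ofFn x)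
    (fun v hv => hcol v (by simpa [Formula.free, List.mem_ofFn] using hv)) with ⟨i, hb⟩ | hb
  · have := Derivable.rule (K := K) (fun _ => mem_clauses_of_formula) 4 rfl
      [K.N.wt w, K.N.el ⟨L.tyW w, s⟩, tupleCode x, n, encode C, i] ⟨der_cond hb rfl, trivial⟩
    refine ⟨testT i (.weq w s x), labelsIn_testT, ?_⟩
    simp only [testT, Tree.code, Atom.code, Formula.code]
    exact this
  · have := Derivable.rule (K := K) (fun _ => mem_clauses_of_formula) 5 rfl
      [K.N.wt w, K.N.el ⟨L.tyW w, s⟩, tupleCode x, n, encode C,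
        K.N.zeroTest (K.N.el ⟨L.tyW w, s⟩)] ⟨der_cond hb rfl, Der.graph _, trivial⟩
    -- The answer of the oracle is itself used as the truth value, so it has to be `0` or `1`.
    refine ⟨.leaf (K.N.zeroTest (K.N.el ⟨L.tyW w, s⟩)), ?_, ?_⟩
    · rw [Tree.LabelsIn, Coding.zeroTest]
      split_ifs
      · exact .inr rfl
      · exact .inl rfl
    · simp only [Tree.code, Formula.code]
      exact this

/-- Here the restriction on predicates is essential: with at most one free variable the colours
cannot be mixed. -/
theorem formulaDer_pred {P : L.Prd} {t : (j : Fin (L.arP P)) → Term L (L.tyP P j)}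
    (h : (Formula.pred P t).IsFOW) : FormulaDer K (.pred P t) 1 := by
  intro C n hcol
  simp only [Formula.IsFOW] at h
  obtain ⟨i, hi⟩ : ∃ i, ∀ v ∈ (Formula.pred P t).free, col C v = some i := by
    rcases (Formula.pred P t).free.eq_empty_or_nonempty with he | ⟨v, hv⟩
    · exact ⟨0, by simp [he]⟩
    · obtain ⟨i, hi⟩ := hcol v hv
      refine ⟨i, fun u hu => ?_⟩
      rw [← hi]
      simp only [Formula.free] at hu hv
      rw [Finset.card_le_one.1 h.1 u hu v hv]
  have hd : Derivable K [7, encode C, i, tupleCode fun j => (t j).code K.N] := by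
    refine der_tuple fun a ha => ?_
    obtain ⟨j, rfl⟩ := (List.mem_ofFn' _ _).1 ha
    refine der_term (t j) (h.2 j) fun v hv => hi v ?_
    simp only [Formula.free, Finset.mem_biUnion]
    exact ⟨j, Finset.mem_univ j, hv⟩
  have := Derivable.rule (K := K) (fun _ => mem_clauses_of_formula) 6 rfl
    [K.N.prd P, tupleCode fun j => (t j).code K.N, n, encode C, i] ⟨hd, trivial⟩
  refine ⟨testT i (.pred P t), labelsIn_testT, ?_⟩
  simp only [testT, Tree.code, Atom.code, Formula.code]
  exact this

theorem FormulaDer.neg {φ : Formula L} {q : ℕ} (h : FormulaDer K φ q) :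
    FormulaDer K φ.neg q := by
  intro C n hcol
  obtain ⟨T, hT, hd⟩ := h C n (by simpa [Formula.free] using hcol)
  obtain ⟨T', hT', hd'⟩ := exists_comb (K := K) (T₂ := .leaf 0) notE_total hT rfl
  have := Derivable.rule (K := K) (fun _ => mem_clauses_of_formula) 7 rfl
    [φ.code K.N, n, encode C, q, T.code, T'.code] ⟨hd, hd', trivial⟩
  refine ⟨T', hT', ?_⟩
  simp only [Formula.code]
  exact this

theorem FormulaDer.or {φ ψ : Formula L} {q q' : ℕ} (h : FormulaDer K φ q)
    (h' : FormulaDer K ψ q') : FormulaDer K (φ.or ψ) (max q q') := by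
  intro C n hcol
  obtain ⟨T, hT, hd⟩ := h C n fun v hv => hcol v (by simp [Formula.free, hv])
  obtain ⟨T', hT', hd'⟩ := h' C n fun v hv => hcol v (by simp [Formula.free, hv])
  obtain ⟨T₀, hT₀, hd₀⟩ := exists_comb (K := K) orE_total hT hT'
  have := Derivable.rule (K := K) (fun _ => mem_clauses_of_formula) 8 rfl
    [φ.code K.N, ψ.code K.N, n, encode C, q, q', T.code, T'.code, T₀.code]
    ⟨hd, hd', hd₀, trivial⟩
  refine ⟨T₀, hT₀, ?_⟩
  simp only [Formula.code]
  exact this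

theorem FormulaDer.ex {φ : Formula L} {q : ℕ} (h : FormulaDer K φ q) (z : ℕ) :
    FormulaDer K (.ex z φ) (4 * q + 5) := by
  intro C n hcol
  let y : Fin (Kind.ex (L := L)).ar ↪ ℕ := ⟨fun _ => z, fun a b _ => Subsingleton.elim
    (α := Fin 1) a b⟩
  have hcol' : ∀ j, ∀ v ∈ φ.free, ∃ i, col (recolY y C j) v = some i := by
    intro j v hv
    change ∃ i, col (recol (List.ofFn y) j C) v = some i
    rw [col_recol]
    split_ifs with hy
    · exact ⟨j, rfl⟩
    · refine hcol v ?_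
      simp only [Formula.free, Finset.mem_sdiff, Finset.mem_singleton]
      refine ⟨hv, fun he => hy ?_⟩
      exact (List.mem_ofFn' _ _).2 ⟨(0 : Fin 1), he.symm⟩
  exact exists_form (κ := .ex) (e := (1 : ℕ)) (y := y) (x₀ := z) trivial h hcol'
    (mem_clauses_of_exists (List.mem_cons_self ..))
    (fun v => by simp only [Kind.form, Formula.code]; rfl) (fun v => rfl)

theorem FormulaDer.agg {φ : Formula L} {q : ℕ} (h : FormulaDer K φ q) {w : L.Wt}
    (hw : Finite (L.El (L.tyW w))) (s : L.El (L.tyW w)) (y : Fin (L.arW w) ↪ ℕ) :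
    FormulaDer K (.agg w s y φ) (4 * q + 5) := by
  intro C n hcol
  have hcol' : ∀ j, ∀ v ∈ φ.free, ∃ i, col (recolY (κ := .sum w) y C j) v = some i := by
    intro j v hv
    change ∃ i, col (recol (List.ofFn y) j C) v = some i
    rw [col_recol]
    split_ifs with hy
    · exact ⟨j, rfl⟩
    · refine hcol v ?_
      simp only [Formula.free, Finset.mem_sdiff]
      refine ⟨hv, fun he => hy ?_⟩
      simp only [Finset.mem_map, Finset.mem_univ, true_and] at he
      exact (List.mem_ofFn' _ _).2 he
  exact exists_form (κ := .sum w) (e := s) (y := y) (x₀ := tupleCode y) hw h hcol'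
    (mem_clauses_of_sum hw (List.mem_cons_of_mem _ (List.mem_map.2 ⟨s, mem_elems hw s, rfl⟩)))
    (fun v => by simp only [Kind.form, Formula.code]; rfl) (fun v => rfl)

/-- The radius is `1` for atomic formulas, a maximum for disjunctions, and `4 * q + 5` after a
quantifier. It depends on the formula only, not on the colouring, which is what allows one
quantifier rule to use the same matrix under several colourings. -/
theorem exists_formulaDer (φ : Formula L) (h : φ.IsFOW) : ∃ q, FormulaDer K φ q := by
  induction φ using Formula.induction with
  | eq x y => exact ⟨1, formulaDer_eq x y⟩
  | rel R x => exact ⟨1, formulaDer_rel R x⟩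
  | weq w s x => exact ⟨1, formulaDer_weq w s x⟩
  | neg φ ih =>
    obtain ⟨q, hq⟩ := ih (by simpa [Formula.IsFOW] using h)
    exact ⟨q, hq.neg⟩
  | or φ ψ ih ih' =>
    simp only [Formula.IsFOW] at h
    obtain ⟨q, hq⟩ := ih h.1
    obtain ⟨q', hq'⟩ := ih' h.2
    exact ⟨_, hq.or hq'⟩
  | ex y φ ih =>
    obtain ⟨q, hq⟩ := ih (by simpa [Formula.IsFOW] using h)
    exact ⟨_, hq.ex y⟩
  | agg w s y φ ih =>
    simp only [Formula.IsFOW] at h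
    obtain ⟨q, hq⟩ := ih h.2
    exact ⟨_, hq.agg h.1 s y⟩
  | pred P t => exact ⟨1, formulaDer_pred h⟩

end Terms

-- Existence of derivations: output

section Output

variable {L : Lang} {K : Ctx L} (x : List ℕ) (q : ℕ)

open Encodable (encode)

theorem exists_outAtom (a : Atom K) :
    ∃ θ, ∃ ρ : List ℕ, Derivable K [16, encode x, q, a.code, θ, encode ρ] := by
  cases a with
  | loc i ψ =>
    cases x with
    | nil =>
      have := Derivable.rule (K := K) (fun _ => mem_clauses_of_output) 1 rfl
        [0, 0, q, i, ψ.code K.N] trivial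
      exact ⟨_, [q], this⟩
    | cons v x =>
      have := Derivable.rule (K := K) (fun _ => mem_clauses_of_output) 0 rfl
        [v, encode x, q, i, ψ.code K.N] trivial
      exact ⟨_, [], this⟩
  | aggr χ =>
    have := Derivable.rule (K := K) (fun _ => mem_clauses_of_output) 2 rfl
      [encode x, 0, q, 0, χ.code K.N] trivial
    exact ⟨_, [], this⟩
  | ge ρ g =>
    have := Derivable.rule (K := K) (fun _ => mem_clauses_of_output) 3 rfl
      [encode x, 0, q, ρ, g.code K.N] trivial
    exact ⟨_, [ρ], this⟩

theorem exists_out {T : Tree K} (hT : T.LabelsIn bits) :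
    ∃ θ ρ, Derivable K [15, encode x, q, T.code, θ, ρ] := by
  induction T with
  | leaf a =>
    rcases hT with rfl | rfl
    · have := Derivable.rule (K := K) (fun _ => mem_clauses_of_output) 5 rfl
        [encode x, 0, q] trivial
      exact ⟨_, _, this⟩
    · have := Derivable.rule (K := K) (fun _ => mem_clauses_of_output) 4 rfl
        [encode x, 0, q] trivial
      exact ⟨_, _, this⟩
  | node a t e iht ihe =>
    obtain ⟨θ, ρ, hd⟩ := exists_outAtom x q a
    obtain ⟨θ₁, ρ₁, hd₁⟩ := iht hT.1
    obtain ⟨θ₂, ρ₂, hd₂⟩ := ihe hT.2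
    have := Derivable.rule (K := K) (fun _ => mem_clauses_of_output) 6 rfl
      [encode x, 0, q, a.code, t.code, e.code, θ, θ₁, θ₂, encode ρ, ρ₁, ρ₂]
      ⟨hd, hd₁, hd₂, trivial⟩
    exact ⟨_, _, this⟩

theorem exists_result {φ : Formula L} (hφ : φ.IsFOW) (hx : φ.free ⊆ x.toFinset) :
    ∃ b, Derivable K [1, φ.code K.N, encode x, b] := by
  obtain ⟨q, hq⟩ := exists_formulaDer (K := K) φ hφ
  obtain ⟨T, hT, hd⟩ := hq (recol x 0 []) 1 fun v hv =>
    ⟨0, by rw [col_recol, if_pos (List.mem_toFinset.1 (hx hv))]⟩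
  obtain ⟨θ, ρ, hd'⟩ := exists_out x q hT
  have h1 : natFn recolFn (Nat.pair (encode x) (Nat.pair 0 0)) = encode (recol x 0 []) :=
    natFn_encode recolFn (x, 0, [])
  rw [← h1] at hd
  have := Derivable.rule (K := K) (fun _ => mem_clauses_of_output) 7 rfl
    [φ.code K.N, encode x, q, T.code, θ, ρ] ⟨hd, hd', trivial⟩
  exact ⟨_, this⟩

end Output

/-! ### Codings -/

section Codings

variable {L : Lang}

theorem Factor.exists_over {i : L.Ty} (f : Factor L i) :
    ∃ D : Set L.Const, D.Countable ∧ ∀ D', D ⊆ D' → f.Over D' := by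
  cases f with
  | const i s => exact ⟨{⟨i, s⟩}, Set.countable_singleton _, fun _ h => h rfl⟩
  | wt w y => exact ⟨∅, Set.countable_empty, fun _ _ => trivial⟩

theorem WProd.exists_over {i : L.Ty} (p : WProd L i) :
    ∃ D : Set L.Const, D.Countable ∧ ∀ D', D ⊆ D' → p.Over D' := by
  induction p with
  | single f => exact f.exists_over
  | times h f p ih =>
    obtain ⟨D₁, hc₁, h₁⟩ := f.exists_over
    obtain ⟨D₂, hc₂, h₂⟩ := ih
    exact ⟨D₁ ∪ D₂, hc₁.union hc₂, fun D hD =>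
      ⟨h₁ D (Set.subset_union_left.trans hD), h₂ D (Set.subset_union_right.trans hD)⟩⟩

theorem exists_countable_and {P Q : Set L.Const → Prop}
    (h₁ : ∃ D : Set L.Const, D.Countable ∧ ∀ D', D ⊆ D' → P D')
    (h₂ : ∃ D : Set L.Const, D.Countable ∧ ∀ D', D ⊆ D' → Q D') :
    ∃ D : Set L.Const, D.Countable ∧ ∀ D', D ⊆ D' → P D' ∧ Q D' := by
  obtain ⟨D₁, hc₁, h₁⟩ := h₁
  obtain ⟨D₂, hc₂, h₂⟩ := h₂
  exact ⟨D₁ ∪ D₂, hc₁.union hc₂, fun D hD =>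
    ⟨h₁ D (Set.subset_union_left.trans hD), h₂ D (Set.subset_union_right.trans hD)⟩⟩

/-- An expression contains countably many constants. -/
theorem Formula.exists_over (φ : Formula L) :
    ∃ D : Set L.Const, D.Countable ∧ ∀ D', D ⊆ D' → φ.Over D' := by
  have htriv : ∃ D : Set L.Const, D.Countable ∧ ∀ D', D ⊆ D' → True :=
    ⟨∅, Set.countable_empty, fun _ _ => trivial⟩
  have hmem (c : L.Const) : ∃ D : Set L.Const, D.Countable ∧ ∀ D', D ⊆ D' → c ∈ D' :=
    ⟨{c}, Set.countable_singleton _, fun _ h => h rfl⟩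
  refine Formula.rec
    (motive_1 := fun φ => ∃ D : Set L.Const, D.Countable ∧ ∀ D', D ⊆ D' → φ.Over D')
    (motive_2 := fun _ t => ∃ D : Set L.Const, D.Countable ∧ ∀ D', D ⊆ D' → t.Over D')
    ?_ ?_ ?_ ?_ ?_ ?_ ?_ ?_ ?_ ?_ ?_ ?_ ?_ ?_ φ
  all_goals intros; simp only [Formula.Over, Term.Over]
  · exact htriv
  · exact htriv
  · exact hmem _
  · assumption
  · exact exists_countable_and ‹_› ‹_›
  · assumption
  · exact exists_countable_and (hmem _) ‹_›
  · rename_i P t ih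
    choose D hc h using ih
    exact ⟨⋃ j, D j, Set.countable_iUnion hc, fun D' hD j =>
      h j D' ((Set.subset_iUnion D j).trans hD)⟩
  · exact hmem _
  · exact htriv
  · exact exists_countable_and ‹_› ‹_›
  · exact exists_countable_and ‹_› ‹_›
  · exact exists_countable_and ‹_› ‹_›
  · exact exists_countable_and (WProd.exists_over _) ‹_›

/-- The rings and groups may be uncountable, but the constants of one formula together with the
elements of the finite weight types form a countable set, and this set can be named. -/
theorem exists_coding (φ : Formula L) : ∃ N : Coding L, φ.Over N.dom := by
  classical
  obtain ⟨D, hD, h⟩ := φ.exists_over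
  have := L.rel_finite
  have := L.wt_finite
  have := L.prd_countable
  let E : Set L.Const := ⋃ w : {w : L.Wt // Finite (L.El (L.tyW w))},
    Set.range fun s : L.El (L.tyW w.1) => (⟨L.tyW w.1, s⟩ : L.Const)
  have hE : E.Countable := Set.countable_iUnion fun w =>
    haveI := w.2
    Set.countable_range _
  obtain ⟨r, hr⟩ := exists_injective_nat L.Rel
  obtain ⟨u, hu⟩ := exists_injective_nat L.Wt
  obtain ⟨p, hp⟩ := exists_injective_nat L.Prd
  obtain ⟨el, hel⟩ := Set.countable_iff_exists_injOn.1 (hD.union hE)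
  exact ⟨⟨r, hr, u, hu, p, hp, D ∪ E, el, hel, fun w hw s =>
    .inr (Set.mem_iUnion.2 ⟨⟨w, hw⟩, s, rfl⟩)⟩, h _ Set.subset_union_left⟩

/-- The search for derivations computes normal forms. -/
theorem exists_algorithm (K : Ctx L) :
    ∃ F : ℕ →. ℕ, Nat.RecursiveIn {(K.N.zeroTest : ℕ →. ℕ)} F ∧
      ∀ (φ : Formula L) (x : List ℕ), φ.IsFOW → φ.free ⊆ x.toFinset → φ.Over K.N.dom →
        ∃ (φ' : ClForm L (L.tyW K.one)) (radii : List ℕ) (r : ℕ),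
          φ'.IsNormal x r ∧ Equivalent K.one K.eZ φ φ' ∧ φ'.Over K.N.dom ∧
          List.Forall₂ (fun ρ g => Term.IsCl ρ g) radii φ'.groundTerms ∧
          Nat.pair (φ'.code K.N) (Nat.pair (Encodable.encode radii) r) ∈
            F (Nat.pair (φ.code K.N) (Encodable.encode x)) := by
  obtain ⟨F, hF, h⟩ := exists_search (clauses K) K.N.zeroTest
  refine ⟨F, hF, fun φ x hφ hx hD => ?_⟩
  obtain ⟨hsound, hdom⟩ := h (φ.code K.N) (Encodable.encode x)
  -- Existence of a derivation only guarantees that the search stops. The output may come from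
  -- another derivation, and soundness applies to whatever is found.
  obtain ⟨b, hb⟩ := Part.dom_iff_mem.1 (hdom (exists_result (K := K) x hφ hx))
  have hm : ResultM K (φ.code K.N) (Encodable.encode x) b := meaning_of_der K (hsound b hb)
  obtain ⟨θ, radii, r, rfl, ho⟩ := hm φ x rfl rfl hφ hD hx
  exact ⟨θ, radii, r, ho.isNormal, fun A _ _ M hM h1 β => (ho.sat_iff A M ⟨hM, h1⟩ β).symm,
    ho.constsIn, ho.radii, hb⟩

end Codings

end WA
theorem mainTheorem5 (L : WA.Lang) (one : L.Wt) (harity : L.arW one = 1)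
    (eZ : (L.alg (L.tyW one)).IntIso) :
    (∀ (φ : WA.Formula L) (x : List ℕ), φ.IsFOW → φ.free ⊆ x.toFinset →
      ∃ (φ' : WA.ClForm L (L.tyW one)) (r : ℕ),
        φ'.IsNormal x r ∧ WA.Equivalent one eZ φ φ') ∧
    (∀ N : WA.Coding L, ∃ F : ℕ →. ℕ, Nat.RecursiveIn {(N.zeroTest : ℕ →. ℕ)} F ∧
      ∀ (φ : WA.Formula L) (x : List ℕ), φ.IsFOW → φ.free ⊆ x.toFinset → φ.Over N.dom →
        ∃ (φ' : WA.ClForm L (L.tyW one)) (radii : List ℕ) (r : ℕ),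
          φ'.IsNormal x r ∧ WA.Equivalent one eZ φ φ' ∧ φ'.Over N.dom ∧
          List.Forall₂ (fun ρ g => WA.Term.IsCl ρ g) radii φ'.groundTerms ∧
          Nat.pair (φ'.code N) (Nat.pair (Encodable.encode radii) r) ∈
            F (Nat.pair (φ.code N) (Encodable.encode x))) := by
  have algorithm := fun N => WA.exists_algorithm ⟨one, harity, eZ, N⟩
  refine ⟨fun φ x hφ hx => ?_, algorithm⟩
  -- The existence statement mentions no coding, so one is chosen to suit the given formula.
  obtain ⟨N, hN⟩ := WA.exists_coding φ
  obtain ⟨F, -, h⟩ := algorithm N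
  obtain ⟨θ, -, r, hn, he, -⟩ := h φ x hφ hx hN
  exact ⟨θ, r, hn, he⟩
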